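/- **Theorem (CLT for sparse random Toeplitz and Hankel matrices).** *Sparsity pattern.* Let $r\in\mathbb N$, let $(b_n)$ and $(b_n^{(1)}),\dots,(b_n^{(2r)})$ be real sequences with $b_n\to\infty$, $b_n/n\to b\in[0,1]$ and $b_n^{(j)}/b_n\to b^{(j)}$ for $1\le j\le 2r$. Put $$B_n=\Big(\bigcup_{j=1}^r[b_n^{(2j-1)},b_n^{(2j)}]\Big)\cap\{0,1,\dots,n-1\},\qquad B_+=\bigcup_{j=1}^r[b^{(2j-1)},b^{(2j)}],$$ assume $B_+\subseteq[0,1]$, and let $B=B_+\cup(-B_+)$. Let $T_n=(1_{\{|i-j|\in B_n\}}\,a_{i-j})_{i,j=1}^n$. *Entries.* $\kappa$ is a real constant, and one of the following holds. - (S) (real symmetric Toeplitz) $a_{-j}=a_j$ are real, $a_0\equiv0$, $(a_j)_{j\ge1}$ are independent, $\mathbb E a_j=0$, $\mathbb E|a_j|^2=1$, $\mathbb E|a_j|^4=\kappa$ for $j\ge1$, and $\sup_{j\ge1}\mathbb E|a_j|^k<\infty$ for all $k\ge3$. - (C) (Hermitian Toeplitz) $a_{-j}=\overline{a_j}$ are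 complex, $a_0\equiv0$, the variables $\mathrm{Re}\,a_j,\mathrm{Im}\,a_j$ ($j\ge1$) are independent, $\mathbb E a_j=\mathbb E a_j^2=0$, $\mathbb E|a_j|^2=1$, $\mathbb E|a_j|^4=\kappa$ for $j\ge1$, and $\sup_{j\ge1}\mathbb E|a_j|^k<\infty$ for all $k\ge3$. - (H) (Hankel) $(a_j)_{j\in\mathbb Z}$ are independent real with $\mathbb E a_j=0$, $\mathbb E|a_j|^2=1$, $\mathbb E|a_j|^4=\kappa$, and $\sup_{j\in\mathbb Z}\mathbb E|a_j|^k<\infty$ for all $k\ge3$. *Partitions and integrals.* For a partition $\pi$ of $\{1,\dots,p+q\}$ introduce one unknown $x_V$ for each block $V$ and write $x_{\pi(i)}$ for the unknown of the block of $i$. A block is *crossing* if it meets both $\{1,\dots,p\}$ and $\{p+1,\dots,p+q\}$. Let $\mathcal P_2(m)$ be the set of pair partitions of $\{1,\dots,m\}$, let $\mathcal P_2(p,q)$ be the set of pair partitions of $\{1,\dots,p+q\}$ with at least one crossing block, and let $\mathcal P_{2,4}(p,q)$ be the set of partitions with exactly one block of size $4$, having two elements in each of $\{1,\dots,p\}$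 and $\{p+1,\dots,p+q\}$, all other blocks being non-crossing pairs. Given signs $s_i\in\{\pm1\}$, put $y_i=s_ix_{\pi(i)}$ and, for $t=\pm1$ and a bounded set $D\subset\mathbb R$, $$f_{I}^{t}(\pi)=\int_{[0,1]^2\times D^{|\pi|}}\delta\Big(\sum_{i=1}^p y_i\Big)\prod_{j=1}^{p}\chi_{[0,1]}\Big(x_0+b\sum_{i=1}^{j}y_i\Big)\prod_{j=p+1}^{p+q}\chi_{[0,1]}\Big(y_0+tb\sum_{i=p+1}^{j}y_i\Big)\,dx_0\,dy_0\prod_V dx_V,$$ where $\delta$ is the Dirac function (a coordinate with nonzero coefficient is eliminated), and let $f_{II}^{t}(\pi)$ be the same integral without the factor $\delta$. *Toeplitz covariances.* Let $s_i=1$ if $i$ is the smallest element of its block or the largest element of a block of size four, and $s_i=-1$ otherwise; let $D=B$. Define $$\sigma_{p,q}=\sum_{\pi}\big(f_I^{+1}(\pi)+f_I^{-1}(\pi)\big)+(\kappa-1)\sum_{\pi\in\mathcal P_{2,4}(p,q)}\big(f_{II}^{+1}(\pi)+f_{II}^{-1}(\pi)\big)\quad\text{in case (S)},$$ $$\sigma_{p,q}=\sum_{\pi}f_I^{+1}(\pi)+(\kappa-1)\sum_{\pi\in\mathcal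 P_{2,4}(p,q)}\big(f_{II}^{+1}(\pi)+f_{II}^{-1}(\pi)\big)\quad\text{in case (C)},$$ where the first sums are over those $\pi\in\mathcal P_2(p,q)$ which have at least three crossing blocks. *Hankel covariances.* Let $s_i=-(-1)^i$. Define $\tilde\sigma_{p,q}^{D}=\sum_\pi f_I^{+1}(\pi)+(\kappa-1)\sum_{\pi'}f_{II}^{+1}(\pi')$, where $\pi$ runs over those elements of $\mathcal P_2(2p,2q)$ for which the equation $\sum_{i\le 2p}y_i=0$ implies $\sum_{i>2p}y_i=0$ and does not imply $x_V=x_W$ for any two different blocks $V,W$, and $\pi'$ runs over those elements of $\mathcal P_{2,4}(2p,2q)$ for which $\sum_{i\le2p}y_i=0$ and $\sum_{i>2p}y_i=0$ hold identically (and $p,q$ are replaced by $2p,2q$ in the definition of $f_I$, $f_{II}$). *Conclusions.* Every variance below is nonnegative, and convergence to $N(0,\sigma^2)$ is convergence in distribution as $n\to\infty$. 1. (Toeplitz) In case (S), and likewise in case (C), let $A_n=T_n/\sqrt{b_n}$. For every $p\ge2$, $$\frac{\sqrt{b_n}}{n}\big(\mathrm{tr}A_n^p-\mathbb E\,\mathrm{tr}A_n^p\big)\longrightarrow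 N(0,\sigma_{p,p}),$$ and for every real polynomial $Q(x)=\sum_{j=2}^{d}q_jx^j$, $$\frac{\sqrt{b_n}}{n}\big(\mathrm{tr}\,Q(A_n)-\mathbb E\,\mathrm{tr}\,Q(A_n)\big)\longrightarrow N\Big(0,\sum_{i,j=2}^{d}q_iq_j\sigma_{i,j}\Big).$$ Moreover, for every $k\ge0$, $\mathbb E\big[\frac1n\mathrm{tr}A_n^{2k+1}\big]\to0$ and $$\mathbb E\Big[\frac1n\mathrm{tr}A_n^{2k}\Big]\longrightarrow\sum_{\pi\in\mathcal P_2(2k)}\int_{[0,1]\times B^k}\prod_{j=1}^{2k}\chi_{[0,1]}\Big(x_0+b\sum_{i=1}^{j}s_ix_{\pi(i)}\Big)\,dx_0\prod_V dx_V .$$ 2. (Hankel) In case (H), let $P_n$ be the backward identity permutation matrix, $H_n=P_nT_n$ and $A_n=H_n/\sqrt{b_n}$. For every $p\ge1$, $$\frac{\sqrt{b_n}}{n}\big(\mathrm{tr}A_n^{2p}-\mathbb E\,\mathrm{tr}A_n^{2p}\big)\longrightarrow N(0,\tilde\sigma^{B}_{p,p}),$$ and for every real polynomial $Q(x)=\sum_{j=0}^{d}q_jx^j$,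 $$\frac{\sqrt{b_n}}{n}\big(\mathrm{tr}\,Q(A_n^2)-\mathbb E\,\mathrm{tr}\,Q(A_n^2)\big)\longrightarrow N\Big(0,\sum_{i,j=1}^{d}q_iq_j\tilde\sigma^{B}_{i,j}\Big).$$ 3. (Hankel, general pattern) Statement 2 remains true if $T_n$ is replaced by $(1_{\{i-j\in B_n'\}}a_{i-j})_{i,j=1}^n$ with $B_n'=\big(\bigcup_{j=1}^r[b_n^{(2j-1)},b_n^{(2j)}]\big)\cap\{0,\pm1,\dots,\pm(n-1)\}$, the assumption $B_+\subseteq[0,1]$ is replaced by $B':=\bigcup_{j=1}^r[b^{(2j-1)},b^{(2j)}]\subseteq[-1,1]$, and $B$ is replaced by $B'$ in the covariances. -/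

import Mathlib

open MeasureTheory ProbabilityTheory Filter Topology

noncomputable section

namespace SparseToeplitz

/-! ### Random entries -/

/-- Entries of the real symmetric Toeplitz model. -/
structure IsSymmetricEntries {Ω : Type*} [MeasurableSpace Ω] (μ : Measure Ω)
    (a : ℤ → Ω → ℝ) (κ : ℝ) : Prop where
  measurable : ∀ j, Measurable (a j)
  symm : ∀ j ω, a (-j) ω = a j ω
  zero : ∀ ω, a 0 ω = 0
  indep : iIndepFun (fun (k : ℕ) ω => a ((k : ℤ) + 1) ω) μ
  mean : ∀ j : ℤ, 1 ≤ j → ∫ ω, a j ω ∂μ = 0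
  second : ∀ j : ℤ, 1 ≤ j → ∫ ω, |a j ω| ^ 2 ∂μ = 1
  fourth : ∀ j : ℤ, 1 ≤ j → ∫ ω, |a j ω| ^ 4 ∂μ = κ
  bounded : ∀ k : ℕ, 3 ≤ k → ∃ C : ℝ, ∀ j : ℤ, 1 ≤ j →
    Integrable (fun ω => |a j ω| ^ k) μ ∧ ∫ ω, |a j ω| ^ k ∂μ ≤ C

/-- Entries of the complex Hermitian Toeplitz model. The independent family consists of
`Re a₁, Re a₂, …` together with `Im a₁, Im a₂, …`. -/
structure IsHermitianEntries {Ω : Type*} [MeasurableSpace Ω] (μ : Measure Ω)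
    (a : ℤ → Ω → ℂ) (κ : ℝ) : Prop where
  measurable : ∀ j, Measurable (a j)
  symm : ∀ j ω, a (-j) ω = (starRingEnd ℂ) (a j ω)
  zero : ∀ ω, a 0 ω = 0
  indep : iIndepFun (Sum.elim (fun (k : ℕ) ω => (a ((k : ℤ) + 1) ω).re)
    (fun (k : ℕ) ω => (a ((k : ℤ) + 1) ω).im)) μ
  mean : ∀ j : ℤ, 1 ≤ j → ∫ ω, a j ω ∂μ = 0
  second : ∀ j : ℤ, 1 ≤ j → ∫ ω, ‖a j ω‖ ^ 2 ∂μ = 1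
  square : ∀ j : ℤ, 1 ≤ j → ∫ ω, (a j ω) ^ 2 ∂μ = 0
  fourth : ∀ j : ℤ, 1 ≤ j → ∫ ω, ‖a j ω‖ ^ 4 ∂μ = κ
  bounded : ∀ k : ℕ, 3 ≤ k → ∃ C : ℝ, ∀ j : ℤ, 1 ≤ j →
    Integrable (fun ω => ‖a j ω‖ ^ k) μ ∧ ∫ ω, ‖a j ω‖ ^ k ∂μ ≤ C

/-- Entries of the real Hankel model: all `a j`, `j ∈ ℤ`, are independent. -/
structure IsHankelEntries {Ω : Type*} [MeasurableSpace Ω] (μ : Measure Ω)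
    (a : ℤ → Ω → ℝ) (κ : ℝ) : Prop where
  measurable : ∀ j, Measurable (a j)
  indep : iIndepFun a μ
  mean : ∀ j, ∫ ω, a j ω ∂μ = 0
  second : ∀ j, ∫ ω, |a j ω| ^ 2 ∂μ = 1
  fourth : ∀ j, ∫ ω, |a j ω| ^ 4 ∂μ = κ
  bounded : ∀ k : ℕ, 3 ≤ k → ∃ C : ℝ, ∀ j : ℤ,
    Integrable (fun ω => |a j ω| ^ k) μ ∧ ∫ ω, |a j ω| ^ k ∂μ ≤ C

/-! ### Sparse Toeplitz and Hankel matrices -/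

/-- `(⋃ⱼ [lo j n, hi j n]) ∩ {0, 1, …, n - 1}`. -/
def indexSet {r : ℕ} (lo hi : Fin r → ℕ → ℝ) (n : ℕ) : Set ℤ :=
  {k | (∃ j, (k : ℝ) ∈ Set.Icc (lo j n) (hi j n)) ∧ 0 ≤ k ∧ k < n}

/-- `(⋃ⱼ [lo j n, hi j n]) ∩ {0, ±1, …, ±(n - 1)}`. -/
def signedIndexSet {r : ℕ} (lo hi : Fin r → ℕ → ℝ) (n : ℕ) : Set ℤ :=
  {k | (∃ j, (k : ℝ) ∈ Set.Icc (lo j n) (hi j n)) ∧ |k| < n}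

open Classical in
/-- The Toeplitz matrix `(1_{i - j ∈ S} a_{i - j})`. -/
def toeplitz {𝕜 : Type*} [Zero 𝕜] (n : ℕ) (S : Set ℤ) (a : ℤ → 𝕜) : Matrix (Fin n) (Fin n) 𝕜 :=
  Matrix.of fun i j => if (i : ℤ) - (j : ℤ) ∈ S then a ((i : ℤ) - (j : ℤ)) else 0

/-- The sparse Toeplitz matrix `(1_{|i - j| ∈ S} a_{i - j})`. -/
def sparseToeplitz {𝕜 : Type*} [Zero 𝕜] (n : ℕ) (S : Set ℤ) (a : ℤ → 𝕜) :
    Matrix (Fin n) (Fin n) 𝕜 :=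
  toeplitz n {k | |k| ∈ S} a

/-- The backward identity permutation matrix, with ones exactly on the anti-diagonal. -/
def backwardIdentity (n : ℕ) : Matrix (Fin n) (Fin n) ℝ :=
  Matrix.of fun i j => if (i : ℕ) + (j : ℕ) + 1 = n then 1 else 0

/-- The trace functional as a real number (for a Hermitian matrix the trace is real). -/
def realTrace {𝕜 : Type*} [RCLike 𝕜] {n : ℕ} (A : Matrix (Fin n) (Fin n) 𝕜) : ℝ :=
  RCLike.re A.trace

/-- `√β / n * (X - 𝔼 X)`. -/
def fluctuation {Ω : Type*} [MeasurableSpace Ω] (μ : Measure Ω) (β : ℝ) (n : ℕ) (X : Ω → ℝ) :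
    Ω → ℝ :=
  fun ω => √β / n * (X ω - ∫ ω', X ω' ∂μ)

/-- `X n` converges in distribution to the centred normal law with variance `v ≥ 0`
(the Dirac mass at `0` if `v = 0`). -/
def ConvergesToNormal {Ω : Type*} [MeasurableSpace Ω] (μ : Measure Ω) [IsProbabilityMeasure μ]
    (X : ℕ → Ω → ℝ) (v : ℝ) : Prop :=
  0 ≤ v ∧ TendstoInDistribution X atTop (id : ℝ → ℝ) (fun _ => μ) (gaussianReal 0 v.toNNReal)

/-! ### Partitions -/

/-- Partitions of an `m`-element set (the points `1, …, m` are the elements of `Fin m`). -/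
abbrev SetPartition (m : ℕ) := Finpartition (Finset.univ : Finset (Fin m))

variable {m : ℕ}

/-- All blocks have two elements. -/
def IsPairing (π : SetPartition m) : Prop := ∀ V ∈ π.parts, V.card = 2

/-- `V` meets both the first `p` points and the remaining points. -/
def IsCrossing (p : ℕ) (V : Finset (Fin m)) : Prop :=
  (∃ i ∈ V, (i : ℕ) < p) ∧ ∃ j ∈ V, p ≤ (j : ℕ)

open Classical in
/-- The pair partitions of `m` points. -/
def pairings (m : ℕ) : Finset (SetPartition m) := Finset.univ.filter IsPairing

open Classical in
/-- The number of blocks which meet both the first `p` points and the remaining points. -/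
def crossingNumber (p : ℕ) (π : SetPartition m) : ℕ := (π.parts.filter (IsCrossing p)).card

open Classical in
/-- `𝒫₂(p, q)`: pair partitions of `p + q` points with a crossing block. -/
def pairings₂ (p q : ℕ) : Finset (SetPartition (p + q)) :=
  (pairings (p + q)).filter fun π => 1 ≤ crossingNumber p π

open Classical in
/-- `𝒫₂,₄(p, q)`: one block with two points in each half, all other blocks being pairs
contained in one of the halves. It is empty unless `p` and `q` are even. -/
def pairings₂₄ (p q : ℕ) : Finset (SetPartition (p + q)) :=
  Finset.univ.filter fun π => ∃ W ∈ π.parts,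
    W.card = 4 ∧ (W.filter fun i : Fin (p + q) => (i : ℕ) < p).card = 2 ∧
    ∀ V ∈ π.parts, V ≠ W → V.card = 2 ∧ ¬ IsCrossing p V

/-- The block of `i`. -/
def block (π : SetPartition m) (i : Fin m) : {V // V ∈ π.parts} :=
  ⟨π.part i, π.part_mem.2 (Finset.mem_univ i)⟩

open Classical in
/-- Toeplitz signs. In a pair the smaller element has sign `1` and the larger one `-1`; in a
block of four elements the smallest and the largest have sign `1`, the others `-1`. -/
def toeplitzSign (π : SetPartition m) (i : Fin m) : ℝ :=
  if (∀ j ∈ π.part i, i ≤ j) ∨ ((π.part i).card = 4 ∧ ∀ j ∈ π.part i, j ≤ i) then 1 else -1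

/-- Hankel signs `-(-1)^i`, where `i` is counted from `1`. -/
def hankelSign (i : Fin m) : ℝ := -(-1) ^ ((i : ℕ) + 1)

/-! ### Integrals associated with partitions

The unknowns `x` are indexed by the blocks of `π`, and `yᵢ = s i * x (block π i)`. -/

/-- `∑_{i ≤ p} yᵢ`. -/
def firstSum (p : ℕ) (π : SetPartition m) (s : Fin m → ℝ) (x : {V // V ∈ π.parts} → ℝ) : ℝ :=
  ∑ i ∈ Finset.univ.filter (fun i : Fin m => (i : ℕ) < p), s i * x (block π i)

/-- `∑_{i > p} yᵢ`. -/
def secondSum (p : ℕ) (π : SetPartition m) (s : Fin m → ℝ) (x : {V // V ∈ π.parts} → ℝ) : ℝ :=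
  ∑ i ∈ Finset.univ.filter (fun i : Fin m => p ≤ (i : ℕ)), s i * x (block π i)

/-- The coefficient of the unknown `x V` in `∑_{i ≤ p} yᵢ`. -/
def firstCoeff (p : ℕ) (π : SetPartition m) (s : Fin m → ℝ) (V : {V // V ∈ π.parts}) : ℝ :=
  ∑ i ∈ Finset.univ.filter (fun i : Fin m => (i : ℕ) < p ∧ block π i = V), s i

/-- The domain of integration `x V ∈ B` together with the constraints
`x₀ + b ∑_{i ≤ j} yᵢ ∈ [0, 1]` for `j ≤ p` and `y₀ + t b ∑_{p < i ≤ j} yᵢ ∈ [0, 1]` for `j > p`,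
where `t = ± 1`. -/
def region (B : Set ℝ) (b : ℝ) (p : ℕ) (π : SetPartition m) (s : Fin m → ℝ) (t x₀ y₀ : ℝ) :
    Set ({V // V ∈ π.parts} → ℝ) :=
  {x | (∀ V, x V ∈ B) ∧
    (∀ j : Fin m, (j : ℕ) < p →
      x₀ + b * ∑ i ∈ Finset.univ.filter (fun i : Fin m => i ≤ j), s i * x (block π i)
        ∈ Set.Icc (0 : ℝ) 1) ∧
    (∀ j : Fin m, p ≤ (j : ℕ) →
      y₀ + t * b *
          ∑ i ∈ Finset.univ.filter (fun i : Fin m => p ≤ (i : ℕ) ∧ i ≤ j), s i * x (block π i)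
        ∈ Set.Icc (0 : ℝ) 1)}

open Classical in
/-- `∫ δ(∑ v, c v * x v) F(x) dx` over `ℝ^ι`, where `δ` is the Dirac function: one solves
`∑ v, c v * x v = 0` for a coordinate `x w` with `c w ≠ 0` and integrates `F / |c w|` over the
other coordinates. The result does not depend on the choice of `w`. -/
def diracIntegral {ι : Type*} [Fintype ι] (c : ι → ℝ) (F : (ι → ℝ) → ℝ) : ℝ :=
  if h : ∃ w, c w ≠ 0 then
    |c h.choose|⁻¹ * ∫ z : {v // v ≠ h.choose} → ℝ,
      F (fun v => if hv : v = h.choose then -(∑ u, c u.1 * z u) / c h.choose else z ⟨v, hv⟩)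
  else 0

/-- Type I integrals. -/
def typeI (B : Set ℝ) (b : ℝ) (p : ℕ) (π : SetPartition m) (s : Fin m → ℝ) (t : ℝ) : ℝ :=
  ∫ x₀ in Set.Icc (0 : ℝ) 1, ∫ y₀ in Set.Icc (0 : ℝ) 1,
    diracIntegral (firstCoeff p π s) ((region B b p π s t x₀ y₀).indicator fun _ => 1)

/-- Type II integrals. -/
def typeII (B : Set ℝ) (b : ℝ) (p : ℕ) (π : SetPartition m) (s : Fin m → ℝ) (t : ℝ) : ℝ :=
  ∫ x₀ in Set.Icc (0 : ℝ) 1, ∫ y₀ in Set.Icc (0 : ℝ) 1,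
    ∫ x : {V // V ∈ π.parts} → ℝ, (region B b p π s t x₀ y₀).indicator (fun _ => (1 : ℝ)) x

/-! ### Limit moments and limit covariances -/

/-- The limit moment of order `m` (it vanishes for odd `m`). -/
def limitMoment (B : Set ℝ) (b : ℝ) (m : ℕ) : ℝ :=
  ∑ π ∈ pairings m, ∫ x₀ in Set.Icc (0 : ℝ) 1,
    ∫ x : {V // V ∈ π.parts} → ℝ,
      {x : {V // V ∈ π.parts} → ℝ | (∀ V, x V ∈ B) ∧ ∀ j : Fin m,
        x₀ + b *
            ∑ i ∈ Finset.univ.filter (fun i : Fin m => i ≤ j), toeplitzSign π i * x (block π i)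
          ∈ Set.Icc (0 : ℝ) 1}.indicator (fun _ => (1 : ℝ)) x

/-- The pair partitions contributing to the Toeplitz covariances. With one crossing block the
equation `∑_{i ≤ p} yᵢ = 0` says that the crossing unknown vanishes, and with two crossing blocks
it says that their unknowns agree up to sign, which are the terms of `𝒫₂,₄(p, q)`. -/
def toeplitzPairings (p q : ℕ) : Finset (SetPartition (p + q)) :=
  (pairings₂ p q).filter fun π => 3 ≤ crossingNumber p π

/-- Limit covariances, real symmetric Toeplitz matrices. -/
def toeplitzCov (B : Set ℝ) (b κ : ℝ) (p q : ℕ) : ℝ :=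
  ∑ π ∈ toeplitzPairings p q,
      (typeI B b p π (toeplitzSign π) 1 + typeI B b p π (toeplitzSign π) (-1)) +
    (κ - 1) * ∑ π ∈ pairings₂₄ p q,
      (typeII B b p π (toeplitzSign π) 1 + typeII B b p π (toeplitzSign π) (-1))

/-- Limit covariances, complex Hermitian Toeplitz matrices. -/
def hermitianCov (B : Set ℝ) (b κ : ℝ) (p q : ℕ) : ℝ :=
  ∑ π ∈ toeplitzPairings p q, typeI B b p π (toeplitzSign π) 1 +
    (κ - 1) * ∑ π ∈ pairings₂₄ p q,
      (typeII B b p π (toeplitzSign π) 1 + typeII B b p π (toeplitzSign π) (-1))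

open Classical in
/-- The pair partitions contributing to the Hankel covariances (`p`, `q` are the numbers of points
in the two halves): the second balance equation follows from the first one, and the first one does
not force the unknowns of two different blocks to be equal. -/
def hankelPairings (p q : ℕ) : Finset (SetPartition (p + q)) :=
  (pairings₂ p q).filter fun π =>
    (∀ x, firstSum p π hankelSign x = 0 → secondSum p π hankelSign x = 0) ∧
    ∀ V W, V ≠ W → ∃ x, firstSum p π hankelSign x = 0 ∧ x V ≠ x W

open Classical in
/-- The elements of `𝒫₂,₄(p, q)` for which both balance equations hold identically. -/
def hankelPairings₂₄ (p q : ℕ) : Finset (SetPartition (p + q)) :=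
  (pairings₂₄ p q).filter fun π =>
    ∀ x, firstSum p π hankelSign x = 0 ∧ secondSum p π hankelSign x = 0

/-- Limit covariances of the traces of the powers `2 * p` and `2 * q`, Hankel matrices. -/
def hankelCov (B : Set ℝ) (b κ : ℝ) (p q : ℕ) : ℝ :=
  ∑ π ∈ hankelPairings (2 * p) (2 * q), typeI B b (2 * p) π hankelSign 1 +
    (κ - 1) * ∑ π ∈ hankelPairings₂₄ (2 * p) (2 * q), typeII B b (2 * p) π hankelSign 1

/-- `∑_{i, j = k}^{deg Q} q_i q_j σ_{i, j}`. -/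
def polyVariance (k : ℕ) (Q : Polynomial ℝ) (σ : ℕ → ℕ → ℝ) : ℝ :=
  ∑ i ∈ Finset.Icc k Q.natDegree, ∑ j ∈ Finset.Icc k Q.natDegree,
    Q.coeff i * Q.coeff j * σ i j

/-- `⋃ⱼ [l j, u j]`. -/
def limitSet {r : ℕ} (l u : Fin r → ℝ) : Set ℝ := ⋃ j, Set.Icc (l j) (u j)

/-- `B₊ ∪ B₋`, where `B₋ = {x | -x ∈ B₊}`. -/
def symmetrize (S : Set ℝ) : Set ℝ := S ∪ {x | -x ∈ S}

end SparseToeplitz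

end

open SparseToeplitz

/-! ### Taylor bounds for the exponential and the method of moments. -/

noncomputable section
namespace SparseToeplitz

/-! The trace of a `p`-th power is a sum over closed walks: over words `x` of length `p` in the
index set with `∑ τ i * x i = 0`, each weighted by the number of starting points from which the walk
stays in `{0, …, n - 1}` (`trace_stepProd`). For Toeplitz matrices all `τ i` are `1`. For Hankel
matrices `(P T)² = Tᵀ T`, so even powers give the alternating signs `τ i = (-1) ^ i`. Letters of
different classes are independent, the class of `x` being `|x|` in the Toeplitz models and `x`
itself in the Hankel model; `IsEntryFamily` treats all models at once.

Normality follows from the method of moments in recursive form (`convergesToNormal_of_moments`):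
besides mean and variance one needs `𝔼 X^(L+2) - (L+1) 𝔼 X² 𝔼 X^L → 0`. Expand the moments into
tuples of centred words. If some class occurs only once, or some word shares no class with another
one, all terms of the recursion vanish. If every word has exactly one neighbour, the words fall into
independent pairs and the recursion is exact. Only entangled tuples remain, in which some word has
two neighbours (`IsEntryFamily.wickDefect_eq_zero`).

Entangled tuples are rare. Words with a prescribed kernel and prescribed signs are determined by
lattice points in the solution space of the balance equations, so there are `O(β^d)` of them, where
`d` is its dimension. The core is the inequality `2 d + L + 1 ≤ N` for `L` entangled words of total
length `N` (`two_mul_finrank_add_le`). To prove it, order the words linearly. Equations of words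
that are last in some block which they really involve form a triangular system, hence are
independent. Use this for an order and for its reverse and add the two estimates. A word that gains
no equation in either order occurs in some block at a place which is neither first nor last, and
such surplus occurrences make twice the number of blocks smaller than `N`. So each word costs one
unit, and a word with two neighbours costs two if the order puts these neighbours at the two ends.
As the weights of the words multiply to `O(β^((L-N)/2))`, the entangled part is `O(β^(-1/2))`.

It remains to compute covariances, that is, sums over pairs of closed words. By `balance_trichotomy`
a pattern either has too small a dimension to count, or is a pair partition for which the first
balance equation implies the second, or has one block of four and non-crossing pairs, with both
balance equations void. The last two kinds give the integrals of types I and II. A block of four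
contributes `𝔼 |a|⁴ - 1`. In a Toeplitz model the two walks may be matched with the same or with
opposite orientation, which is the sign `t`, and the opposite orientation has the weight `𝔼 a²`.

Finally, lattice point counts converge to volumes (`tendsto_card_latticeSet`): a count is the
integral of an indicator evaluated at integral parts, and dominated convergence applies, since
almost every point avoids the boundary hyperplanes. A balance equation with coefficients `0`, `±1`
is solved for one unknown without changing the integer lattice, which produces the Dirac factor.
Limit moments are the same computation with an empty second word. -/

lemma hasDerivAt_expTaylor (K : ℕ) (y : ℝ) :
    HasDerivAt (fun y : ℝ => Complex.exp (y * Complex.I) -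
      ∑ k ∈ Finset.range (K + 1), ((y : ℂ) * Complex.I) ^ k / (k.factorial : ℂ))
      (Complex.I * (Complex.exp (y * Complex.I) -
      ∑ k ∈ Finset.range K, ((y : ℂ) * Complex.I) ^ k / (k.factorial : ℂ))) y := by
  have h0 : HasDerivAt (fun y : ℝ => (y : ℂ) * Complex.I) Complex.I y := by
    simpa using (Complex.ofRealCLM.hasDerivAt (x := y)).mul_const Complex.I
  have h1 : HasDerivAt (fun y : ℝ => Complex.exp (y * Complex.I))
      (Complex.exp (y * Complex.I) * Complex.I) y := h0.cexp
  have h2 : HasDerivAt (fun y : ℝ => ∑ k ∈ Finset.range (K + 1),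
      ((y : ℂ) * Complex.I) ^ k / (k.factorial : ℂ))
      (∑ k ∈ Finset.range (K + 1),
        (k * ((y : ℂ) * Complex.I) ^ (k - 1) * Complex.I) / (k.factorial : ℂ)) y := by
    apply HasDerivAt.fun_sum
    intro k _
    exact (h0.pow k).div_const _
  refine (h1.sub h2).congr_deriv ?_
  symm
  rw [Finset.sum_range_succ', mul_sub, Finset.mul_sum]
  simp only [Nat.cast_zero, zero_mul, zero_div, add_zero]
  congr 1
  · ring
  · refine Finset.sum_congr rfl fun k _ => ?_
    rw [Nat.factorial_succ]
    have : ((k + 1 : ℕ) : ℂ) ≠ 0 := by exact_mod_cast Nat.succ_ne_zero k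
    have h3 : (k.factorial : ℂ) ≠ 0 := by exact_mod_cast k.factorial_ne_zero
    push_cast at this ⊢
    field_simp

/-- Taylor's bound for the exponential on the imaginary axis. -/
lemma norm_expTaylor_le (K : ℕ) (y : ℝ) :
    ‖Complex.exp (y * Complex.I) -
      ∑ k ∈ Finset.range K, ((y : ℂ) * Complex.I) ^ k / (k.factorial : ℂ)‖
      ≤ |y| ^ K / K.factorial := by
  induction K generalizing y with
  | zero => simp [Complex.norm_exp_ofReal_mul_I]
  | succ K ih =>
    set g : ℕ → ℝ → ℂ := fun K y => Complex.exp (y * Complex.I) -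
      ∑ k ∈ Finset.range K, ((y : ℂ) * Complex.I) ^ k / (k.factorial : ℂ) with hg
    have h0 : g (K + 1) 0 = 0 := by
      simp [hg, Finset.sum_range_succ']
    have hd : ∀ s : ℝ, HasDerivAt (g (K + 1)) (Complex.I * g K s) s :=
      fun s => hasDerivAt_expTaylor K s
    have hcont : Continuous fun s : ℝ => Complex.I * g K s := by
      simp only [hg]; fun_prop
    -- The comparison of derivatives runs to the right from `0`; the factor `σ = ±1` reflects the
    -- negative half-line onto it.
    have key : ∀ y : ℝ, 0 ≤ y → ∀ σ : ℝ, |σ| = 1 →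
        ‖g (K + 1) (σ * y)‖ ≤ y ^ (K + 1) / (K + 1).factorial := by
      intro y hy σ hσ
      have hd2 : ∀ s : ℝ, HasDerivAt (fun s => g (K + 1) (σ * s))
          (σ • (Complex.I * g K (σ * s))) s := fun s =>
        (hd (σ * s)).scomp s (by simpa using (hasDerivAt_id s).const_mul σ)
      have hd3 : ∀ s : ℝ, HasDerivAt (fun s : ℝ => s ^ (K + 1) / ((K + 1).factorial : ℝ))
          (s ^ K / K.factorial) s := by
        intro s
        refine (((hasDerivAt_id s).pow (K + 1)).div_const ((K + 1).factorial : ℝ)).congr_deriv ?_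
        rw [Nat.factorial_succ]
        have h3 : (K.factorial : ℝ) ≠ 0 := by exact_mod_cast K.factorial_ne_zero
        push_cast
        simp
        field_simp
      refine image_norm_le_of_norm_deriv_right_le_deriv_boundary
        (f := fun s => g (K + 1) (σ * s)) (a := 0) (b := y)
        (B := fun s : ℝ => s ^ (K + 1) / ((K + 1).factorial : ℝ))
        (f' := fun s => σ • (Complex.I * g K (σ * s))) (B' := fun s => s ^ K / K.factorial)
        ?_ ?_ ?_ ?_ ?_ ⟨hy, le_rfl⟩
      · exact fun s _ => (hd2 s).continuousAt.continuousWithinAt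
      · exact fun s _ => (hd2 s).hasDerivWithinAt
      · simp [h0]
      · exact fun s => hd3 s
      · intro s hs
        rw [norm_smul, Real.norm_eq_abs, hσ, one_mul, norm_mul, Complex.norm_I, one_mul]
        refine (ih (σ * s)).trans_eq ?_
        rw [abs_mul, hσ, one_mul, abs_of_nonneg hs.1]
    rcases le_total 0 y with hy | hy
    · simpa [abs_of_nonneg hy] using key y hy 1 (by simp)
    · simpa [abs_of_nonpos hy] using key (-y) (by linarith) (-1) (by simp)

/-- `g k = m k / k!`, where `m k` are the moments of the centred normal law of variance `v`. -/
def gaussianCoeff (v : ℝ) : ℕ → ℝ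
  | 0 => 1
  | 1 => 0
  | (k + 2) => v * gaussianCoeff v k / (k + 2)

lemma gaussianCoeff_odd (v : ℝ) (j : ℕ) : gaussianCoeff v (2 * j + 1) = 0 := by
  induction j with
  | zero => rfl
  | succ j ih =>
    rw [show 2 * (j + 1) + 1 = (2 * j + 1) + 2 by ring, gaussianCoeff, ih]; simp

lemma gaussianCoeff_even (v : ℝ) (j : ℕ) :
    gaussianCoeff v (2 * j) = (v / 2) ^ j / j.factorial := by
  induction j with
  | zero => simp [gaussianCoeff]
  | succ j ih =>
    rw [show 2 * (j + 1) = (2 * j) + 2 by ring, gaussianCoeff, ih, Nat.factorial_succ]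
    have h3 : (j.factorial : ℝ) ≠ 0 := by exact_mod_cast j.factorial_ne_zero
    push_cast
    field_simp
    ring

/-- Odd coefficients vanish, so cutting the moment series at an even order leaves a partial sum of
the exponential series of `-v t² / 2`, the logarithm of the Gaussian characteristic function. -/
lemma sum_range_two_mul_gaussianCoeff (v t : ℝ) (J : ℕ) :
    ∑ k ∈ Finset.range (2 * J), ((t : ℂ) * Complex.I) ^ k * (gaussianCoeff v k : ℂ)
      = ∑ j ∈ Finset.range J, ((-(v * t ^ 2 / 2) : ℝ) : ℂ) ^ j / (j.factorial : ℂ) := by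
  induction J with
  | zero => simp
  | succ J ih =>
    rw [show 2 * (J + 1) = 2 * J + 1 + 1 by ring, Finset.sum_range_succ, Finset.sum_range_succ, ih,
      Finset.sum_range_succ, gaussianCoeff_odd, gaussianCoeff_even]
    push_cast
    rw [pow_mul, mul_pow, Complex.I_sq]
    simp only [mul_zero, add_zero, add_right_inj]
    rw [show (-((v : ℂ) * (t : ℂ) ^ 2 / 2)) = ((t : ℂ) ^ 2 * -1) * (v / 2) by ring, mul_pow _ ((v : ℂ) / 2)]
    ring

variable {Ω : Type*} [MeasurableSpace Ω]

/-- The method of moments for a centred normal limit. -/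
theorem convergesToNormal_of_moments (μ : Measure Ω) [IsProbabilityMeasure μ] (X : ℕ → Ω → ℝ)
    (v : ℝ) (hm : ∀ n, Measurable (X n)) (hint : ∀ n (k : ℕ), Integrable (fun ω => X n ω ^ k) μ)
    (h1 : Tendsto (fun n => ∫ ω, X n ω ∂μ) atTop (𝓝 0))
    (h2 : Tendsto (fun n => ∫ ω, X n ω ^ 2 ∂μ) atTop (𝓝 v))
    (hrec : ∀ L : ℕ, Tendsto (fun n => ∫ ω, X n ω ^ (L + 2) ∂μ -
      (L + 1) * ((∫ ω, X n ω ^ 2 ∂μ) * ∫ ω, X n ω ^ L ∂μ)) atTop (𝓝 0)) :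
    ConvergesToNormal μ X v := by
  have hv : 0 ≤ v := ge_of_tendsto' h2 fun n => integral_nonneg fun ω => sq_nonneg _
  -- The recursion forces the limits of the moments by strong induction: `m (k + 2) = (k + 1) v m
  -- k`.
  have hmom : ∀ k : ℕ, Tendsto (fun n => ∫ ω, X n ω ^ k ∂μ) atTop
      (𝓝 (gaussianCoeff v k * k.factorial)) := by
    intro k
    induction k using Nat.strong_induction_on with
    | _ k ih =>
      match k with
      | 0 => simp [gaussianCoeff]
      | 1 => simpa [gaussianCoeff] using h1
      | k + 2 =>
        have := (hrec k).add ((h2.mul (ih k (by omega))).const_mul ((k : ℝ) + 1))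
        convert this using 2
        · ring
        · rw [gaussianCoeff, Nat.factorial_succ, Nat.factorial_succ]
          push_cast
          field_simp
          ring
  refine ⟨hv, fun n => (hm n).aemeasurable, by fun_prop, ?_⟩
  refine ProbabilityMeasure.tendsto_iff_tendsto_charFun.2 fun t => ?_
  simp only [ProbabilityMeasure.coe_mk, Measure.map_id, charFun_gaussianReal]
  have hchar : ∀ n, charFun (μ.map (X n)) t = ∫ ω, Complex.exp ((t * X n ω : ℝ) * Complex.I) ∂μ := by
    intro n
    rw [charFun_apply_real, integral_map (hm n).aemeasurable (by fun_prop)]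
    simp
  simp only [hchar]
  -- Cutting at the even order `2 J` makes the Taylor remainder `|t X|^(2 J)` a genuine moment,
  -- whose limit is known.
  have hbound : ∀ (J n : ℕ), ‖∫ ω, Complex.exp ((t * X n ω : ℝ) * Complex.I) ∂μ -
      ∑ k ∈ Finset.range (2 * J), ((t : ℂ) * Complex.I) ^ k *
        (((∫ ω, X n ω ^ k ∂μ) / k.factorial : ℝ) : ℂ)‖
      ≤ t ^ (2 * J) * (∫ ω, X n ω ^ (2 * J) ∂μ) / (2 * J).factorial := by
    intro J n
    have e1 : ∑ k ∈ Finset.range (2 * J), ((t : ℂ) * Complex.I) ^ k *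
        (((∫ ω, X n ω ^ k ∂μ) / k.factorial : ℝ) : ℂ) =
        ∫ ω, ∑ k ∈ Finset.range (2 * J), (((t * X n ω : ℝ) : ℂ) * Complex.I) ^ k /
          (k.factorial : ℂ) ∂μ := by
      have hi : ∀ k ∈ Finset.range (2 * J), Integrable (fun ω =>
          (((t * X n ω : ℝ) : ℂ) * Complex.I) ^ k / (k.factorial : ℂ)) μ := by
        intro k _
        have := ((hint n k).ofReal (𝕜 := ℂ)).const_mul (((t : ℂ) * Complex.I) ^ k / (k.factorial : ℂ))
        refine this.congr (Eventually.of_forall fun ω => ?_)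
        simp
        ring
      rw [integral_finsetSum _ hi]
      refine Finset.sum_congr rfl fun k _ => ?_
      have : ∀ ω, (((t * X n ω : ℝ) : ℂ) * Complex.I) ^ k / (k.factorial : ℂ) =
          (((t : ℂ) * Complex.I) ^ k / (k.factorial : ℂ)) * ((X n ω ^ k : ℝ) : ℂ) := by
        intro ω; push_cast; ring
      simp_rw [this]
      rw [integral_const_mul, integral_complex_ofReal]
      push_cast; ring
    have hi2 : Integrable (fun ω => Complex.exp ((t * X n ω : ℝ) * Complex.I)) μ := by
      refine Integrable.of_bound (C := 1) (by have := hm n; fun_prop) (Eventually.of_forall fun ω => ?_)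
      rw [Complex.norm_exp_ofReal_mul_I]
    have hi3 : Integrable (fun ω => ∑ k ∈ Finset.range (2 * J),
        (((t * X n ω : ℝ) : ℂ) * Complex.I) ^ k / (k.factorial : ℂ)) μ := by
      refine integrable_finsetSum _ fun k _ => ?_
      have := ((hint n k).ofReal (𝕜 := ℂ)).const_mul (((t : ℂ) * Complex.I) ^ k / (k.factorial : ℂ))
      refine this.congr (Eventually.of_forall fun ω => ?_)
      simp
      ring
    rw [e1, ← integral_sub hi2 hi3]
    refine (norm_integral_le_of_norm_le
      (g := fun ω => t ^ (2 * J) / (2 * J).factorial * X n ω ^ (2 * J))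
      ((hint n _).const_mul _) (Eventually.of_forall fun ω => ?_)).trans_eq ?_
    · refine (norm_expTaylor_le (2 * J) (t * X n ω)).trans_eq ?_
      rw [(even_two_mul J).pow_abs, mul_pow]; ring
    · rw [integral_const_mul]; ring
  have hexp : Tendsto (fun J : ℕ => ∑ j ∈ Finset.range J,
      ((-(v * t ^ 2 / 2) : ℝ) : ℂ) ^ j / (j.factorial : ℂ)) atTop
      (𝓝 (Complex.exp ((-(v * t ^ 2 / 2) : ℝ) : ℂ))) := by
    rw [Complex.exp_eq_exp_ℂ]
    exact (NormedSpace.expSeries_div_hasSum_exp (𝔸 := ℂ) _).tendsto_sum_nat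
  have htail : Tendsto (fun J : ℕ => (v * t ^ 2 / 2) ^ J / (J.factorial : ℝ)) atTop (𝓝 0) :=
    FloorSemiring.tendsto_pow_div_factorial_atTop _
  have hlim : Complex.exp ((t : ℂ) * ((0 : ℝ) : ℂ) * Complex.I -
      ((v.toNNReal : ℝ) : ℂ) * (t : ℂ) ^ 2 / 2) = Complex.exp ((-(v * t ^ 2 / 2) : ℝ) : ℂ) := by
    rw [Real.coe_toNNReal v hv]; congr 1; push_cast; ring
  rw [Metric.tendsto_atTop]
  intro ε hε
  -- `J` is fixed before `n`. It makes both the tail of the exponential series and the limit `(v t²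
  -- / 2)^J / J!` of the Taylor remainder small.
  obtain ⟨J, hJ1, hJ2⟩ := ((Metric.tendsto_atTop.1 hexp (ε / 3) (by positivity)).imp
    fun N h => h).elim fun N hN =>
    ((Metric.tendsto_atTop.1 htail (ε / 3) (by positivity)).elim fun N' hN' =>
      ⟨max N N', hN _ (le_max_left _ _), hN' _ (le_max_right _ _)⟩ :
      ∃ J, dist (∑ j ∈ Finset.range J,
      ((-(v * t ^ 2 / 2) : ℝ) : ℂ) ^ j / (j.factorial : ℂ))
        (Complex.exp ((-(v * t ^ 2 / 2) : ℝ) : ℂ)) < ε / 3 ∧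
        dist ((v * t ^ 2 / 2) ^ J / (J.factorial : ℝ)) 0 < ε / 3)
  have hA : Tendsto (fun n => ∑ k ∈ Finset.range (2 * J), ((t : ℂ) * Complex.I) ^ k *
        (((∫ ω, X n ω ^ k ∂μ) / k.factorial : ℝ) : ℂ)) atTop
      (𝓝 (∑ j ∈ Finset.range J, ((-(v * t ^ 2 / 2) : ℝ) : ℂ) ^ j / (j.factorial : ℂ))) := by
    rw [← sum_range_two_mul_gaussianCoeff]
    refine tendsto_finsetSum _ fun k _ => Tendsto.const_mul _ ?_
    refine (Complex.continuous_ofReal.tendsto _).comp ?_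
    have := (hmom k).div_const (k.factorial : ℝ)
    rwa [mul_div_cancel_right₀] at this
    exact_mod_cast k.factorial_ne_zero
  have hB : Tendsto (fun n => t ^ (2 * J) * (∫ ω, X n ω ^ (2 * J) ∂μ) / (2 * J).factorial) atTop
      (𝓝 ((v * t ^ 2 / 2) ^ J / (J.factorial : ℝ))) := by
    have := ((hmom (2 * J)).const_mul (t ^ (2 * J))).div_const ((2 * J).factorial : ℝ)
    convert this using 2
    rw [← mul_assoc, mul_div_cancel_right₀ _ (by exact_mod_cast (2 * J).factorial_ne_zero),
      gaussianCoeff_even, pow_mul, mul_div_assoc', ← mul_pow]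
    congr 2; ring
  have hB' : ∀ᶠ n in atTop, t ^ (2 * J) * (∫ ω, X n ω ^ (2 * J) ∂μ) / (2 * J).factorial < ε / 3 := by
    refine hB.eventually_lt_const (lt_of_le_of_lt (le_abs_self _) ?_)
    rwa [Real.dist_eq, sub_zero] at hJ2
  obtain ⟨N, hN⟩ := eventually_atTop.1
    (((Metric.tendsto_nhds.1 hA) (ε / 3) (by positivity)).and hB')
  refine ⟨N, fun n hn => ?_⟩
  obtain ⟨h3, h4⟩ := hN n hn
  rw [hlim]
  have h5 := (hbound J n).trans_lt h4
  rw [← dist_eq_norm] at h5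
  calc dist _ _ ≤ _ + _ := dist_triangle4 _ _ _ _
    _ < ε / 3 + ε / 3 + ε / 3 := by gcongr
    _ = ε := by ring

end SparseToeplitz
end

noncomputable section
namespace SparseToeplitz

/-! ### Moment bounds -/

/-- `f` is measurable and its absolute moments are bounded by `B`. -/
def MomentBound {Ω : Type*} [MeasurableSpace Ω] (μ : Measure Ω) (f : Ω → ℂ) (B : ℕ → ℝ) : Prop :=
  Measurable f ∧ ∀ k : ℕ, Integrable (fun ω => ‖f ω‖ ^ k) μ ∧ ∫ ω, ‖f ω‖ ^ k ∂μ ≤ B k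

section MomentBound

variable {Ω : Type*} [MeasurableSpace Ω] {μ : Measure Ω}

lemma integrable_norm_pow_of_le {f : Ω → ℂ} {g : Ω → ℝ} {B : ℝ} (k : ℕ) (hf : Measurable f)
    (hg : Integrable g μ) (h : ∀ ω, ‖f ω‖ ^ k ≤ g ω) (hB : ∫ ω, g ω ∂μ ≤ B) :
    Integrable (fun ω => ‖f ω‖ ^ k) μ ∧ ∫ ω, ‖f ω‖ ^ k ∂μ ≤ B := by
  have h1 : Integrable (fun ω => ‖f ω‖ ^ k) μ := by
    refine hg.mono' (by fun_prop) (Eventually.of_forall fun ω => ?_)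
    rw [Real.norm_of_nonneg (by positivity)]
    exact h ω
  exact ⟨h1, (integral_mono h1 hg h).trans hB⟩

/-- From `2 x y ≤ x² + y²`: doubling the order of the moments replaces Hölder's inequality. -/
lemma MomentBound.mul {f g : Ω → ℂ} {B B' : ℕ → ℝ} (hf : MomentBound μ f B)
    (hg : MomentBound μ g B') :
    MomentBound μ (fun ω => f ω * g ω) (fun k => B (2 * k) + B' (2 * k)) := by
  refine ⟨hf.1.mul hg.1, fun k => ?_⟩
  refine integrable_norm_pow_of_le k (hf.1.mul hg.1) ((hf.2 (2 * k)).1.add (hg.2 (2 * k)).1)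
    (fun ω => ?_) ?_
  · simp only [Pi.add_apply]
    rw [norm_mul, mul_pow, pow_mul' _ 2, pow_mul' _ 2]
    nlinarith [sq_nonneg (‖f ω‖ ^ k - ‖g ω‖ ^ k), sq_nonneg (‖f ω‖ ^ k), sq_nonneg (‖g ω‖ ^ k)]
  · rw [integral_add' (hf.2 _).1 (hg.2 _).1]
    exact add_le_add (hf.2 _).2 (hg.2 _).2

lemma MomentBound.add {f g : Ω → ℂ} {B B' : ℕ → ℝ} (hf : MomentBound μ f B)
    (hg : MomentBound μ g B') :
    MomentBound μ (fun ω => f ω + g ω) (fun k => 2 ^ k * (B k + B' k)) := by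
  have hm : Measurable fun ω => f ω + g ω := hf.1.add hg.1
  refine ⟨hm, fun k => integrable_norm_pow_of_le k hm
    (((hf.2 k).1.add (hg.2 k).1).const_mul (2 ^ k)) (fun ω => ?_) ?_⟩
  · simp only [Pi.add_apply]
    have h1 : ‖f ω + g ω‖ ≤ 2 * max ‖f ω‖ ‖g ω‖ := by
      refine (norm_add_le _ _).trans ?_
      linarith [le_max_left ‖f ω‖ ‖g ω‖, le_max_right ‖f ω‖ ‖g ω‖]
    refine (pow_le_pow_left₀ (norm_nonneg _) h1 k).trans ?_
    rw [mul_pow]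
    gcongr
    rcases max_choice ‖f ω‖ ‖g ω‖ with h | h <;> rw [h]
    · linarith [pow_nonneg (norm_nonneg (g ω)) k]
    · linarith [pow_nonneg (norm_nonneg (f ω)) k]
  · rw [integral_const_mul, integral_add' (hf.2 _).1 (hg.2 _).1]
    exact mul_le_mul_of_nonneg_left (add_le_add (hf.2 k).2 (hg.2 k).2) (by positivity)

lemma momentBound_const [IsProbabilityMeasure μ] (c : ℂ) :
    MomentBound μ (fun _ => c) fun k => ‖c‖ ^ k :=
  ⟨measurable_const, fun k => by simp⟩

lemma exists_momentBound_sum [IsProbabilityMeasure μ] {ι : Type*} (s : Finset ι) (f : ι → Ω → ℂ)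
    (hf : ∀ i ∈ s, ∃ B, MomentBound μ (f i) B) : ∃ B, MomentBound μ (fun ω => ∑ i ∈ s, f i ω) B := by
  classical
  induction s using Finset.induction_on with
  | empty => exact ⟨_, by simpa using momentBound_const (μ := μ) 0⟩
  | insert i s hi ih =>
    obtain ⟨B, hB⟩ := hf i (Finset.mem_insert_self i s)
    obtain ⟨B', hB'⟩ := ih fun j hj => hf j (Finset.mem_insert_of_mem hj)
    refine ⟨fun k => 2 ^ k * (B k + B' k), ?_⟩
    simp only [Finset.sum_insert hi]
    exact hB.add hB'

lemma MomentBound.add_const [IsProbabilityMeasure μ] {f : Ω → ℂ} {B : ℕ → ℝ} {c : ℂ} {C : ℝ}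
    (hf : MomentBound μ f B) (hc : ‖c‖ ≤ C) :
    MomentBound μ (fun ω => f ω + c) (fun k => 2 ^ k * (B k + C ^ k)) := by
  have h := hf.add (momentBound_const c)
  refine ⟨h.1, fun k => ⟨(h.2 k).1, (h.2 k).2.trans ?_⟩⟩
  exact mul_le_mul_of_nonneg_left
    (add_le_add le_rfl (pow_le_pow_left₀ (norm_nonneg _) hc k)) (by positivity)

lemma MomentBound.integrable {f : Ω → ℂ} {B : ℕ → ℝ} (hf : MomentBound μ f B) :
    Integrable f μ := by
  have := (hf.2 1).1
  simp only [pow_one] at this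
  exact (integrable_norm_iff hf.1.aestronglyMeasurable).1 this

lemma MomentBound.norm_integral_le {f : Ω → ℂ} {B : ℕ → ℝ} (hf : MomentBound μ f B) :
    ‖∫ ω, f ω ∂μ‖ ≤ B 1 :=
  (norm_integral_le_integral_norm f).trans (by simpa using (hf.2 1).2)

lemma momentBound_one [IsProbabilityMeasure μ] : MomentBound μ (fun _ => (1 : ℂ)) fun _ => 1 :=
  ⟨measurable_const, fun k => by simp⟩

/-- Products of `m` functions with common moment bounds have common moment bounds. -/
lemma exists_momentBound_prod [IsProbabilityMeasure μ] (B : ℕ → ℝ) (m : ℕ) :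
    ∃ B' : ℕ → ℝ, ∀ {ι : Type} (s : Finset ι) (f : ι → Ω → ℂ), s.card ≤ m →
      (∀ i ∈ s, MomentBound μ (f i) B) → MomentBound μ (fun ω => ∏ i ∈ s, f i ω) B' := by
  classical
  induction m with
  | zero =>
    refine ⟨fun _ => 1, fun s f hs _ => ?_⟩
    rw [Finset.card_eq_zero.1 (Nat.le_zero.1 hs)]
    simpa using momentBound_one
  | succ m ih =>
    obtain ⟨B', hB'⟩ := ih
    -- The absolute values and the `1` keep the bound valid for the empty product, as index sets
    -- smaller than `m + 1` are allowed.
    refine ⟨fun k => |B (2 * k)| + |B' (2 * k)| + 1, fun s f hs hf => ?_⟩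
    rcases s.eq_empty_or_nonempty with rfl | ⟨i, hi⟩
    · refine ⟨by simp, fun k => ⟨by simp, ?_⟩⟩
      simp only [Finset.prod_empty, norm_one, one_pow, integral_const, probReal_univ, smul_eq_mul,
        mul_one]
      linarith [abs_nonneg (B (2 * k)), abs_nonneg (B' (2 * k))]
    · have h1 := (hf i hi).mul (hB' (s.erase i) f (by rw [Finset.card_erase_of_mem hi]; omega)
        fun j hj => hf j (Finset.mem_of_mem_erase hj))
      have h2 : (fun ω => f i ω * ∏ j ∈ s.erase i, f j ω) = fun ω => ∏ i ∈ s, f i ω := by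
        funext ω; exact Finset.mul_prod_erase s (fun j => f j ω) hi
      rw [h2] at h1
      refine ⟨h1.1, fun k => ⟨(h1.2 k).1, (h1.2 k).2.trans ?_⟩⟩
      linarith [le_abs_self (B (2 * k)), le_abs_self (B' (2 * k))]

end MomentBound

/-! ### Families of entries which are independent up to a class function -/

/-- The entries `a x` are centred, have uniformly bounded moments, and tuples of entries with
disjoint classes are independent. -/
structure IsEntryFamily {Ω : Type*} [MeasurableSpace Ω] (μ : Measure Ω) (a : ℤ → Ω → ℂ)
    (cl : ℤ → ℤ) : Prop where
  indep : ∀ F G : Finset ℤ, (∀ x ∈ F, ∀ y ∈ G, cl x ≠ cl y) →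
    IndepFun (fun ω (x : F) => a x ω) (fun ω (y : G) => a y ω) μ
  mean : ∀ x, ∫ ω, a x ω ∂μ = 0
  bounded : ∃ B : ℕ → ℝ, ∀ x, MomentBound μ (a x) B

/-- `f` is a measurable function of the entries `a x`, `x ∈ F`. -/
def DependsOnEntries {Ω : Type*} (a : ℤ → Ω → ℂ) (F : Finset ℤ) (f : Ω → ℂ) : Prop :=
  ∃ φ : (F → ℂ) → ℂ, Measurable φ ∧ ∀ ω, f ω = φ fun x => a x ω

section DependsOnEntries

variable {Ω : Type*} {a : ℤ → Ω → ℂ} {F G : Finset ℤ} {f g : Ω → ℂ}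

lemma dependsOnEntries_entry {x : ℤ} (hx : x ∈ F) : DependsOnEntries a F (a x) :=
  ⟨fun v => v ⟨x, hx⟩, measurable_pi_apply _, fun _ => rfl⟩

lemma DependsOnEntries.sub_const (hf : DependsOnEntries a F f) (c : ℂ) :
    DependsOnEntries a F fun ω => f ω - c := by
  obtain ⟨φ, h1, h2⟩ := hf
  exact ⟨fun v => φ v - c, h1.sub_const c, fun ω => by simp only [h2]⟩

lemma dependsOnEntries_prod {ι : Type*} (s : Finset ι) (f : ι → Ω → ℂ)
    (hf : ∀ i ∈ s, DependsOnEntries a F (f i)) :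
    DependsOnEntries a F fun ω => ∏ i ∈ s, f i ω := by
  classical
  induction s using Finset.induction_on with
  | empty => exact ⟨fun _ => 1, measurable_const, fun ω => by simp⟩
  | insert i s hi ih =>
    obtain ⟨φ, h1, h2⟩ := hf i (Finset.mem_insert_self i s)
    obtain ⟨ψ, h3, h4⟩ := ih fun j hj => hf j (Finset.mem_insert_of_mem hj)
    exact ⟨fun v => φ v * ψ v, h1.mul h3, fun ω => by
      simp only [Finset.prod_insert hi, h2, ← h4]⟩

variable [MeasurableSpace Ω] {μ : Measure Ω} {cl : ℤ → ℤ}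

lemma IsEntryFamily.measurable (ha : IsEntryFamily μ a cl) (x : ℤ) : Measurable (a x) :=
  let ⟨_, hB⟩ := ha.bounded
  (hB x).1

lemma IsEntryFamily.integral_mul (ha : IsEntryFamily μ a cl) (hf : DependsOnEntries a F f)
    (hg : DependsOnEntries a G g) (hFG : ∀ x ∈ F, ∀ y ∈ G, cl x ≠ cl y) :
    ∫ ω, f ω * g ω ∂μ = (∫ ω, f ω ∂μ) * ∫ ω, g ω ∂μ := by
  obtain ⟨φ, h1, h2⟩ := hf
  obtain ⟨ψ, h3, h4⟩ := hg
  simp_rw [h2, h4]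
  have hm : ∀ F : Finset ℤ, Measurable fun ω (x : F) => a x ω := fun F =>
    measurable_pi_lambda _ fun x => ha.measurable x
  exact (ha.indep F G hFG).integral_fun_comp_mul_comp (hm F).aemeasurable (hm G).aemeasurable
    h1.aestronglyMeasurable h3.aestronglyMeasurable

end DependsOnEntries

/-- `∏ᵢ a (x i)`. -/
def wordProd {Ω ι : Type*} [Fintype ι] (a : ℤ → Ω → ℂ) (x : ι → ℤ) (ω : Ω) : ℂ := ∏ i, a (x i) ω

/-- `∏ᵢ a (x i) - 𝔼 ∏ᵢ a (x i)`. -/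
def centredProd {Ω ι : Type*} [Fintype ι] [MeasurableSpace Ω] (μ : Measure Ω) (a : ℤ → Ω → ℂ)
    (x : ι → ℤ) (ω : Ω) : ℂ := wordProd a x ω - ∫ ω', wordProd a x ω' ∂μ

section Words

lemma dependsOnEntries_wordProd {Ω : Type*} {a : ℤ → Ω → ℂ} {ι : Type*} [Fintype ι] (F : Finset ℤ) (x : ι → ℤ)
    (hx : ∀ i, x i ∈ F) : DependsOnEntries a F (wordProd a x) :=
  dependsOnEntries_prod _ _ fun i _ => dependsOnEntries_entry (hx i)

variable {Ω : Type*} [MeasurableSpace Ω] {μ : Measure Ω} {a : ℤ → Ω → ℂ} {cl : ℤ → ℤ}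

lemma IsEntryFamily.exists_momentBound_wordProd [IsProbabilityMeasure μ]
    (ha : IsEntryFamily μ a cl) (m : ℕ) :
    ∃ B : ℕ → ℝ, ∀ {ι : Type} [Fintype ι] (x : ι → ℤ), Fintype.card ι ≤ m →
      MomentBound μ (wordProd a x) B := by
  obtain ⟨B, hB⟩ := ha.bounded
  obtain ⟨B', hB'⟩ := exists_momentBound_prod (μ := μ) B m
  exact ⟨B', fun x hx => hB' Finset.univ _ (by simpa using hx) fun i _ => hB (x i)⟩

lemma IsEntryFamily.exists_momentBound_centredProd [IsProbabilityMeasure μ]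
    (ha : IsEntryFamily μ a cl) (m : ℕ) :
    ∃ B : ℕ → ℝ, ∀ {ι : Type} [Fintype ι] (x : ι → ℤ), Fintype.card ι ≤ m →
      MomentBound μ (centredProd μ a x) B := by
  obtain ⟨B, hB⟩ := ha.exists_momentBound_wordProd m
  refine ⟨fun k => 2 ^ k * (B k + B 1 ^ k), fun x hx => ?_⟩
  have := (hB x hx).add_const (C := B 1) (c := -∫ ω', wordProd a x ω' ∂μ)
    (by rw [norm_neg]; exact (hB x hx).norm_integral_le)
  simp only [← sub_eq_add_neg] at this
  exact this

end Words

/-- Expansion of a product of two integrals of products of sums. -/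
lemma integral_prod_sum_mul {Ω : Type*} [MeasurableSpace Ω] {μ : Measure Ω} [SFinite μ]
    {κ : Type*} [Fintype κ] [DecidableEq κ] {ι : κ → Type*} (W : ∀ k, Finset (ι k))
    (u : ∀ k, ι k → ℂ) (f : ∀ k, ι k → Ω → ℂ)
    (hf : ∀ (x : ∀ k, ι k) (A : Finset κ), Integrable (fun ω => ∏ k ∈ A, f k (x k) ω) μ)
    (A : Finset κ) :
    (∫ ω, ∏ k ∈ A, ∑ j ∈ W k, u k j * f k j ω ∂μ) *
        (∫ ω, ∏ k ∈ Aᶜ, ∑ j ∈ W k, u k j * f k j ω ∂μ) =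
      ∑ x ∈ Fintype.piFinset W, (∏ k, u k (x k)) *
        ((∫ ω, ∏ k ∈ A, f k (x k) ω ∂μ) * ∫ ω, ∏ k ∈ Aᶜ, f k (x k) ω ∂μ) := by
  have split : ∀ f g : κ → ℂ, (∏ k ∈ A, f k) * ∏ k ∈ Aᶜ, g k = ∏ k, if k ∈ A then f k else g k := by
    intro f g
    rw [← Finset.prod_mul_prod_compl A (fun k => if k ∈ A then f k else g k)]
    congr 1
    · exact Finset.prod_congr rfl fun k hk => by rw [if_pos hk]
    · exact Finset.prod_congr rfl fun k hk => by rw [if_neg (Finset.mem_compl.1 hk)]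
  -- On two independent copies of `Ω` the product of the integrals is one integral: factors with `k
  -- ∈ A` use the first copy, the others the second, and the product of sums expands in one step.
  rw [← integral_prod_mul]
  have h1 : ∀ z : Ω × Ω, (∏ k ∈ A, ∑ j ∈ W k, u k j * f k j z.1) *
      ∏ k ∈ Aᶜ, ∑ j ∈ W k, u k j * f k j z.2 = ∑ x ∈ Fintype.piFinset W, (∏ k, u k (x k)) *
        ((∏ k ∈ A, f k (x k) z.1) * ∏ k ∈ Aᶜ, f k (x k) z.2) := by
    intro z
    rw [split]
    have : ∀ k, (if k ∈ A then ∑ j ∈ W k, u k j * f k j z.1 else ∑ j ∈ W k, u k j * f k j z.2) =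
        ∑ j ∈ W k, u k j * if k ∈ A then f k j z.1 else f k j z.2 := by
      intro k; split_ifs <;> rfl
    simp_rw [this]
    rw [Finset.prod_univ_sum]
    refine Finset.sum_congr rfl fun x _ => ?_
    rw [Finset.prod_mul_distrib, split]
  simp_rw [h1]
  rw [integral_finsetSum]
  · refine Finset.sum_congr rfl fun x _ => ?_
    rw [integral_const_mul]
    congr 1
    exact integral_prod_mul (fun ω => ∏ k ∈ A, f k (x k) ω) fun ω => ∏ k ∈ Aᶜ, f k (x k) ω
  · intro x _
    exact ((hf x A).mul_prod (hf x Aᶜ)).const_mul _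

/-! ### Products of several centred words -/

section Slots

variable {Ω : Type*} [MeasurableSpace Ω] {μ : Measure Ω} {a : ℤ → Ω → ℂ} {cl : ℤ → ℤ}
  {κ : Type} {p : κ → ℕ}

/-- Two words share a class. -/
def Adjacent (cl : ℤ → ℤ) (x : ∀ k, Fin (p k) → ℤ) (k l : κ) : Prop :=
  ∃ i j, cl (x k i) = cl (x l j)

/-- Every class occurs at least twice, every word has a neighbour, and some word has two
neighbours. -/
def IsEntangled (cl : ℤ → ℤ) (x : ∀ k, Fin (p k) → ℤ) : Prop :=
  (∀ s : Σ k, Fin (p k), ∃ t : Σ k, Fin (p k), t ≠ s ∧ cl (x t.1 t.2) = cl (x s.1 s.2)) ∧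
  (∀ k, ∃ l, l ≠ k ∧ Adjacent cl x k l) ∧
  ∃ k l l', l ≠ k ∧ l' ≠ k ∧ l ≠ l' ∧ Adjacent cl x k l ∧ Adjacent cl x k l'

lemma Adjacent.symm {x : ∀ k, Fin (p k) → ℤ} {k l : κ} (h : Adjacent cl x k l) :
    Adjacent cl x l k :=
  let ⟨i, j, hij⟩ := h
  ⟨j, i, hij.symm⟩

/-- `𝔼 ∏_{k ∈ A} Yₖ`, where `Yₖ` is the centred product along the word `x k`. -/
def jointMoment (μ : Measure Ω) (a : ℤ → Ω → ℂ) (x : ∀ k, Fin (p k) → ℤ) (A : Finset κ) : ℂ :=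
  ∫ ω, ∏ k ∈ A, centredProd μ a (x k) ω ∂μ

/-- The letters of the words `x k`, `k ∈ A`. -/
def letters [DecidableEq κ] (x : ∀ k, Fin (p k) → ℤ) (A : Finset κ) : Finset ℤ :=
  A.biUnion fun k => Finset.univ.image (x k)

lemma mem_letters [DecidableEq κ] {x : ∀ k, Fin (p k) → ℤ} {A : Finset κ} {y : ℤ} :
    y ∈ letters x A ↔ ∃ k ∈ A, ∃ i, x k i = y := by
  simp [letters]

lemma dependsOnEntries_slots [DecidableEq κ] (x : ∀ k, Fin (p k) → ℤ) (A : Finset κ) :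
    DependsOnEntries a (letters x A) fun ω => ∏ k ∈ A, centredProd μ a (x k) ω :=
  dependsOnEntries_prod _ _ fun k hk =>
    (dependsOnEntries_wordProd _ _ fun i => mem_letters.2 ⟨k, hk, i, rfl⟩).sub_const _

lemma IsEntryFamily.jointMoment_union [DecidableEq κ] (ha : IsEntryFamily μ a cl)
    (x : ∀ k, Fin (p k) → ℤ) (A B : Finset κ) (hAB : Disjoint A B)
    (h : ∀ k ∈ A, ∀ l ∈ B, ¬ Adjacent cl x k l) :
    jointMoment μ a x (A ∪ B) = jointMoment μ a x A * jointMoment μ a x B := by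
  unfold jointMoment
  simp_rw [Finset.prod_union hAB]
  refine ha.integral_mul (dependsOnEntries_slots x A) (dependsOnEntries_slots x B) ?_
  intro y hy z hz hyz
  obtain ⟨k, hk, i, rfl⟩ := mem_letters.1 hy
  obtain ⟨l, hl, j, rfl⟩ := mem_letters.1 hz
  exact h k hk l hl ⟨i, j, hyz⟩

/-- A letter whose class does not recur is independent of all other letters and centred. -/
lemma IsEntryFamily.integral_wordProd_eq_zero (ha : IsEntryFamily μ a cl) {ι : Type*} [Fintype ι]
    (x : ι → ℤ) (i : ι) (hi : ∀ j, j ≠ i → cl (x j) ≠ cl (x i)) :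
    ∫ ω, wordProd a x ω ∂μ = 0 := by
  classical
  have h1 : ∀ ω, wordProd a x ω = a (x i) ω * ∏ j ∈ Finset.univ.erase i, a (x j) ω := fun ω =>
    (Finset.mul_prod_erase _ _ (Finset.mem_univ i)).symm
  simp_rw [h1]
  rw [ha.integral_mul (F := {x i}) (G := (Finset.univ.erase i).image x)
    (dependsOnEntries_entry (by simp))
    (dependsOnEntries_prod _ _ fun j hj => dependsOnEntries_entry (Finset.mem_image_of_mem _ hj)),
    ha.mean, zero_mul]
  intro y hy z hz
  obtain ⟨j, hj, rfl⟩ := Finset.mem_image.1 hz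
  rw [Finset.mem_singleton.1 hy]
  exact (hi j (Finset.ne_of_mem_erase hj)).symm

/-- The word containing the lonely letter has mean zero, so its centring changes nothing and the
letter splits off from the whole product as an independent centred factor. -/
lemma IsEntryFamily.jointMoment_eq_zero_of_single [DecidableEq κ] (ha : IsEntryFamily μ a cl)
    (x : ∀ k, Fin (p k) → ℤ) (A : Finset κ) (s : Σ k, Fin (p k)) (hs : s.1 ∈ A)
    (h : ∀ t : Σ k, Fin (p k), t ≠ s → cl (x t.1 t.2) ≠ cl (x s.1 s.2)) :
    jointMoment μ a x A = 0 := by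
  obtain ⟨k, i⟩ := s
  have h0 : ∫ ω, wordProd a (x k) ω ∂μ = 0 :=
    ha.integral_wordProd_eq_zero (x k) i fun j hj => h ⟨k, j⟩ (by simpa using hj)
  have h1 : ∀ ω, ∏ k ∈ A, centredProd μ a (x k) ω = a (x k i) ω *
      ((∏ j ∈ Finset.univ.erase i, a (x k j) ω) * ∏ l ∈ A.erase k, centredProd μ a (x l) ω) := by
    intro ω
    rw [← Finset.mul_prod_erase A _ hs, ← mul_assoc,
      Finset.mul_prod_erase Finset.univ (fun j => a (x k j) ω) (Finset.mem_univ i)]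
    simp only [centredProd, h0, sub_zero]
    rfl
  unfold jointMoment
  simp_rw [h1]
  set G : Finset ℤ := (Finset.univ.erase i).image (x k) ∪ letters x (A.erase k) with hG
  have h2 : DependsOnEntries a G fun ω =>
      (∏ j ∈ Finset.univ.erase i, a (x k j) ω) * ∏ l ∈ A.erase k, centredProd μ a (x l) ω := by
    -- The two factors are written as a product over `Bool`, so that `dependsOnEntries_prod` covers
    -- them.
    have e : (fun ω => (∏ j ∈ Finset.univ.erase i, a (x k j) ω) *
        ∏ l ∈ A.erase k, centredProd μ a (x l) ω) = fun ω => ∏ b : Bool, (Bool.rec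
          (∏ j ∈ Finset.univ.erase i, a (x k j) ω)
          (∏ l ∈ A.erase k, centredProd μ a (x l) ω) b : ℂ) := by
      funext ω; rw [Fintype.prod_bool, mul_comm]
    rw [e]
    refine dependsOnEntries_prod _ (fun b ω => (Bool.rec
          (∏ j ∈ Finset.univ.erase i, a (x k j) ω)
          (∏ l ∈ A.erase k, centredProd μ a (x l) ω) b : ℂ)) fun b _ => ?_
    cases b
    · exact dependsOnEntries_prod _ _ fun j hj => dependsOnEntries_entry
        (Finset.mem_union_left _ (Finset.mem_image_of_mem _ hj))
    · exact dependsOnEntries_prod _ _ fun l hl => (dependsOnEntries_wordProd _ _ fun j =>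
        Finset.mem_union_right _ (mem_letters.2 ⟨l, hl, j, rfl⟩)).sub_const _
  rw [ha.integral_mul (F := {x k i}) (dependsOnEntries_entry (by simp)) h2, ha.mean, zero_mul]
  intro y hy z hz
  rw [Finset.mem_singleton.1 hy]
  rcases Finset.mem_union.1 hz with hz | hz
  · obtain ⟨j, hj, rfl⟩ := Finset.mem_image.1 hz
    exact (h ⟨k, j⟩ (by simpa using Finset.ne_of_mem_erase hj)).symm
  · obtain ⟨l, hl, j, rfl⟩ := mem_letters.1 hz
    refine (h ⟨l, j⟩ fun e => Finset.ne_of_mem_erase hl (congrArg Sigma.fst e)).symm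

lemma jointMoment_empty [IsProbabilityMeasure μ] (x : ∀ k, Fin (p k) → ℤ) :
    jointMoment μ a x ∅ = 1 := by
  simp [jointMoment]

lemma IsEntryFamily.jointMoment_singleton [IsProbabilityMeasure μ] (ha : IsEntryFamily μ a cl)
    (x : ∀ k, Fin (p k) → ℤ) (k : κ) :
    jointMoment μ a x {k} = 0 := by
  obtain ⟨B, hB⟩ := ha.exists_momentBound_wordProd (p k)
  have := (hB (x k) (by simp)).integrable
  simp only [jointMoment, Finset.prod_singleton, centredProd]
  rw [integral_sub this (integrable_const _)]
  simp

/-- A word that shares no class with the other words of `A` is independent of them, and its centred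
product has mean zero. -/
lemma IsEntryFamily.jointMoment_eq_zero_of_isolated [DecidableEq κ] [IsProbabilityMeasure μ]
    (ha : IsEntryFamily μ a cl) (x : ∀ k, Fin (p k) → ℤ) (A : Finset κ) (k : κ) (hk : k ∈ A)
    (h : ∀ l ∈ A, l ≠ k → ¬ Adjacent cl x k l) : jointMoment μ a x A = 0 := by
  rw [← Finset.insert_erase hk, Finset.insert_eq, ha.jointMoment_union,
    ha.jointMoment_singleton, zero_mul]
  · simp
  · intro l hl m hm
    rw [Finset.mem_singleton.1 hl]
    exact h m (Finset.mem_of_mem_erase hm) (Finset.ne_of_mem_erase hm)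

/-- The defect of the Wick recursion for the centred products along the words `x k`. -/
def wickDefect [Fintype κ] [DecidableEq κ] (μ : Measure Ω) (a : ℤ → Ω → ℂ)
    (x : ∀ k, Fin (p k) → ℤ) (k : κ) : ℂ :=
  jointMoment μ a x Finset.univ - ∑ l ∈ Finset.univ.erase k,
    jointMoment μ a x {k, l} * jointMoment μ a x {k, l}ᶜ

/-- A class occurring once, or a word without neighbour, annihilates the full moment and one factor
of each term of the sum. Otherwise no word has two neighbours, so adjacency is a perfect matching;
the only surviving term is that of the partner of `k`, and it equals the full moment by
independence. -/
lemma IsEntryFamily.wickDefect_eq_zero [Fintype κ] [DecidableEq κ] [IsProbabilityMeasure μ]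
    (ha : IsEntryFamily μ a cl) (x : ∀ k, Fin (p k) → ℤ) (k : κ) (h : ¬ IsEntangled cl x) :
    wickDefect μ a x k = 0 := by
  unfold wickDefect
  by_cases h1 : ∀ s : Σ k, Fin (p k), ∃ t : Σ k, Fin (p k), t ≠ s ∧ cl (x t.1 t.2) = cl (x s.1 s.2)
  swap
  · push Not at h1
    obtain ⟨s, hs⟩ := h1
    rw [ha.jointMoment_eq_zero_of_single x _ s (Finset.mem_univ _) hs, Finset.sum_eq_zero, sub_zero]
    intro l _
    by_cases hm : s.1 ∈ ({k, l} : Finset κ)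
    · rw [ha.jointMoment_eq_zero_of_single x _ s hm hs, zero_mul]
    · rw [ha.jointMoment_eq_zero_of_single x _ s (Finset.mem_compl.2 hm) hs, mul_zero]
  by_cases h2 : ∀ k, ∃ l, l ≠ k ∧ Adjacent cl x k l
  swap
  · push Not at h2
    obtain ⟨m, hm⟩ := h2
    have hm' : ∀ A : Finset κ, m ∈ A → jointMoment μ a x A = 0 := fun A hA =>
      ha.jointMoment_eq_zero_of_isolated x A m hA fun l _ => hm l
    rw [hm' _ (Finset.mem_univ _), Finset.sum_eq_zero, sub_zero]
    intro l _
    by_cases hl : m ∈ ({k, l} : Finset κ)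
    · rw [hm' _ hl, zero_mul]
    · rw [hm' _ (Finset.mem_compl.2 hl), mul_zero]
  have h3 : ∀ k l l', l ≠ k → l' ≠ k → Adjacent cl x k l → Adjacent cl x k l' → l = l' := by
    intro k l l' e1 e2 e3 e4
    by_contra e5
    exact h ⟨h1, h2, k, l, l', e1, e2, e5, e3, e4⟩
  obtain ⟨l, hlk, hl⟩ := h2 k
  -- For `m` other than the partner `l`, the word `k` is isolated in `{k, m}`; for `l` itself no
  -- class links `{k, l}` with its complement.
  rw [Finset.sum_eq_single_of_mem l (by simp [hlk])]
  · rw [← ha.jointMoment_union x _ _ disjoint_compl_right, Finset.union_compl, sub_self]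
    intro m hm m' hm' hadj
    simp only [Finset.mem_insert, Finset.mem_singleton] at hm
    simp only [Finset.mem_compl, Finset.mem_insert, Finset.mem_singleton, not_or] at hm'
    rcases hm with rfl | rfl
    · exact hm'.2 (h3 m m' l hm'.1 hlk hadj hl)
    · exact hm'.1 (h3 m m' k hm'.2 hlk.symm hadj hl.symm)
  · intro m hm hml
    have hmk := Finset.ne_of_mem_erase hm
    rw [ha.jointMoment_eq_zero_of_isolated x {k, m} k (by simp), zero_mul]
    intro l' hl' hl'k hadj
    simp only [Finset.mem_insert, Finset.mem_singleton] at hl'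
    rcases hl' with rfl | rfl
    · exact hl'k rfl
    · exact hml (h3 k l' l hl'k hlk hadj hl)

lemma IsEntryFamily.exists_momentBound_slots [Fintype κ] [IsProbabilityMeasure μ]
    (ha : IsEntryFamily μ a cl) (p : κ → ℕ) :
    ∃ B : ℕ → ℝ, ∀ (x : ∀ k, Fin (p k) → ℤ) (A : Finset κ),
      MomentBound μ (fun ω => ∏ k ∈ A, centredProd μ a (x k) ω) B := by
  obtain ⟨B, hB⟩ := ha.exists_momentBound_centredProd (∑ k, p k)
  obtain ⟨B', hB'⟩ := exists_momentBound_prod (μ := μ) B (Fintype.card κ)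
  refine ⟨B', fun x A => hB' A _ (Finset.card_le_univ A) fun k _ => hB (x k) ?_⟩
  rw [Fintype.card_fin]
  exact Finset.single_le_sum (f := p) (fun _ _ => Nat.zero_le _) (Finset.mem_univ k)

lemma IsEntryFamily.exists_norm_wickDefect_le [Fintype κ] [DecidableEq κ] [IsProbabilityMeasure μ]
    (ha : IsEntryFamily μ a cl) (p : κ → ℕ) (k : κ) :
    ∃ C : ℝ, 0 ≤ C ∧ ∀ x : ∀ k, Fin (p k) → ℤ, ‖wickDefect μ a x k‖ ≤ C := by
  obtain ⟨B, hB⟩ := ha.exists_momentBound_slots p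
  have h1 : ∀ (x : ∀ k, Fin (p k) → ℤ) (A : Finset κ), ‖jointMoment μ a x A‖ ≤ |B 1| :=
    fun x A => ((hB x A).norm_integral_le).trans (le_abs_self _)
  refine ⟨|B 1| + ∑ l ∈ Finset.univ.erase k, |B 1| * |B 1|, by positivity, fun x => ?_⟩
  refine (norm_sub_le _ _).trans (add_le_add (h1 x _) ((norm_sum_le _ _).trans ?_))
  refine Finset.sum_le_sum fun l _ => ?_
  rw [norm_mul]
  exact mul_le_mul (h1 x _) (h1 x _) (norm_nonneg _) (abs_nonneg _)

/-- `∑ₓ u x Yₓ` over the words `x ∈ W`. -/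
def wordSum {m : ℕ} (μ : Measure Ω) (a : ℤ → Ω → ℂ) (W : Finset (Fin m → ℤ))
    (u : (Fin m → ℤ) → ℂ) (ω : Ω) : ℂ := ∑ x ∈ W, u x * centredProd μ a x ω

lemma IsEntryFamily.integral_prod_wordSum_mul [Fintype κ] [DecidableEq κ] [IsProbabilityMeasure μ]
    (ha : IsEntryFamily μ a cl) (W : ∀ k, Finset (Fin (p k) → ℤ)) (u : ∀ k, (Fin (p k) → ℤ) → ℂ)
    (A : Finset κ) :
    (∫ ω, ∏ k ∈ A, wordSum μ a (W k) (u k) ω ∂μ) * (∫ ω, ∏ k ∈ Aᶜ, wordSum μ a (W k) (u k) ω ∂μ) =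
      ∑ x ∈ Fintype.piFinset W, (∏ k, u k (x k)) *
        (jointMoment μ a x A * jointMoment μ a x Aᶜ) := by
  obtain ⟨B, hB⟩ := ha.exists_momentBound_slots p
  exact integral_prod_sum_mul W u (fun k x => centredProd μ a x) (fun x A => (hB x A).integrable) A

lemma IsEntryFamily.wick_recursion [Fintype κ] [DecidableEq κ] [IsProbabilityMeasure μ]
    (ha : IsEntryFamily μ a cl) (W : ∀ k, Finset (Fin (p k) → ℤ)) (u : ∀ k, (Fin (p k) → ℤ) → ℂ)
    (k : κ) :
    (∫ ω, ∏ k, wordSum μ a (W k) (u k) ω ∂μ) - ∑ l ∈ Finset.univ.erase k,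
      (∫ ω, wordSum μ a (W k) (u k) ω * wordSum μ a (W l) (u l) ω ∂μ) *
        (∫ ω, ∏ k ∈ {k, l}ᶜ, wordSum μ a (W k) (u k) ω ∂μ) =
      ∑ x ∈ Fintype.piFinset W, (∏ k, u k (x k)) * wickDefect μ a x k := by
  have h0 := ha.integral_prod_wordSum_mul W u Finset.univ
  simp only [Finset.compl_univ, Finset.prod_empty, integral_const, probReal_univ, one_smul,
    mul_one, jointMoment_empty] at h0
  have h1 : ∀ l ∈ Finset.univ.erase k,
      (∫ ω, wordSum μ a (W k) (u k) ω * wordSum μ a (W l) (u l) ω ∂μ) *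
        (∫ ω, ∏ k ∈ {k, l}ᶜ, wordSum μ a (W k) (u k) ω ∂μ) =
      ∑ x ∈ Fintype.piFinset W, (∏ k, u k (x k)) *
        (jointMoment μ a x {k, l} * jointMoment μ a x {k, l}ᶜ) := by
    intro l hl
    rw [← ha.integral_prod_wordSum_mul W u {k, l}]
    simp_rw [Finset.prod_pair (Finset.ne_of_mem_erase hl).symm]
  rw [h0, Finset.sum_congr rfl h1, Finset.sum_comm, ← Finset.sum_sub_distrib]
  refine Finset.sum_congr rfl fun x _ => ?_
  rw [wickDefect, mul_sub, Finset.mul_sum]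

open Classical in
/-- The Wick recursion holds up to the number of entangled tuples of words. -/
lemma IsEntryFamily.exists_norm_wick_recursion_le [Fintype κ] [DecidableEq κ] [IsProbabilityMeasure μ]
    (ha : IsEntryFamily μ a cl) (p : κ → ℕ) (k : κ) :
    ∃ C : ℝ, 0 ≤ C ∧ ∀ (W : ∀ k, Finset (Fin (p k) → ℤ)) (u : ∀ k, (Fin (p k) → ℤ) → ℂ)
      (U : κ → ℝ), (∀ k, ∀ x ∈ W k, ‖u k x‖ ≤ U k) →
    ‖(∫ ω, ∏ k, wordSum μ a (W k) (u k) ω ∂μ) - ∑ l ∈ Finset.univ.erase k,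
      (∫ ω, wordSum μ a (W k) (u k) ω * wordSum μ a (W l) (u l) ω ∂μ) *
        (∫ ω, ∏ k ∈ {k, l}ᶜ, wordSum μ a (W k) (u k) ω ∂μ)‖ ≤
      C * (∏ k, U k) * ((Fintype.piFinset W).filter (IsEntangled cl)).card := by
  obtain ⟨C, hC, h⟩ := ha.exists_norm_wickDefect_le p k
  refine ⟨C, hC, fun W u U hU => ?_⟩
  rw [ha.wick_recursion W u k, ← Finset.sum_filter_of_ne (p := IsEntangled cl)]
  · refine (norm_sum_le _ _).trans ((Finset.sum_le_card_nsmul _ _ (C * ∏ k, U k) ?_).trans_eq ?_)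
    · intro x hx
      rw [norm_mul, norm_prod, mul_comm]
      refine mul_le_mul (h x) (Finset.prod_le_prod (fun _ _ => norm_nonneg _) fun k _ => hU k _ ?_)
        (Finset.prod_nonneg fun _ _ => norm_nonneg _) hC
      exact Fintype.mem_piFinset.1 (Finset.mem_filter.1 hx).1 k
    · rw [nsmul_eq_mul]; ring
  · intro x _ hx
    by_contra hE
    exact hx (by rw [ha.wickDefect_eq_zero x k hE, mul_zero])

end Slots

end SparseToeplitz
end

noncomputable section
namespace SparseToeplitz

/-! ### Lattice points in subspaces -/

section Lattice

variable {ι : Type*} [Fintype ι]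

/-- A subspace of `ℝ^ι` embeds into the functions on `finrank` many coordinates. -/
lemma exists_coordinates (W : Submodule ℝ (ι → ℝ)) :
    ∃ J : Finset ι, J.card ≤ Module.finrank ℝ W ∧ ∀ w ∈ W, (∀ j ∈ J, w j = 0) → w = 0 := by
  classical
  have hne : ({J | ∀ w ∈ W, (∀ j ∈ J, w j = 0) → w = 0} : Set (Finset ι)).Nonempty :=
    ⟨Finset.univ, fun w _ h => funext fun i => h i (Finset.mem_univ i)⟩
  obtain ⟨J, hJ, hmin⟩ := (Set.toFinite {J : Finset ι | ∀ w ∈ W, (∀ j ∈ J, w j = 0) → w = 0}).exists_minimal hne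
  refine ⟨J, ?_, hJ⟩
  -- `J` is a minimal set of coordinates that determines the vectors of `W`. By minimality each `j ∈
  -- J` has a vector of `W` vanishing on `J` except at `j`; these vectors are independent, which
  -- bounds the size of `J`.
  have h1 : ∀ j : J, ∃ w : W, (∀ i ∈ J.erase j, (w : ι → ℝ) i = 0) ∧ (w : ι → ℝ) j ≠ 0 := by
    intro j
    by_contra hcon
    push Not at hcon
    have h2 : J.erase j ∈ ({J | ∀ w ∈ W, (∀ j ∈ J, w j = 0) → w = 0} : Set (Finset ι)) := by
      intro w hw h0
      refine hJ w hw fun i hi => ?_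
      by_cases hij : i = j
      · rw [hij]; exact hcon ⟨w, hw⟩ h0
      · exact h0 i (Finset.mem_erase.2 ⟨hij, hi⟩)
    exact absurd (hmin h2 (Finset.erase_subset _ _) j.2) (Finset.notMem_erase _ _)
  choose w hw0 hw1 using h1
  have hli : LinearIndependent ℝ w := by
    rw [Fintype.linearIndependent_iff]
    intro g hg j
    have h3 := congrFun (congrArg Subtype.val hg) (j : ι)
    simp only [Submodule.coe_sum, Submodule.coe_smul, Finset.sum_apply, Pi.smul_apply, smul_eq_mul,
      Submodule.coe_zero, Pi.zero_apply] at h3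
    rw [Finset.sum_eq_single j] at h3
    · exact (mul_eq_zero.1 h3).resolve_right (hw1 j)
    · intro i _ hij
      rw [hw0 i j (Finset.mem_erase.2 ⟨fun e => hij (Subtype.ext e.symm), j.2⟩), mul_zero]
    · simp
  simpa using hli.fintype_card_le_finrank

open Classical in
-- By `exists_coordinates` at most `finrank` coordinates determine a vector of `W`, and each of them
-- takes at most `A.card` values.
lemma card_lattice_le [DecidableEq ι] (W : Submodule ℝ (ι → ℝ)) (A : Finset ℤ) :
    ((Fintype.piFinset fun _ : ι => A).filter fun z => (fun i => (z i : ℝ)) ∈ W).card ≤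
      A.card ^ Module.finrank ℝ W := by
  obtain ⟨J, hJ, h⟩ := exists_coordinates W
  rcases A.eq_empty_or_nonempty with rfl | hA
  · rcases isEmpty_or_nonempty ι with hι | ⟨⟨i⟩⟩
    · have : Module.finrank ℝ W = 0 := by
        have := Submodule.finrank_le W
        simpa using this
      rw [this]
      refine (Finset.card_filter_le _ _).trans ?_
      simp
    · have : Nonempty ι := ⟨i⟩
      simp
  · calc _ ≤ (Fintype.piFinset fun _ : J => A).card := by
          refine Finset.card_le_card_of_injOn (fun z j => z j) ?_ ?_
          · intro z hz
            have := (Finset.mem_filter.1 hz).1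
            exact Finset.mem_coe.2 (Fintype.mem_piFinset.2 fun j => Fintype.mem_piFinset.1 this j)
          · intro z hz z' hz' he
            have h1 := W.sub_mem (Finset.mem_filter.1 hz).2 (Finset.mem_filter.1 hz').2
            have h2 := h _ h1 fun j hj => by
              have := congrFun he ⟨j, hj⟩
              simp only at this
              simp [this]
            funext i
            have := congrFun h2 i
            simp only [Pi.sub_apply, Pi.zero_apply, sub_eq_zero] at this
            exact_mod_cast this
      _ = A.card ^ J.card := by simp
      _ ≤ _ := Nat.pow_le_pow_right hA.card_pos hJ

/-- Triangular systems of equations. -/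
lemma finrank_add_card_le {κ : Type*} (v : κ → ι → ℝ) (ρ : κ → ℤ) (hρ : Function.Injective ρ)
    (K : Finset κ) (β : κ → ι) (h1 : ∀ k ∈ K, v k (β k) ≠ 0)
    (h2 : ∀ k ∈ K, ∀ l, ρ k < ρ l → v l (β k) = 0) (W : Submodule ℝ (ι → ℝ))
    (hW : ∀ z ∈ W, ∀ k ∈ K, ∑ i, v k i * z i = 0) :
    Module.finrank ℝ W + K.card ≤ Fintype.card ι := by
  classical
  have hinj : Set.InjOn β K := by
    intro k hk l hl e
    by_contra hne
    rcases lt_or_gt_of_ne (fun h => hne (hρ h)) with h | h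
    · exact h1 l hl (e ▸ h2 k hk l h)
    · exact h1 k hk (e ▸ h2 l hl k h)
  -- The claim is that the coordinates outside the pivots `β k` determine a vector of `W`.
  set J : Finset ι := Finset.univ \ K.image β with hJ
  have hJc : J.card + K.card = Fintype.card ι := by
    have h3 := Finset.card_sdiff_add_card_eq_card (Finset.subset_univ (K.image β))
    rwa [Finset.card_image_of_injOn hinj] at h3
  let φ : W →ₗ[ℝ] (J → ℝ) :=
    { toFun := fun w j => (w : ι → ℝ) j
      map_add' := fun _ _ => rfl
      map_smul' := fun _ _ => rfl }
  have hφ : Function.Injective φ := by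
    rw [← LinearMap.ker_eq_bot, LinearMap.ker_eq_bot']
    intro w hw
    have hoff : ∀ i, i ∉ K.image β → (w : ι → ℝ) i = 0 := fun i hi =>
      congrFun hw ⟨i, by simp [hJ, hi]⟩
    by_contra hne
    have hbad : (K.filter fun k => (w : ι → ℝ) (β k) ≠ 0).Nonempty := by
      rw [Finset.nonempty_iff_ne_empty]
      intro h0
      refine hne (Subtype.ext (funext fun i => ?_))
      by_cases hi : i ∈ K.image β
      · obtain ⟨k, hk, rfl⟩ := Finset.mem_image.1 hi
        by_contra h4
        have : k ∈ K.filter fun k => (w : ι → ℝ) (β k) ≠ 0 := Finset.mem_filter.2 ⟨hk, h4⟩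
        rw [h0] at this
        simp at this
      · exact hoff i hi
    -- Among the pivots with nonzero coordinate take the one of largest `ρ`. In its equation earlier
    -- pivots have coefficient zero and later ones have coordinate zero, so only one nonzero term
    -- would remain.
    obtain ⟨k, hk, hmax⟩ := Finset.exists_max_image _ ρ hbad
    obtain ⟨hkK, hk0⟩ := Finset.mem_filter.1 hk
    have h3 := hW w w.2 k hkK
    rw [Finset.sum_eq_single (β k)] at h3
    · exact (mul_ne_zero (h1 k hkK) hk0) h3
    · intro i _ hik
      by_cases hi : i ∈ K.image β
      · obtain ⟨s, hs, rfl⟩ := Finset.mem_image.1 hi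
        by_cases h4 : (w : ι → ℝ) (β s) = 0
        · rw [h4, mul_zero]
        · have h5 := hmax s (Finset.mem_filter.2 ⟨hs, h4⟩)
          have h6 : s ≠ k := fun e => hik (by rw [e])
          rw [h2 s hs k (lt_of_le_of_ne h5 fun e => h6 (hρ e)), zero_mul]
      · rw [hoff i hi, mul_zero]
    · simp
  have h4 := LinearMap.finrank_le_finrank_of_injective hφ
  rw [Module.finrank_fintype_fun_eq_card, Fintype.card_coe] at h4
  omega

end Lattice

/-! ### The dimension of the solution space for entangled words -/

section Entangled

variable {P κ : Type*} [Fintype P] [DecidableEq P] [Fintype κ] [DecidableEq κ]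

/-- The number of positions of the word `k` in the block `V`. -/
def mult (wd : P → κ) (V : Finset P) (k : κ) : ℕ := (V.filter fun i => wd i = k).card

lemma sum_mult (wd : P → κ) (V : Finset P) : ∑ k, mult wd V k = V.card :=
  (Finset.card_eq_sum_card_fiberwise fun i _ => Finset.mem_univ (wd i)).symm

/-- `k` is the last word which meets `V`. -/
def IsLastWord (wd : P → κ) (ρ : κ → ℤ) (V : Finset P) (k : κ) : Prop :=
  0 < mult wd V k ∧ ∀ l, 0 < mult wd V l → ρ l ≤ ρ k

open Classical in
/-- The number of occurrences of the word `k` in `V` which are neither first nor last. -/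
def innerMult (wd : P → κ) (ρ : κ → ℤ) (V : Finset P) (k : κ) : ℤ :=
  mult wd V k - (if IsLastWord wd ρ V k then 1 else 0) -
    (if IsLastWord wd (fun l => -ρ l) V k then 1 else 0)

variable {wd : P → κ} {ρ : κ → ℤ}

lemma mult_eq_card_of_unique (V : Finset P) (k : κ) (h : ∀ l, 0 < mult wd V l → l = k) :
    mult wd V k = V.card := by
  rw [← sum_mult wd V, Finset.sum_eq_single k]
  · intro l _ hl
    by_contra h0
    exact hl (h l (Nat.pos_of_ne_zero h0))
  · simp

lemma exists_isLastWord (ρ : κ → ℤ) (V : Finset P) (hV : V.Nonempty) :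
    ∃ k, IsLastWord wd ρ V k := by
  obtain ⟨i, hi, hmax⟩ := Finset.exists_max_image V (fun i => ρ (wd i)) hV
  refine ⟨wd i, Finset.card_pos.2 ⟨i, by simp [hi]⟩, fun l hl => ?_⟩
  obtain ⟨j, hj⟩ := Finset.card_pos.1 hl
  obtain ⟨hjV, rfl⟩ := Finset.mem_filter.1 hj
  exact hmax j hjV

/-- Two units are subtracted only if `k` is both the first and the last word of `V`. Then `V` lies
in a single word, and its at least two points all belong to `k`. -/
lemma innerMult_nonneg (hρ : Function.Injective ρ) (V : Finset P) (hV : 2 ≤ V.card) (k : κ) :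
    0 ≤ innerMult wd ρ V k := by
  unfold innerMult
  by_cases h1 : IsLastWord wd ρ V k <;> by_cases h2 : IsLastWord wd (fun l => -ρ l) V k
  · have : mult wd V k = V.card := mult_eq_card_of_unique V k fun l hl =>
      hρ (le_antisymm (h1.2 l hl) (by have := h2.2 l hl; simp only at this; linarith))
    simp only [if_pos h1, if_pos h2]; omega
  · have := h1.1
    simp only [if_pos h1, if_neg h2]; omega
  · have := h2.1
    simp only [if_neg h1, if_pos h2]; omega
  · simp only [if_neg h1, if_neg h2]; omega

/-- Every nonempty block has a last word and, for the reversed order, a first word. -/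
lemma sum_innerMult_le (V : Finset P) (hV : V.Nonempty) :
    ∑ k, innerMult wd ρ V k ≤ V.card - 2 := by
  classical
  unfold innerMult
  rw [Finset.sum_sub_distrib, Finset.sum_sub_distrib, ← Nat.cast_sum, sum_mult]
  have h : ∀ ρ : κ → ℤ, (1 : ℤ) ≤ ∑ k, if IsLastWord wd ρ V k then 1 else 0 := by
    intro ρ
    obtain ⟨k, hk⟩ := exists_isLastWord (wd := wd) ρ V hV
    have := Finset.single_le_sum (f := fun k => if IsLastWord wd ρ V k then (1 : ℤ) else 0)
      (fun k _ => by positivity) (Finset.mem_univ k)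
    simpa [hk] using this
  have h1 := h ρ
  have h2 := h fun l => -ρ l
  linarith

/-- A linear order in which two given elements come first and last. -/
lemma exists_order (l l' : κ) (h : l ≠ l') :
    ∃ ρ : κ → ℤ, Function.Injective ρ ∧ (∀ k, k ≠ l → ρ l < ρ k) ∧ ∀ k, k ≠ l' → ρ k < ρ l' := by
  let e := Fintype.equivFin κ
  refine ⟨fun k => if k = l then -1 else if k = l' then Fintype.card κ else (e k : ℕ), ?_, ?_, ?_⟩
  · intro a b hab
    have ha := (e a).2
    have hb := (e b).2
    simp only at hab
    split_ifs at hab with h1 h2 h3 h4 h5 h6 h7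
    all_goals first | (subst_vars; rfl) | omega | skip
    exact e.injective (Fin.ext (by exact_mod_cast hab))
  · intro k hk
    have := (e k).2
    simp only [if_true, if_neg hk]
    split_ifs <;> omega
  · intro k hk
    have := (e k).2
    simp only [if_neg h.symm, if_true, if_neg hk]
    split_ifs <;> omega

variable (π : Finpartition (Finset.univ : Finset P)) (v : κ → {V // V ∈ π.parts} → ℝ)

open Classical in
-- For each counted word take as pivot a block in which it is last and has a nonzero coefficient.
-- Later words do not meet that block, so these equations form a triangular system.
lemma finrank_add_card_isLastWord_le (wd : P → κ) (ρ : κ → ℤ) (hρ : Function.Injective ρ)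
    (hv0 : ∀ k V, v k V ≠ 0 → 0 < mult wd V.1 k) (W : Submodule ℝ ({V // V ∈ π.parts} → ℝ))
    (hW : ∀ z ∈ W, ∀ k, ∑ V, v k V * z V = 0) :
    Module.finrank ℝ W + (Finset.univ.filter fun k => ∃ V, v k V ≠ 0 ∧ IsLastWord wd ρ V.1 k).card ≤
      Fintype.card {V // V ∈ π.parts} := by
  set K := Finset.univ.filter fun k => ∃ V, v k V ≠ 0 ∧ IsLastWord wd ρ V.1 k with hK
  rcases K.eq_empty_or_nonempty with h0 | ⟨k0, hk0⟩
  · rw [h0, Finset.card_empty, add_zero]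
    simpa using Submodule.finrank_le W
  obtain ⟨V0, -⟩ := (Finset.mem_filter.1 hk0).2
  have hβ : ∀ k, ∃ V, k ∈ K → v k V ≠ 0 ∧ IsLastWord wd ρ V.1 k := by
    intro k
    by_cases hk : k ∈ K
    · obtain ⟨V, hV⟩ := (Finset.mem_filter.1 hk).2
      exact ⟨V, fun _ => hV⟩
    · exact ⟨V0, fun h => absurd h hk⟩
  choose β hβ using hβ
  refine finrank_add_card_le v ρ hρ K β (fun k hk => (hβ k hk).1) ?_ W fun z hz k _ => hW z hz k
  intro k hk l hl
  by_contra hne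
  exact absurd ((hβ k hk).2.2 l (hv0 l _ hne)) (not_le.2 hl)

/-- The solution space of the balance equations of entangled words is small. -/
lemma two_mul_finrank_add_le (wd : P → κ) (hv0 : ∀ k V, v k V ≠ 0 → 0 < mult wd V.1 k)
    (hv1 : ∀ k V, mult wd V.1 k = 1 → v k V ≠ 0)
    (hnd : ∀ k V, v k V ≠ 0 → ∃ V', V' ≠ V ∧ v k V' ≠ 0)
    (h2 : ∀ V ∈ π.parts, 2 ≤ V.card)
    (hnb : ∀ k, ∃ l, l ≠ k ∧ ∃ V ∈ π.parts, 0 < mult wd V k ∧ 0 < mult wd V l)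
    (k₀ l₀ l₁ : κ) (hl₀ : l₀ ≠ k₀) (hl₁ : l₁ ≠ k₀) (hl : l₀ ≠ l₁)
    (hV₀ : ∃ V ∈ π.parts, 0 < mult wd V k₀ ∧ 0 < mult wd V l₀)
    (hV₁ : ∃ V ∈ π.parts, 0 < mult wd V k₀ ∧ 0 < mult wd V l₁)
    (W : Submodule ℝ ({V // V ∈ π.parts} → ℝ)) (hW : ∀ z ∈ W, ∀ k, ∑ V, v k V * z V = 0) :
    2 * Module.finrank ℝ W + Fintype.card κ + 1 ≤ Fintype.card P := by
  classical
  -- With `l₀` at the beginning and `l₁` at the end, `k₀` is not first in the block shared with `l₀`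
  -- and not last in the block shared with `l₁`.
  obtain ⟨ρ, hρ, hfirst, hlast⟩ := exists_order l₀ l₁ hl
  -- Each word is credited with `F` and `G`, the equations it contributes to the triangular systems
  -- of `ρ` and of the reversed order, and with its surplus occurrences `m`. All credits together
  -- are at most `card P - 2 * finrank W`.
  set F := fun k => if ∃ V, v k V ≠ 0 ∧ IsLastWord wd ρ V.1 k then (1 : ℤ) else 0 with hF
  set G := fun k => if ∃ V, v k V ≠ 0 ∧ IsLastWord wd (fun l => -ρ l) V.1 k then (1 : ℤ) else 0
    with hG
  set m := fun (V : {V // V ∈ π.parts}) k => innerMult wd ρ V.1 k with hm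
  have hF0 : ∀ k, 0 ≤ F k := fun k => by simp only [hF]; positivity
  have hG0 : ∀ k, 0 ≤ G k := fun k => by simp only [hG]; positivity
  have hm0 : ∀ V k, 0 ≤ m V k := fun V k => innerMult_nonneg hρ V.1 (h2 V.1 V.2) k
  have hone : ∀ k V, m V k ≤ ∑ V, m V k := fun k V =>
    Finset.single_le_sum (f := fun V => m V k) (fun V _ => hm0 V k) (Finset.mem_univ V)
  have htwo : ∀ k V V', V ≠ V' → m V k + m V' k ≤ ∑ V, m V k := fun k V V' h => by
    rw [← Finset.sum_pair (f := fun V => m V k) h]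
    exact Finset.sum_le_sum_of_subset_of_nonneg (Finset.subset_univ _) fun V _ _ => hm0 V k
  have hFl : ∀ k V, v k V ≠ 0 → 1 ≤ F k ∨ ¬ IsLastWord wd ρ V.1 k := by
    intro k V hV
    by_cases h : IsLastWord wd ρ V.1 k
    · left; simp only [hF]; rw [if_pos ⟨V, hV, h⟩]
    · exact Or.inr h
  have hGl : ∀ k V, v k V ≠ 0 → 1 ≤ G k ∨ ¬ IsLastWord wd (fun l => -ρ l) V.1 k := by
    intro k V hV
    by_cases h : IsLastWord wd (fun l => -ρ l) V.1 k
    · left; simp only [hG]; rw [if_pos ⟨V, hV, h⟩]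
    · exact Or.inr h
  have hmne : ∀ k V, ¬ IsLastWord wd ρ V.1 k → (mult wd V.1 k : ℤ) ≤ m V k + 1 := by
    intro k V h
    simp only [hm, innerMult, if_neg h]
    split_ifs <;> omega
  have hmne' : ∀ k V, ¬ IsLastWord wd (fun l => -ρ l) V.1 k → (mult wd V.1 k : ℤ) ≤ m V k + 1 := by
    intro k V h
    simp only [hm, innerMult, if_neg h]
    split_ifs <;> omega
  have hmboth : ∀ k V, ¬ IsLastWord wd ρ V.1 k → ¬ IsLastWord wd (fun l => -ρ l) V.1 k →
      (mult wd V.1 k : ℤ) ≤ m V k := by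
    intro k V h h'
    simp only [hm, innerMult, if_neg h, if_neg h']
    omega
  have hbase : ∀ k V, v k V ≠ 0 → 1 ≤ F k + G k + m V k := by
    intro k V hV
    have := hv0 k V hV
    rcases hFl k V hV with h | h
    · linarith [hG0 k, hm0 V k]
    rcases hGl k V hV with h' | h'
    · linarith [hF0 k, hm0 V k]
    have := hmboth k V h h'
    have := hF0 k
    have := hG0 k
    omega
  have hzero : ∀ k V, v k V = 0 → 0 < mult wd V.1 k → 2 ≤ mult wd V.1 k := by
    intro k V h h'
    by_contra h3
    exact hv1 k V (by omega) h
  have hc1 : ∀ k, 1 ≤ F k + G k + ∑ V, m V k := by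
    intro k
    by_cases hex : ∃ V, v k V ≠ 0
    · obtain ⟨V, hV⟩ := hex
      linarith [hbase k V hV, hone k V]
    -- If the equation of `k` is void, then in the block shared with a neighbour `k` occurs at least
    -- twice, since a single occurrence would have a nonzero coefficient. It is not both first and
    -- last there, so one occurrence is surplus.
    · push Not at hex
      obtain ⟨l, hlk, V, hV, hk, hl⟩ := hnb k
      have h3 := hzero k ⟨V, hV⟩ (hex _) hk
      have h4 : ¬ IsLastWord wd ρ V k ∨ ¬ IsLastWord wd (fun l => -ρ l) V k := by
        by_contra hcon
        push Not at hcon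
        exact hlk (hρ (le_antisymm (hcon.1.2 l hl) (by have := hcon.2.2 l hl; simp only at this; linarith)))
      have h5 : (mult wd V k : ℤ) ≤ m ⟨V, hV⟩ k + 1 := by
        rcases h4 with h4 | h4
        · exact hmne k ⟨V, hV⟩ h4
        · exact hmne' k ⟨V, hV⟩ h4
      have h6 := hone k ⟨V, hV⟩
      have := hF0 k
      have := hG0 k
      simp only at h3
      omega
  have hc2 : 2 ≤ F k₀ + G k₀ + ∑ V, m V k₀ := by
    obtain ⟨V, hV, hVk, hVl⟩ := hV₀
    obtain ⟨V', hV', hVk', hVl'⟩ := hV₁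
    have n1 : ¬ IsLastWord wd (fun l => -ρ l) V k₀ := fun h => by
      have := h.2 l₀ hVl
      have := hfirst k₀ hl₀.symm
      simp only at *
      linarith
    have n2 : ¬ IsLastWord wd ρ V' k₀ := fun h => by
      have := h.2 l₁ hVl'
      have := hlast k₀ hl₁.symm
      linarith
    have f0 := hF0 k₀
    have g0 := hG0 k₀
    have e1 := hmne' k₀ ⟨V, hV⟩ n1
    have e2 := hmne k₀ ⟨V', hV'⟩ n2
    simp only at e1 e2
    -- If one block meets all three words, `k₀` is strictly inside it. That credits one unit, or two
    -- when the coefficient vanishes; otherwise nondegeneracy supplies another block with a nonzero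
    -- coefficient, which yields the second unit.
    by_cases heq : V = V'
    · subst heq
      have h3 := hmboth k₀ ⟨V, hV⟩ n2 n1
      by_cases h0 : v k₀ ⟨V, hV⟩ = 0
      · have h4 := hzero k₀ _ h0 hVk
        have h5 := hone k₀ ⟨V, hV⟩
        simp only at h3 h4
        omega
      · obtain ⟨U, hU, hU0⟩ := hnd k₀ _ h0
        have h4 := htwo k₀ U ⟨V, hV⟩ hU
        have h5 := hbase k₀ U hU0
        simp only at h3
        omega
    · have hne : (⟨V, hV⟩ : {V // V ∈ π.parts}) ≠ ⟨V', hV'⟩ := fun h => heq (congrArg Subtype.val h)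
      have h4 := htwo k₀ _ _ hne
      by_cases h0 : v k₀ ⟨V, hV⟩ = 0 <;> by_cases h1 : v k₀ ⟨V', hV'⟩ = 0
      · have h5 := hzero k₀ _ h0 hVk
        have h6 := hzero k₀ _ h1 hVk'
        simp only at h5 h6
        omega
      · have h5 := hzero k₀ _ h0 hVk
        have h6 := hbase k₀ _ h1
        simp only at h5
        omega
      · have h5 := hbase k₀ _ h0
        have h6 := hzero k₀ _ h1 hVk'
        simp only at h6
        omega
      -- In `V` the word `k₀` is not first: it is either last, which credits `F`, or inner. In `V'`
      -- the roles of first and last are exchanged, so the second unit comes from `G` or from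
      -- another block.
      · have a1 : 1 ≤ F k₀ + m ⟨V, hV⟩ k₀ := by
          rcases hFl k₀ _ h0 with h | h
          · linarith [hm0 ⟨V, hV⟩ k₀]
          · have := hmboth k₀ ⟨V, hV⟩ h n1
            simp only at this
            omega
        have a2 : 1 ≤ G k₀ + m ⟨V', hV'⟩ k₀ := by
          rcases hGl k₀ _ h1 with h | h
          · linarith [hm0 ⟨V', hV'⟩ k₀]
          · have := hmboth k₀ ⟨V', hV'⟩ n2 h
            simp only at this
            omega
        linarith
  have hsum : (Fintype.card κ : ℤ) + 1 ≤ ∑ k, (F k + G k + ∑ V, m V k) := by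
    have h3 : ∀ k, (if k = k₀ then (2 : ℤ) else 1) ≤ F k + G k + ∑ V, m V k := by
      intro k
      split_ifs with h
      · rw [h]; exact hc2
      · exact hc1 k
    refine le_trans (le_of_eq ?_) (Finset.sum_le_sum fun k _ => h3 k)
    have h4 : ∀ k, (if k = k₀ then (2 : ℤ) else 1) = 1 + if k = k₀ then 1 else 0 := by
      intro k; split_ifs <;> rfl
    simp_rw [h4]
    rw [Finset.sum_add_distrib]
    simp
  have hFs : ∑ k, F k = ((Finset.univ.filter fun k => ∃ V, v k V ≠ 0 ∧
      IsLastWord wd ρ V.1 k).card : ℤ) := by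
    simp [hF]
  have hGs : ∑ k, G k = ((Finset.univ.filter fun k => ∃ V, v k V ≠ 0 ∧
      IsLastWord wd (fun l => -ρ l) V.1 k).card : ℤ) := by
    simp [hG]
  have hms : ∑ k, ∑ V, m V k ≤ (Fintype.card P : ℤ) - 2 * Fintype.card {V // V ∈ π.parts} := by
    rw [Finset.sum_comm]
    refine (Finset.sum_le_sum fun V _ => sum_innerMult_le (wd := wd) (ρ := ρ) V.1
      (π.nonempty_of_mem_parts V.2)).trans (le_of_eq ?_)
    rw [Finset.sum_sub_distrib]
    have h5 : ∑ V : {V // V ∈ π.parts}, (V.1.card : ℤ) = Fintype.card P := by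
      have h6 := π.sum_card_parts
      rw [Finset.card_univ, ← Finset.sum_coe_sort] at h6
      exact_mod_cast h6
    rw [h5]
    simp [mul_comm]
  rw [Finset.sum_add_distrib, Finset.sum_add_distrib, hFs, hGs] at hsum
  have r1 := finrank_add_card_isLastWord_le π v wd ρ hρ hv0 W hW
  have r2 := finrank_add_card_isLastWord_le π v wd (fun l => -ρ l)
    (fun a b h => hρ (by simpa using h)) hv0 W hW
  omega

end Entangled

end SparseToeplitz
end

noncomputable section
namespace SparseToeplitz

/-! ### Kernels of words -/

/-- A decomposition `x = sg x * cl x` with `sg x = ± 1`. -/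
structure IsSignDecomposition (sg cl : ℤ → ℤ) : Prop where
  eq : ∀ x, sg x * cl x = x
  sign : ∀ x, sg x = 1 ∨ sg x = -1

section Kernel

variable {P : Type*} [Fintype P] [DecidableEq P]

open Classical in
/-- The partition of the positions of a word into the level sets of the class. -/
def kernel (cl : ℤ → ℤ) (x : P → ℤ) : Finpartition (Finset.univ : Finset P) :=
  Finpartition.ofSetoid (Setoid.ker fun i => cl (x i))

lemma mem_part_kernel {cl : ℤ → ℤ} {x : P → ℤ} {i j : P} :
    j ∈ (kernel cl x).part i ↔ cl (x i) = cl (x j) := by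
  classical
  unfold kernel
  rw [Finpartition.mem_part_ofSetoid_iff_rel]
  rfl

/-- The block of a position. -/
def blockOf (π : Finpartition (Finset.univ : Finset P)) (i : P) : {V // V ∈ π.parts} :=
  ⟨π.part i, π.part_mem.2 (Finset.mem_univ i)⟩

/-- A representative of a block. -/
def rep (π : Finpartition (Finset.univ : Finset P)) (V : {V // V ∈ π.parts}) : P :=
  (π.nonempty_of_mem_parts V.2).choose

lemma rep_mem (π : Finpartition (Finset.univ : Finset P)) (V : {V // V ∈ π.parts}) :
    rep π V ∈ V.1 := (π.nonempty_of_mem_parts V.2).choose_spec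

lemma blockOf_eq_iff (π : Finpartition (Finset.univ : Finset P)) (i : P) (V : {V // V ∈ π.parts}) :
    blockOf π i = V ↔ i ∈ V.1 := by
  rw [← π.part_eq_iff_mem V.2, Subtype.ext_iff]
  rfl

lemma mem_blockOf (π : Finpartition (Finset.univ : Finset P)) (i : P) : i ∈ (blockOf π i).1 :=
  (blockOf_eq_iff π i _).1 rfl

lemma blockOf_rep (π : Finpartition (Finset.univ : Finset P)) (V : {V // V ∈ π.parts}) :
    blockOf π (rep π V) = V := (blockOf_eq_iff π _ V).2 (rep_mem π V)

lemma blockOf_kernel_eq_iff {cl : ℤ → ℤ} {x : P → ℤ} {i j : P} :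
    blockOf (kernel cl x) i = blockOf (kernel cl x) j ↔ cl (x i) = cl (x j) := by
  rw [blockOf_eq_iff, eq_comm (a := cl (x i))]
  exact mem_part_kernel

lemma cl_eq_of_mem_part {cl : ℤ → ℤ} {x : P → ℤ} {V : Finset P} (hV : V ∈ (kernel cl x).parts)
    {i j : P} (hi : i ∈ V) (hj : j ∈ V) : cl (x i) = cl (x j) := by
  rw [← blockOf_kernel_eq_iff, (blockOf_eq_iff _ i ⟨V, hV⟩).2 hi, (blockOf_eq_iff _ j ⟨V, hV⟩).2 hj]

lemma mem_part_of_cl_eq {cl : ℤ → ℤ} {x : P → ℤ} {V : Finset P} (hV : V ∈ (kernel cl x).parts)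
    {i j : P} (hi : i ∈ V) (h : cl (x i) = cl (x j)) : j ∈ V := by
  rw [← blockOf_kernel_eq_iff, (blockOf_eq_iff _ i ⟨V, hV⟩).2 hi] at h
  exact (blockOf_eq_iff _ j ⟨V, hV⟩).1 h.symm

/-- The common class on each block. -/
def blockValue (π : Finpartition (Finset.univ : Finset P)) (cl : ℤ → ℤ) (x : P → ℤ)
    (V : {V // V ∈ π.parts}) : ℤ := cl (x (rep π V))

lemma blockValue_blockOf {π : Finpartition (Finset.univ : Finset P)} {cl : ℤ → ℤ} {x : P → ℤ}
    (h : kernel cl x = π) (i : P) : blockValue π cl x (blockOf π i) = cl (x i) := by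
  subst h
  exact cl_eq_of_mem_part (blockOf _ i).2 (rep_mem _ _) (mem_blockOf _ i)

/-- The words with kernel `π` and signs `E`. -/
def HasPattern (sg cl : ℤ → ℤ) (π : Finpartition (Finset.univ : Finset P)) (E x : P → ℤ) : Prop :=
  kernel cl x = π ∧ ∀ i, sg (x i) = E i

open Classical in
/-- Words with a given pattern whose block values belong to a given subspace. -/
lemma card_pattern_le {sg cl : ℤ → ℤ} (hd : IsSignDecomposition sg cl)
    (π : Finpartition (Finset.univ : Finset P)) (E : P → ℤ) (W : Submodule ℝ ({V // V ∈ π.parts} → ℝ))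
    (S : Finset ℤ) (X : Finset (P → ℤ)) (hS : ∀ x ∈ X, ∀ i, x i ∈ S)
    (hX : ∀ x ∈ X, HasPattern sg cl π E x ∧ (fun V => (blockValue π cl x V : ℝ)) ∈ W) :
    X.card ≤ S.card ^ Module.finrank ℝ W := by
  set T := (Fintype.piFinset fun _ : {V // V ∈ π.parts} => S.image cl).filter
    fun z => (fun i => (z i : ℝ)) ∈ W with hT
  have h1 : T.card ≤ S.card ^ Module.finrank ℝ W :=
    (card_lattice_le W _).trans (Nat.pow_le_pow_left Finset.card_image_le _)
  -- With kernel and signs prescribed, a word is recovered from its block values.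
  refine le_trans (Finset.card_le_card_of_injOn (t := T) (blockValue π cl) ?_ ?_) h1
  · intro x hx
    refine Finset.mem_coe.2 (Finset.mem_filter.2 ⟨Fintype.mem_piFinset.2 fun V => ?_, (hX x hx).2⟩)
    exact Finset.mem_image_of_mem _ (hS x hx _)
  · intro x hx y hy he
    funext i
    rw [← hd.eq (x i), ← hd.eq (y i), (hX x hx).1.2, (hX y hy).1.2,
      ← blockValue_blockOf (hX x hx).1.1, ← blockValue_blockOf (hX y hy).1.1, he]

/-- The coefficient of a block in the equation `∑ᵢ τ i * x i = 0` of the word `k`. -/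
def wordCoeff {κ : Type*} [DecidableEq κ] (wd : P → κ) (π : Finpartition (Finset.univ : Finset P))
    (s : P → ℤ) (k : κ) (V : {V // V ∈ π.parts}) : ℝ := ∑ i ∈ V.1.filter fun i => wd i = k, (s i : ℝ)

lemma sum_wordCoeff {κ : Type*} [DecidableEq κ] (wd : P → κ)
    (π : Finpartition (Finset.univ : Finset P)) (s : P → ℤ) (k : κ) (z : {V // V ∈ π.parts} → ℝ) :
    ∑ V, wordCoeff wd π s k V * z V =
      ∑ i ∈ Finset.univ.filter fun i => wd i = k, (s i : ℝ) * z (blockOf π i) := by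
  unfold wordCoeff
  simp_rw [Finset.sum_mul]
  rw [← Finset.sum_fiberwise (Finset.univ.filter fun i => wd i = k) (blockOf π)]
  refine Finset.sum_congr rfl fun V _ => ?_
  have : V.1.filter (fun i => wd i = k) =
      (Finset.univ.filter fun i => wd i = k).filter fun i => blockOf π i = V := by
    ext i; simp [blockOf_eq_iff, and_comm]
  rw [this]
  refine Finset.sum_congr rfl fun i hi => ?_
  rw [(Finset.mem_filter.1 hi).2]

/-- The solution space of the balance equations. -/
def balanceSpace {κ : Type*} [DecidableEq κ] (wd : P → κ)
    (π : Finpartition (Finset.univ : Finset P)) (s : P → ℤ) :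
    Submodule ℝ ({V // V ∈ π.parts} → ℝ) where
  carrier := {z | ∀ k, ∑ V, wordCoeff wd π s k V * z V = 0}
  add_mem' := fun {a b} ha hb k => by
    simp only [Pi.add_apply, mul_add, Finset.sum_add_distrib, ha k, hb k, add_zero]
  zero_mem' := fun k => by simp
  smul_mem' := fun c a ha k => by
    simp only [Pi.smul_apply, smul_eq_mul, mul_left_comm _ c, ← Finset.mul_sum, ha k, mul_zero]

lemma blockValue_mem_balanceSpace {κ : Type*} [DecidableEq κ] {sg cl : ℤ → ℤ}
    (hd : IsSignDecomposition sg cl) (wd : P → κ) {π : Finpartition (Finset.univ : Finset P)}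
    {E x τ : P → ℤ} (hx : HasPattern sg cl π E x)
    (h : ∀ k, ∑ i ∈ Finset.univ.filter fun i => wd i = k, τ i * x i = 0) :
    (fun V => (blockValue π cl x V : ℝ)) ∈ balanceSpace wd π fun i => τ i * E i := by
  intro k
  rw [sum_wordCoeff]
  have h1 : ∀ i, (((τ i * E i : ℤ) : ℝ)) * (blockValue π cl x (blockOf π i) : ℝ) =
      ((τ i * x i : ℤ) : ℝ) := by
    intro i
    rw [blockValue_blockOf hx.1, ← Int.cast_mul, ← hx.2 i, mul_assoc, hd.eq]
  simp_rw [h1]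
  rw [← Int.cast_sum, h k, Int.cast_zero]

end Kernel

/-- The coefficient of the class `c` in `∑ᵢ τ i * x i`. -/
def classCoeff {m : ℕ} (sg cl : ℤ → ℤ) (τ : ℕ → ℤ) (x : Fin m → ℤ) (c : ℤ) : ℤ :=
  ∑ i ∈ Finset.univ.filter fun i => cl (x i) = c, τ i * sg (x i)

/-- The equation `∑ᵢ τ i * x i = 0` does not have the form `c * z = 0`. -/
def IsNondegenerate {m : ℕ} (sg cl : ℤ → ℤ) (τ : ℕ → ℤ) (x : Fin m → ℤ) : Prop :=
  ∀ c, classCoeff sg cl τ x c ≠ 0 → ∃ c', c' ≠ c ∧ classCoeff sg cl τ x c' ≠ 0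

section Count

variable {κ : Type} [Fintype κ] [DecidableEq κ] {p : κ → ℕ} {sg cl : ℤ → ℤ} {τ : ℕ → ℤ}

lemma filter_sigma_fst (k : κ) (f : (Σ k, Fin (p k)) → Prop) [DecidablePred f] :
    Finset.univ.filter (fun s : Σ k, Fin (p k) => s.1 = k ∧ f s) =
      (Finset.univ.filter fun i : Fin (p k) => f ⟨k, i⟩).map (Function.Embedding.sigmaMk k) := by
  ext ⟨l, j⟩
  simp only [Finset.mem_filter, Finset.mem_univ, true_and, Finset.mem_map,
    Function.Embedding.sigmaMk_apply]
  constructor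
  · rintro ⟨rfl, h⟩
    exact ⟨j, h, rfl⟩
  · rintro ⟨i, hi, h⟩
    cases h
    exact ⟨rfl, hi⟩

/-- Links the two descriptions of a coefficient, by blocks of positions and by values of the class,
so that `IsNondegenerate`, a condition on a single word, applies to the joint kernel of a tuple. -/
lemma wordCoeff_kernel (x : ∀ k, Fin (p k) → ℤ)
    {E : (Σ k, Fin (p k)) → ℤ} {π : Finpartition (Finset.univ : Finset (Σ k, Fin (p k)))}
    (hx : HasPattern sg cl π E fun s => x s.1 s.2) (k : κ) (V : {V // V ∈ π.parts}) :
    wordCoeff Sigma.fst π (fun s => τ s.2 * E s) k V =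
      classCoeff sg cl τ (x k) (blockValue π cl (fun s => x s.1 s.2) V) := by
  classical
  obtain ⟨rfl, hE⟩ := hx
  unfold wordCoeff classCoeff
  have h1 : V.1.filter (fun i => i.1 = k) = Finset.univ.filter fun s : Σ k, Fin (p k) =>
      s.1 = k ∧ cl (x s.1 s.2) = blockValue _ cl (fun s => x s.1 s.2) V := by
    ext s
    simp only [Finset.mem_filter, Finset.mem_univ, true_and, and_comm (a := s ∈ V.1)]
    refine and_congr_right fun _ => ?_
    rw [← blockOf_eq_iff, ← blockValue_blockOf (cl := cl) (x := fun s : Σ k, Fin (p k) => x s.1 s.2) rfl]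
    constructor
    · intro h; rw [h]
    · intro h
      rw [← blockOf_rep _ V, blockOf_kernel_eq_iff]
      rw [blockValue_blockOf rfl] at h
      exact h
  rw [h1, filter_sigma_fst k (fun s => cl (x s.1 s.2) = blockValue _ cl (fun s => x s.1 s.2) V),
    Finset.sum_map]
  push_cast
  refine Finset.sum_congr rfl fun i _ => ?_
  rw [← hE]
  rfl

/-- The balance equations of entangled words have few solutions. -/
lemma two_mul_finrank_balanceSpace_add_le (hd : IsSignDecomposition sg cl)
    (hτ : ∀ k, τ k = 1 ∨ τ k = -1) (x : ∀ k, Fin (p k) → ℤ)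
    (hnd : ∀ k, IsNondegenerate sg cl τ (x k)) (hE : IsEntangled cl x)
    {E : (Σ k, Fin (p k)) → ℤ} {π : Finpartition (Finset.univ : Finset (Σ k, Fin (p k)))}
    (hx : HasPattern sg cl π E fun s => x s.1 s.2) :
    2 * Module.finrank ℝ (balanceSpace Sigma.fst π fun s => τ s.2 * E s) + Fintype.card κ + 1 ≤
      ∑ k, p k := by
  have hcard : ∑ k, p k = Fintype.card (Σ k, Fin (p k)) := by simp
  rw [hcard]
  have hcoef := wordCoeff_kernel (τ := τ) x hx
  have hπ := hx.1
  have hadj : ∀ {k l}, Adjacent cl x k l →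
      ∃ V ∈ π.parts, 0 < mult Sigma.fst V k ∧ 0 < mult Sigma.fst V l := by
    rintro k l ⟨i, j, hij⟩
    subst hπ
    refine ⟨_, (blockOf (kernel cl fun s : Σ k, Fin (p k) => x s.1 s.2) ⟨k, i⟩).2, ?_, ?_⟩
    · exact Finset.card_pos.2 ⟨⟨k, i⟩, Finset.mem_filter.2 ⟨mem_blockOf _ _, rfl⟩⟩
    · exact Finset.card_pos.2 ⟨⟨l, j⟩, Finset.mem_filter.2 ⟨mem_part_of_cl_eq
        (x := fun s : Σ k, Fin (p k) => x s.1 s.2) (blockOf _ _).2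
        (mem_blockOf _ (⟨k, i⟩ : Σ k, Fin (p k))) hij, rfl⟩⟩
  obtain ⟨e1, e2, k₀, l₀, l₁, a1, a2, a3, a4, a5⟩ := hE
  refine two_mul_finrank_add_le π (wordCoeff Sigma.fst π fun s => τ s.2 * E s) Sigma.fst
    ?_ ?_ ?_ ?_ (fun k => ?_) k₀ l₀ l₁ a1 a2 a3 (hadj a4) (hadj a5) _ fun z hz => hz
  · intro k V h
    by_contra h0
    refine h ?_
    unfold wordCoeff
    rw [Finset.card_eq_zero.1 (Nat.eq_zero_of_not_pos h0), Finset.sum_empty]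
  · intro k V h
    obtain ⟨s, hs⟩ := Finset.card_eq_one.1 h
    unfold wordCoeff
    rw [hs, Finset.sum_singleton]
    simp only [← hx.2]
    rcases hτ s.2 with h1 | h1 <;> rcases hd.sign (x s.1 s.2) with h2 | h2 <;> simp [h1, h2]
  · intro k V h
    rw [hcoef] at h
    obtain ⟨c', hc', h1⟩ := hnd k _ (by exact_mod_cast h)
    obtain ⟨i, hi⟩ : (Finset.univ.filter fun i => cl (x k i) = c').Nonempty := by
      rw [Finset.nonempty_iff_ne_empty]
      intro h0
      rw [classCoeff, h0, Finset.sum_empty] at h1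
      exact h1 rfl
    have hi := (Finset.mem_filter.1 hi).2
    have hv : blockValue π cl (fun s => x s.1 s.2) (blockOf π ⟨k, i⟩) = c' := by
      rw [blockValue_blockOf hπ]; exact hi
    refine ⟨blockOf π ⟨k, i⟩, fun e => hc' ?_, ?_⟩
    · rw [← e, hv]
    · rw [hcoef, hv]; exact_mod_cast h1
  · intro V hV
    obtain ⟨s, hs⟩ := π.nonempty_of_mem_parts hV
    obtain ⟨t, hts, ht⟩ := e1 s
    subst hπ
    exact Finset.one_lt_card.2 ⟨s, hs, t,
      mem_part_of_cl_eq (x := fun s : Σ k, Fin (p k) => x s.1 s.2) hV hs ht.symm, hts.symm⟩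
  · obtain ⟨l, hl, h⟩ := e2 k
    exact ⟨l, hl, hadj h⟩

lemma pow_mul_sqrt_pow_le {R : ℝ} (hR : 1 ≤ R) {f l N : ℕ} (h : 2 * f + l ≤ N) :
    R ^ f * √R ^ l ≤ √R ^ N := by
  have h1 : R ^ f = √R ^ (2 * f) := by rw [pow_mul, Real.sq_sqrt (by linarith)]
  rw [h1, ← pow_add]
  exact pow_le_pow_right₀ (Real.one_le_sqrt.2 hR) h

open Classical in
/-- Entangled tuples of words are rare. -/
lemma exists_card_entangled_le (hd : IsSignDecomposition sg cl) (hτ : ∀ k, τ k = 1 ∨ τ k = -1)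
    (p : κ → ℕ) : ∃ C : ℝ, 0 ≤ C ∧ ∀ (S : Finset ℤ) (R : ℝ), 1 ≤ R → S.card ≤ R →
      ∀ W : ∀ k, Finset (Fin (p k) → ℤ), (∀ k, ∀ x ∈ W k, (∀ i, x i ∈ S) ∧
        (∑ i : Fin (p k), τ i * x i = 0) ∧ IsNondegenerate sg cl τ x) →
      ((Fintype.piFinset W).filter (IsEntangled cl)).card * √R ^ (Fintype.card κ + 1) ≤
        C * √R ^ (∑ k, p k) := by
  -- `I` lists all patterns, a partition together with a vector of signs; the constant is their
  -- number.
  set I := (Finset.univ : Finset (Finpartition (Finset.univ : Finset (Σ k, Fin (p k))))) ×ˢ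
    Fintype.piFinset fun _ : Σ k, Fin (p k) => ({1, -1} : Finset ℤ) with hI
  refine ⟨I.card, by positivity, fun S R hR hS W hW => ?_⟩
  set X := (Fintype.piFinset W).filter (IsEntangled cl) with hX
  have hcover : X ⊆ I.biUnion fun j => X.filter fun x =>
      HasPattern sg cl j.1 j.2 fun s => x s.1 s.2 := by
    intro x hx
    refine Finset.mem_biUnion.2 ⟨(kernel cl fun s => x s.1 s.2, fun s => sg (x s.1 s.2)),
      Finset.mem_product.2 ⟨Finset.mem_univ _, Fintype.mem_piFinset.2 fun s => ?_⟩,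
      Finset.mem_filter.2 ⟨hx, rfl, fun _ => rfl⟩⟩
    rcases hd.sign (x s.1 s.2) with h | h <;> simp [h]
  have hpiece : ∀ j ∈ I, ((X.filter fun x => HasPattern sg cl j.1 j.2 fun s => x s.1 s.2).card : ℝ) *
      √R ^ (Fintype.card κ + 1) ≤ √R ^ (∑ k, p k) := by
    intro j _
    rcases (X.filter fun x => HasPattern sg cl j.1 j.2 fun s => x s.1 s.2).eq_empty_or_nonempty
      with h0 | ⟨y, hy⟩
    · rw [h0, Finset.card_empty, Nat.cast_zero, zero_mul]; positivity
    obtain ⟨hyX, hyp⟩ := Finset.mem_filter.1 hy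
    obtain ⟨hyW, hyE⟩ := Finset.mem_filter.1 hyX
    have hyW := Fintype.mem_piFinset.1 hyW
    -- The balance space depends only on the pattern, so one entangled member `y` of the class
    -- bounds its dimension for all members.
    have hdim := two_mul_finrank_balanceSpace_add_le hd hτ y (fun k => (hW k _ (hyW k)).2.2) hyE hyp
    set f := Module.finrank ℝ (balanceSpace Sigma.fst j.1 fun s => τ s.2 * j.2 s) with hf
    have hcount : (X.filter fun x => HasPattern sg cl j.1 j.2 fun s => x s.1 s.2).card ≤
        S.card ^ f := by
      have hinj : Function.Injective fun (x : ∀ k, Fin (p k) → ℤ) (s : Σ k, Fin (p k)) => x s.1 s.2 := by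
        intro x x' h
        funext k i
        exact congrFun h ⟨k, i⟩
      rw [← Finset.card_image_of_injective _ hinj]
      refine card_pattern_le hd j.1 j.2 _ S _ ?_ ?_
      · intro x hx s
        obtain ⟨y, hy, rfl⟩ := Finset.mem_image.1 hx
        exact (hW _ _ (Fintype.mem_piFinset.1
          (Finset.mem_filter.1 (Finset.mem_filter.1 hy).1).1 s.1)).1 s.2
      · intro x hx
        obtain ⟨y, hy, rfl⟩ := Finset.mem_image.1 hx
        obtain ⟨hy, hyp⟩ := Finset.mem_filter.1 hy
        refine ⟨hyp, blockValue_mem_balanceSpace hd Sigma.fst hyp fun k => ?_⟩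
        have h3 := (hW _ _ (Fintype.mem_piFinset.1 (Finset.mem_filter.1 hy).1 k)).2.1
        have h4 := filter_sigma_fst (p := p) k fun _ => True
        simp only [and_true, Finset.filter_true] at h4
        rw [h4, Finset.sum_map]
        exact h3
    calc _ ≤ R ^ f * √R ^ (Fintype.card κ + 1) := by
          gcongr
          calc ((X.filter fun x => HasPattern sg cl j.1 j.2 fun s => x s.1 s.2).card : ℝ)
              ≤ (S.card : ℝ) ^ f := by exact_mod_cast hcount
            _ ≤ R ^ f := by gcongr
      _ ≤ _ := pow_mul_sqrt_pow_le hR (by omega)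
  have h1 : (X.card : ℝ) ≤ ∑ j ∈ I,
      ((X.filter fun x => HasPattern sg cl j.1 j.2 fun s => x s.1 s.2).card : ℝ) := by
    exact_mod_cast (Finset.card_le_card hcover).trans Finset.card_biUnion_le
  calc (X.card : ℝ) * √R ^ (Fintype.card κ + 1) ≤ (∑ j ∈ I,
      ((X.filter fun x => HasPattern sg cl j.1 j.2 fun s => x s.1 s.2).card : ℝ)) *
        √R ^ (Fintype.card κ + 1) := by gcongr
    _ ≤ ∑ j ∈ I, √R ^ (∑ k, p k) := by
        rw [Finset.sum_mul]
        exact Finset.sum_le_sum hpiece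
    _ = _ := by rw [Finset.sum_const, nsmul_eq_mul]

end Count

end SparseToeplitz
end

noncomputable section
namespace SparseToeplitz

/-! ### Closed words and the central limit theorem for their sums -/

/-- The words over `S` of length `p` with `∑ᵢ τ i * x i = 0`. -/
def closedWords (τ : ℕ → ℤ) (S : Finset ℤ) (p : ℕ) : Finset (Fin p → ℤ) :=
  (Fintype.piFinset fun _ => S).filter fun x => ∑ i : Fin p, τ i * x i = 0

/-- The walk with steps `τ i * x i` which starts at `i` stays in `{0, …, n - 1}`. -/
def IsWalk {p : ℕ} (n : ℕ) (τ : ℕ → ℤ) (x : Fin p → ℤ) (i : ℤ) : Prop :=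
  ∀ j : Fin p, i + ∑ k ∈ Finset.univ.filter fun k => k ≤ j, τ k * x k ∈ Set.Ico (0 : ℤ) n

open Classical in
/-- The number of admissible starting points of a walk. -/
def startCount {p : ℕ} (n : ℕ) (τ : ℕ → ℤ) (x : Fin p → ℤ) : ℕ :=
  ((Finset.Ico (0 : ℤ) n).filter (IsWalk n τ x)).card

open Classical in
lemma startCount_le {p : ℕ} (n : ℕ) (τ : ℕ → ℤ) (x : Fin p → ℤ) : startCount n τ x ≤ n :=
  (Finset.card_filter_le _ _).trans (by simp)

/-- The weight of a word in the normalized trace of a power. -/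
def wordWeight (β : ℝ) (n : ℕ) (τ : ℕ → ℤ) {p : ℕ} (x : Fin p → ℤ) : ℝ :=
  √β / n * (√β)⁻¹ ^ p * startCount n τ x

lemma abs_wordWeight_le (β : ℝ) (n : ℕ) (τ : ℕ → ℤ) {p : ℕ} (x : Fin p → ℤ) :
    |wordWeight β n τ x| ≤ √β * (√β)⁻¹ ^ p := by
  unfold wordWeight
  rw [abs_of_nonneg (by positivity)]
  have h1 : (startCount n τ x : ℝ) ≤ n := by exact_mod_cast startCount_le n τ x
  rcases Nat.eq_zero_or_pos n with rfl | hn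
  · simp; positivity
  · have hn' : (0 : ℝ) < n := by exact_mod_cast hn
    calc √β / n * (√β)⁻¹ ^ p * startCount n τ x ≤ √β / n * (√β)⁻¹ ^ p * n := by gcongr
      _ = √β * (√β)⁻¹ ^ p := by field_simp

/-- The normalized fluctuation of the trace of the power `p`. -/
def traceFluctuation {Ω : Type*} [MeasurableSpace Ω] (μ : Measure Ω) (a : ℤ → Ω → ℂ) (β : ℝ)
    (n : ℕ) (τ : ℕ → ℤ) (S : Finset ℤ) (p : ℕ) (ω : Ω) : ℂ :=
  wordSum μ a (closedWords τ S p) (fun x => (wordWeight β n τ x : ℂ)) ω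

section CLT

variable {Ω : Type*} [MeasurableSpace Ω] {μ : Measure Ω} [IsProbabilityMeasure μ]
  {a : ℤ → Ω → ℂ} {sg cl : ℤ → ℤ} {τ : ℕ → ℤ}

lemma IsEntryFamily.exists_momentBound_wordSum (ha : IsEntryFamily μ a cl) {m : ℕ}
    (W : Finset (Fin m → ℤ)) (u : (Fin m → ℤ) → ℂ) : ∃ B, MomentBound μ (wordSum μ a W u) B := by
  obtain ⟨B, hB⟩ := ha.exists_momentBound_centredProd m
  exact exists_momentBound_sum W (fun x ω => u x * centredProd μ a x ω) fun x _ =>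
    ⟨_, (momentBound_const (u x)).mul (hB x (by simp))⟩

lemma IsEntryFamily.integral_centredProd (ha : IsEntryFamily μ a cl) {m : ℕ} (x : Fin m → ℤ) :
    ∫ ω, centredProd μ a x ω ∂μ = 0 := by
  obtain ⟨B, hB⟩ := ha.exists_momentBound_wordProd m
  unfold centredProd
  rw [integral_sub (hB x (by simp)).integrable (integrable_const _)]
  simp

lemma IsEntryFamily.integral_wordSum (ha : IsEntryFamily μ a cl) {m : ℕ}
    (W : Finset (Fin m → ℤ)) (u : (Fin m → ℤ) → ℂ) : ∫ ω, wordSum μ a W u ω ∂μ = 0 := by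
  obtain ⟨B, hB⟩ := ha.exists_momentBound_centredProd m
  unfold wordSum
  rw [integral_finsetSum _ fun x _ => (hB x (by simp)).integrable.const_mul _]
  refine Finset.sum_eq_zero fun x _ => ?_
  rw [integral_const_mul, ha.integral_centredProd, mul_zero]

lemma exists_momentBound_prod' {κ : Type} [Finite κ] (f : κ → Ω → ℂ)
    (hf : ∀ k, ∃ B, MomentBound μ (f k) B) (A : Finset κ) :
    ∃ B, MomentBound μ (fun ω => ∏ k ∈ A, f k ω) B := by
  classical
  induction A using Finset.induction_on with
  | empty => exact ⟨fun _ => 1, by simpa using momentBound_one⟩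
  | insert i s hi ih =>
    obtain ⟨B, hB⟩ := hf i
    obtain ⟨B', hB'⟩ := ih
    refine ⟨fun k => B (2 * k) + B' (2 * k), ?_⟩
    simp only [Finset.prod_insert hi]
    exact hB.mul hB'

/-- Power counting: for `L` words of total length `N` the weights multiply to at most `√β ^ (L -
N)`, while there are `O(√β ^ (N - L - 1))` entangled tuples. The defect is `O(1 / √β)`. -/
lemma IsEntryFamily.tendsto_wick_recursion (ha : IsEntryFamily μ a cl)
    (hd : IsSignDecomposition sg cl) (hτ : ∀ k, τ k = 1 ∨ τ k = -1) {β : ℕ → ℝ}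
    (hβ : Tendsto β atTop atTop) {S : ℕ → Finset ℤ} {C₀ : ℝ}
    (hS : ∀ᶠ n in atTop, ((S n).card : ℝ) ≤ C₀ * β n) {κ : Type} [Fintype κ] [DecidableEq κ]
    (p : κ → ℕ)
    (hnd : ∀ k n, ∀ x ∈ closedWords τ (S n) (p k), IsNondegenerate sg cl τ x) (k : κ) :
    Tendsto (fun n => (∫ ω, ∏ k, traceFluctuation μ a (β n) n τ (S n) (p k) ω ∂μ) -
      ∑ l ∈ Finset.univ.erase k,
      (∫ ω, traceFluctuation μ a (β n) n τ (S n) (p k) ω *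
        traceFluctuation μ a (β n) n τ (S n) (p l) ω ∂μ) *
        (∫ ω, ∏ k ∈ {k, l}ᶜ, traceFluctuation μ a (β n) n τ (S n) (p k) ω ∂μ)) atTop (𝓝 0) := by
  classical
  obtain ⟨C, hC, h1⟩ := ha.exists_norm_wick_recursion_le p k
  obtain ⟨C', hC', h2⟩ := exists_card_entangled_le hd hτ p
  -- The counting bound needs a size parameter which is at least `1` and dominates `(S n).card`; `D
  -- * β n` has both properties.
  set D : ℝ := max C₀ 1 with hD
  have hD1 : 1 ≤ D := le_max_right _ _
  set N := ∑ k, p k with hN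
  set L := Fintype.card κ with hL
  have hlim : Tendsto (fun n => C * C' * √D ^ N * (√(β n))⁻¹) atTop (𝓝 0) := by
    have := (tendsto_inv_atTop_zero.comp (Real.tendsto_sqrt_atTop.comp hβ)).const_mul
      (C * C' * √D ^ N)
    simpa using this
  refine squeeze_zero_norm' ?_ hlim
  filter_upwards [hS, hβ.eventually_ge_atTop 1] with n hn hβn
  have hW := h1 (fun k => closedWords τ (S n) (p k)) (fun k x => (wordWeight (β n) n τ x : ℂ))
    (fun k => √(β n) * (√(β n))⁻¹ ^ (p k))
    (fun k x _ => by rw [Complex.norm_real]; exact abs_wordWeight_le _ _ _ _)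
  refine hW.trans ?_
  have h3 : 1 ≤ D * β n := by nlinarith
  have h4 := h2 (S n) (D * β n) h3
    (hn.trans (mul_le_mul_of_nonneg_right (le_max_left _ _) (by linarith)))
    (fun k => closedWords τ (S n) (p k)) (fun k x hx => by
      have h5 := Finset.mem_filter.1 hx
      exact ⟨fun i => Fintype.mem_piFinset.1 h5.1 i, h5.2, hnd k n x hx⟩)
  set E : ℝ := (((Fintype.piFinset fun k => closedWords τ (S n) (p k)).filter
    (IsEntangled cl)).card : ℝ) with hE
  have hs : 0 < √(β n) := Real.sqrt_pos.2 (by linarith)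
  have hprod : ∏ k, (√(β n) * (√(β n))⁻¹ ^ (p k)) = √(β n) ^ L * (√(β n))⁻¹ ^ N := by
    rw [Finset.prod_mul_distrib, Finset.prod_const, Finset.card_univ, Finset.prod_pow_eq_pow_sum]
  rw [hprod]
  have h6 : E * √(β n) ^ (L + 1) ≤ C' * (√D ^ N * √(β n) ^ N) := by
    refine le_trans ?_ (h4.trans_eq ?_)
    · have : √(β n) ≤ √(D * β n) := Real.sqrt_le_sqrt (by nlinarith)
      gcongr
    · rw [Real.sqrt_mul (by linarith), mul_pow]
  have h7 : E * √(β n) ^ L * (√(β n))⁻¹ ^ N ≤ C' * √D ^ N * (√(β n))⁻¹ := by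
    rw [inv_pow, ← div_eq_mul_inv, ← div_eq_mul_inv, div_le_div_iff₀ (by positivity) hs]
    calc E * √(β n) ^ L * √(β n) = E * √(β n) ^ (L + 1) := by ring
      _ ≤ _ := h6
      _ = _ := by ring
  calc C * (√(β n) ^ L * (√(β n))⁻¹ ^ N) * E = C * (E * √(β n) ^ L * (√(β n))⁻¹ ^ N) := by ring
    _ ≤ C * (C' * √D ^ N * (√(β n))⁻¹) := by gcongr
    _ = _ := by ring

/-- Linear combinations of normalized fluctuations are asymptotically normal as soon as their
covariances converge. -/
theorem IsEntryFamily.convergesToNormal (ha : IsEntryFamily μ a cl)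
    (hd : IsSignDecomposition sg cl) (hτ : ∀ k, τ k = 1 ∨ τ k = -1) {β : ℕ → ℝ}
    (hβ : Tendsto β atTop atTop) {S : ℕ → Finset ℤ} {C₀ : ℝ}
    (hS : ∀ᶠ n in atTop, ((S n).card : ℝ) ≤ C₀ * β n) (I : Finset ℕ)
    (hnd : ∀ p ∈ I, ∀ n, ∀ x ∈ closedWords τ (S n) p, IsNondegenerate sg cl τ x)
    (q : ℕ → ℝ) (Y : ℕ → Ω → ℝ)
    (hY : ∀ n ω, (Y n ω : ℂ) = ∑ p ∈ I, (q p : ℂ) * traceFluctuation μ a (β n) n τ (S n) p ω)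
    (σ : ℕ → ℕ → ℝ)
    (hσ : ∀ p ∈ I, ∀ p' ∈ I, Tendsto (fun n => ∫ ω, traceFluctuation μ a (β n) n τ (S n) p ω *
      traceFluctuation μ a (β n) n τ (S n) p' ω ∂μ) atTop (𝓝 (σ p p' : ℂ))) :
    ConvergesToNormal μ Y (∑ i ∈ I, ∑ j ∈ I, q i * q j * σ i j) := by
  set X := fun n p => traceFluctuation μ a (β n) n τ (S n) p with hX
  have hXm : ∀ n p, ∃ B, MomentBound μ (X n p) B := fun n p => ha.exists_momentBound_wordSum _ _
  have hYm : ∀ n, ∃ B, MomentBound μ (fun ω => (Y n ω : ℂ)) B := by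
    intro n
    simp_rw [hY]
    refine exists_momentBound_sum I (fun p ω => (q p : ℂ) * X n p ω) fun p _ => ?_
    obtain ⟨B, hB⟩ := hXm n p
    exact ⟨_, (momentBound_const (q p : ℂ)).mul hB⟩
  have hmeas : ∀ n, Measurable (Y n) := by
    intro n
    obtain ⟨B, hB⟩ := hYm n
    exact Complex.measurable_re.comp hB.1
  have hexp : ∀ {κ : Type} [Fintype κ] [DecidableEq κ] (n : ℕ) (A : Finset κ),
      (∫ ω, (Y n ω : ℂ) ^ A.card ∂μ) * (∫ ω, (Y n ω : ℂ) ^ Aᶜ.card ∂μ) =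
      ∑ x ∈ Fintype.piFinset fun _ : κ => I, (∏ k, (q (x k) : ℂ)) *
        ((∫ ω, ∏ k ∈ A, X n (x k) ω ∂μ) * ∫ ω, ∏ k ∈ Aᶜ, X n (x k) ω ∂μ) := by
    intro κ _ _ n A
    have := integral_prod_sum_mul (μ := μ) (fun _ : κ => I) (fun _ p => (q p : ℂ))
      (fun _ p => X n p) (fun x A => by
        obtain ⟨B, hB⟩ := exists_momentBound_prod' (fun k => X n (x k)) (fun k => hXm n _) A
        exact hB.integrable) A
    rw [← this]
    simp_rw [hY, Finset.prod_const]
    rfl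
  refine convergesToNormal_of_moments μ Y _ hmeas ?_ ?_ ?_ ?_
  · intro n k
    obtain ⟨B, hB⟩ := hYm n
    refine (hB.2 k).1.mono' ((hmeas n).pow_const k).aestronglyMeasurable
      (Eventually.of_forall fun ω => ?_)
    simp
  · have : ∀ n, ∫ ω, Y n ω ∂μ = 0 := by
      intro n
      have h1 : ∫ ω, (Y n ω : ℂ) ∂μ = 0 := by
        simp_rw [hY]
        rw [integral_finsetSum]
        · refine Finset.sum_eq_zero fun p _ => ?_
          rw [integral_const_mul]
          unfold traceFluctuation
          rw [ha.integral_wordSum, mul_zero]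
        · intro p _
          obtain ⟨B, hB⟩ := hXm n p
          exact hB.integrable.const_mul _
      rw [integral_complex_ofReal] at h1
      exact_mod_cast h1
    simp [this]
  · rw [← Filter.tendsto_ofReal_iff]
    have h1 : ∀ n, ((∫ ω, Y n ω ^ 2 ∂μ : ℝ) : ℂ) = ∑ i ∈ I, ∑ j ∈ I, (q i : ℂ) * q j *
        ∫ ω, X n i ω * X n j ω ∂μ := by
      intro n
      rw [← integral_complex_ofReal]
      have h2 : ∀ ω, ((Y n ω ^ 2 : ℝ) : ℂ) = ∑ i ∈ I, ∑ j ∈ I, (q i : ℂ) * q j *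
          (X n i ω * X n j ω) := by
        intro ω
        push_cast
        rw [hY, sq, Finset.sum_mul_sum]
        refine Finset.sum_congr rfl fun i _ => Finset.sum_congr rfl fun j _ => ?_
        ring
      have hint : ∀ i j, Integrable (fun ω => X n i ω * X n j ω) μ := by
        intro i j
        obtain ⟨B, hB⟩ := hXm n i
        obtain ⟨B', hB'⟩ := hXm n j
        exact (hB.mul hB').integrable
      simp_rw [h2]
      rw [integral_finsetSum _ fun i _ => integrable_finsetSum _ fun j _ => (hint i j).const_mul _]
      refine Finset.sum_congr rfl fun i _ => ?_
      rw [integral_finsetSum _ fun j _ => (hint i j).const_mul _]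
      exact Finset.sum_congr rfl fun j _ => integral_const_mul _ _
    simp only [h1]
    push_cast
    exact tendsto_finsetSum _ fun i hi => tendsto_finsetSum _ fun j hj =>
      (hσ i hi j hj).const_mul _
  · intro L
    rw [← Filter.tendsto_ofReal_iff]
    -- Multilinear expansion of `Y`: each of the `L + 1` possible partners `l` of slot `0` carries
    -- one copy of `𝔼 Y² 𝔼 Y^L`, which turns the defect of `Y` into a combination of defects of the
    -- single powers.
    have h1 : ∀ n, ((∫ ω, Y n ω ^ (L + 2) ∂μ -
        (L + 1) * ((∫ ω, Y n ω ^ 2 ∂μ) * ∫ ω, Y n ω ^ L ∂μ) : ℝ) : ℂ) =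
        ∑ x ∈ Fintype.piFinset fun _ : Fin (L + 2) => I, (∏ k, (q (x k) : ℂ)) *
          ((∫ ω, ∏ k, X n (x k) ω ∂μ) - ∑ l ∈ Finset.univ.erase (0 : Fin (L + 2)),
            (∫ ω, X n (x 0) ω * X n (x l) ω ∂μ) * ∫ ω, ∏ k ∈ {0, l}ᶜ, X n (x k) ω ∂μ) := by
      intro n
      have e0 := hexp n (Finset.univ : Finset (Fin (L + 2)))
      simp only [Finset.card_univ, Fintype.card_fin, Finset.compl_univ, Finset.card_empty, pow_zero,
        Finset.prod_empty, integral_const, probReal_univ, one_smul, mul_one] at e0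
      have e1 : ∀ l ∈ Finset.univ.erase (0 : Fin (L + 2)),
          (∫ ω, (Y n ω : ℂ) ^ 2 ∂μ) * (∫ ω, (Y n ω : ℂ) ^ L ∂μ) =
          ∑ x ∈ Fintype.piFinset fun _ : Fin (L + 2) => I, (∏ k, (q (x k) : ℂ)) *
            ((∫ ω, X n (x 0) ω * X n (x l) ω ∂μ) * ∫ ω, ∏ k ∈ {0, l}ᶜ, X n (x k) ω ∂μ) := by
        intro l hl
        have hl0 := (Finset.ne_of_mem_erase hl).symm
        have := hexp n ({0, l} : Finset (Fin (L + 2)))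
        rw [Finset.card_compl, Finset.card_pair hl0, Fintype.card_fin, Nat.add_sub_cancel] at this
        rw [this]
        simp_rw [Finset.prod_pair hl0]
      have e2 : ((L : ℂ) + 1) * ((∫ ω, (Y n ω : ℂ) ^ 2 ∂μ) * ∫ ω, (Y n ω : ℂ) ^ L ∂μ) =
          ∑ l ∈ Finset.univ.erase (0 : Fin (L + 2)),
          (∫ ω, (Y n ω : ℂ) ^ 2 ∂μ) * (∫ ω, (Y n ω : ℂ) ^ L ∂μ) := by
        rw [Finset.sum_const, Finset.card_erase_of_mem (Finset.mem_univ _), Finset.card_univ,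
          Fintype.card_fin, nsmul_eq_mul]
        push_cast
        simp
      push_cast
      rw [← integral_complex_ofReal, ← integral_complex_ofReal, ← integral_complex_ofReal]
      push_cast
      rw [e0, e2, Finset.sum_congr rfl e1, Finset.sum_comm, ← Finset.sum_sub_distrib]
      refine Finset.sum_congr rfl fun x _ => ?_
      rw [mul_sub, Finset.mul_sum]
    simp only [h1, Complex.ofReal_zero]
    rw [show (0 : ℂ) = ∑ x ∈ Fintype.piFinset fun _ : Fin (L + 2) => I,
      (∏ k, (q (x k) : ℂ)) * 0 by simp]
    refine tendsto_finsetSum _ fun x hx => Tendsto.const_mul _ ?_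
    exact ha.tendsto_wick_recursion hd hτ hβ hS x
      (fun k => hnd (x k) (Fintype.mem_piFinset.1 hx k)) 0

end CLT

end SparseToeplitz
end

noncomputable section
namespace SparseToeplitz

/-! ### Lattice point counts as Riemann sums -/

/-- A level set of a nonzero linear form is a proper affine subspace, hence a null set. -/
lemma ae_ne_of_linearMap_ne_zero {E : Type*} [NormedAddCommGroup E] [NormedSpace ℝ E]
    [MeasurableSpace E] [BorelSpace E] [FiniteDimensional ℝ E] (ν : Measure E) [ν.IsAddHaarMeasure]
    (φ : E →ₗ[ℝ] ℝ) (hφ : φ ≠ 0) (c : ℝ) : ∀ᵐ z ∂ν, φ z ≠ c := by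
  rw [ae_iff]
  simp only [ne_eq, not_not]
  obtain ⟨w, hw⟩ : ∃ w, φ w ≠ 0 := by
    by_contra h
    push Not at h
    exact hφ (LinearMap.ext h)
  let s : AffineSubspace ℝ E := AffineSubspace.mk' ((c / φ w) • w) (LinearMap.ker φ)
  have hs : {z | φ z = c} = (s : Set E) := by
    ext z
    simp only [Set.mem_ofPred_eq, SetLike.mem_coe, s, AffineSubspace.mem_mk', LinearMap.mem_ker,
      vsub_eq_sub, map_sub, map_smul, smul_eq_mul, div_mul_cancel₀ _ hw, sub_eq_zero]
  rw [hs]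
  refine Measure.addHaar_affineSubspace ν s fun htop => ?_
  have h1 : (((c + 1) / φ w) • w) ∈ s := by rw [htop]; trivial
  have h2 : (((c + 1) / φ w) • w) ∈ (s : Set E) := h1
  rw [← hs] at h2
  simp only [Set.mem_ofPred_eq, map_smul, smul_eq_mul, div_mul_cancel₀ _ hw] at h2
  linarith

lemma integral_floor_eq {s : ℝ} (hs : 0 < s) (i : ℤ) :
    ∫ u : ℝ, (if ⌊s * u⌋ = i then (1 : ℝ) else 0) = s⁻¹ := by
  have h1 : ∀ u : ℝ, (if ⌊s * u⌋ = i then (1 : ℝ) else 0) =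
      (Set.Ico (i / s) ((i + 1) / s)).indicator (fun _ => (1 : ℝ)) u := by
    intro u
    have : ⌊s * u⌋ = i ↔ u ∈ Set.Ico (i / s) ((i + 1) / s) := by
      rw [Int.floor_eq_iff, Set.mem_Ico, div_le_iff₀ hs, lt_div_iff₀ hs, mul_comm u s]
    by_cases h : u ∈ Set.Ico (i / s) ((i + 1) / s)
    · rw [if_pos (this.2 h), Set.indicator_of_mem h]
    · rw [if_neg fun h' => h (this.1 h'), Set.indicator_of_notMem h]
  simp_rw [h1]
  rw [integral_indicator measurableSet_Ico, setIntegral_const, smul_eq_mul, mul_one,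
    Measure.real, Real.volume_Ico, ENNReal.toReal_ofReal]
  · field_simp; ring
  · rw [← sub_div]
    have : (i : ℝ) + 1 - i = 1 := by ring
    rw [this]; positivity

/-- Sequences of integers which are proportional to `β` eventually belong to `S n` if and only if
the limit of the quotients belongs to `B`, apart from finitely many exceptional limits. -/
def Approximates (β : ℕ → ℝ) (S : ℕ → Finset ℤ) (B : Set ℝ) : Prop :=
  ∃ N : Finset ℝ, ∀ y ∉ N, ∀ k : ℕ → ℤ, Tendsto (fun n => (k n : ℝ) / β n) atTop (𝓝 y) →
    ∀ᶠ n in atTop, (k n ∈ S n ↔ y ∈ B)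

lemma tendsto_floor_mul_div {β : ℕ → ℝ} (hβ : Tendsto β atTop atTop) (y : ℝ) :
    Tendsto (fun n => (⌊β n * y⌋ : ℝ) / β n) atTop (𝓝 y) := by
  have h1 : Tendsto (fun n => y - (β n)⁻¹) atTop (𝓝 y) := by
    simpa using (tendsto_inv_atTop_zero.comp hβ).const_sub y
  refine tendsto_of_tendsto_of_tendsto_of_le_of_le' h1 tendsto_const_nhds ?_ ?_
  · filter_upwards [hβ.eventually_gt_atTop 0] with n hn
    rw [le_div_iff₀ hn]
    have := Int.lt_floor_add_one (β n * y)
    have h2 : (y - (β n)⁻¹) * β n = β n * y - 1 := by field_simp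
    linarith
  · filter_upwards [hβ.eventually_gt_atTop 0] with n hn
    rw [div_le_iff₀ hn]
    linarith [Int.floor_le (β n * y)]

/-- At the end points `0` and `1` the limit does not decide on which side the sequence lies; they
are excluded here and avoided almost everywhere later. -/
lemma eventually_mem_Ico_iff {m : ℕ → ℤ} {w : ℝ} (h0 : w ≠ 0) (h1 : w ≠ 1)
    (hm : Tendsto (fun n : ℕ => (m n : ℝ) / n) atTop (𝓝 w)) :
    ∀ᶠ n : ℕ in atTop, (m n ∈ Set.Ico (0 : ℤ) n ↔ w ∈ Set.Icc (0 : ℝ) 1) := by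
  have hpos := eventually_gt_atTop (0 : ℕ)
  rcases lt_or_gt_of_ne h0 with h | h
  · filter_upwards [hm.eventually_lt_const h, hpos] with n hn hn0
    have hn0' : (0 : ℝ) < n := by exact_mod_cast hn0
    have : (m n : ℝ) < 0 := by
      by_contra hcon
      exact absurd hn (not_lt.2 (div_nonneg (not_lt.1 hcon) hn0'.le))
    have h2 : m n < 0 := by exact_mod_cast this
    exact iff_of_false (fun h3 => absurd h3.1 (not_le.2 h2)) fun h3 => absurd h3.1 (not_le.2 h)
  rcases lt_or_gt_of_ne h1 with h' | h'
  · filter_upwards [hm.eventually_lt_const h', hm.eventually_const_lt h, hpos] with n hn hn1 hn0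
    have hn0' : (0 : ℝ) < n := by exact_mod_cast hn0
    refine iff_of_true ⟨?_, ?_⟩ ⟨h.le, h'.le⟩
    · have := (div_pos_iff_of_pos_right hn0').1 hn1
      exact_mod_cast this.le
    · rw [div_lt_one hn0'] at hn
      exact_mod_cast hn
  · filter_upwards [hm.eventually_const_lt h', hpos] with n hn hn0
    have hn0' : (0 : ℝ) < n := by exact_mod_cast hn0
    rw [one_lt_div hn0'] at hn
    refine iff_of_false (fun h3 => ?_) fun h3 => absurd h3.2 (not_le.2 h')
    have h4 : (m n : ℝ) < n := by exact_mod_cast h3.2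
    linarith

section LatticeCount

variable {ι α γ γ' : Type*} [Fintype ι] [DecidableEq ι] [Fintype α] [Fintype γ] [Fintype γ']

/-- The value of an integral linear form. -/
def linForm {R : Type*} [CommRing R] (ℓ : ι → ℤ) (k : ι → R) : R := ∑ i, (ℓ i : R) * k i

/-- The coordinatewise integral parts of a point, after scaling. -/
def floorMap (s t r : ℝ) (z : ℝ × ℝ × (ι → ℝ)) : ℤ × ℤ × (ι → ℤ) :=
  (⌊s * z.1⌋, ⌊t * z.2.1⌋, fun i => ⌊r * z.2.2 i⌋)

/-- The product Lebesgue measure. -/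
abbrev prodVolume (ι : Type*) [Fintype ι] : Measure (ℝ × ℝ × (ι → ℝ)) :=
  (volume : Measure ℝ).prod ((volume : Measure ℝ).prod (volume : Measure (ι → ℝ)))

instance isAddHaarMeasure_prodVolume : (prodVolume ι).IsAddHaarMeasure := by
  have : ((volume : Measure ℝ).prod (volume : Measure (ι → ℝ))).IsAddHaarMeasure :=
    Measure.prod.instIsAddHaarMeasure _ _
  exact Measure.prod.instIsAddHaarMeasure _ _

lemma measurable_floorMap (s t r : ℝ) : Measurable (floorMap (ι := ι) s t r) := by
  unfold floorMap
  refine Measurable.prodMk (by fun_prop) (Measurable.prodMk (by fun_prop) ?_)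
  refine measurable_pi_lambda _ fun i => Int.measurable_floor.comp ?_
  fun_prop

open Classical in
-- The points whose scaled integral parts are a given lattice point form a box with sides `1/s`,
-- `1/t` and `1/r`.
lemma integral_floorMap_eq {s t r : ℝ} (hs : 0 < s) (ht : 0 < t) (hr : 0 < r)
    (p : ℤ × ℤ × (ι → ℤ)) :
    Integrable (fun z => if floorMap s t r z = p then (1 : ℝ) else 0) (prodVolume ι) ∧
    ∫ z, (if floorMap s t r z = p then (1 : ℝ) else 0) ∂prodVolume ι =
      s⁻¹ * (t⁻¹ * r⁻¹ ^ Fintype.card ι) := by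
  have h1 : ∀ z : ℝ × ℝ × (ι → ℝ), (if floorMap s t r z = p then (1 : ℝ) else 0) =
      (if ⌊s * z.1⌋ = p.1 then 1 else 0) * ((if ⌊t * z.2.1⌋ = p.2.1 then 1 else 0) *
        ∏ i, if ⌊r * z.2.2 i⌋ = p.2.2 i then 1 else 0) := by
    intro z
    have : floorMap s t r z = p ↔ ⌊s * z.1⌋ = p.1 ∧ ⌊t * z.2.1⌋ = p.2.1 ∧
        ∀ i, ⌊r * z.2.2 i⌋ = p.2.2 i := by
      rw [Prod.ext_iff, Prod.ext_iff, funext_iff]; rfl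
    rw [Finset.prod_ite_zero]
    simp only [this, Finset.mem_univ, true_imp_iff, Finset.prod_const_one]
    split_ifs <;> simp_all
  have h3 : ∫ z : ℝ × ℝ × (ι → ℝ), (if floorMap s t r z = p then (1 : ℝ) else 0) ∂prodVolume ι =
      s⁻¹ * (t⁻¹ * r⁻¹ ^ Fintype.card ι) := by
    simp_rw [h1]
    rw [integral_prod_mul (fun u : ℝ => if ⌊s * u⌋ = p.1 then (1 : ℝ) else 0)
      (fun w : ℝ × (ι → ℝ) => (if ⌊t * w.1⌋ = p.2.1 then 1 else 0) *
        ∏ i, if ⌊r * w.2 i⌋ = p.2.2 i then 1 else 0),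
      integral_prod_mul (fun u : ℝ => if ⌊t * u⌋ = p.2.1 then (1 : ℝ) else 0)
      (fun y : ι → ℝ => ∏ i, if ⌊r * y i⌋ = p.2.2 i then 1 else 0),
      integral_fintype_prod_volume_eq_prod (fun i (y : ℝ) => if ⌊r * y⌋ = p.2.2 i then (1 : ℝ) else 0),
      integral_floor_eq hs, integral_floor_eq ht]
    simp_rw [integral_floor_eq hr]
    simp
  refine ⟨?_, h3⟩
  -- Integrability is read off from the value: a non-integrable function would have integral `0`,
  -- but the volume of the box is positive.
  by_contra hcon
  rw [integral_undef hcon] at h3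
  have : 0 < s⁻¹ * (t⁻¹ * r⁻¹ ^ Fintype.card ι) := by positivity
  linarith

open Classical in
lemma integral_floorMap_mem {s t r : ℝ} (hs : 0 < s) (ht : 0 < t) (hr : 0 < r)
    (T : Finset (ℤ × ℤ × (ι → ℤ))) :
    ∫ z, (if floorMap s t r z ∈ T then (1 : ℝ) else 0) ∂prodVolume ι =
      T.card * (s⁻¹ * (t⁻¹ * r⁻¹ ^ Fintype.card ι)) := by
  have h1 : ∀ z : ℝ × ℝ × (ι → ℝ), (if floorMap s t r z ∈ T then (1 : ℝ) else 0) =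
      ∑ p ∈ T, if floorMap s t r z = p then (1 : ℝ) else 0 := fun z => by simp
  simp_rw [h1]
  rw [integral_finsetSum _ fun p _ => (integral_floorMap_eq hs ht hr p).1]
  simp_rw [(integral_floorMap_eq hs ht hr _).2]
  rw [Finset.sum_const, nsmul_eq_mul]

open Classical in
/-- The lattice points `(i, j, k)` such that the forms `ℓ` take values in `S` at `k` and the walks
`i + lam c k` and `j + lam' c k` stay in `{0, …, n - 1}`. -/
def latticeSet (n : ℕ) (S : Finset ℤ) (ℓ : α → ι → ℤ) (lam : γ → ι → ℤ) (lam' : γ' → ι → ℤ) :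
    Finset (ℤ × ℤ × (ι → ℤ)) :=
  ((Finset.Ico (0 : ℤ) n) ×ˢ (Finset.Ico (0 : ℤ) n) ×ˢ Fintype.piFinset fun _ => S).filter fun t =>
    (∀ a, linForm (ℓ a) t.2.2 ∈ S) ∧ (∀ c, t.1 + linForm (lam c) t.2.2 ∈ Set.Ico (0 : ℤ) n) ∧
    ∀ c, t.2.1 + linForm (lam' c) t.2.2 ∈ Set.Ico (0 : ℤ) n

/-- The limit region. -/
def limitRegion (B : Set ℝ) (b : ℝ) (ℓ : α → ι → ℤ) (lam : γ → ι → ℤ) (lam' : γ' → ι → ℤ)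
    (u v : ℝ) : Set (ι → ℝ) :=
  {y | (∀ a, linForm (ℓ a) y ∈ B) ∧ (∀ c, u + b * linForm (lam c) y ∈ Set.Icc (0 : ℝ) 1) ∧
    ∀ c, v + b * linForm (lam' c) y ∈ Set.Icc (0 : ℝ) 1}

lemma tendsto_linForm_floor_div {β : ℕ → ℝ} (hβ : Tendsto β atTop atTop) (ℓ : ι → ℤ) (y : ι → ℝ) :
    Tendsto (fun n => ((linForm ℓ (fun i => ⌊β n * y i⌋) : ℤ) : ℝ) / β n) atTop
      (𝓝 (linForm ℓ y)) := by
  have h1 : ∀ n, ((linForm ℓ (fun i => ⌊β n * y i⌋) : ℤ) : ℝ) / β n =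
      ∑ i, (ℓ i : ℝ) * ((⌊β n * y i⌋ : ℝ) / β n) := by
    intro n
    simp only [linForm]
    push_cast
    rw [Finset.sum_div]
    exact Finset.sum_congr rfl fun i _ => mul_div_assoc _ _ _
  simp_rw [h1]
  exact tendsto_finsetSum _ fun i _ => (tendsto_floor_mul_div hβ (y i)).const_mul _

/-- `linForm ℓ` as a linear map on the last component. -/
def linFormMap (ℓ : ι → ℤ) : (ℝ × ℝ × (ι → ℝ)) →ₗ[ℝ] ℝ where
  toFun z := linForm ℓ z.2.2
  map_add' z w := by
    simp [linForm, mul_add, Finset.sum_add_distrib]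
  map_smul' c z := by
    simp [linForm, Finset.mul_sum, mul_left_comm]

lemma linForm_single (ℓ : ι → ℤ) (i : ι) : linForm ℓ (Pi.single i (1 : ℝ)) = ℓ i := by
  unfold linForm
  rw [Finset.sum_eq_single i]
  · simp
  · intro j _ hj; simp [hj]
  · simp

lemma linForm_single_left {R : Type*} [CommRing R] (i : ι) (k : ι → R) :
    linForm (Pi.single i (1 : ℤ)) k = k i := by
  unfold linForm
  rw [Finset.sum_eq_single i]
  · simp
  · intro j _ hj; simp [hj]
  · simp

open Classical in
-- Each of the finitely many conditions defining the lattice set stabilizes to its limit form unless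
-- the point lies on one of finitely many hyperplanes. These are null sets, because the forms `ℓ a`
-- do not vanish and each walk condition contains its own starting variable.
lemma tendsto_floorMap_mem {β : ℕ → ℝ} (hβ : Tendsto β atTop atTop) {b : ℝ}
    (hβb : Tendsto (fun n : ℕ => β n / n) atTop (𝓝 b)) {S : ℕ → Finset ℤ} {B : Set ℝ}
    (hS : Approximates β S B) (ℓ : α → ι → ℤ) (lam : γ → ι → ℤ) (lam' : γ' → ι → ℤ)
    (hℓ : ∀ a, ℓ a ≠ 0) (hcoord : ∀ i, ∃ a, ℓ a = Pi.single i 1) :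
    ∀ᵐ z ∂prodVolume ι, Tendsto (fun n : ℕ => if floorMap n n (β n) z ∈ latticeSet n (S n) ℓ lam lam'
      then (1 : ℝ) else 0) atTop (𝓝 ((Set.Icc (0 : ℝ) 1).indicator (fun _ => (Set.Icc (0 : ℝ) 1).indicator
        (fun _ => (limitRegion B b ℓ lam lam' z.1 z.2.1).indicator (fun _ => (1 : ℝ)) z.2.2) z.2.1) z.1)) := by
  obtain ⟨N, hN⟩ := hS
  have a1 : ∀ᵐ z ∂prodVolume ι, ∀ a, ∀ y ∈ N, linForm (ℓ a) z.2.2 ≠ y := by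
    rw [ae_all_iff]
    intro a
    rw [Filter.eventually_all_finset]
    intro y _
    refine ae_ne_of_linearMap_ne_zero (prodVolume ι) (linFormMap (ℓ a)) (fun h => hℓ a ?_) y
    funext i
    have h0 : linForm (ℓ a) (Pi.single i (1 : ℝ)) = 0 :=
      LinearMap.congr_fun h (0, 0, Pi.single i 1)
    rw [linForm_single] at h0
    exact_mod_cast h0
  have a2 : ∀ (ℓ : ι → ℤ) (c : ℝ), ∀ᵐ z ∂prodVolume ι, z.1 + b * linForm ℓ z.2.2 ≠ c := by
    intro ℓ c
    refine ae_ne_of_linearMap_ne_zero (prodVolume ι)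
      (LinearMap.fst ℝ ℝ (ℝ × (ι → ℝ)) + b • linFormMap ℓ) (fun h => ?_) c
    have := LinearMap.congr_fun h (1, 0, 0)
    simp [linFormMap, linForm] at this
  have a3 : ∀ (ℓ : ι → ℤ) (c : ℝ), ∀ᵐ z ∂prodVolume ι, z.2.1 + b * linForm ℓ z.2.2 ≠ c := by
    intro ℓ c
    refine ae_ne_of_linearMap_ne_zero (prodVolume ι)
      ((LinearMap.fst ℝ ℝ (ι → ℝ)).comp (LinearMap.snd ℝ ℝ (ℝ × (ι → ℝ))) + b • linFormMap ℓ)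
      (fun h => ?_) c
    have := LinearMap.congr_fun h (0, 1, 0)
    simp [linFormMap, linForm] at this
  have a4 : ∀ c : ℝ, ∀ᵐ z ∂prodVolume ι, z.1 ≠ c := fun c => by
    filter_upwards [a2 0 c] with z hz
    simpa [linForm] using hz
  have a5 : ∀ c : ℝ, ∀ᵐ z ∂prodVolume ι, z.2.1 ≠ c := fun c => by
    filter_upwards [a3 0 c] with z hz
    simpa [linForm] using hz
  filter_upwards [a1, a4 0, a4 1, a5 0, a5 1, ae_all_iff.2 fun c => a2 (lam c) 0,
    ae_all_iff.2 fun c => a2 (lam c) 1, ae_all_iff.2 fun c => a3 (lam' c) 0,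
    ae_all_iff.2 fun c => a3 (lam' c) 1] with z h1 h2 h3 h4 h5 h6 h7 h8 h9
  have hn : Tendsto (fun n : ℕ => (n : ℝ)) atTop atTop := tendsto_natCast_atTop_atTop
  have hlam : ∀ ℓ : ι → ℤ, Tendsto (fun n : ℕ =>
      ((linForm ℓ (fun i => ⌊β n * z.2.2 i⌋) : ℤ) : ℝ) / n) atTop (𝓝 (b * linForm ℓ z.2.2)) := by
    intro ℓ
    have := hβb.mul (tendsto_linForm_floor_div hβ ℓ z.2.2)
    refine this.congr' ?_
    filter_upwards [hβ.eventually_gt_atTop 0] with n hn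
    field_simp
  have e1 := eventually_mem_Ico_iff h2 h3 (tendsto_floor_mul_div hn z.1)
  have e2 := eventually_mem_Ico_iff h4 h5 (tendsto_floor_mul_div hn z.2.1)
  have e3 : ∀ᶠ n : ℕ in atTop, ∀ a, (linForm (ℓ a) (fun i => ⌊β n * z.2.2 i⌋) ∈ S n ↔
      linForm (ℓ a) z.2.2 ∈ B) := by
    rw [eventually_all]
    intro a
    exact hN _ (fun h => h1 a _ h rfl) _ (tendsto_linForm_floor_div hβ (ℓ a) z.2.2)
  have e4 : ∀ᶠ n : ℕ in atTop, ∀ c, (⌊(n : ℝ) * z.1⌋ + linForm (lam c) (fun i => ⌊β n * z.2.2 i⌋) ∈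
      Set.Ico (0 : ℤ) n ↔ z.1 + b * linForm (lam c) z.2.2 ∈ Set.Icc (0 : ℝ) 1) := by
    rw [eventually_all]
    intro c
    refine eventually_mem_Ico_iff (h6 c) (h7 c) ?_
    refine ((tendsto_floor_mul_div hn z.1).add (hlam (lam c))).congr fun n => ?_
    push_cast
    rw [add_div]
  have e5 : ∀ᶠ n : ℕ in atTop, ∀ c, (⌊(n : ℝ) * z.2.1⌋ + linForm (lam' c) (fun i => ⌊β n * z.2.2 i⌋) ∈
      Set.Ico (0 : ℤ) n ↔ z.2.1 + b * linForm (lam' c) z.2.2 ∈ Set.Icc (0 : ℝ) 1) := by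
    rw [eventually_all]
    intro c
    refine eventually_mem_Ico_iff (h8 c) (h9 c) ?_
    refine ((tendsto_floor_mul_div hn z.2.1).add (hlam (lam' c))).congr fun n => ?_
    push_cast
    rw [add_div]
  refine tendsto_const_nhds.congr' ?_
  filter_upwards [e1, e2, e3, e4, e5] with n e1 e2 e3 e4 e5
  have hmem : floorMap n n (β n) z ∈ latticeSet n (S n) ℓ lam lam' ↔
      z.1 ∈ Set.Icc (0 : ℝ) 1 ∧ z.2.1 ∈ Set.Icc (0 : ℝ) 1 ∧
        z.2.2 ∈ limitRegion B b ℓ lam lam' z.1 z.2.1 := by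
    unfold latticeSet limitRegion floorMap
    simp only [Finset.mem_filter, Finset.mem_product, Finset.mem_Ico, Fintype.mem_piFinset,
      Set.mem_ofPred_eq]
    rw [← Set.mem_Ico, ← Set.mem_Ico, e1, e2]
    simp only [e3, e4, e5]
    constructor
    · rintro ⟨⟨hu, hv, -⟩, h⟩
      exact ⟨hu, hv, h⟩
    · rintro ⟨hu, hv, h⟩
      -- Membership of the coordinates in `S n` is not a separate limit condition, since the
      -- coordinate forms are among the `ℓ a`.
      refine ⟨⟨hu, hv, fun i => ?_⟩, h⟩
      obtain ⟨a, ha⟩ := hcoord i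
      have h10 := (e3 a).2 (h.1 a)
      rwa [ha, linForm_single_left] at h10
  by_cases hu : z.1 ∈ Set.Icc (0 : ℝ) 1
  · by_cases hv : z.2.1 ∈ Set.Icc (0 : ℝ) 1
    · by_cases hy : z.2.2 ∈ limitRegion B b ℓ lam lam' z.1 z.2.1
      · rw [Set.indicator_of_mem hu, Set.indicator_of_mem hv, Set.indicator_of_mem hy,
          if_pos (hmem.2 ⟨hu, hv, hy⟩)]
      · rw [Set.indicator_of_mem hu, Set.indicator_of_mem hv, Set.indicator_of_notMem hy,
          if_neg fun h => hy (hmem.1 h).2.2]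
    · rw [Set.indicator_of_mem hu, Set.indicator_of_notMem hv, if_neg fun h => hv (hmem.1 h).2.1]
  · rw [Set.indicator_of_notMem hu, if_neg fun h => hu (hmem.1 h).1]

/-- Lattice point counts converge to the volume of the limit region. -/
theorem tendsto_card_latticeSet {β : ℕ → ℝ} (hβ : Tendsto β atTop atTop) {b : ℝ}
    (hβb : Tendsto (fun n : ℕ => β n / n) atTop (𝓝 b)) {S : ℕ → Finset ℤ} {B : Set ℝ}
    (hS : Approximates β S B) {C₀ : ℝ} (hC₀ : ∀ᶠ n in atTop, ∀ k ∈ S n, |(k : ℝ)| ≤ C₀ * β n)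
    (ℓ : α → ι → ℤ) (lam : γ → ι → ℤ) (lam' : γ' → ι → ℤ)
    (hℓ : ∀ a, ℓ a ≠ 0) (hcoord : ∀ i, ∃ a, ℓ a = Pi.single i 1) :
    Tendsto (fun n : ℕ => ((latticeSet n (S n) ℓ lam lam').card : ℝ) *
      ((n : ℝ)⁻¹ * ((n : ℝ)⁻¹ * (β n)⁻¹ ^ Fintype.card ι))) atTop
      (𝓝 (∫ u in Set.Icc (0 : ℝ) 1, ∫ v in Set.Icc (0 : ℝ) 1, ∫ y : ι → ℝ,
        (limitRegion B b ℓ lam lam' u v).indicator (fun _ => (1 : ℝ)) y)) := by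
  classical
  set F : ℕ → ℝ × ℝ × (ι → ℝ) → ℝ := fun n z =>
    if floorMap n n (β n) z ∈ latticeSet n (S n) ℓ lam lam' then (1 : ℝ) else 0 with hF
  set G : ℝ × ℝ × (ι → ℝ) → ℝ := fun z => (Set.Icc (0 : ℝ) 1).indicator
    (fun _ => (Set.Icc (0 : ℝ) 1).indicator
        (fun _ => (limitRegion B b ℓ lam lam' z.1 z.2.1).indicator (fun _ => (1 : ℝ)) z.2.2) z.2.1) z.1
    with hG
  -- The common support for dominated convergence. The letters are at most `C₀ * β n`, and rounding
  -- costs at most `1` once `β n ≥ 1`.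
  set box : Set (ℝ × ℝ × (ι → ℝ)) := Set.Icc (0 : ℝ) 1 ×ˢ Set.Icc (0 : ℝ) 1 ×ˢ
    Set.Icc (fun _ => -(C₀ + 1)) (fun _ => C₀ + 1) with hbox
  have hconv : ∀ᵐ z ∂prodVolume ι, Tendsto (fun n => F n z) atTop (𝓝 (G z)) :=
    tendsto_floorMap_mem hβ hβb hS ℓ lam lam' hℓ hcoord
  have hmeas : ∀ n, Measurable (F n) := by
    intro n
    have h1 : Measurable fun p : ℤ × ℤ × (ι → ℤ) => if p ∈ latticeSet n (S n) ℓ lam lam' then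
      (1 : ℝ) else 0 := measurable_of_countable _
    exact h1.comp (measurable_floorMap _ _ _)
  have hboxm : MeasurableSet box := measurableSet_Icc.prod (measurableSet_Icc.prod measurableSet_Icc)
  have hboxint : Integrable (box.indicator fun _ => (1 : ℝ)) (prodVolume ι) := by
    refine (integrable_indicator_iff hboxm).2 (integrableOn_const ?_)
    have hK : IsCompact box := isCompact_Icc.prod (isCompact_Icc.prod isCompact_Icc)
    exact hK.measure_lt_top.ne
  have hbound : ∀ᶠ n in atTop, ∀ z, ‖F n z‖ ≤ box.indicator (fun _ => (1 : ℝ)) z := by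
    filter_upwards [hC₀, hβ.eventually_ge_atTop 1, eventually_gt_atTop 0] with n hn hβn hn0 z
    simp only [hF]
    split_ifs with h
    · rw [Set.indicator_of_mem]
      · simp
      · have hn0' : (0 : ℝ) < n := by exact_mod_cast hn0
        have h1 := Finset.mem_product.1 (Finset.mem_filter.1 h).1
        have h2 := Finset.mem_product.1 h1.2
        have hfl : ∀ u : ℝ, ⌊(n : ℝ) * u⌋ ∈ Finset.Ico (0 : ℤ) n → u ∈ Set.Icc (0 : ℝ) 1 := by
          intro u hu
          obtain ⟨hu1, hu2⟩ := Finset.mem_Ico.1 hu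
          have h3 : 0 ≤ (n : ℝ) * u := Int.floor_nonneg.1 hu1
          have h4 : (n : ℝ) * u < (n : ℤ) := Int.floor_lt.1 hu2
          refine ⟨nonneg_of_mul_nonneg_right h3 hn0', ?_⟩
          push_cast at h4
          by_contra hcon
          nlinarith
        refine ⟨hfl _ h1.1, hfl _ h2.1, ?_⟩
        have h5 : ∀ i, |z.2.2 i| ≤ C₀ + 1 := by
          intro i
          have h6 := hn _ (Fintype.mem_piFinset.1 h2.2 i)
          have h7 := Int.floor_le (β n * z.2.2 i)
          have h8 := Int.lt_floor_add_one (β n * z.2.2 i)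
          have h6' := abs_le.1 h6
          simp only [floorMap] at h6'
          rw [abs_le]
          constructor <;> by_contra hcon <;> nlinarith
        exact ⟨fun i => (abs_le.1 (h5 i)).1, fun i => (abs_le.1 (h5 i)).2⟩
    · rw [norm_zero]
      exact Set.indicator_nonneg (fun _ _ => zero_le_one) _
  -- `B` is an arbitrary set; measurability of the limit indicator is inherited from the converging
  -- sequence.
  have hGm : AEStronglyMeasurable G (prodVolume ι) :=
    aestronglyMeasurable_of_tendsto_ae atTop (fun n => (hmeas n).aestronglyMeasurable) hconv
  have hGint : Integrable G (prodVolume ι) := by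
    refine hboxint.mono' hGm ?_
    filter_upwards [hconv] with z hz
    refine le_of_tendsto hz.norm ?_
    filter_upwards [hbound] with n hn using hn z
  have hlim := tendsto_integral_filter_of_dominated_convergence (μ := prodVolume ι) _
    (Eventually.of_forall fun n => (hmeas n).aestronglyMeasurable)
    (hbound.mono fun n h => Eventually.of_forall h) hboxint hconv
  have hGi : ∫ z, G z ∂prodVolume ι = ∫ u in Set.Icc (0 : ℝ) 1, ∫ v in Set.Icc (0 : ℝ) 1, ∫ y : ι → ℝ,
        (limitRegion B b ℓ lam lam' u v).indicator (fun _ => (1 : ℝ)) y := by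
    rw [integral_prod _ hGint, ← integral_indicator measurableSet_Icc]
    refine integral_congr_ae ?_
    filter_upwards [hGint.prod_right_ae] with u hu
    rw [integral_prod _ hu]
    by_cases hmu : u ∈ Set.Icc (0 : ℝ) 1
    · rw [Set.indicator_of_mem hmu, ← integral_indicator measurableSet_Icc]
      refine integral_congr_ae (Eventually.of_forall fun v => ?_)
      simp only [hG, Set.indicator_of_mem hmu]
      by_cases hmv : v ∈ Set.Icc (0 : ℝ) 1
      · simp only [Set.indicator_of_mem hmv]
      · simp only [Set.indicator_of_notMem hmv, integral_zero]
    · simp only [hG, Set.indicator_of_notMem hmu, integral_zero]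
  rw [← hGi]
  refine hlim.congr' ?_
  filter_upwards [hβ.eventually_gt_atTop 0, eventually_gt_atTop 0] with n hn hn0
  have hn0' : (0 : ℝ) < n := by exact_mod_cast hn0
  exact integral_floorMap_mem hn0' hn0' hn _

end LatticeCount

end SparseToeplitz
end

noncomputable section
namespace SparseToeplitz

/-! ### Traces of products of Toeplitz matrices as sums over words -/

section Trace

variable {n : ℕ} {τ : ℕ → ℤ}

lemma isWalk_snoc {p : ℕ} (x : Fin p → ℤ) (y i : ℤ) :
    IsWalk n τ (Fin.snoc x y : Fin (p + 1) → ℤ) i ↔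
      IsWalk n τ x i ∧ i + ∑ k : Fin p, τ k * x k + τ p * y ∈ Set.Ico (0 : ℤ) n := by
  unfold IsWalk
  rw [Fin.forall_fin_succ']
  refine and_congr (forall_congr' fun j => ?_) ?_
  · rw [Finset.sum_filter, Fin.sum_univ_castSucc, Finset.sum_filter]
    simp
  · rw [Finset.sum_filter, Fin.sum_univ_castSucc]
    simp [Fin.le_last, add_assoc]

lemma IsWalk.add_sum_mem {p : ℕ} {x : Fin p → ℤ} {i : ℤ} (h : IsWalk n τ x i)
    (hi : i ∈ Set.Ico (0 : ℤ) n) : i + ∑ k : Fin p, τ k * x k ∈ Set.Ico (0 : ℤ) n := by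
  rcases p with - | p
  · simpa using hi
  · have := h (Fin.last p)
    rwa [Finset.filter_true_of_mem fun k _ => Fin.le_last k] at this

/-- The matrices with entries `g (τ (j - i))`, where `g = a` on `S` and `g = 0` elsewhere. -/
def stepMatrix (n : ℕ) (S : Finset ℤ) (a : ℤ → ℂ) (t : ℤ) : Matrix (Fin n) (Fin n) ℂ :=
  Matrix.of fun i j => if t * ((j : ℤ) - i) ∈ S then a (t * ((j : ℤ) - i)) else 0

/-- The product of the step matrices with signs `τ 0, …, τ (p - 1)`. -/
def stepProd (n : ℕ) (S : Finset ℤ) (a : ℤ → ℂ) (τ : ℕ → ℤ) : ℕ → Matrix (Fin n) (Fin n) ℂ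
  | 0 => 1
  | p + 1 => stepProd n S a τ p * stepMatrix n S a (τ p)

lemma sum_piFinset_snoc {M : Type*} [AddCommMonoid M] {p : ℕ} (S : Finset ℤ)
    (f : (Fin (p + 1) → ℤ) → M) :
    ∑ x ∈ Fintype.piFinset (fun _ : Fin (p + 1) => S), f x =
      ∑ x ∈ Fintype.piFinset (fun _ : Fin p => S), ∑ y ∈ S, f (Fin.snoc x y : Fin (p + 1) → ℤ) := by
  rw [← Finset.sum_product']
  symm
  refine Finset.sum_nbij' (fun z => (Fin.snoc z.1 z.2 : Fin (p + 1) → ℤ))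
    (fun x => (Fin.init x, x (Fin.last p))) ?_ ?_ ?_ ?_ ?_
  · intro z hz
    rw [Finset.mem_product, Fintype.mem_piFinset] at hz
    rw [Fintype.mem_piFinset, Fin.forall_fin_succ']
    simpa using hz
  · intro x hx
    rw [Fintype.mem_piFinset, Fin.forall_fin_succ'] at hx
    rw [Finset.mem_product, Fintype.mem_piFinset]
    exact hx
  · intro z _
    simp
  · intro x _
    simp
  · intro z _
    rfl

open Classical in
-- Expanding the matrix product gives a sum over walks from `i` to `j` inside `{0, …, n - 1}`; the
-- intermediate points are encoded by the steps.
lemma stepProd_apply (hτ : ∀ k, τ k = 1 ∨ τ k = -1) (S : Finset ℤ) (a : ℤ → ℂ) (p : ℕ)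
    (i j : Fin n) : stepProd n S a τ p i j = ∑ x ∈ Fintype.piFinset (fun _ : Fin p => S),
      if IsWalk n τ x i ∧ (i : ℤ) + ∑ k : Fin p, τ k * x k = j then ∏ k, a (x k) else 0 := by
  induction p generalizing j with
  | zero =>
    rw [stepProd, Matrix.one_apply]
    simp [IsWalk, Fin.ext_iff]
  | succ p ih =>
    rw [stepProd, Matrix.mul_apply, sum_piFinset_snoc]
    simp_rw [ih, Finset.sum_mul]
    rw [Finset.sum_comm]
    refine Finset.sum_congr rfl fun x _ => ?_
    by_cases hx : IsWalk n τ x i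
    · have hi : (i : ℤ) ∈ Set.Ico (0 : ℤ) n := ⟨by positivity, by exact_mod_cast i.2⟩
      have hm := hx.add_sum_mem hi
      obtain ⟨l, hl⟩ : ∃ l : Fin n, (l : ℤ) = (i : ℤ) + ∑ k : Fin p, τ k * x k := by
        refine ⟨⟨((i : ℤ) + ∑ k : Fin p, τ k * x k).toNat, ?_⟩, ?_⟩
        · have := hm.2; have := hm.1; omega
        · exact Int.toNat_of_nonneg hm.1
      rw [Finset.sum_eq_single l]
      · rw [if_pos ⟨hx, hl.symm⟩, stepMatrix, Matrix.of_apply]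
        -- As `τ p` is its own inverse, the last letter is forced by the end point `j` and the last
        -- but one position `l`.
        have h1 : ∀ y, (IsWalk n τ (Fin.snoc x y : Fin (p + 1) → ℤ) i ∧
            (i : ℤ) + ∑ k : Fin (p + 1), τ k * (Fin.snoc x y : Fin (p + 1) → ℤ) k = j) ↔
            τ p * ((j : ℤ) - l) = y := by
          intro y
          rw [isWalk_snoc, Fin.sum_univ_castSucc]
          simp only [Fin.snoc_castSucc, Fin.snoc_last, Fin.val_castSucc, Fin.val_last, ← add_assoc,
            ← hl]
          have hj : (j : ℤ) ∈ Set.Ico (0 : ℤ) n := ⟨by positivity, by exact_mod_cast j.2⟩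
          have h2 : (l : ℤ) + τ p * y = j ↔ τ p * ((j : ℤ) - l) = y := by
            rcases hτ p with h | h <;> rw [h] <;> constructor <;> intro h <;> linarith
          rw [← h2]
          constructor
          · exact fun h => h.2
          · intro h
            exact ⟨⟨hx, h ▸ hj⟩, h⟩
        simp_rw [h1, Fin.prod_univ_castSucc, Fin.snoc_castSucc, Fin.snoc_last]
        rw [Finset.sum_ite_eq]
        split_ifs <;> simp
      · intro l' _ hne
        rw [if_neg, zero_mul]
        rintro ⟨-, h⟩
        exact hne (Fin.ext (by exact_mod_cast (hl.trans h).symm))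
      · simp
    · rw [Finset.sum_eq_zero, Finset.sum_eq_zero]
      · intro y _
        rw [if_neg]
        rw [isWalk_snoc]
        exact fun h => hx h.1.1
      · intro l _
        rw [if_neg fun h => hx h.1, zero_mul]

theorem trace_stepProd (hτ : ∀ k, τ k = 1 ∨ τ k = -1) (S : Finset ℤ) (a : ℤ → ℂ) (p : ℕ) :
    (stepProd n S a τ p).trace =
      ∑ x ∈ closedWords τ S p, (startCount n τ x : ℂ) * ∏ k, a (x k) := by
  classical
  unfold Matrix.trace closedWords
  simp_rw [Matrix.diag_apply, stepProd_apply hτ]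
  rw [Finset.sum_comm, Finset.sum_filter]
  refine Finset.sum_congr rfl fun x _ => ?_
  simp_rw [add_eq_left]
  split_ifs with h
  · simp_rw [and_iff_left h]
    rw [← Finset.sum_filter, Finset.sum_const, nsmul_eq_mul]
    congr 2
    unfold startCount
    refine Finset.card_bij (fun i _ => (i : ℤ)) (fun i hi => ?_) (fun i _ j _ h => ?_) fun i hi => ?_
    · rw [Finset.mem_filter, Finset.mem_Ico]
      exact ⟨⟨by positivity, by exact_mod_cast i.2⟩, (Finset.mem_filter.1 hi).2⟩
    · exact Fin.ext (by exact_mod_cast h)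
    · rw [Finset.mem_filter, Finset.mem_Ico] at hi
      obtain ⟨⟨h0, h1⟩, h2⟩ := hi
      lift i to ℕ using h0
      exact ⟨⟨i, by exact_mod_cast h1⟩, Finset.mem_filter.2 ⟨Finset.mem_univ _, h2⟩, rfl⟩
  · exact Finset.sum_eq_zero fun i _ => if_neg fun h' => h h'.2

lemma stepProd_one (S : Finset ℤ) (a : ℤ → ℂ) (p : ℕ) :
    stepProd n S a (fun _ => 1) p = stepMatrix n S a 1 ^ p := by
  induction p with
  | zero => rw [stepProd, pow_zero]
  | succ p ih => rw [stepProd, ih, pow_succ]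

lemma stepProd_alternating (S : Finset ℤ) (a : ℤ → ℂ) (p : ℕ) :
    stepProd n S a (fun k => (-1) ^ k) (2 * p) =
      (stepMatrix n S a 1 * stepMatrix n S a (-1)) ^ p := by
  induction p with
  | zero => rw [mul_zero, stepProd, pow_zero]
  | succ p ih =>
    rw [mul_add, mul_one, stepProd, stepProd, ih, pow_succ, Matrix.mul_assoc]
    congr 3 <;> simp

/-- The condition on `F` allows `0` to be dropped from the index set when `a 0 = 0`. The Toeplitz
models need this, as their words must not contain the letter `0`. -/
lemma toeplitz_eq_stepMatrix {S : Set ℤ} {F : Finset ℤ} {a : ℤ → ℂ}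
    (h : ∀ k, k ∈ F ↔ k ∈ S ∧ (k = 0 → a 0 ≠ 0 ∨ 0 ∈ F)) :
    toeplitz n S a = stepMatrix n F a (-1) := by
  classical
  ext i j
  have h1 : -1 * ((j : ℤ) - i) = i - j := by ring
  rw [toeplitz, stepMatrix, Matrix.of_apply, Matrix.of_apply, h1]
  by_cases hF : (i : ℤ) - j ∈ F
  · rw [if_pos hF, if_pos ((h _).1 hF).1]
  · rw [if_neg hF]
    split_ifs with hS
    · by_contra hne
      refine hF ((h _).2 ⟨hS, fun h0 => Or.inl ?_⟩)
      rwa [← h0]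
    · rfl

lemma stepMatrix_neg_transpose (S : Finset ℤ) (a : ℤ → ℂ) (t : ℤ) :
    (stepMatrix n S a t).transpose = stepMatrix n S a (-t) := by
  ext i j
  have : -t * ((j : ℤ) - i) = t * (i - j) := by ring
  rw [Matrix.transpose_apply, stepMatrix, stepMatrix, Matrix.of_apply, Matrix.of_apply, this]

/-- The trace of the product of `p` scaled step matrices. -/
def walkSum {Ω : Type*} (a : ℤ → Ω → ℂ) (β : ℝ) (n : ℕ) (τ : ℕ → ℤ) (S : Finset ℤ) (p : ℕ) (ω : Ω) :
    ℂ := ((√β)⁻¹ ^ p : ℝ) * ∑ x ∈ closedWords τ S p, (startCount n τ x : ℂ) * wordProd a x ω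

/-- The entries depend on `i - j`, whereas steps are `j - i`; transposition exchanges the two and
preserves the trace. -/
lemma trace_smul_toeplitz_pow {Ω : Type*} {a : ℤ → Ω → ℂ} {S : Set ℤ} {F : Finset ℤ} {ω : Ω}
    (h : ∀ k, k ∈ F ↔ k ∈ S ∧ (k = 0 → a 0 ω ≠ 0 ∨ 0 ∈ F)) (β : ℝ) (p : ℕ) :
    (((√β)⁻¹ • toeplitz n S fun k => a k ω) ^ p).trace = walkSum a β n (fun _ => 1) F p ω := by
  rw [smul_pow, Matrix.trace_smul, toeplitz_eq_stepMatrix (a := fun k => a k ω) h,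
    ← Matrix.trace_transpose, Matrix.transpose_pow, stepMatrix_neg_transpose, neg_neg,
    ← stepProd_one, trace_stepProd fun _ => Or.inl rfl]
  simp [walkSum, wordProd]

lemma map_ofReal_pow (M : Matrix (Fin n) (Fin n) ℝ) (p : ℕ) :
    (M ^ p).map ((↑) : ℝ → ℂ) = M.map ((↑) : ℝ → ℂ) ^ p :=
  map_pow (Complex.ofRealHom.mapMatrix (m := Fin n)) M p

lemma ofReal_realTrace (M : Matrix (Fin n) (Fin n) ℝ) :
    (realTrace M : ℂ) = (M.map ((↑) : ℝ → ℂ)).trace := by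
  simp [realTrace, Matrix.trace]

lemma map_ofReal_toeplitz (c : ℝ) (S : Set ℤ) (a : ℤ → ℝ) :
    (c • toeplitz n S a).map ((↑) : ℝ → ℂ) = c • toeplitz n S fun k => (a k : ℂ) := by
  ext i j
  simp only [toeplitz, Matrix.map_apply, Matrix.smul_apply, Matrix.of_apply, smul_eq_mul]
  split_ifs <;> simp

lemma ofReal_realTrace_of_isHermitian {M : Matrix (Fin n) (Fin n) ℂ} (hM : M.IsHermitian) :
    (realTrace M : ℂ) = M.trace := by
  have h : (starRingEnd ℂ) M.trace = M.trace := by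
    rw [starRingEnd_apply, ← Matrix.trace_conjTranspose, hM.eq]
  exact Complex.conj_eq_iff_re.1 h

lemma backwardIdentity_mul (M : Matrix (Fin n) (Fin n) ℝ) (i j : Fin n) :
    (backwardIdentity n * M) i j = M i.rev j := by
  rw [Matrix.mul_apply, Finset.sum_eq_single i.rev]
  · rw [backwardIdentity, Matrix.of_apply, if_pos, one_mul]
    rw [Fin.val_rev]; omega
  · intro k _ hk
    rw [backwardIdentity, Matrix.of_apply, if_neg, zero_mul]
    intro h
    refine hk (Fin.ext ?_)
    rw [Fin.val_rev]; omega
  · simp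

lemma mul_backwardIdentity (M : Matrix (Fin n) (Fin n) ℝ) (i j : Fin n) :
    (M * backwardIdentity n) i j = M i j.rev := by
  rw [Matrix.mul_apply, Finset.sum_eq_single j.rev]
  · rw [backwardIdentity, Matrix.of_apply, if_pos, mul_one]
    rw [Fin.val_rev]; omega
  · intro k _ hk
    rw [backwardIdentity, Matrix.of_apply, if_neg, mul_zero]
    intro h
    refine hk (Fin.ext ?_)
    rw [Fin.val_rev]; omega
  · simp

/-- Reversing both indices transposes a Toeplitz matrix, so `P T P = Tᵀ`. Even powers of the Hankel
matrix therefore become alternating products of `Tᵀ` and `T`. -/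
lemma sq_backwardIdentity_mul_toeplitz (S : Set ℤ) (a : ℤ → ℝ) :
    (backwardIdentity n * toeplitz n S a) ^ 2 = (toeplitz n S a).transpose * toeplitz n S a := by
  rw [sq, ← Matrix.mul_assoc]
  congr 1
  ext i j
  have h : ((i.rev : Fin n) : ℤ) - (j.rev : Fin n) = (j : ℤ) - i := by
    rw [Fin.val_rev, Fin.val_rev]; omega
  rw [mul_backwardIdentity, backwardIdentity_mul, Matrix.transpose_apply, toeplitz, Matrix.of_apply,
    Matrix.of_apply, h]

lemma ofReal_realTrace_hankel_pow {Ω : Type*} {a : ℤ → Ω → ℝ} {S : Set ℤ} {F : Finset ℤ} {ω : Ω}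
    (h : ∀ k, k ∈ F ↔ k ∈ S) (β : ℝ) (p : ℕ) :
    (realTrace (((√β)⁻¹ • (backwardIdentity n * toeplitz n S fun k => a k ω)) ^ (2 * p)) : ℂ) =
      walkSum (fun k ω => (a k ω : ℂ)) β n (fun k => (-1) ^ k) F (2 * p) ω := by
  have hT : (toeplitz n S fun k => a k ω).map ((↑) : ℝ → ℂ) =
      stepMatrix n F (fun k => (a k ω : ℂ)) (-1) := by
    have := map_ofReal_toeplitz (n := n) 1 S fun k => a k ω
    rw [one_smul, one_smul] at this
    rw [this]
    refine toeplitz_eq_stepMatrix fun k => ?_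
    rw [h, h]
    constructor
    · exact fun hk => ⟨hk, fun h0 => Or.inr (h0 ▸ hk)⟩
    · exact fun hk => hk.1
  have hmul : ∀ M N : Matrix (Fin n) (Fin n) ℝ, (M * N).map ((↑) : ℝ → ℂ) =
      M.map ((↑) : ℝ → ℂ) * N.map ((↑) : ℝ → ℂ) := fun M N =>
    map_mul (Complex.ofRealHom.mapMatrix (m := Fin n)) M N
  rw [smul_pow, pow_mul (backwardIdentity n * _), sq_backwardIdentity_mul_toeplitz,
    ofReal_realTrace, Matrix.map_smul' _ _ _ (by simp), map_ofReal_pow, hmul, Matrix.transpose_map,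
    hT, stepMatrix_neg_transpose, neg_neg, Matrix.trace_smul, ← stepProd_alternating,
    trace_stepProd fun k => neg_one_pow_eq_or ℤ k]
  simp [walkSum, wordProd]

lemma realTrace_sum_smul {𝕜 : Type*} [RCLike 𝕜] (s : Finset ℕ) (c : ℕ → ℝ)
    (M : ℕ → Matrix (Fin n) (Fin n) 𝕜) :
    realTrace (∑ j ∈ s, c j • M j) = ∑ j ∈ s, c j * realTrace (M j) := by
  unfold realTrace
  rw [Matrix.trace_sum, map_sum]
  refine Finset.sum_congr rfl fun j _ => ?_
  rw [Matrix.trace_smul, RCLike.smul_re]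

lemma realTrace_aeval {𝕜 : Type*} [RCLike 𝕜] (A : Matrix (Fin n) (Fin n) 𝕜) (Q : Polynomial ℝ) :
    realTrace (Polynomial.aeval A Q) =
      ∑ j ∈ Finset.range (Q.natDegree + 1), Q.coeff j * realTrace (A ^ j) := by
  rw [Polynomial.aeval_eq_sum_range, realTrace_sum_smul]

end Trace

lemma IsEntryFamily.integral_walkSum {Ω : Type*} [MeasurableSpace Ω] {μ : Measure Ω}
    [IsProbabilityMeasure μ] {a : ℤ → Ω → ℂ} {cl : ℤ → ℤ} (ha : IsEntryFamily μ a cl) (β : ℝ) (n : ℕ)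
    (τ : ℕ → ℤ) (S : Finset ℤ) (p : ℕ) : ∫ ω, walkSum a β n τ S p ω ∂μ = ((√β)⁻¹ ^ p : ℝ) *
      ∑ x ∈ closedWords τ S p, (startCount n τ x : ℂ) * ∫ ω, wordProd a x ω ∂μ := by
  obtain ⟨B, hB⟩ := ha.exists_momentBound_wordProd p
  unfold walkSum
  rw [integral_const_mul, integral_finsetSum _ fun x _ =>
    (hB x (by simp)).integrable.const_mul _]
  simp_rw [integral_const_mul]

/-- Centring removes the constant `c`, which absorbs the constant term of a polynomial. -/
lemma IsEntryFamily.ofReal_fluctuation {Ω : Type*} [MeasurableSpace Ω] {μ : Measure Ω}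
    [IsProbabilityMeasure μ] {a : ℤ → Ω → ℂ} {cl : ℤ → ℤ} (ha : IsEntryFamily μ a cl) {β : ℝ} {n : ℕ}
    {τ : ℕ → ℤ} {S : Finset ℤ} (I : Finset ℕ) (q : ℕ → ℝ) (c : ℝ) (X : Ω → ℝ)
    (hX : ∀ ω, (X ω : ℂ) = c + ∑ p ∈ I, (q p : ℂ) * walkSum a β n τ S p ω) (ω : Ω) :
    (fluctuation μ β n X ω : ℂ) = ∑ p ∈ I, (q p : ℂ) * traceFluctuation μ a β n τ S p ω := by
  have hint : ∀ (p : ℕ) (x : Fin p → ℤ), Integrable (wordProd a x) μ := fun p x => by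
    obtain ⟨B, hB⟩ := ha.exists_momentBound_wordProd p
    exact (hB x (by simp)).integrable
  have hsum : ∀ p, Integrable (walkSum a β n τ S p) μ := fun p =>
    (integrable_finsetSum _ fun x _ => (hint p x).const_mul _).const_mul _
  have h1 : (∫ ω, X ω ∂μ : ℂ) = c + ∑ p ∈ I, (q p : ℂ) * ∫ ω, walkSum a β n τ S p ω ∂μ := by
    simp_rw [hX]
    rw [integral_add (integrable_const _) (integrable_finsetSum _ fun p _ => (hsum p).const_mul _),
      integral_finsetSum _ fun p _ => (hsum p).const_mul _]
    simp [integral_const_mul]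
  unfold fluctuation
  have h0 : ((∫ ω, X ω ∂μ : ℝ) : ℂ) = ∫ ω, (X ω : ℂ) ∂μ := integral_ofReal.symm
  rw [Complex.ofReal_mul, Complex.ofReal_sub, h0, h1, hX, add_sub_add_left_eq_sub, ← Finset.sum_sub_distrib, Finset.mul_sum]
  refine Finset.sum_congr rfl fun p _ => ?_
  rw [ha.integral_walkSum, walkSum, ← mul_sub, ← mul_sub, ← Finset.sum_sub_distrib, traceFluctuation, wordSum]
  simp_rw [← mul_sub, Finset.mul_sum, centredProd, wordWeight]
  refine Finset.sum_congr rfl fun x _ => ?_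
  push_cast
  ring

end SparseToeplitz
end

noncomputable section
namespace SparseToeplitz

/-! ### Lattice points under balance equations -/

section Config

open Classical

variable {ι γ γ' : Type*} [Fintype ι] [Fintype γ] [Fintype γ']

/-- The points `(i, j, z)` with `z ∈ S ^ ι` which satisfy the balance equations `f z = 0` and
`g z = 0`, and for which the two walks stay in `{0, …, n - 1}`. -/
def configSet (n : ℕ) (S : Finset ℤ) (f g : ι → ℤ) (lam : γ → ι → ℤ) (lam' : γ' → ι → ℤ) :
    Finset (ℤ × ℤ × (ι → ℤ)) :=
  ((Finset.Ico (0 : ℤ) n) ×ˢ (Finset.Ico (0 : ℤ) n) ×ˢ Fintype.piFinset fun _ => S).filter fun t =>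
    (linForm f t.2.2 = 0 ∧ linForm g t.2.2 = 0) ∧
      (∀ c, t.1 + linForm (lam c) t.2.2 ∈ Set.Ico (0 : ℤ) n) ∧
      ∀ c, t.2.1 + linForm (lam' c) t.2.2 ∈ Set.Ico (0 : ℤ) n

lemma mem_configSet {n : ℕ} {S : Finset ℤ} {f g : ι → ℤ} {lam : γ → ι → ℤ} {lam' : γ' → ι → ℤ}
    {t : ℤ × ℤ × (ι → ℤ)} : t ∈ configSet n S f g lam lam' ↔
      (t.1 ∈ Finset.Ico (0 : ℤ) n ∧ t.2.1 ∈ Finset.Ico (0 : ℤ) n ∧ ∀ i, t.2.2 i ∈ S) ∧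
      (linForm f t.2.2 = 0 ∧ linForm g t.2.2 = 0) ∧
      (∀ c, t.1 + linForm (lam c) t.2.2 ∈ Set.Ico (0 : ℤ) n) ∧
      ∀ c, t.2.1 + linForm (lam' c) t.2.2 ∈ Set.Ico (0 : ℤ) n := by
  simp only [configSet, Finset.mem_filter, Finset.mem_product, Fintype.mem_piFinset]

/-- The coordinate forms. -/
def coordForm (i : ι) : ι → ℤ := Pi.single i 1

variable {β : ℕ → ℝ} {b : ℝ} {S : ℕ → Finset ℤ} {B : Set ℝ} {C₀ : ℝ}

lemma coordForm_ne_zero (i : ι) : coordForm i ≠ 0 := by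
  intro h
  have := congrFun h i
  simp [coordForm] at this

/-- Without balance equations all block unknowns are free, and the coordinate forms alone express
that they belong to `S n`. -/
theorem tendsto_card_configSet_zero (hβ : Tendsto β atTop atTop)
    (hβb : Tendsto (fun n : ℕ => β n / n) atTop (𝓝 b)) (hS : Approximates β S B)
    (hC₀ : ∀ᶠ n in atTop, ∀ k ∈ S n, |(k : ℝ)| ≤ C₀ * β n)
    (lam : γ → ι → ℤ) (lam' : γ' → ι → ℤ) :
    Tendsto (fun n : ℕ => ((configSet n (S n) (0 : ι → ℤ) 0 lam lam').card : ℝ) *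
      ((n : ℝ)⁻¹ * ((n : ℝ)⁻¹ * (β n)⁻¹ ^ Fintype.card ι))) atTop
      (𝓝 (∫ u in Set.Icc (0 : ℝ) 1, ∫ v in Set.Icc (0 : ℝ) 1, ∫ y : ι → ℝ,
        (limitRegion B b coordForm lam lam' u v).indicator (fun _ => (1 : ℝ)) y)) := by
  have h := tendsto_card_latticeSet hβ hβb hS hC₀ (coordForm (ι := ι)) lam lam' coordForm_ne_zero
    fun i => ⟨i, rfl⟩
  refine h.congr fun n => ?_
  congr 3
  ext t
  rw [mem_configSet, latticeSet, Finset.mem_filter]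
  simp only [Finset.mem_product, Fintype.mem_piFinset, coordForm, linForm_single_left]
  simp [linForm]
  tauto

/-- The point of `R ^ ι` whose coordinate at `w` is the value of `ℓ` at the other coordinates. -/
def extendBy {R : Type*} [CommRing R] (w : ι) (ℓ : {v // v ≠ w} → ℤ) (z : {v // v ≠ w} → R) (v : ι) :
    R := if hv : v = w then linForm ℓ z else z ⟨v, hv⟩

lemma extendBy_self {R : Type*} [CommRing R] (w : ι) (ℓ : {v // v ≠ w} → ℤ) (z : {v // v ≠ w} → R) :
    extendBy w ℓ z w = linForm ℓ z := dif_pos rfl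

lemma extendBy_of_ne {R : Type*} [CommRing R] (w : ι) (ℓ : {v // v ≠ w} → ℤ) (z : {v // v ≠ w} → R)
    {v : ι} (hv : v ≠ w) : extendBy w ℓ z v = z ⟨v, hv⟩ := dif_neg hv

/-- The pull-back of a form along `extendBy`. -/
def restrictForm (w : ι) (ℓ : {v // v ≠ w} → ℤ) (lam : ι → ℤ) (u : {v // v ≠ w}) : ℤ :=
  lam u + lam w * ℓ u

lemma sum_eq_add_sum_ne {M : Type*} [AddCommMonoid M] (w : ι) (F : ι → M) :
    ∑ v, F v = F w + ∑ u : {v // v ≠ w}, F u := by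
  rw [← Finset.sum_subtype (Finset.univ.erase w) (by simp) F, Finset.add_sum_erase _ _ (Finset.mem_univ w)]

lemma linForm_extendBy {R : Type*} [CommRing R] (w : ι) (ℓ : {v // v ≠ w} → ℤ) (lam : ι → ℤ)
    (z : {v // v ≠ w} → R) : linForm lam (extendBy w ℓ z) = linForm (restrictForm w ℓ lam) z := by
  unfold linForm
  rw [sum_eq_add_sum_ne w, extendBy_self, linForm, Finset.mul_sum, ← Finset.sum_add_distrib]
  refine Finset.sum_congr rfl fun u _ => ?_
  rw [extendBy_of_ne w ℓ z u.2, restrictForm]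
  push_cast
  ring

/-- The form which solves `f z = 0` for the coordinate `w`, when `f w = ± 1`. -/
def solveForm (f : ι → ℤ) (w : ι) (u : {v // v ≠ w}) : ℤ := -(f w) * f u

lemma linForm_eq_zero_iff {f : ι → ℤ} {w : ι} (hw : f w = 1 ∨ f w = -1) (z : ι → ℤ) :
    linForm f z = 0 ↔ z w = linForm (solveForm f w) fun u => z u := by
  have h1 : linForm (solveForm f w) (fun u : {v // v ≠ w} => z u) =
      -(f w) * ∑ u : {v // v ≠ w}, f u * z u := by
    simp only [linForm, solveForm, Finset.mul_sum, Int.cast_id, mul_assoc]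
  rw [h1, linForm, sum_eq_add_sum_ne w]
  simp only [Int.cast_id]
  rcases hw with h | h <;> rw [h] <;> constructor <;> intro h <;> linarith

/-- The equation `f z = 0` is solved for one coordinate. Its coefficient is `±1`, so integer points
correspond to integer points and the Jacobian in `diracIntegral` is `1`; the equation `g z = 0`
comes for free. A second nonzero coefficient makes the eliminated coordinate a nonzero form of the
remaining ones, so that its boundary values are again avoided almost everywhere. -/
theorem tendsto_card_configSet (hβ : Tendsto β atTop atTop)
    (hβb : Tendsto (fun n : ℕ => β n / n) atTop (𝓝 b)) (hS : Approximates β S B)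
    (hC₀ : ∀ᶠ n in atTop, ∀ k ∈ S n, |(k : ℝ)| ≤ C₀ * β n)
    (lam : γ → ι → ℤ) (lam' : γ' → ι → ℤ) (f g : ι → ℤ) (c : ι → ℝ) (hc : ∀ v, c v = f v)
    (hf : ∀ v, f v = 0 ∨ f v = 1 ∨ f v = -1) (h2 : ∃ v w, v ≠ w ∧ f v ≠ 0 ∧ f w ≠ 0)
    (hg : ∀ z : ι → ℤ, linForm f z = 0 → linForm g z = 0) :
    Tendsto (fun n : ℕ => ((configSet n (S n) f g lam lam').card : ℝ) *
      ((n : ℝ)⁻¹ * ((n : ℝ)⁻¹ * (β n)⁻¹ ^ (Fintype.card ι - 1)))) atTop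
      (𝓝 (∫ u in Set.Icc (0 : ℝ) 1, ∫ v in Set.Icc (0 : ℝ) 1, diracIntegral c
        ((limitRegion B b coordForm lam lam' u v).indicator (fun _ => (1 : ℝ))))) := by
  obtain rfl : c = fun v => (f v : ℝ) := funext hc
  have hex : ∃ w, (f w : ℝ) ≠ 0 := by
    obtain ⟨v, w, -, hv, -⟩ := h2
    exact ⟨v, by exact_mod_cast hv⟩
  -- The eliminated coordinate has to be the one which `diracIntegral` chooses.
  set w := hex.choose with hw
  have hcw : (f w : ℝ) ≠ 0 := hex.choose_spec
  have hfw : f w = 1 ∨ f w = -1 := by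
    rcases hf w with h | h
    · rw [h] at hcw; simp at hcw
    · exact h
  set ℓ := solveForm f w with hℓ
  -- All original coordinates as forms in the remaining ones: the form at `w` imposes that the
  -- eliminated unknown belongs to `S n`, the others are coordinate forms.
  let L : ι → {v // v ≠ w} → ℤ := fun v => restrictForm w ℓ (coordForm v)
  have hLv : ∀ {R : Type} [CommRing R] (v : ι) (z : {v // v ≠ w} → R),
      linForm (L v) z = extendBy w ℓ z v := by
    intro R _ v z
    rw [← linForm_extendBy, coordForm, linForm_single_left]
  have hL0 : ∀ v, L v ≠ 0 := by
    intro v hv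
    by_cases h : v = w
    · obtain ⟨u, hu, hfu⟩ : ∃ u, u ≠ w ∧ f u ≠ 0 := by
        obtain ⟨v₁, v₂, hne, h1, h2⟩ := h2
        by_cases h3 : v₁ = w
        · exact ⟨v₂, fun h4 => hne (h3.trans h4.symm), h2⟩
        · exact ⟨v₁, h3, h1⟩
      have := congrFun hv ⟨u, hu⟩
      simp only [L, restrictForm, coordForm, h, Pi.single_eq_same, Pi.single_eq_of_ne hu, hℓ,
        solveForm, Pi.zero_apply] at this
      rcases hfw with h | h <;> rw [h] at this <;> simp at this <;> exact hfu this
    · have := congrFun hv ⟨v, h⟩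
      simp [L, restrictForm, coordForm, Pi.single_eq_of_ne (Ne.symm h)] at this
  have hLc : ∀ i, ∃ a, L a = Pi.single i 1 := by
    intro i
    refine ⟨i, ?_⟩
    funext u
    simp only [L, restrictForm, coordForm, Pi.single_eq_of_ne (Ne.symm i.2), zero_mul, add_zero]
    by_cases h : u = i
    · rw [h, Pi.single_eq_same, Pi.single_eq_same]
    · rw [Pi.single_eq_of_ne h, Pi.single_eq_of_ne fun h' => h (Subtype.ext h')]
  have h := tendsto_card_latticeSet hβ hβb hS hC₀ L (fun c => restrictForm w ℓ (lam c))
    (fun c => restrictForm w ℓ (lam' c)) hL0 hLc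
  have hcard : Fintype.card {v // v ≠ w} = Fintype.card ι - 1 := by
    rw [Fintype.card_subtype_compl, Fintype.card_subtype_eq]
  rw [hcard] at h
  have hint : ∀ u v : ℝ, ∫ y : {v // v ≠ w} → ℝ, (limitRegion B b L (fun c => restrictForm w ℓ (lam c))
      (fun c => restrictForm w ℓ (lam' c)) u v).indicator (fun _ => (1 : ℝ)) y =
      diracIntegral (fun v => (f v : ℝ)) ((limitRegion B b coordForm lam lam' u v).indicator (fun _ => (1 : ℝ))) := by
    intro u v
    rw [diracIntegral, dif_pos hex]
    have hone : |(f hex.choose : ℝ)|⁻¹ = 1 := by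
      rw [← hw]
      rcases hfw with h | h <;> rw [h] <;> simp
    rw [hone, one_mul]
    refine congrArg (integral volume) (funext fun z => ?_)
    have hz : (fun v => if hv : v = hex.choose then -(∑ u : {v // v ≠ hex.choose}, (f u.1 : ℝ) * z u) /
        (f hex.choose : ℝ) else z ⟨v, hv⟩) = extendBy w ℓ z := by
      funext v
      unfold extendBy
      split_ifs with hv
      · have h3 : linForm ℓ z = -(f w : ℝ) * ∑ u : {v // v ≠ w}, (f u.1 : ℝ) * z u := by
          simp only [linForm, hℓ, solveForm, Finset.mul_sum]
          push_cast
          simp_rw [mul_assoc]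
        rw [h3]
        have h4 : ∀ s : ℝ, -s / (f w : ℝ) = -(f w : ℝ) * s := by
          intro s
          rcases hfw with h | h <;> rw [h] <;> simp
        exact h4 _
      · rfl
    simp only [hz]
    have hmem : z ∈ limitRegion B b L (fun c => restrictForm w ℓ (lam c))
      (fun c => restrictForm w ℓ (lam' c)) u v ↔ extendBy w ℓ z ∈ limitRegion B b coordForm lam lam' u v := by
      simp only [limitRegion, Set.mem_ofPred_eq, linForm_extendBy, L]
    by_cases hm : extendBy w ℓ z ∈ limitRegion B b coordForm lam lam' u v
    · rw [Set.indicator_of_mem hm, Set.indicator_of_mem (hmem.2 hm)]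
    · rw [Set.indicator_of_notMem hm, Set.indicator_of_notMem fun h' => hm (hmem.1 h')]
  simp_rw [hint] at h
  refine h.congr fun n => ?_
  congr 2
  refine Finset.card_nbij' (fun t => (t.1, t.2.1, extendBy w ℓ t.2.2))
    (fun t => (t.1, t.2.1, fun u => t.2.2 u)) ?_ ?_ ?_ ?_
  · rintro ⟨i, j, z⟩ ht
    have ht' := Finset.mem_filter.1 ht
    simp only [Finset.mem_product, Fintype.mem_piFinset] at ht'
    obtain ⟨⟨h1, h2, h3⟩, h4, h5, h6⟩ := ht'
    have h7 : linForm f (extendBy w ℓ z) = 0 := by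
      rw [linForm_eq_zero_iff hfw, extendBy_self]
      congr 1
      funext u
      rw [extendBy_of_ne _ _ _ u.2]
    refine mem_configSet.2 ⟨⟨h1, h2, fun v => ?_⟩, ⟨h7, hg _ h7⟩, fun c => ?_, fun c => ?_⟩
    · have := h4 v
      rwa [hLv] at this
    · simp only [linForm_extendBy]; exact h5 c
    · simp only [linForm_extendBy]; exact h6 c
  · rintro ⟨i, j, z⟩ ht
    obtain ⟨⟨h1, h2, h3⟩, ⟨h4, -⟩, h5, h6⟩ := mem_configSet.1 ht
    have hz : extendBy w ℓ (fun u : {v // v ≠ w} => z u) = z := by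
      funext v
      by_cases hv : v = w
      · subst hv
        rw [extendBy_self]
        exact ((linForm_eq_zero_iff hfw z).1 h4).symm
      · rw [extendBy_of_ne _ _ _ hv]
    refine Finset.mem_filter.2 ⟨?_, fun v => ?_, fun c => ?_, fun c => ?_⟩
    · simp only [Finset.mem_product, Fintype.mem_piFinset]
      exact ⟨h1, h2, fun u => h3 u⟩
    · simp only [hLv, hz]; exact h3 v
    · simp only [← linForm_extendBy, hz]; exact h5 c
    · simp only [← linForm_extendBy, hz]; exact h6 c
  · rintro ⟨i, j, z⟩ _
    simp only [Prod.mk.injEq, true_and]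
    funext u
    rw [extendBy_of_ne _ _ _ u.2]
  · rintro ⟨i, j, z⟩ ht
    obtain ⟨-, ⟨h4, -⟩, -⟩ := mem_configSet.1 ht
    simp only [Prod.mk.injEq, true_and]
    funext v
    by_cases hv : v = w
    · subst hv
      rw [extendBy_self]
      exact ((linForm_eq_zero_iff hfw z).1 h4).symm
    · rw [extendBy_of_ne _ _ _ hv]

end Config

end SparseToeplitz
end

noncomputable section
namespace SparseToeplitz

/-! ### Negligible contributions -/

/-- The normalization `n⁻² (√β)⁻ᴺ`. -/
def scale (β : ℝ) (N n : ℕ) : ℝ := (n : ℝ)⁻¹ * ((n : ℝ)⁻¹ * (√β)⁻¹ ^ N)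

lemma scale_nonneg (β : ℝ) (N n : ℕ) : 0 ≤ scale β N n := by
  unfold scale; positivity

lemma scale_two_mul {β : ℝ} (hβ : 0 ≤ β) (k n : ℕ) :
    scale β (2 * k) n = (n : ℝ)⁻¹ * ((n : ℝ)⁻¹ * β⁻¹ ^ k) := by
  unfold scale
  rw [pow_mul, inv_pow, Real.sq_sqrt hβ]

/-- The factor `n²` cancels, `|S|^f` is `O(√β ^ (2 f))`, and `2 f < N` leaves at least one factor `1
/ √β`. -/
lemma tendsto_sq_mul_card_pow_mul_scale {β : ℕ → ℝ} (hβ : Tendsto β atTop atTop) {S : ℕ → Finset ℤ}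
    {C₀ : ℝ} (hS : ∀ᶠ n in atTop, ((S n).card : ℝ) ≤ C₀ * β n) {f N : ℕ} (h : 2 * f + 1 ≤ N) :
    Tendsto (fun n : ℕ => (n : ℝ) ^ 2 * ((S n).card : ℝ) ^ f * scale (β n) N n) atTop (𝓝 0) := by
  have h1 : Tendsto (fun n => C₀ ^ f * (√(β n))⁻¹) atTop (𝓝 0) := by
    simpa using ((tendsto_inv_atTop_zero.comp
      (Real.tendsto_sqrt_atTop.comp hβ)).const_mul (C₀ ^ f))
  refine squeeze_zero' (Eventually.of_forall fun n => mul_nonneg (by positivity) (scale_nonneg _ _ _))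
    ?_ h1
  filter_upwards [hS, hβ.eventually_ge_atTop 1, eventually_gt_atTop 0] with n hn hβn hn0
  have hn' : (0 : ℝ) < n := by exact_mod_cast hn0
  have hs1 : 1 ≤ √(β n) := Real.one_le_sqrt.2 hβn
  have hs0 : 0 < √(β n) := by linarith
  have hC : 0 ≤ C₀ := by
    have : (0 : ℝ) ≤ C₀ * β n := le_trans (by positivity) hn
    exact nonneg_of_mul_nonneg_left this (by linarith)
  have h2 : ((S n).card : ℝ) ^ f ≤ C₀ ^ f * √(β n) ^ (2 * f) := by
    rw [pow_mul, Real.sq_sqrt (by linarith), ← mul_pow]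
    gcongr
  obtain ⟨k, rfl⟩ := Nat.exists_eq_add_of_le h
  calc (n : ℝ) ^ 2 * ((S n).card : ℝ) ^ f * scale (β n) (2 * f + 1 + k) n
      ≤ (n : ℝ) ^ 2 * (C₀ ^ f * √(β n) ^ (2 * f)) * scale (β n) (2 * f + 1 + k) n := by
        gcongr
        exact scale_nonneg _ _ _
    _ = C₀ ^ f * (√(β n))⁻¹ * (√(β n))⁻¹ ^ k := by
        unfold scale
        rw [pow_add, pow_add, pow_one, inv_pow _ (2 * f)]
        field_simp
    _ ≤ C₀ ^ f * (√(β n))⁻¹ * 1 := by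
        gcongr
        exact pow_le_one₀ (by positivity) (inv_le_one_of_one_le₀ hs1)
    _ = _ := mul_one _

section Distinct

open Classical

variable {ι γ γ' : Type*} [Fintype ι] [Fintype γ] [Fintype γ']

/-- The solutions of two balance equations. -/
def solutionSpace (f g : ι → ℤ) : Submodule ℝ (ι → ℝ) where
  carrier := {z | linForm f z = 0 ∧ linForm g z = 0}
  add_mem' {x y} hx hy := by
    simp only [Set.mem_ofPred_eq, linForm, Pi.add_apply, mul_add, Finset.sum_add_distrib] at *
    exact ⟨by rw [hx.1, hy.1, add_zero], by rw [hx.2, hy.2, add_zero]⟩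
  zero_mem' := by simp [linForm]
  smul_mem' c x hx := by
    simp only [Set.mem_ofPred_eq, linForm, Pi.smul_apply, smul_eq_mul, mul_left_comm,
      ← Finset.mul_sum] at *
    exact ⟨by rw [hx.1, mul_zero], by rw [hx.2, mul_zero]⟩

lemma mem_solutionSpace {f g : ι → ℤ} {z : ι → ℝ} :
    z ∈ solutionSpace f g ↔ linForm f z = 0 ∧ linForm g z = 0 := Iff.rfl

lemma cast_linForm (f : ι → ℤ) (z : ι → ℤ) : ((linForm f z : ℤ) : ℝ) = linForm f fun i => (z i : ℝ) := by
  simp [linForm]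

/-- The hyperplane `z v = e * z w`. -/
def tieSpace (v w : ι) (e : ℤ) : Submodule ℝ (ι → ℝ) where
  carrier := {z | z v = e * z w}
  add_mem' {x y} hx hy := by
    simp only [Set.mem_ofPred_eq, Pi.add_apply, mul_add] at *
    rw [hx, hy]
  zero_mem' := by simp
  smul_mem' c x hx := by
    simp only [Set.mem_ofPred_eq, Pi.smul_apply, smul_eq_mul] at *
    rw [hx]; ring

/-- Configurations with distinct classes have the same asymptotics. -/
theorem tendsto_card_injective {sg cl : ℤ → ℤ} (hd : IsSignDecomposition sg cl) {β : ℕ → ℝ}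
    (hβ : Tendsto β atTop atTop) {S : ℕ → Finset ℤ}
    {C₀ : ℝ} (hS : ∀ᶠ n in atTop, ((S n).card : ℝ) ≤ C₀ * β n) {f g : ι → ℤ} {lam : γ → ι → ℤ}
    {lam' : γ' → ι → ℤ} {N : ℕ} (hN : 2 * Module.finrank ℝ (solutionSpace f g) ≤ N)
    (hgen : ∀ v w, v ≠ w → ∀ x y : ℤ, ∃ z ∈ solutionSpace f g, z v ≠ (sg x * sg y : ℤ) * z w) {L : ℝ}
    (hL : Tendsto (fun n : ℕ => ((configSet n (S n) f g lam lam').card : ℝ) * scale (β n) N n) atTop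
      (𝓝 L)) :
    Tendsto (fun n : ℕ => (((configSet n (S n) f g lam lam').filter fun t =>
      Function.Injective fun v => cl (t.2.2 v)).card : ℝ) * scale (β n) N n) atTop (𝓝 L) := by
  -- If two coordinates have the same class, then `z v = ± z w`. By `hgen` this cuts the solution
  -- space properly, so such points are negligible. Only signs of the form `sg x * sg y` can occur;
  -- if `sg = 1`, the sign `-1` need not be excluded.
  let pairs : Finset ((ι × ι) × ℤ) := ((Finset.univ.filter fun vw : ι × ι => vw.1 ≠ vw.2) ×ˢ
    {1, -1}).filter fun t => ∃ x y, t.2 = sg x * sg y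
  let U : (ι × ι) × ℤ → Submodule ℝ (ι → ℝ) := fun t => solutionSpace f g ⊓ tieSpace t.1.1 t.1.2 t.2
  have hU : ∀ t ∈ pairs, 2 * Module.finrank ℝ (U t) + 1 ≤ N := by
    intro t ht
    obtain ⟨ht1, x, y, ht2⟩ := Finset.mem_filter.1 ht
    have hne := (Finset.mem_filter.1 (Finset.mem_product.1 ht1).1).2
    obtain ⟨z, hz, hz'⟩ := hgen _ _ hne x y
    have : U t < solutionSpace f g := by
      refine lt_of_le_of_ne inf_le_left fun h => hz' ?_
      rw [← h] at hz
      have := hz.2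
      rw [← ht2]
      exact this
    have := Submodule.finrank_lt_finrank_of_lt this
    omega
  have hbad : Tendsto (fun n : ℕ => ∑ t ∈ pairs, (n : ℝ) ^ 2 *
      ((S n).card : ℝ) ^ (Module.finrank ℝ (U t)) * scale (β n) N n) atTop (𝓝 0) := by
    rw [← Finset.sum_const_zero (s := pairs)]
    exact tendsto_finsetSum _ fun t ht => tendsto_sq_mul_card_pow_mul_scale hβ hS (hU t ht)
  have hle : ∀ n, (((configSet n (S n) f g lam lam').filter fun t =>
      ¬ Function.Injective fun v => cl (t.2.2 v)).card : ℝ) * scale (β n) N n ≤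
      ∑ t ∈ pairs, (n : ℝ) ^ 2 * ((S n).card : ℝ) ^ (Module.finrank ℝ (U t)) * scale (β n) N n := by
    intro n
    rw [← Finset.sum_mul]
    refine mul_le_mul_of_nonneg_right ?_ (scale_nonneg _ _ _)
    have hsub : ((configSet n (S n) f g lam lam').filter fun t =>
        ¬ Function.Injective fun v => cl (t.2.2 v)) ⊆ pairs.biUnion fun t =>
          (Finset.Ico (0 : ℤ) n) ×ˢ (Finset.Ico (0 : ℤ) n) ×ˢ
          ((Fintype.piFinset fun _ => S n).filter fun z => (fun i => (z i : ℝ)) ∈ U t) := by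
      rintro ⟨i, j, z⟩ ht
      obtain ⟨h1, h2⟩ := Finset.mem_filter.1 ht
      obtain ⟨⟨h3, h4, h5⟩, ⟨h6, h7⟩, -⟩ := mem_configSet.1 h1
      rw [Function.Injective] at h2
      push Not at h2
      obtain ⟨v, w, h8, hne⟩ := h2
      have hz : z v = sg (z v) * sg (z w) * z w := by
        conv_lhs => rw [← hd.eq (z v)]
        simp only at h8
        rw [h8, mul_assoc]
        congr 1
        conv_rhs => rw [← hd.eq (z w), ← mul_assoc, hd.eq]
        rcases hd.sign (z w) with h | h <;> simp [h]
      refine Finset.mem_biUnion.2 ⟨((v, w), sg (z v) * sg (z w)), ?_, ?_⟩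
      · refine Finset.mem_filter.2 ⟨Finset.mem_product.2 ⟨by simpa using hne, ?_⟩, _, _, rfl⟩
        rcases hd.sign (z v) with h | h <;> rcases hd.sign (z w) with h' | h' <;> simp [h, h']
      · refine Finset.mem_product.2 ⟨h3, Finset.mem_product.2 ⟨h4, Finset.mem_filter.2
          ⟨Fintype.mem_piFinset.2 h5, ⟨?_, ?_⟩, ?_⟩⟩⟩
        · rw [← cast_linForm, h6, Int.cast_zero]
        · rw [← cast_linForm, h7, Int.cast_zero]
        · change (z v : ℝ) = ((sg (z v) * sg (z w) : ℤ) : ℝ) * z w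
          exact_mod_cast hz
    have h1 := (Finset.card_le_card hsub).trans Finset.card_biUnion_le
    refine le_trans (Nat.cast_le.2 h1) ?_
    rw [Nat.cast_sum]
    refine Finset.sum_le_sum fun t _ => ?_
    rw [Finset.card_product, Finset.card_product, Int.card_Ico, sub_zero, Int.toNat_natCast]
    have h2 := card_lattice_le (U t) (S n)
    push_cast
    rw [sq, mul_assoc]
    gcongr
    exact_mod_cast h2
  have hzero := squeeze_zero (fun n => mul_nonneg (Nat.cast_nonneg _) (scale_nonneg _ _ _)) hle hbad
  have h := hL.sub hzero
  rw [sub_zero] at h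
  refine h.congr fun n => ?_
  rw [← sub_mul]
  congr 1
  rw [sub_eq_iff_eq_add]
  exact_mod_cast (Finset.card_filter_add_card_filter_not _).symm

end Distinct

end SparseToeplitz
end

noncomputable section
namespace SparseToeplitz

/-! ### Pairs of closed words and leading configurations -/

section Words

open Classical

variable {p q : ℕ} {τ : ℕ → ℤ}

/-- The first `p` letters. -/
def fstWord (w : Fin (p + q) → ℤ) : Fin p → ℤ := fun i => w (Fin.castAdd q i)

/-- The last `q` letters. -/
def sndWord (w : Fin (p + q) → ℤ) : Fin q → ℤ := fun i => w (Fin.natAdd p i)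

/-- The step signs of two consecutive words. -/
def stepSign (τ : ℕ → ℤ) (p : ℕ) {m : ℕ} (i : Fin m) : ℤ := if (i : ℕ) < p then τ i else τ (i - p)

/-- The first `p` positions. -/
def lowSet (p : ℕ) {m : ℕ} : Finset (Fin m) := Finset.univ.filter fun i => (i : ℕ) < p

/-- The positions after the first `p`. -/
def highSet (p : ℕ) {m : ℕ} : Finset (Fin m) := Finset.univ.filter fun i => p ≤ (i : ℕ)

/-- The pairs of closed words over `S`. -/
def doubleWords (τ : ℕ → ℤ) (S : Finset ℤ) (p q : ℕ) : Finset (Fin (p + q) → ℤ) :=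
  (Fintype.piFinset fun _ => S).filter fun w =>
    fstWord w ∈ closedWords τ S p ∧ sndWord w ∈ closedWords τ S q

lemma mem_doubleWords {S : Finset ℤ} {w : Fin (p + q) → ℤ} : w ∈ doubleWords τ S p q ↔
    (∀ i, w i ∈ S) ∧ fstWord w ∈ closedWords τ S p ∧ sndWord w ∈ closedWords τ S q := by
  simp only [doubleWords, Finset.mem_filter, Fintype.mem_piFinset]

lemma sum_doubleWords {M : Type*} [AddCommMonoid M] (S : Finset ℤ)
    (F : (Fin p → ℤ) → (Fin q → ℤ) → M) :
    ∑ x ∈ closedWords τ S p, ∑ y ∈ closedWords τ S q, F x y =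
      ∑ w ∈ doubleWords τ S p q, F (fstWord w) (sndWord w) := by
  rw [← Finset.sum_product']
  refine Finset.sum_nbij' (fun z => (Fin.append z.1 z.2 : Fin (p + q) → ℤ))
    (fun w => (fstWord w, sndWord w)) ?_ ?_ ?_ ?_ ?_
  · intro z hz
    obtain ⟨h1, h2⟩ := Finset.mem_product.1 hz
    have e1 : fstWord (Fin.append z.1 z.2) = z.1 := by funext i; simp [fstWord]
    have e2 : sndWord (Fin.append z.1 z.2) = z.2 := by funext i; simp [sndWord]
    refine mem_doubleWords.2 ⟨fun i => ?_, by rwa [e1], by rwa [e2]⟩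
    have h3 := Fintype.mem_piFinset.1 (Finset.mem_filter.1 h1).1
    have h4 := Fintype.mem_piFinset.1 (Finset.mem_filter.1 h2).1
    refine Fin.addCases (fun i => ?_) (fun i => ?_) i
    · rw [Fin.append_left]; exact h3 i
    · rw [Fin.append_right]; exact h4 i
  · intro w hw
    exact Finset.mem_product.2 (mem_doubleWords.1 hw).2
  · intro z _
    refine Prod.ext ?_ ?_ <;> funext i <;> simp [fstWord, sndWord]
  · intro w _
    funext i
    refine Fin.addCases (fun i => ?_) (fun i => ?_) i
    · rw [Fin.append_left]; rfl
    · rw [Fin.append_right]; rfl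
  · intro z _
    congr 1 <;> funext i <;> simp [fstWord, sndWord]

lemma sum_lowSet {M : Type*} [AddCommMonoid M] (F : Fin (p + q) → M) :
    ∑ i ∈ lowSet p, F i = ∑ i : Fin p, F (Fin.castAdd q i) := by
  rw [lowSet, Finset.sum_filter, Fin.sum_univ_add]
  simp

lemma sum_highSet {M : Type*} [AddCommMonoid M] (F : Fin (p + q) → M) :
    ∑ i ∈ highSet p, F i = ∑ i : Fin q, F (Fin.natAdd p i) := by
  rw [highSet, Finset.sum_filter, Fin.sum_univ_add]
  simp [Nat.not_le.2 (Fin.is_lt _)]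

lemma mem_closedWords_fstWord {S : Finset ℤ} {w : Fin (p + q) → ℤ} (hw : ∀ i, w i ∈ S) :
    fstWord w ∈ closedWords τ S p ↔ ∑ i ∈ lowSet p, stepSign τ p i * w i = 0 := by
  rw [sum_lowSet, closedWords, Finset.mem_filter, Fintype.mem_piFinset]
  simp only [fstWord, hw, implies_true, true_and, stepSign, Fin.val_castAdd, Fin.is_lt, if_true]

lemma mem_closedWords_sndWord {S : Finset ℤ} {w : Fin (p + q) → ℤ} (hw : ∀ i, w i ∈ S) :
    sndWord w ∈ closedWords τ S q ↔ ∑ i ∈ highSet p, stepSign τ p i * w i = 0 := by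
  rw [sum_highSet, closedWords, Finset.mem_filter, Fintype.mem_piFinset]
  simp [sndWord, hw, stepSign]

lemma isWalk_fstWord {n : ℕ} {w : Fin (p + q) → ℤ} {i : ℤ} : IsWalk n τ (fstWord w) i ↔
    ∀ j : {j : Fin (p + q) // (j : ℕ) < p}, i + ∑ k ∈ Finset.univ.filter (fun k => k ≤ j.1),
      stepSign τ p k * w k ∈ Set.Ico (0 : ℤ) n := by
  have h : ∀ j : Fin p, ∑ k ∈ Finset.univ.filter (fun k => k ≤ Fin.castAdd q j),
      stepSign τ p k * w k = ∑ k ∈ Finset.univ.filter (fun k => k ≤ j), τ k * fstWord w k := by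
    intro j
    rw [Finset.sum_filter, Fin.sum_univ_add, Finset.sum_filter]
    have h2 : ∀ k : Fin q, ¬ Fin.natAdd p k ≤ Fin.castAdd q j := by
      intro k hk
      have := Fin.le_def.1 hk
      simp at this
      omega
    simp [fstWord, stepSign, h2]
    simp only [Fin.le_def, Fin.val_castAdd]
  constructor
  · rintro hw ⟨j, hj⟩
    have := hw ⟨j, hj⟩
    rw [← h] at this
    exact this
  · intro hw j
    rw [← h]
    exact hw ⟨Fin.castAdd q j, by simp⟩

lemma isWalk_sndWord {n : ℕ} {w : Fin (p + q) → ℤ} {i : ℤ} : IsWalk n τ (sndWord w) i ↔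
    ∀ j : {j : Fin (p + q) // p ≤ (j : ℕ)}, i +
      ∑ k ∈ Finset.univ.filter (fun k : Fin (p + q) => p ≤ (k : ℕ) ∧ k ≤ j.1),
        stepSign τ p k * w k ∈ Set.Ico (0 : ℤ) n := by
  have h : ∀ j : Fin q, ∑ k ∈ Finset.univ.filter
      (fun k : Fin (p + q) => p ≤ (k : ℕ) ∧ k ≤ Fin.natAdd p j),
      stepSign τ p k * w k = ∑ k ∈ Finset.univ.filter (fun k => k ≤ j), τ k * sndWord w k := by
    intro j
    rw [Finset.sum_filter, Fin.sum_univ_add, Finset.sum_filter]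
    simp [sndWord, stepSign, Nat.not_le.2 (Fin.is_lt _)]
  constructor
  · rintro hw ⟨j, hj⟩
    have := hw ⟨(j : ℕ) - p, by omega⟩
    rw [← h] at this
    have hj' : Fin.natAdd p (⟨(j : ℕ) - p, by omega⟩ : Fin q) = j := Fin.ext (by simp; omega)
    rw [hj'] at this
    exact this
  · intro hw j
    rw [← h]
    exact hw ⟨Fin.natAdd p j, by simp⟩

/-- The form `∑_{i ∈ A} e i * z (block of i)`. -/
def blockForm {P : Type*} [Fintype P] [DecidableEq P] (π : Finpartition (Finset.univ : Finset P))
    (e : P → ℤ) (A : Finset P) (V : {V // V ∈ π.parts}) : ℤ :=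
  ∑ i ∈ A.filter fun i => blockOf π i = V, e i

lemma linForm_blockForm {P : Type*} [Fintype P] [DecidableEq P] {R : Type*} [CommRing R]
    (π : Finpartition (Finset.univ : Finset P)) (e : P → ℤ) (A : Finset P)
    (z : {V // V ∈ π.parts} → R) :
    linForm (blockForm π e A) z = ∑ i ∈ A, (e i : R) * z (blockOf π i) := by
  unfold linForm blockForm
  rw [← Finset.sum_fiberwise A (blockOf π)]
  refine Finset.sum_congr rfl fun V _ => ?_
  push_cast
  rw [Finset.sum_mul]
  refine Finset.sum_congr rfl fun i hi => ?_
  rw [(Finset.mem_filter.1 hi).2]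

lemma kernel_eq_iff {P : Type*} [Fintype P] [DecidableEq P] {cl : ℤ → ℤ} {w : P → ℤ}
    {π : Finpartition (Finset.univ : Finset P)} :
    kernel cl w = π ↔ ∀ i j, cl (w i) = cl (w j) ↔ blockOf π i = blockOf π j := by
  constructor
  · rintro rfl i j
    exact blockOf_kernel_eq_iff.symm
  · intro h
    have h1 : ∀ i, (kernel cl w).part i = π.part i := by
      intro i
      ext j
      rw [mem_part_kernel, h, eq_comm, blockOf_eq_iff]
      rfl
    have h2 : ∀ (σ : Finpartition (Finset.univ : Finset P)) (V : Finset P),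
        V ∈ σ.parts ↔ ∃ i, σ.part i = V := by
      intro σ V
      constructor
      · intro hV
        obtain ⟨i, hi⟩ := σ.nonempty_of_mem_parts hV
        exact ⟨i, (σ.part_eq_iff_mem hV).2 hi⟩
      · rintro ⟨i, rfl⟩
        exact σ.part_mem.2 (Finset.mem_univ i)
    ext V
    rw [h2, h2]
    simp_rw [h1]

/-- The words with kernel `π` for which `E i * w i` is constant on each block. -/
def IsLeading {P : Type*} [Fintype P] [DecidableEq P] (cl : ℤ → ℤ)
    (π : Finpartition (Finset.univ : Finset P)) (E w : P → ℤ) : Prop :=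
  kernel cl w = π ∧ ∀ i j, blockOf π i = blockOf π j → E i * w i = E j * w j

/-- The configurations attached to a partition and effective signs. -/
def blockConfig (n : ℕ) (S : Finset ℤ) (p : ℕ) {m : ℕ} (π : SetPartition m) (e : Fin m → ℤ) :
    Finset (ℤ × ℤ × ({V // V ∈ π.parts} → ℤ)) :=
  configSet n S (blockForm π e (lowSet p)) (blockForm π e (highSet p))
    (fun j : {j : Fin m // (j : ℕ) < p} =>
      blockForm π e (Finset.univ.filter fun k => k ≤ j.1))
    (fun j : {j : Fin m // p ≤ (j : ℕ)} =>
      blockForm π e (Finset.univ.filter fun k => p ≤ (k : ℕ) ∧ k ≤ j.1))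

/-- A leading word is `w i = E i * z (block of i)` for a unique vector `z` of block values with
distinct classes, and the admissible starts of its two walks are the other two components of a
configuration. -/
theorem sum_startCount_leading {n : ℕ} {S : Finset ℤ} {cl : ℤ → ℤ} {π : SetPartition (p + q)}
    {E : Fin (p + q) → ℤ} (hE : ∀ i, E i = 1 ∨ E i = -1) (hES : ∀ i, ∀ x ∈ S, E i * x ∈ S)
    (hEcl : ∀ i x, cl (E i * x) = cl x) :
    ∑ w ∈ (doubleWords τ S p q).filter (IsLeading cl π E),
      startCount n τ (fstWord w) * startCount n τ (sndWord w) =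
    ((blockConfig n S p π fun i => stepSign τ p i * E i).filter fun t =>
      Function.Injective fun V => cl (t.2.2 V)).card := by
  have hEE : ∀ i, E i * E i = 1 := fun i => by rcases hE i with h | h <;> simp [h]
  let toW : ({V // V ∈ π.parts} → ℤ) → Fin (p + q) → ℤ := fun z k => E k * z (blockOf π k)
  let toZ : (Fin (p + q) → ℤ) → {V // V ∈ π.parts} → ℤ := fun w V => E (rep π V) * w (rep π V)
  have hZW : ∀ z, toZ (toW z) = z := by
    intro z
    funext V
    simp only [toZ, toW, ← mul_assoc, hEE, one_mul, blockOf_rep]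
  have hWZ : ∀ w, IsLeading cl π E w → toW (toZ w) = w := by
    intro w hw
    funext k
    simp only [toZ, toW]
    rw [hw.2 (rep π (blockOf π k)) k (blockOf_rep π _), ← mul_assoc, hEE, one_mul]
  have hform : ∀ (A : Finset (Fin (p + q))) z, linForm (blockForm π (fun i => stepSign τ p i * E i) A) z =
      ∑ i ∈ A, stepSign τ p i * toW z i := by
    intro A z
    rw [linForm_blockForm]
    exact Finset.sum_congr rfl fun i _ => by simp only [toW, Int.cast_id, mul_assoc]
  have hiff : ∀ (z : {V // V ∈ π.parts} → ℤ) (i j : ℤ),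
      ((i, j, z) ∈ (blockConfig n S p π fun i => stepSign τ p i * E i).filter fun t =>
      Function.Injective fun V => cl (t.2.2 V)) ↔
      toW z ∈ (doubleWords τ S p q).filter (IsLeading cl π E) ∧
        i ∈ (Finset.Ico (0 : ℤ) n).filter (IsWalk n τ (fstWord (toW z))) ∧
        j ∈ (Finset.Ico (0 : ℤ) n).filter (IsWalk n τ (sndWord (toW z))) := by
    intro z i j
    have hS : (∀ V, z V ∈ S) ↔ ∀ k, toW z k ∈ S := by
      constructor
      · exact fun h k => hES k _ (h _)
      · intro h V
        have h1 := hES (rep π V) _ (h (rep π V))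
        simp only [toW, ← mul_assoc, hEE, one_mul, blockOf_rep] at h1
        exact h1
    have hlead : IsLeading cl π E (toW z) ↔ Function.Injective fun V => cl (z V) := by
      rw [IsLeading, kernel_eq_iff]
      simp only [toW, hEcl]
      constructor
      · rintro ⟨h, -⟩ V W hVW
        have := (h (rep π V) (rep π W)).1 (by rw [blockOf_rep, blockOf_rep]; exact hVW)
        rwa [blockOf_rep, blockOf_rep] at this
      · intro h
        refine ⟨fun i j => ⟨fun h' => h h', fun h' => by rw [h']⟩, fun i j h' => ?_⟩
        rw [← mul_assoc, ← mul_assoc, hEE, hEE, h']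
    rw [Finset.mem_filter, blockConfig, mem_configSet, Finset.mem_filter, Finset.mem_filter,
      Finset.mem_filter, mem_doubleWords, hlead, isWalk_fstWord, isWalk_sndWord]
    simp only [hform, hS]
    constructor
    · rintro ⟨⟨⟨h1, h2, h3⟩, ⟨h4, h5⟩, h6, h7⟩, h8⟩
      exact ⟨⟨⟨h3, (mem_closedWords_fstWord h3).2 h4, (mem_closedWords_sndWord h3).2 h5⟩, h8⟩,
        ⟨h1, h6⟩, h2, h7⟩
    · rintro ⟨⟨⟨h3, h4, h5⟩, h8⟩, ⟨h1, h6⟩, h2, h7⟩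
      exact ⟨⟨⟨h1, h2, h3⟩, ⟨(mem_closedWords_fstWord h3).1 h4, (mem_closedWords_sndWord h3).1 h5⟩,
        h6, h7⟩, h8⟩
  simp only [startCount, ← Finset.card_product]
  rw [← Finset.card_sigma]
  refine Finset.card_nbij' (fun s => (s.2.1, s.2.2, toZ s.1)) (fun t => ⟨toW t.2.2, (t.1, t.2.1)⟩)
    ?_ ?_ ?_ ?_
  · rintro ⟨w, i, j⟩ hs
    obtain ⟨h1, h2⟩ := Finset.mem_sigma.1 hs
    refine Finset.mem_coe.2 ((hiff _ _ _).2 ?_)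
    rw [hWZ _ (Finset.mem_filter.1 h1).2]
    exact ⟨h1, Finset.mem_product.1 h2⟩
  · rintro ⟨i, j, z⟩ ht
    obtain ⟨h1, h2, h3⟩ := (hiff _ _ _).1 ht
    exact Finset.mem_sigma.2 ⟨h1, Finset.mem_product.2 ⟨h2, h3⟩⟩
  · rintro ⟨w, i, j⟩ hs
    obtain ⟨h1, h2⟩ := Finset.mem_sigma.1 hs
    simp only [hWZ _ (Finset.mem_filter.1 h1).2]
  · rintro ⟨i, j, z⟩ _
    simp only [hZW]

end Words

end SparseToeplitz
end

noncomputable section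
namespace SparseToeplitz

/-! ### Limits of weighted sums over pairs of closed words -/

section LeadingSum

open Classical

variable {p q : ℕ} {τ : ℕ → ℤ} {sg cl : ℤ → ℤ}

/-- The dimension of the space of solutions of the balance equations for a pattern. -/
def patternDim (τ : ℕ → ℤ) (p : ℕ) {m : ℕ} (π : SetPartition m) (E : Fin m → ℤ) : ℕ :=
  Module.finrank ℝ (solutionSpace (blockForm π (fun i => stepSign τ p i * E i) (lowSet p))
    (blockForm π (fun i => stepSign τ p i * E i) (highSet p)))

/-- The number of walks along a pair of words. -/
def pairCount (n : ℕ) (τ : ℕ → ℤ) (w : Fin (p + q) → ℤ) : ℕ :=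
  startCount n τ (fstWord w) * startCount n τ (sndWord w)

lemma card_doubleWords_pattern_le (hd : IsSignDecomposition sg cl) (S : Finset ℤ)
    (π : SetPartition (p + q)) (E : Fin (p + q) → ℤ) :
    ((doubleWords τ S p q).filter (HasPattern sg cl π E)).card ≤ S.card ^ patternDim τ p π E := by
  refine card_pattern_le hd π E _ S _ (fun w hw => (mem_doubleWords.1 (Finset.mem_filter.1 hw).1).1)
    fun w hw => ?_
  obtain ⟨h1, h2⟩ := Finset.mem_filter.1 hw
  obtain ⟨h3, h4, h5⟩ := mem_doubleWords.1 h1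
  refine ⟨h2, ?_⟩
  have h6 : ∀ A : Finset (Fin (p + q)), linForm (blockForm π (fun i => stepSign τ p i * E i) A)
      (fun V => (blockValue π cl w V : ℝ)) = ((∑ i ∈ A, stepSign τ p i * w i : ℤ) : ℝ) := by
    intro A
    rw [← cast_linForm, linForm_blockForm]
    congr 1
    refine Finset.sum_congr rfl fun i _ => ?_
    rw [blockValue_blockOf h2.1, Int.cast_id, mul_assoc, ← h2.2 i, hd.eq]
  rw [mem_solutionSpace, h6, h6, (mem_closedWords_fstWord h3).1 h4, (mem_closedWords_sndWord h3).1 h5]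
  simp

/-- There are at most `n²` pairs of starting points, and the words are counted pattern by pattern
through the dimension of the solution space. -/
lemma norm_sum_le_pattern (hd : IsSignDecomposition sg cl) (n : ℕ) (S : Finset ℤ) (N : ℕ)
    (Φ : (Fin (p + q) → ℤ) → ℂ) {C : ℝ} (hΦ : ∀ w, ‖Φ w‖ ≤ C) (W : Finset (Fin (p + q) → ℤ))
    (hW : W ⊆ doubleWords τ S p q) (hbad : ∀ w ∈ W, Φ w ≠ 0 →
      2 * patternDim τ p (kernel cl w) (fun i => sg (w i)) + 1 ≤ N) :
    ‖∑ w ∈ W, (pairCount n τ w : ℂ) * Φ w‖ ≤ C * ∑ t ∈ ((Finset.univ : Finset (SetPartition (p + q))) ×ˢ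
      (Fintype.piFinset fun _ : Fin (p + q) => ({1, -1} : Finset ℤ))).filter fun t =>
        2 * patternDim τ p t.1 t.2 + 1 ≤ N, (n : ℝ) ^ 2 * (S.card : ℝ) ^ patternDim τ p t.1 t.2 := by
  set T := ((Finset.univ : Finset (SetPartition (p + q))) ×ˢ
      (Fintype.piFinset fun _ : Fin (p + q) => ({1, -1} : Finset ℤ))).filter fun t =>
        2 * patternDim τ p t.1 t.2 + 1 ≤ N with hT
  have hC : 0 ≤ C := (norm_nonneg _).trans (hΦ 0)
  have h1 : ∀ w, ‖(pairCount n τ w : ℂ) * Φ w‖ ≤ if Φ w ≠ 0 then (n : ℝ) ^ 2 * C else 0 := by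
    intro w
    split_ifs with h
    · rw [norm_mul, Complex.norm_natCast]
      refine mul_le_mul ?_ (hΦ w) (norm_nonneg _) (by positivity)
      rw [sq, pairCount]
      push_cast
      gcongr <;> exact startCount_le _ _ _
    · rw [not_not.1 h, mul_zero, norm_zero]
  refine (norm_sum_le _ _).trans ((Finset.sum_le_sum fun w _ => h1 w).trans ?_)
  rw [← Finset.sum_filter, Finset.sum_const, nsmul_eq_mul]
  have h2 : (W.filter fun w => Φ w ≠ 0) ⊆ T.biUnion fun t =>
      (doubleWords τ S p q).filter (HasPattern sg cl t.1 t.2) := by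
    intro w hw
    obtain ⟨hw1, hw2⟩ := Finset.mem_filter.1 hw
    refine Finset.mem_biUnion.2 ⟨(kernel cl w, fun i => sg (w i)), ?_, ?_⟩
    · refine Finset.mem_filter.2 ⟨Finset.mem_product.2 ⟨Finset.mem_univ _,
        Fintype.mem_piFinset.2 fun i => ?_⟩, hbad w hw1 hw2⟩
      simpa using hd.sign (w i)
    · exact Finset.mem_filter.2 ⟨hW hw1, rfl, fun _ => rfl⟩
  have h3 : ((W.filter fun w => Φ w ≠ 0).card : ℝ) ≤ ∑ t ∈ T, (S.card : ℝ) ^ patternDim τ p t.1 t.2 := by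
    have h4 := ((Finset.card_le_card h2).trans Finset.card_biUnion_le).trans
      (Finset.sum_le_sum fun t _ => card_doubleWords_pattern_le hd S t.1 t.2)
    exact_mod_cast h4
  calc ((W.filter fun w => Φ w ≠ 0).card : ℝ) * ((n : ℝ) ^ 2 * C)
      ≤ (∑ t ∈ T, (S.card : ℝ) ^ patternDim τ p t.1 t.2) * ((n : ℝ) ^ 2 * C) := by gcongr
    _ = _ := by rw [← Finset.mul_sum]; ring

/-- `Φ` is constant on each leading family, so these families contribute the main terms; any other
word with `Φ w ≠ 0` has a pattern of deficient dimension and is negligible. -/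
theorem tendsto_sum_doubleWords (hd : IsSignDecomposition sg cl) {β : ℕ → ℝ}
    (hβ : Tendsto β atTop atTop) {S : ℕ → Finset ℤ}
    {C₀ : ℝ} (hS : ∀ᶠ n in atTop, ((S n).card : ℝ) ≤ C₀ * β n) (N : ℕ)
    (Φ : (Fin (p + q) → ℤ) → ℂ) {C : ℝ} (hΦ : ∀ w, ‖Φ w‖ ≤ C)
    {κ : Type*} (K : Finset κ) (π : κ → SetPartition (p + q)) (E : κ → Fin (p + q) → ℤ)
    (M : κ → ℂ) (L : κ → ℝ)
    (hclass : ∀ n, ∀ w ∈ doubleWords τ (S n) p q, Φ w ≠ 0 →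
      (∃ k ∈ K, IsLeading cl (π k) (E k) w) ∨
        2 * patternDim τ p (kernel cl w) (fun i => sg (w i)) + 1 ≤ N)
    (hdisj : ∀ n, ∀ w ∈ doubleWords τ (S n) p q, ∀ k ∈ K, ∀ k' ∈ K, IsLeading cl (π k) (E k) w →
      IsLeading cl (π k') (E k') w → k = k')
    (hM : ∀ n, ∀ w ∈ doubleWords τ (S n) p q, ∀ k ∈ K, IsLeading cl (π k) (E k) w → Φ w = M k)
    (hL : ∀ k ∈ K, Tendsto (fun n => ((∑ w ∈ (doubleWords τ (S n) p q).filter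
      (IsLeading cl (π k) (E k)), pairCount n τ w : ℕ) : ℝ) * scale (β n) N n) atTop (𝓝 (L k))) :
    Tendsto (fun n => (∑ w ∈ doubleWords τ (S n) p q, (pairCount n τ w : ℂ) * Φ w) *
      (scale (β n) N n : ℂ)) atTop (𝓝 (∑ k ∈ K, M k * (L k : ℂ))) := by
  set T := ((Finset.univ : Finset (SetPartition (p + q))) ×ˢ
      (Fintype.piFinset fun _ : Fin (p + q) => ({1, -1} : Finset ℤ))).filter fun t =>
        2 * patternDim τ p t.1 t.2 + 1 ≤ N with hT
  let rest := fun n => (doubleWords τ (S n) p q).filter fun w =>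
    ¬ ∃ k ∈ K, IsLeading cl (π k) (E k) w
  have hrest : Tendsto (fun n => (∑ w ∈ rest n, (pairCount n τ w : ℂ) * Φ w) *
      (scale (β n) N n : ℂ)) atTop (𝓝 0) := by
    have h1 : Tendsto (fun n : ℕ => C * ∑ t ∈ T, (n : ℝ) ^ 2 *
        ((S n).card : ℝ) ^ patternDim τ p t.1 t.2 * scale (β n) N n) atTop (𝓝 0) := by
      have : (0 : ℝ) = C * ∑ t ∈ T, 0 := by simp
      rw [this]
      exact (tendsto_finsetSum _ fun t ht => tendsto_sq_mul_card_pow_mul_scale hβ hS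
        (Finset.mem_filter.1 ht).2).const_mul C
    refine squeeze_zero_norm (fun n => ?_) h1
    rw [norm_mul, Complex.norm_real, Real.norm_of_nonneg (scale_nonneg _ _ _), ← Finset.sum_mul,
      ← mul_assoc]
    refine mul_le_mul_of_nonneg_right ?_ (scale_nonneg _ _ _)
    refine norm_sum_le_pattern hd n (S n) N Φ hΦ (rest n) (Finset.filter_subset _ _) ?_
    intro w hw hne
    obtain ⟨hw1, hw2⟩ := Finset.mem_filter.1 hw
    exact (hclass n w hw1 hne).resolve_left hw2
  have hmain : Tendsto (fun n => ∑ k ∈ K, M k * ((((∑ w ∈ (doubleWords τ (S n) p q).filter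
      (IsLeading cl (π k) (E k)), pairCount n τ w : ℕ) : ℝ) * scale (β n) N n : ℝ) : ℂ)) atTop
      (𝓝 (∑ k ∈ K, M k * (L k : ℂ))) :=
    tendsto_finsetSum _ fun k hk =>
      ((Complex.continuous_ofReal.tendsto _).comp (hL k hk)).const_mul (M k)
  have h := hmain.add hrest
  rw [add_zero] at h
  refine h.congr fun n => ?_
  have hsplit : (doubleWords τ (S n) p q).filter (fun w => ∃ k ∈ K, IsLeading cl (π k) (E k) w) =
      K.biUnion fun k => (doubleWords τ (S n) p q).filter (IsLeading cl (π k) (E k)) := by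
    ext w
    simp only [Finset.mem_filter, Finset.mem_biUnion]
    constructor
    · rintro ⟨h1, k, hk, h2⟩
      exact ⟨k, hk, h1, h2⟩
    · rintro ⟨k, hk, h1, h2⟩
      exact ⟨h1, k, hk, h2⟩
  rw [← Finset.sum_filter_add_sum_filter_not (doubleWords τ (S n) p q)
    (fun w => ∃ k ∈ K, IsLeading cl (π k) (E k) w), hsplit, Finset.sum_biUnion, add_mul]
  · congr 1
    rw [Finset.sum_mul]
    refine Finset.sum_congr rfl fun k hk => ?_
    push_cast
    rw [← mul_assoc, Finset.mul_sum]
    congr 1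
    refine Finset.sum_congr rfl fun w hw => ?_
    obtain ⟨hw1, hw2⟩ := Finset.mem_filter.1 hw
    rw [hM n w hw1 k hk hw2, mul_comm]
  · intro k hk k' hk' hne
    rw [Function.onFun, Finset.disjoint_left]
    intro w hw hw'
    obtain ⟨hw1, hw2⟩ := Finset.mem_filter.1 hw
    exact hne (hdisj n w hw1 k hk k' hk' hw2 (Finset.mem_filter.1 hw').2)

end LeadingSum

end SparseToeplitz
end

noncomputable section
namespace SparseToeplitz

/-! ### Leading configurations and the integrals of types I and II -/

section Integrals

open Classical

variable {m p : ℕ}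

/-- The orientation `t` of the second walk is absorbed into the effective signs `e`. -/
lemma region_eq_limitRegion (B : Set ℝ) (b : ℝ) (π : SetPartition m) (s : Fin m → ℝ) (t u v : ℝ)
    (e : Fin m → ℤ) (hlow : ∀ i : Fin m, (i : ℕ) < p → (e i : ℝ) = s i)
    (hhigh : ∀ i : Fin m, p ≤ (i : ℕ) → (e i : ℝ) = t * s i) :
    region B b p π s t u v = limitRegion B b coordForm
      (fun j : {j : Fin m // (j : ℕ) < p} => blockForm π e (Finset.univ.filter fun k => k ≤ j.1))
      (fun j : {j : Fin m // p ≤ (j : ℕ)} =>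
        blockForm π e (Finset.univ.filter fun k => p ≤ (k : ℕ) ∧ k ≤ j.1)) u v := by
  ext x
  simp only [region, limitRegion, Set.mem_ofPred_eq, coordForm, linForm_single_left,
    linForm_blockForm, Subtype.forall]
  refine and_congr Iff.rfl (and_congr (forall_congr' fun j => forall_congr' fun hj => ?_)
    (forall_congr' fun j => forall_congr' fun hj => ?_))
  · have : ∑ i ∈ Finset.univ.filter (fun i => i ≤ j), s i * x (block π i) =
        ∑ i ∈ Finset.univ.filter (fun i => i ≤ j), (e i : ℝ) * x (blockOf π i) := by
      refine Finset.sum_congr rfl fun i hi => ?_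
      have h1 := Fin.le_def.1 (Finset.mem_filter.1 hi).2
      rw [hlow i (by omega)]
      rfl
    rw [this]
  · have : t * b * ∑ i ∈ Finset.univ.filter (fun i : Fin m => p ≤ (i : ℕ) ∧ i ≤ j),
        s i * x (block π i) = b * ∑ i ∈ Finset.univ.filter (fun i : Fin m => p ≤ (i : ℕ) ∧ i ≤ j),
          (e i : ℝ) * x (blockOf π i) := by
      rw [mul_comm t b, mul_assoc, Finset.mul_sum]
      congr 1
      refine Finset.sum_congr rfl fun i hi => ?_
      rw [hhigh i (Finset.mem_filter.1 hi).2.1, mul_assoc]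
      rfl
    rw [this]

lemma firstCoeff_eq_blockForm (π : SetPartition m) (s : Fin m → ℝ)
    (e : Fin m → ℤ) (hlow : ∀ i : Fin m, (i : ℕ) < p → (e i : ℝ) = s i) (V : {V // V ∈ π.parts}) :
    firstCoeff p π s V = blockForm π e (lowSet p) V := by
  unfold firstCoeff blockForm lowSet
  push_cast
  rw [Finset.filter_filter]
  refine Finset.sum_congr rfl fun i hi => ?_
  exact (hlow i (Finset.mem_filter.1 hi).2.1).symm

lemma two_mul_card_parts_of_isPairing {π : SetPartition m} (h : IsPairing π) :
    2 * Fintype.card {V // V ∈ π.parts} = m := by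
  have h1 := π.sum_card_parts
  rw [Finset.sum_congr rfl h, Finset.sum_const, smul_eq_mul, Finset.card_univ, Fintype.card_fin] at h1
  rw [Fintype.card_coe]
  omega

lemma finrank_solutionSpace_le {ι : Type*} [Fintype ι] (f g : ι → ℤ) :
    Module.finrank ℝ (solutionSpace f g) ≤ Fintype.card ι :=
  (Submodule.finrank_le _).trans (Module.finrank_fintype_fun_eq_card ℝ).le

lemma finrank_solutionSpace_lt {ι : Type*} [Fintype ι] {f g : ι → ℤ} (h : f ≠ 0 ∨ g ≠ 0) :
    Module.finrank ℝ (solutionSpace f g) < Fintype.card ι := by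
  rw [← Module.finrank_fintype_fun_eq_card (η := ι) ℝ]
  refine Submodule.finrank_lt ?_
  intro htop
  have h1 : ∀ i, Pi.single i (1 : ℝ) ∈ solutionSpace f g := fun i => by rw [htop]; trivial
  simp only [mem_solutionSpace, linForm_single] at h1
  rcases h with h | h <;> refine h (funext fun i => ?_)
  · exact_mod_cast (h1 i).1
  · exact_mod_cast (h1 i).2

variable {q : ℕ} {τ : ℕ → ℤ} {sg cl : ℤ → ℤ} {β : ℕ → ℝ} {b : ℝ} {S : ℕ → Finset ℤ} {B : Set ℝ}
  {C₀ : ℝ}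

/-- A pair partition has `(p + q) / 2` blocks, one of which is eliminated by the balance equation,
so the number of points matches `N = p + q - 2`. The separation of unknowns in `hgen` makes
coincidences of classes negligible. -/
theorem tendsto_leading_typeI (hd : IsSignDecomposition sg cl) (hβ : Tendsto β atTop atTop)
    (hβb : Tendsto (fun n : ℕ => β n / n) atTop (𝓝 b)) (hS : Approximates β S B)
    (hC₀ : ∀ᶠ n in atTop, ∀ k ∈ S n, |(k : ℝ)| ≤ C₀ * β n)
    {C₁ : ℝ} (hcard : ∀ᶠ n in atTop, ((S n).card : ℝ) ≤ C₁ * β n)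
    {π : SetPartition (p + q)} (hπ : IsPairing π) {E : Fin (p + q) → ℤ}
    (hE : ∀ i, E i = 1 ∨ E i = -1) (hES : ∀ n i, ∀ x ∈ S n, E i * x ∈ S n)
    (hEcl : ∀ i x, cl (E i * x) = cl x) (s : Fin (p + q) → ℝ) (t : ℝ)
    {e : Fin (p + q) → ℤ} (he : ∀ i, stepSign τ p i * E i = e i)
    (hlow : ∀ i : Fin (p + q), (i : ℕ) < p → (e i : ℝ) = s i)
    (hhigh : ∀ i : Fin (p + q), p ≤ (i : ℕ) → (e i : ℝ) = t * s i)
    (hf : ∀ V, blockForm π e (lowSet p) V = 0 ∨ blockForm π e (lowSet p) V = 1 ∨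
      blockForm π e (lowSet p) V = -1)
    (h2 : ∃ V W, V ≠ W ∧ blockForm π e (lowSet p) V ≠ 0 ∧ blockForm π e (lowSet p) W ≠ 0)
    (hg : ∀ z : {V // V ∈ π.parts} → ℝ, linForm (blockForm π e (lowSet p)) z = 0 →
      linForm (blockForm π e (highSet p)) z = 0)
    (hgen : ∀ V W, V ≠ W → ∀ x y : ℤ, ∃ z : {V // V ∈ π.parts} → ℝ,
      linForm (blockForm π e (lowSet p)) z = 0 ∧ z V ≠ (sg x * sg y : ℤ) * z W)
    {N : ℕ} (hN : N + 2 = p + q) :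
    Tendsto (fun n => ((∑ w ∈ (doubleWords τ (S n) p q).filter
      (IsLeading cl π E), pairCount n τ w : ℕ) : ℝ) * scale (β n) N n) atTop
      (𝓝 (typeI B b p π s t)) := by
  obtain rfl : (fun i => stepSign τ p i * E i) = e := funext he
  have hparts := two_mul_card_parts_of_isPairing hπ
  have hN' : N = 2 * (Fintype.card {V // V ∈ π.parts} - 1) := by omega
  unfold pairCount
  simp_rw [sum_startCount_leading hE (hES _) hEcl]
  refine tendsto_card_injective hd hβ hcard ?_ ?_ ?_
  · have := finrank_solutionSpace_lt (f := blockForm π (fun i => stepSign τ p i * E i) (lowSet p))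
      (g := blockForm π (fun i => stepSign τ p i * E i) (highSet p)) (by
        obtain ⟨V, -, -, hV, -⟩ := h2
        exact Or.inl fun h => hV (congrFun h V))
    omega
  · intro V W hVW x y
    obtain ⟨z, h3, h4⟩ := hgen V W hVW x y
    exact ⟨z, ⟨h3, hg z h3⟩, h4⟩
  · have h := tendsto_card_configSet hβ hβb hS hC₀
      (fun j : {j : Fin (p + q) // (j : ℕ) < p} => blockForm π (fun i => stepSign τ p i * E i)
        (Finset.univ.filter fun k => k ≤ j.1))
      (fun j : {j : Fin (p + q) // p ≤ (j : ℕ)} => blockForm π (fun i => stepSign τ p i * E i)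
        (Finset.univ.filter fun k => p ≤ (k : ℕ) ∧ k ≤ j.1)) _
      (blockForm π (fun i => stepSign τ p i * E i) (highSet p)) (firstCoeff p π s)
      (firstCoeff_eq_blockForm π s _ hlow) hf h2 (fun z hz => by
        have h3 := hg (fun V => z V) (by rw [← cast_linForm, hz, Int.cast_zero])
        rw [← cast_linForm] at h3
        exact_mod_cast h3)
    simp_rw [← region_eq_limitRegion B b π s t _ _ _ hlow hhigh] at h
    refine h.congr' ?_
    filter_upwards [hβ.eventually_ge_atTop 0] with n hn
    rw [hN', scale_two_mul hn]

/-- Both balance equations are void, so every block unknown is free and the exponent is the number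
of blocks. -/
theorem tendsto_leading_typeII (hd : IsSignDecomposition sg cl) (hβ : Tendsto β atTop atTop)
    (hβb : Tendsto (fun n : ℕ => β n / n) atTop (𝓝 b)) (hS : Approximates β S B)
    (hC₀ : ∀ᶠ n in atTop, ∀ k ∈ S n, |(k : ℝ)| ≤ C₀ * β n)
    {C₁ : ℝ} (hcard : ∀ᶠ n in atTop, ((S n).card : ℝ) ≤ C₁ * β n)
    {π : SetPartition (p + q)} {E : Fin (p + q) → ℤ}
    (hE : ∀ i, E i = 1 ∨ E i = -1) (hES : ∀ n i, ∀ x ∈ S n, E i * x ∈ S n)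
    (hEcl : ∀ i x, cl (E i * x) = cl x) (s : Fin (p + q) → ℝ) (t : ℝ)
    {e : Fin (p + q) → ℤ} (he : ∀ i, stepSign τ p i * E i = e i)
    (hlow : ∀ i : Fin (p + q), (i : ℕ) < p → (e i : ℝ) = s i)
    (hhigh : ∀ i : Fin (p + q), p ≤ (i : ℕ) → (e i : ℝ) = t * s i)
    (hf : blockForm π e (lowSet p) = 0) (hg : blockForm π e (highSet p) = 0) {N : ℕ}
    (hN : N = 2 * Fintype.card {V // V ∈ π.parts}) :
    Tendsto (fun n => ((∑ w ∈ (doubleWords τ (S n) p q).filter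
      (IsLeading cl π E), pairCount n τ w : ℕ) : ℝ) * scale (β n) N n) atTop
      (𝓝 (typeII B b p π s t)) := by
  obtain rfl : (fun i => stepSign τ p i * E i) = e := funext he
  unfold pairCount
  simp_rw [sum_startCount_leading hE (hES _) hEcl]
  refine tendsto_card_injective hd hβ hcard ?_ ?_ ?_
  · rw [hN]
    exact Nat.mul_le_mul_left 2 (finrank_solutionSpace_le _ _)
  · intro V W hVW x y
    refine ⟨Pi.single V 1, ?_, ?_⟩
    · rw [hf, hg]
      simp [mem_solutionSpace, linForm]
    · rw [Pi.single_eq_same, Pi.single_eq_of_ne hVW.symm]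
      simp
  · have h := tendsto_card_configSet_zero hβ hβb hS hC₀
      (fun j : {j : Fin (p + q) // (j : ℕ) < p} => blockForm π (fun i => stepSign τ p i * E i)
        (Finset.univ.filter fun k => k ≤ j.1))
      (fun j : {j : Fin (p + q) // p ≤ (j : ℕ)} => blockForm π (fun i => stepSign τ p i * E i)
        (Finset.univ.filter fun k => p ≤ (k : ℕ) ∧ k ≤ j.1))
    simp_rw [← region_eq_limitRegion B b π s t _ _ _ hlow hhigh] at h
    refine h.congr' ?_
    filter_upwards [hβ.eventually_ge_atTop 0] with n hn
    rw [hN, scale_two_mul hn]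
    rw [hf, hg]

end Integrals

end SparseToeplitz
end

noncomputable section
namespace SparseToeplitz

/-! ### Covariances of products of entries -/

section Blocks

open Classical

variable {Ω : Type*} [MeasurableSpace Ω] {μ : Measure Ω} [IsProbabilityMeasure μ]
  {a : ℤ → Ω → ℂ} {cl : ℤ → ℤ}

lemma prod_eq_prod_blocks {P M : Type*} [Fintype P] [DecidableEq P] [CommMonoid M]
    (π : Finpartition (Finset.univ : Finset P)) (A : Finset P) (F : P → M) :
    ∏ i ∈ A, F i = ∏ V ∈ π.parts, ∏ i ∈ V.filter (· ∈ A), F i := by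
  rw [← Finset.prod_biUnion]
  · congr 1
    ext i
    simp only [Finset.mem_biUnion, Finset.mem_filter]
    exact ⟨fun h => ⟨_, (blockOf π i).2, mem_blockOf π i, h⟩, fun ⟨_, _, _, h⟩ => h⟩
  · intro V hV W hW hne
    exact (π.disjoint hV hW hne).mono (Finset.filter_subset _ _) (Finset.filter_subset _ _)

/-- The expectation of a product of entries factorizes over the blocks of the kernel. -/
lemma IsEntryFamily.integral_prod_blocks (ha : IsEntryFamily μ a cl) {P : Type*} [Fintype P]
    [DecidableEq P] (w : P → ℤ) (A : Finset P) :
    ∫ ω, ∏ i ∈ A, a (w i) ω ∂μ =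
      ∏ V ∈ (kernel cl w).parts, ∫ ω, ∏ i ∈ V.filter (· ∈ A), a (w i) ω ∂μ := by
  have h : ∀ s ⊆ (kernel cl w).parts, ∫ ω, ∏ V ∈ s, ∏ i ∈ V.filter (· ∈ A), a (w i) ω ∂μ =
      ∏ V ∈ s, ∫ ω, ∏ i ∈ V.filter (· ∈ A), a (w i) ω ∂μ := by
    intro s
    induction s using Finset.induction_on with
    | empty => intro _; simp
    | insert V s hV ih =>
      intro hs
      rw [Finset.prod_insert hV, ← ih fun W hW => hs (Finset.mem_insert_of_mem hW)]
      simp_rw [Finset.prod_insert hV]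
      refine ha.integral_mul (F := V.image w) (G := (s.biUnion id).image w)
        (dependsOnEntries_prod _ _ fun i hi => dependsOnEntries_entry
          (Finset.mem_image_of_mem _ (Finset.mem_filter.1 hi).1))
        (dependsOnEntries_prod _ _ fun W hW => dependsOnEntries_prod _ _ fun i hi =>
          dependsOnEntries_entry (Finset.mem_image_of_mem _
            (Finset.mem_biUnion.2 ⟨W, hW, (Finset.mem_filter.1 hi).1⟩))) ?_
      intro x hx y hy hxy
      obtain ⟨i, hi, rfl⟩ := Finset.mem_image.1 hx
      obtain ⟨j, hj, rfl⟩ := Finset.mem_image.1 hy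
      obtain ⟨W, hW, hjW⟩ := Finset.mem_biUnion.1 hj
      have hVp := hs (Finset.mem_insert_self V s)
      have hWp := hs (Finset.mem_insert_of_mem hW)
      have hjV : j ∈ V := mem_part_of_cl_eq hVp hi hxy
      have : V = W := (kernel cl w).eq_of_mem_parts hVp hWp hjV hjW
      exact hV (this ▸ hW)
  rw [← h _ subset_rfl]
  simp_rw [← prod_eq_prod_blocks (kernel cl w) A]

variable {p q : ℕ}

/-- The covariance of the products of entries along two consecutive words. -/
def pairCov (μ : Measure Ω) (a : ℤ → Ω → ℂ) (w : Fin (p + q) → ℤ) : ℂ :=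
  ∫ ω, wordProd a w ω ∂μ - (∫ ω, wordProd a (fstWord w) ω ∂μ) * ∫ ω, wordProd a (sndWord w) ω ∂μ

lemma wordProd_eq_mul (w : Fin (p + q) → ℤ) (ω : Ω) :
    wordProd a w ω = wordProd a (fstWord w) ω * wordProd a (sndWord w) ω := Fin.prod_univ_add _

lemma IsEntryFamily.integral_centredProd_mul (ha : IsEntryFamily μ a cl) (w : Fin (p + q) → ℤ) :
    ∫ ω, centredProd μ a (fstWord w) ω * centredProd μ a (sndWord w) ω ∂μ = pairCov μ a w := by
  obtain ⟨B, hB⟩ := ha.exists_momentBound_wordProd (p + q)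
  have hi : ∀ {k : ℕ} (x : Fin k → ℤ), k ≤ p + q → Integrable (wordProd a x) μ := fun x hk =>
    (hB x (by simpa using hk)).integrable
  unfold centredProd
  have h1 : ∀ ω, (wordProd a (fstWord w) ω - ∫ ω', wordProd a (fstWord w) ω' ∂μ) *
      (wordProd a (sndWord w) ω - ∫ ω', wordProd a (sndWord w) ω' ∂μ) =
      wordProd a w ω - (∫ ω', wordProd a (fstWord w) ω' ∂μ) * wordProd a (sndWord w) ω -
        (wordProd a (fstWord w) ω - ∫ ω', wordProd a (fstWord w) ω' ∂μ) *
          ∫ ω', wordProd a (sndWord w) ω' ∂μ := by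
    intro ω
    rw [wordProd_eq_mul w ω]
    ring
  simp_rw [h1]
  rw [integral_sub, integral_sub (hi _ le_rfl) ((hi _ (by omega)).const_mul _), integral_const_mul,
    integral_mul_const, integral_sub (hi _ (by omega)) (integrable_const _), integral_const]
  · simp [pairCov]
  · exact (hi _ le_rfl).sub ((hi _ (by omega)).const_mul _)
  · exact ((hi _ (by omega)).sub (integrable_const _)).mul_const _

lemma IsEntryFamily.exists_norm_pairCov_le (ha : IsEntryFamily μ a cl) (p q : ℕ) :
    ∃ C, ∀ w : Fin (p + q) → ℤ, ‖pairCov μ a w‖ ≤ C := by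
  obtain ⟨B, hB⟩ := ha.exists_momentBound_wordProd (p + q)
  refine ⟨B 1 + B 1 * B 1, fun w => (norm_sub_le _ _).trans (add_le_add
    (hB w (by simp)).norm_integral_le ?_)⟩
  rw [norm_mul]
  have h1 := (hB (fstWord w) (by simp)).norm_integral_le
  exact mul_le_mul h1 (hB (sndWord w) (by simp)).norm_integral_le (norm_nonneg _)
    ((norm_nonneg _).trans h1)

lemma IsEntryFamily.integral_traceFluctuation_mul (ha : IsEntryFamily μ a cl) {β : ℝ} (hβ : 0 < β)
    (n : ℕ) (τ : ℕ → ℤ) (S : Finset ℤ) {N : ℕ} (hN : N + 2 = p + q) :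
    ∫ ω, traceFluctuation μ a β n τ S p ω * traceFluctuation μ a β n τ S q ω ∂μ =
      (∑ w ∈ doubleWords τ S p q, (pairCount n τ w : ℂ) * pairCov μ a w) * (scale β N n : ℂ) := by
  obtain ⟨B, hB⟩ := ha.exists_momentBound_centredProd (p + q)
  have hint : ∀ (x : Fin p → ℤ) (y : Fin q → ℤ), Integrable (fun ω =>
      (wordWeight β n τ x * centredProd μ a x ω) * (wordWeight β n τ y * centredProd μ a y ω)) μ := by
    intro x y
    exact (((momentBound_const _).mul (hB x (by simp))).mul
      ((momentBound_const _).mul (hB y (by simp)))).integrable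
  unfold traceFluctuation wordSum
  simp_rw [Finset.sum_mul_sum]
  rw [integral_finsetSum _ fun x _ => integrable_finsetSum _ fun y _ => hint x y]
  have h1 : ∀ x : Fin p → ℤ, ∫ ω, ∑ y ∈ closedWords τ S q,
      (wordWeight β n τ x * centredProd μ a x ω) * (wordWeight β n τ y * centredProd μ a y ω) ∂μ =
      ∑ y ∈ closedWords τ S q, (wordWeight β n τ x * wordWeight β n τ y : ℂ) *
        ∫ ω, centredProd μ a x ω * centredProd μ a y ω ∂μ := by
    intro x
    rw [integral_finsetSum _ fun y _ => hint x y]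
    refine Finset.sum_congr rfl fun y _ => ?_
    rw [← integral_const_mul]
    refine integral_congr_ae (Eventually.of_forall fun ω => ?_)
    simp only
    ring
  simp_rw [h1]
  rw [sum_doubleWords S fun x y => (wordWeight β n τ x * wordWeight β n τ y : ℂ) *
        ∫ ω, centredProd μ a x ω * centredProd μ a y ω ∂μ, Finset.sum_mul]
  refine Finset.sum_congr rfl fun w _ => ?_
  rw [ha.integral_centredProd_mul]
  have hs : √β ≠ 0 := (Real.sqrt_pos.2 hβ).ne'
  have h2 : wordWeight β n τ (fstWord w) * wordWeight β n τ (sndWord w) =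
      pairCount n τ w * scale β N n := by
    -- The two prefactors `√β / n` cancel two of the `p + q` factors `1 / √β`; hence the exponent `N
    -- = p + q - 2`.
    have h3 : (√β)⁻¹ ^ p * (√β)⁻¹ ^ q * √β ^ 2 = (√β)⁻¹ ^ N := by
      rw [← pow_add, ← hN, pow_add, mul_assoc, ← mul_pow, inv_mul_cancel₀ hs, one_pow, mul_one]
    unfold wordWeight pairCount scale
    rw [← h3]
    push_cast
    ring
  rw [← Complex.ofReal_mul, h2]
  push_cast
  ring

lemma wordProd_fstWord (w : Fin (p + q) → ℤ) (ω : Ω) :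
    wordProd a (fstWord w) ω = ∏ i ∈ lowSet p, a (w i) ω := by
  rw [lowSet, Finset.prod_filter, Fin.prod_univ_add]
  simp [wordProd, fstWord]

lemma wordProd_sndWord (w : Fin (p + q) → ℤ) (ω : Ω) :
    wordProd a (sndWord w) ω = ∏ i ∈ highSet p, a (w i) ω := by
  rw [highSet, Finset.prod_filter, Fin.prod_univ_add]
  simp [wordProd, sndWord, Nat.not_le.2 (Fin.is_lt _)]

lemma IsEntryFamily.two_le_card_of_integral_ne_zero (ha : IsEntryFamily μ a cl) {P : Type} [Fintype P]
    [DecidableEq P] {w : P → ℤ} (h : ∫ ω, wordProd a w ω ∂μ ≠ 0) (V : Finset P)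
    (hV : V ∈ (kernel cl w).parts) : 2 ≤ V.card := by
  by_contra hlt
  have hpos : 0 < V.card := Finset.card_pos.2 ((kernel cl w).nonempty_of_mem_parts hV)
  obtain ⟨i, rfl⟩ := Finset.card_eq_one.1 (by omega : V.card = 1)
  refine h ?_
  unfold wordProd
  rw [ha.integral_prod_blocks w Finset.univ]
  refine Finset.prod_eq_zero hV ?_
  simp only [Finset.mem_univ, Finset.filter_true, Finset.prod_singleton]
  exact ha.mean _

/-- A singleton block is a centred factor both in the joint expectation and in the expectation of
the word that contains it. -/
lemma IsEntryFamily.two_le_card_of_pairCov_ne_zero (ha : IsEntryFamily μ a cl)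
    {w : Fin (p + q) → ℤ} (h : pairCov μ a w ≠ 0) (V : Finset (Fin (p + q)))
    (hV : V ∈ (kernel cl w).parts) : 2 ≤ V.card := by
  by_contra hlt
  have h0 : ∫ ω, wordProd a w ω ∂μ = 0 := by
    by_contra h'
    exact hlt (ha.two_le_card_of_integral_ne_zero h' V hV)
  have hpos : 0 < V.card := Finset.card_pos.2 ((kernel cl w).nonempty_of_mem_parts hV)
  obtain ⟨i, rfl⟩ := Finset.card_eq_one.1 (by omega : V.card = 1)
  refine h ?_
  rw [pairCov, h0, zero_sub, neg_eq_zero, mul_eq_zero]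
  by_cases hi : (i : ℕ) < p
  · left
    simp_rw [wordProd_fstWord]
    rw [ha.integral_prod_blocks w (lowSet p)]
    refine Finset.prod_eq_zero hV ?_
    have : ({i} : Finset (Fin (p + q))).filter (· ∈ lowSet p) = {i} := by
      rw [Finset.filter_true_of_mem]
      intro j hj
      rw [Finset.mem_singleton.1 hj]
      exact Finset.mem_filter.2 ⟨Finset.mem_univ _, hi⟩
    rw [this]
    simp only [Finset.prod_singleton]
    exact ha.mean _
  · right
    simp_rw [wordProd_sndWord]
    rw [ha.integral_prod_blocks w (highSet p)]
    refine Finset.prod_eq_zero hV ?_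
    have : ({i} : Finset (Fin (p + q))).filter (· ∈ highSet p) = {i} := by
      rw [Finset.filter_true_of_mem]
      intro j hj
      rw [Finset.mem_singleton.1 hj]
      exact Finset.mem_filter.2 ⟨Finset.mem_univ _, not_lt.1 hi⟩
    rw [this]
    simp only [Finset.prod_singleton]
    exact ha.mean _

lemma pairCov_eq (ha : IsEntryFamily μ a cl) (w : Fin (p + q) → ℤ) : pairCov μ a w =
    ∏ V ∈ (kernel cl w).parts, ∫ ω, ∏ i ∈ V, a (w i) ω ∂μ -
      ∏ V ∈ (kernel cl w).parts, ((∫ ω, ∏ i ∈ V.filter (· ∈ lowSet p), a (w i) ω ∂μ) *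
        ∫ ω, ∏ i ∈ V.filter (· ∈ highSet p), a (w i) ω ∂μ) := by
  rw [pairCov, Finset.prod_mul_distrib, ← ha.integral_prod_blocks, ← ha.integral_prod_blocks]
  simp_rw [wordProd_fstWord, wordProd_sndWord]
  congr 1
  unfold wordProd
  rw [ha.integral_prod_blocks w Finset.univ]
  simp only [Finset.mem_univ, Finset.filter_true]

lemma not_isCrossing_cases {m : ℕ} {V : Finset (Fin m)} (h : ¬ IsCrossing p V) :
    (V.filter (· ∈ lowSet p) = V ∧ V.filter (· ∈ highSet p) = ∅) ∨
      (V.filter (· ∈ lowSet p) = ∅ ∧ V.filter (· ∈ highSet p) = V) := by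
  by_cases h1 : ∃ i ∈ V, (i : ℕ) < p
  · left
    have h2 : ∀ j ∈ V, (j : ℕ) < p := fun j hj => by
      by_contra hlt
      exact h ⟨h1, j, hj, not_lt.1 hlt⟩
    constructor
    · exact Finset.filter_true_of_mem fun j hj => Finset.mem_filter.2 ⟨Finset.mem_univ _, h2 j hj⟩
    · exact Finset.filter_false_of_mem fun j hj hj' =>
        absurd (h2 j hj) (not_lt.2 (Finset.mem_filter.1 hj').2)
  · right
    push Not at h1
    constructor
    · exact Finset.filter_false_of_mem fun j hj hj' =>
        absurd (Finset.mem_filter.1 hj').2 (not_lt.2 (h1 j hj))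
    · exact Finset.filter_true_of_mem fun j hj => Finset.mem_filter.2 ⟨Finset.mem_univ _, h1 j hj⟩

lemma integral_mul_of_not_isCrossing {m : ℕ} {V : Finset (Fin m)} (h : ¬ IsCrossing p V)
    (w : Fin m → ℤ) : (∫ ω, ∏ i ∈ V.filter (· ∈ lowSet p), a (w i) ω ∂μ) *
        ∫ ω, ∏ i ∈ V.filter (· ∈ highSet p), a (w i) ω ∂μ = ∫ ω, ∏ i ∈ V, a (w i) ω ∂μ := by
  rcases not_isCrossing_cases h with ⟨h1, h2⟩ | ⟨h1, h2⟩ <;> rw [h1, h2] <;> simp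

/-- Without crossing blocks the two terms of the covariance factorize in the same way and cancel. -/
lemma IsEntryFamily.exists_isCrossing_of_pairCov_ne_zero (ha : IsEntryFamily μ a cl)
    {w : Fin (p + q) → ℤ} (h : pairCov μ a w ≠ 0) :
    ∃ V ∈ (kernel cl w).parts, IsCrossing p V := by
  by_contra hcon
  push Not at hcon
  refine h ?_
  rw [pairCov_eq ha, sub_eq_zero]
  exact Finset.prod_congr rfl fun V hV => (integral_mul_of_not_isCrossing (hcon V hV) w).symm

/-- The covariance for a pair partition with a crossing block. -/
lemma IsEntryFamily.pairCov_of_isPairing (ha : IsEntryFamily μ a cl) {w : Fin (p + q) → ℤ}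
    (hpair : IsPairing (kernel cl w)) (hcr : ∃ V ∈ (kernel cl w).parts, IsCrossing p V) :
    pairCov μ a w = ∏ V ∈ (kernel cl w).parts, ∫ ω, ∏ i ∈ V, a (w i) ω ∂μ := by
  obtain ⟨V, hV, ⟨i, hi, hip⟩, j, hj, hjp⟩ := hcr
  rw [pairCov_eq ha, sub_eq_self]
  refine Finset.prod_eq_zero hV ?_
  -- A crossing pair leaves one centred letter in each word, so the product of the separate
  -- expectations vanishes.
  have h1 : V.filter (· ∈ lowSet p) = {i} := by
    have h2 : V.filter (· ∈ lowSet p) ⊂ V := by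
      refine Finset.filter_ssubset.2 ⟨j, hj, fun h => ?_⟩
      have := (Finset.mem_filter.1 h).2
      omega
    have h3 := Finset.card_lt_card h2
    rw [hpair V hV] at h3
    refine (Finset.eq_of_subset_of_card_le (Finset.singleton_subset_iff.2 ?_) ?_).symm
    · exact Finset.mem_filter.2 ⟨hi, Finset.mem_filter.2 ⟨Finset.mem_univ _, hip⟩⟩
    · rw [Finset.card_singleton]; omega
  rw [h1]
  simp only [Finset.prod_singleton]
  rw [ha.mean, zero_mul]

/-- The covariance for a partition into one block of four and non-crossing pairs. -/
lemma IsEntryFamily.pairCov_of_four (ha : IsEntryFamily μ a cl) {w : Fin (p + q) → ℤ}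
    {W : Finset (Fin (p + q))} (hW : W ∈ (kernel cl w).parts)
    (hnc : ∀ V ∈ (kernel cl w).parts, V ≠ W → ¬ IsCrossing p V)
    (h2 : ∀ V ∈ (kernel cl w).parts, V ≠ W → ∫ ω, ∏ i ∈ V, a (w i) ω ∂μ = 1) {κ : ℂ}
    (h4 : ∫ ω, ∏ i ∈ W, a (w i) ω ∂μ = κ)
    (hl : ∫ ω, ∏ i ∈ W.filter (· ∈ lowSet p), a (w i) ω ∂μ = 1)
    (hh : ∫ ω, ∏ i ∈ W.filter (· ∈ highSet p), a (w i) ω ∂μ = 1) :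
    pairCov μ a w = κ - 1 := by
  rw [pairCov_eq ha, Finset.prod_eq_single_of_mem W hW, Finset.prod_eq_single_of_mem W hW, h4, hl, hh,
    mul_one]
  · intro V hV hne
    rw [integral_mul_of_not_isCrossing (hnc V hV hne), h2 V hV hne]
  · exact fun V hV hne => h2 V hV hne

end Blocks

end SparseToeplitz
end

noncomputable section
namespace SparseToeplitz

/-! ### Classification of the leading partitions -/

section Classification

open Classical

variable {m p : ℕ} {π : SetPartition m} {e : Fin m → ℤ}

lemma even_card_of_sum_eq_zero {P : Type*} {e : P → ℤ} (he : ∀ i, e i = 1 ∨ e i = -1) (A : Finset P)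
    (h : ∑ i ∈ A, e i = 0) : Even A.card := by
  have h1 : ∀ A : Finset P, (2 : ℤ) ∣ ∑ i ∈ A, e i + A.card := by
    intro A
    induction A using Finset.induction_on with
    | empty => simp
    | insert i A hi ih =>
      rw [Finset.sum_insert hi, Finset.card_insert_of_notMem hi]
      push_cast
      rcases he i with h | h <;> rw [h] <;> omega
  have h2 := h1 A
  rw [h, zero_add] at h2
  rw [even_iff_two_dvd]
  exact_mod_cast h2

lemma blockForm_apply (π : SetPartition m) (e : Fin m → ℤ) (A : Finset (Fin m))
    (V : {V // V ∈ π.parts}) : blockForm π e A V = ∑ i ∈ V.1.filter (· ∈ A), e i := by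
  unfold blockForm
  congr 1
  ext i
  simp only [Finset.mem_filter, blockOf_eq_iff]
  tauto

lemma mem_lowSet {i : Fin m} : i ∈ lowSet p ↔ (i : ℕ) < p := by simp [lowSet]

lemma mem_highSet {i : Fin m} : i ∈ highSet p ↔ p ≤ (i : ℕ) := by simp [highSet]

lemma blockForm_pair {V : {V // V ∈ π.parts}} {i j : Fin m} (hij : i ≠ j) (hV : V.1 = {i, j})
    (A : Finset (Fin m)) : blockForm π e A V =
      (if i ∈ A then e i else 0) + if j ∈ A then e j else 0 := by
  rw [blockForm_apply, hV, Finset.sum_filter, Finset.sum_pair hij]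

lemma exists_of_isCrossing_of_card {V : Finset (Fin m)} (h : IsCrossing p V) (h2 : V.card = 2) :
    ∃ i j : Fin m, (i : ℕ) < p ∧ p ≤ (j : ℕ) ∧ i ≠ j ∧ V = {i, j} := by
  obtain ⟨⟨i, hi, hip⟩, j, hj, hjp⟩ := h
  have hij : i ≠ j := fun h => by rw [h] at hip; omega
  refine ⟨i, j, hip, hjp, hij, (Finset.eq_of_subset_of_card_le ?_ ?_).symm⟩
  · intro k hk
    rcases Finset.mem_insert.1 hk with rfl | hk
    · exact hi
    · rwa [Finset.mem_singleton.1 hk]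
  · rw [h2, Finset.card_pair hij]

lemma blockForm_crossing_pair {V : {V // V ∈ π.parts}} {i j : Fin m} (hi : (i : ℕ) < p)
    (hj : p ≤ (j : ℕ)) (hij : i ≠ j) (hV : V.1 = {i, j}) :
    blockForm π e (lowSet p) V = e i ∧ blockForm π e (highSet p) V = e j := by
  rw [blockForm_pair hij hV, blockForm_pair hij hV, if_pos (mem_lowSet.2 hi),
    if_neg fun h => absurd (mem_lowSet.1 h) (by omega), if_neg fun h => absurd (mem_highSet.1 h) (by omega),
    if_pos (mem_highSet.2 hj), add_zero, zero_add]
  exact ⟨rfl, rfl⟩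

lemma blockForm_ne_zero_of_crossing (he : ∀ i, e i = 1 ∨ e i = -1) {V : {V // V ∈ π.parts}}
    (h : IsCrossing p V.1) (h2 : V.1.card = 2) :
    (blockForm π e (lowSet p) V = 1 ∨ blockForm π e (lowSet p) V = -1) ∧
      (blockForm π e (highSet p) V = 1 ∨ blockForm π e (highSet p) V = -1) := by
  obtain ⟨i, j, hi, hj, hij, hV⟩ := exists_of_isCrossing_of_card h h2
  obtain ⟨h3, h4⟩ := blockForm_crossing_pair (e := e) hi hj hij hV
  rw [h3, h4]
  exact ⟨he i, he j⟩

lemma card_add_le (h2 : ∀ V ∈ π.parts, 2 ≤ V.card) {V : Finset (Fin m)} (hV : V ∈ π.parts) :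
    V.card + 2 * Fintype.card {V // V ∈ π.parts} ≤ m + 2 := by
  have h1 := π.sum_card_parts
  rw [Finset.card_univ, Fintype.card_fin, ← Finset.add_sum_erase _ _ hV] at h1
  have h3 := Finset.card_nsmul_le_sum (π.parts.erase V) (fun W => W.card) 2 fun W hW =>
    h2 W (Finset.mem_of_mem_erase hW)
  rw [Finset.card_erase_of_mem hV, smul_eq_mul] at h3
  have : 1 ≤ π.parts.card := Finset.card_pos.2 ⟨V, hV⟩
  rw [Fintype.card_coe]
  omega

lemma card_add_card_add_le (h2 : ∀ V ∈ π.parts, 2 ≤ V.card) {V W : Finset (Fin m)} (hV : V ∈ π.parts)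
    (hW : W ∈ π.parts) (hne : V ≠ W) :
    V.card + W.card + 2 * Fintype.card {V // V ∈ π.parts} ≤ m + 4 := by
  have h1 := π.sum_card_parts
  have hW' : W ∈ π.parts.erase V := Finset.mem_erase.2 ⟨hne.symm, hW⟩
  rw [Finset.card_univ, Fintype.card_fin, ← Finset.add_sum_erase _ _ hV,
    ← Finset.add_sum_erase _ _ hW'] at h1
  have h3 := Finset.card_nsmul_le_sum ((π.parts.erase V).erase W) (fun W => W.card) 2 fun U hU =>
    h2 U (Finset.mem_of_mem_erase (Finset.mem_of_mem_erase hU))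
  rw [Finset.card_erase_of_mem hW', Finset.card_erase_of_mem hV, smul_eq_mul] at h3
  have : 1 ≤ (π.parts.erase V).card := Finset.card_pos.2 ⟨W, hW'⟩
  rw [Finset.card_erase_of_mem hV] at this
  rw [Fintype.card_coe]
  omega

lemma isPairing_of_le (h2 : ∀ V ∈ π.parts, 2 ≤ V.card)
    (h : m ≤ 2 * Fintype.card {V // V ∈ π.parts}) : IsPairing π := fun V hV => by
  have := card_add_le h2 hV
  have := h2 V hV
  omega

lemma mem_pairings₂_of_isCrossing {q : ℕ} {π : SetPartition (p + q)} (hπ : IsPairing π)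
    (h : ∃ V ∈ π.parts, IsCrossing p V) : π ∈ pairings₂ p q := by
  refine Finset.mem_filter.2 ⟨Finset.mem_filter.2 ⟨Finset.mem_univ _, hπ⟩, ?_⟩
  obtain ⟨V, hV, hc⟩ := h
  exact Finset.card_pos.2 ⟨V, Finset.mem_filter.2 ⟨hV, hc⟩⟩

/-- Either the balance equations cut the dimension, or the partition is of one of the two types
which contribute to the limit covariance. -/
theorem balance_trichotomy {q : ℕ} {π : SetPartition (p + q)} {e : Fin (p + q) → ℤ}
    (he : ∀ i, e i = 1 ∨ e i = -1)
    (h2 : ∀ V ∈ π.parts, 2 ≤ V.card) (hcr : ∃ V ∈ π.parts, IsCrossing p V) {N : ℕ}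
    (hN : N + 2 = p + q) :
    2 * Module.finrank ℝ (solutionSpace (blockForm π e (lowSet p)) (blockForm π e (highSet p))) + 1 ≤ N ∨
    (π ∈ pairings₂₄ p q ∧ blockForm π e (lowSet p) = 0 ∧ blockForm π e (highSet p) = 0) ∨
    (π ∈ pairings₂ p q ∧ ∀ z : {V // V ∈ π.parts} → ℝ, linForm (blockForm π e (lowSet p)) z = 0 →
      linForm (blockForm π e (highSet p)) z = 0) := by
  set f := blockForm π e (lowSet p) with hf
  set g := blockForm π e (highSet p) with hg
  obtain ⟨V₀, hV₀, hc₀⟩ := id hcr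
  have hle := finrank_solutionSpace_le f g
  -- If both equations are void, the dimension is at most the number of blocks. A crossing block
  -- then meets both halves in a positive even number of points, so it has at least four. A count of
  -- at least `N / 2` blocks leaves room only for one block of size four and pairs.
  by_cases h0 : f = 0 ∧ g = 0
  · by_cases hbig : 2 * Fintype.card {V // V ∈ π.parts} + 1 ≤ N
    · left; omega
    right; left
    refine ⟨?_, h0.1, h0.2⟩
    have hlow : ∀ V ∈ π.parts, Even (V.filter (· ∈ lowSet p)).card := fun V hV =>
      even_card_of_sum_eq_zero he _ (by rw [← blockForm_apply π e _ ⟨V, hV⟩, ← hf, h0.1]; rfl)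
    have hhigh : ∀ V ∈ π.parts, Even (V.filter (· ∈ highSet p)).card := fun V hV =>
      even_card_of_sum_eq_zero he _ (by rw [← blockForm_apply π e _ ⟨V, hV⟩, ← hg, h0.2]; rfl)
    have hncr : ∀ V ∈ π.parts, V.card = 2 → ¬ IsCrossing p V := fun V hV hc hcr => by
      have := (blockForm_ne_zero_of_crossing he (V := ⟨V, hV⟩) hcr hc).1
      rw [← hf, h0.1] at this
      simp at this
    have hsum : (V₀.filter (· ∈ lowSet p)).card + (V₀.filter (· ∈ highSet p)).card = V₀.card := by
      rw [← Finset.card_filter_add_card_filter_not (s := V₀) (· ∈ lowSet p)]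
      congr 2
      ext i
      simp [mem_lowSet, mem_highSet]
    obtain ⟨⟨i, hi, hip⟩, j, hj, hjp⟩ := id hc₀
    have hl1 : 0 < (V₀.filter (· ∈ lowSet p)).card :=
      Finset.card_pos.2 ⟨i, Finset.mem_filter.2 ⟨hi, mem_lowSet.2 hip⟩⟩
    have hh1 : 0 < (V₀.filter (· ∈ highSet p)).card :=
      Finset.card_pos.2 ⟨j, Finset.mem_filter.2 ⟨hj, mem_highSet.2 hjp⟩⟩
    obtain ⟨k, hk⟩ := hlow V₀ hV₀
    obtain ⟨k', hk'⟩ := hhigh V₀ hV₀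
    have hV₀c := card_add_le h2 hV₀
    refine Finset.mem_filter.2 ⟨Finset.mem_univ _, V₀, hV₀, by omega, ?_, fun V hV hne => ?_⟩
    · have : (V₀.filter fun i : Fin (p + q) => (i : ℕ) < p) = V₀.filter (· ∈ lowSet p) := by
        ext i; simp [mem_lowSet]
      rw [this]
      omega
    · have h3 := card_add_card_add_le h2 hV hV₀ hne
      have h4 := h2 V hV
      have h5 : V.card = 2 := by omega
      exact ⟨h5, hncr V hV h5⟩
  -- One nontrivial equation costs one dimension, so only pair partitions can reach `N / 2`. If the
  -- second equation does not follow from the first, a further dimension is lost.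
  · have h0' : f ≠ 0 ∨ g ≠ 0 := by
      by_contra h
      push Not at h
      exact h0 h
    have hlt := finrank_solutionSpace_lt h0'
    by_cases hbig : 2 * Fintype.card {V // V ∈ π.parts} + 1 ≤ p + q
    · left; omega
    have hpair : IsPairing π := isPairing_of_le h2 (by omega)
    by_cases hker : ∀ z : {V // V ∈ π.parts} → ℝ, linForm f z = 0 → linForm g z = 0
    · exact Or.inr (Or.inr ⟨mem_pairings₂_of_isCrossing hpair hcr, hker⟩)
    · left
      push Not at hker
      obtain ⟨z, hz1, hz2⟩ := hker
      have hf0 : f ≠ 0 := by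
        intro h
        have := (blockForm_ne_zero_of_crossing he (V := ⟨V₀, hV₀⟩) hc₀ (hpair V₀ hV₀)).1
        rw [← hf, h] at this
        simp at this
      have h3 := finrank_solutionSpace_lt (f := f) (g := 0) (Or.inl hf0)
      have h4 : solutionSpace f g < solutionSpace f 0 := by
        refine lt_of_le_of_ne (fun x hx => ⟨hx.1, by simp [linForm]⟩) fun h => hz2 ?_
        have : z ∈ solutionSpace f 0 := ⟨hz1, by simp [linForm]⟩
        rw [← h] at this
        exact this.2
      have h5 := Submodule.finrank_lt_finrank_of_lt h4
      have := two_mul_card_parts_of_isPairing hpair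
      omega

/-- The counterpart of `balance_trichotomy` for expectations: nothing is gained from centring, so
the threshold is `p + q` and void equations on a pair partition are the only leading case. -/
theorem balance_dichotomy {q : ℕ} {π : SetPartition (p + q)} {e : Fin (p + q) → ℤ}
    (h2 : ∀ V ∈ π.parts, 2 ≤ V.card) :
    2 * Module.finrank ℝ (solutionSpace (blockForm π e (lowSet p)) (blockForm π e (highSet p))) + 1 ≤
      p + q ∨
    (IsPairing π ∧ blockForm π e (lowSet p) = 0 ∧ blockForm π e (highSet p) = 0) := by
  set f := blockForm π e (lowSet p) with hf
  set g := blockForm π e (highSet p) with hg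
  have hle := finrank_solutionSpace_le f g
  by_cases hbig : 2 * Fintype.card {V // V ∈ π.parts} + 1 ≤ p + q
  · left; omega
  have hpair : IsPairing π := isPairing_of_le h2 (by omega)
  by_cases h0 : f = 0 ∧ g = 0
  · exact Or.inr ⟨hpair, h0⟩
  · left
    have hlt := finrank_solutionSpace_lt (f := f) (g := g) (by
      by_contra h
      push Not at h
      exact h0 h)
    have := two_mul_card_parts_of_isPairing hpair
    omega

lemma linForm_single_sub {ι : Type*} [Fintype ι] [DecidableEq ι] (f : ι → ℤ) (i j : ι) (x y : ℝ) :
    linForm f (Pi.single i x - Pi.single j y) = f i * x - f j * y := by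
  simp [linForm, mul_sub, Pi.single_apply]

/-- If the second balance equation follows from the first one, then the non-crossing blocks do not
occur in either of them, and on the crossing blocks they are proportional with ratio `± 1`. -/
lemma proportional_of_ker_le (hπ : IsPairing π) (he : ∀ i, e i = 1 ∨ e i = -1)
    (hcr : ∃ V ∈ π.parts, IsCrossing p V)
    (hker : ∀ z : {V // V ∈ π.parts} → ℝ, linForm (blockForm π e (lowSet p)) z = 0 →
      linForm (blockForm π e (highSet p)) z = 0) :
    (∀ V : {V // V ∈ π.parts}, ¬ IsCrossing p V.1 → blockForm π e (lowSet p) V = 0 ∧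
      blockForm π e (highSet p) V = 0) ∧
    ∃ t : ℤ, (t = 1 ∨ t = -1) ∧ ∀ V : {V // V ∈ π.parts}, IsCrossing p V.1 →
      blockForm π e (highSet p) V = -t * blockForm π e (lowSet p) V := by
  obtain ⟨U', hU', hcU⟩ := hcr
  let U : {V // V ∈ π.parts} := ⟨U', hU'⟩
  obtain ⟨hfU, hgU⟩ := blockForm_ne_zero_of_crossing he (V := U) hcU (hπ U' hU')
  have hrel : ∀ V, blockForm π e (highSet p) V * blockForm π e (lowSet p) U =
      blockForm π e (highSet p) U * blockForm π e (lowSet p) V := by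
    intro V
    -- The vector with entries `f U` at `V` and `-f V` at `U` solves the first equation; evaluating
    -- the second one at it makes all `2 × 2` minors vanish.
    have h1 := hker (Pi.single V (blockForm π e (lowSet p) U : ℝ) -
      Pi.single U (blockForm π e (lowSet p) V : ℝ)) (by rw [linForm_single_sub]; ring)
    rw [linForm_single_sub, sub_eq_zero] at h1
    exact_mod_cast h1
  refine ⟨fun V hV => ?_, -(blockForm π e (highSet p) U * blockForm π e (lowSet p) U), ?_, fun V _ => ?_⟩
  · have hr := hrel V
    rcases not_isCrossing_cases hV with ⟨-, h⟩ | ⟨h, -⟩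
    · have h0 : blockForm π e (highSet p) V = 0 := by rw [blockForm_apply, h, Finset.sum_empty]
      rw [h0, zero_mul] at hr
      refine ⟨?_, h0⟩
      rcases hgU with h' | h' <;> rw [h'] at hr <;> linarith
    · have h0 : blockForm π e (lowSet p) V = 0 := by rw [blockForm_apply, h, Finset.sum_empty]
      rw [h0, mul_zero] at hr
      refine ⟨h0, ?_⟩
      rcases hfU with h' | h' <;> rw [h'] at hr <;> linarith
  · rcases hfU with h | h <;> rcases hgU with h' | h' <;> simp [h, h']
  · have hr := hrel V
    rcases hfU with h | h <;> rw [h] at hr ⊢ <;> linarith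

end Classification

end SparseToeplitz
end

noncomputable section
namespace SparseToeplitz

/-! ### The limit covariances of Hankel matrices -/

section Hankel

open Classical

lemma firstSum_eq_linForm {m p : ℕ} (π : SetPartition m) (s : Fin m → ℝ) (e : Fin m → ℤ)
    (h : ∀ i, (e i : ℝ) = s i) (x : {V // V ∈ π.parts} → ℝ) :
    firstSum p π s x = linForm (blockForm π e (lowSet p)) x := by
  rw [linForm_blockForm, firstSum, lowSet]
  exact Finset.sum_congr rfl fun i _ => by rw [h]; rfl

lemma secondSum_eq_linForm {m p : ℕ} (π : SetPartition m) (s : Fin m → ℝ) (e : Fin m → ℤ)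
    (h : ∀ i, (e i : ℝ) = s i) (x : {V // V ∈ π.parts} → ℝ) :
    secondSum p π s x = linForm (blockForm π e (highSet p)) x := by
  rw [linForm_blockForm, secondSum, highSet]
  exact Finset.sum_congr rfl fun i _ => by rw [h]; rfl

lemma isSignDecomposition_one_id : IsSignDecomposition (fun _ => 1) id :=
  ⟨fun x => one_mul x, fun _ => Or.inl rfl⟩

/-- The first word has even length, so restarting the alternation at the second word agrees with the
parity of the overall position. -/
lemma stepSign_alternating {p m : ℕ} (i : Fin m) :
    stepSign (fun k => (-1) ^ k) (2 * p) i = (-1) ^ (i : ℕ) := by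
  unfold stepSign
  split_ifs with h
  · rfl
  · obtain ⟨k, hk⟩ := Nat.exists_eq_add_of_le (not_lt.1 h)
    rw [hk, Nat.add_sub_cancel_left, pow_add, pow_mul]
    simp

lemma hankelSign_eq {m : ℕ} (i : Fin m) : hankelSign i = (-1) ^ (i : ℕ) := by
  unfold hankelSign
  rw [pow_succ]; ring

lemma sum_alternating (p : ℕ) : ∑ i : Fin (2 * p), (-1 : ℤ) ^ (i : ℕ) = 0 := by
  rw [Fin.sum_univ_eq_sum_range (fun i => (-1 : ℤ) ^ i)]
  induction p with
  | zero => simp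
  | succ p ih =>
    rw [mul_add, mul_one, Finset.sum_range_succ, Finset.sum_range_succ, ih]
    simp [pow_succ]

lemma eq_of_blockOf_eq {P : Type*} [Fintype P] [DecidableEq P] {w : P → ℤ} {i j : P}
    (h : blockOf (kernel id w) i = blockOf (kernel id w) j) : w i = w j := blockOf_kernel_eq_iff.1 h

variable {Ω : Type*} [MeasurableSpace Ω] {μ : Measure Ω} [IsProbabilityMeasure μ]
  {a : ℤ → Ω → ℂ} {p q : ℕ}

lemma eq_of_mem_part {P : Type*} [Fintype P] [DecidableEq P] {w : P → ℤ} {V : Finset P}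
    (hV : V ∈ (kernel id w).parts) {i j : P} (hi : i ∈ V) (hj : j ∈ V) : w i = w j :=
  cl_eq_of_mem_part hV hi hj

lemma integral_prod_of_card {k : ℕ} {c : ℂ} (h : ∀ x, ∫ ω, a x ω ^ k ∂μ = c) {P : Type*} [Fintype P]
    [DecidableEq P] {w : P → ℤ} {V W : Finset P} (hV : V ∈ (kernel id w).parts) (hWV : W ⊆ V)
    (hk : W.card = k) (hk0 : k ≠ 0) : ∫ ω, ∏ i ∈ W, a (w i) ω ∂μ = c := by
  obtain ⟨i, hi⟩ := Finset.card_pos.1 (by omega : 0 < W.card)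
  rw [← h (w i)]
  refine integral_congr_ae (Eventually.of_forall fun ω => ?_)
  simp only
  rw [← hk, ← Finset.prod_const]
  exact Finset.prod_congr rfl fun j hj => by rw [eq_of_mem_part hV (hWV hj) (hWV hi)]

lemma card_parts_of_mem_pairings₂₄ {π : SetPartition (p + q)} (h : π ∈ pairings₂₄ p q) :
    p + q = 2 * Fintype.card {V // V ∈ π.parts} + 2 := by
  obtain ⟨W, hW, h4, -, h2⟩ := (Finset.mem_filter.1 h).2
  have h1 := π.sum_card_parts
  rw [Finset.card_univ, Fintype.card_fin, ← Finset.add_sum_erase _ _ hW, h4,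
    Finset.sum_congr rfl fun V hV => (h2 V (Finset.mem_of_mem_erase hV)
      (Finset.ne_of_mem_erase hV)).1, Finset.sum_const, Finset.card_erase_of_mem hW, smul_eq_mul] at h1
  have : 1 ≤ π.parts.card := Finset.card_pos.2 ⟨W, hW⟩
  rw [Fintype.card_coe]
  omega

lemma not_isPairing_of_mem_pairings₂₄ {π : SetPartition (p + q)} (h : π ∈ pairings₂₄ p q) :
    ¬ IsPairing π := by
  obtain ⟨W, hW, h4, -, h2⟩ := (Finset.mem_filter.1 h).2
  intro h'
  have := h' W hW
  omega

lemma exists_isCrossing_of_mem_pairings₂ {π : SetPartition (p + q)} (h : π ∈ pairings₂ p q) :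
    IsPairing π ∧ ∃ V ∈ π.parts, IsCrossing p V := by
  obtain ⟨h1, h2⟩ := Finset.mem_filter.1 h
  obtain ⟨V, hV⟩ := Finset.card_pos.1 (show 0 < crossingNumber p π from h2)
  exact ⟨(Finset.mem_filter.1 h1).2, V, (Finset.mem_filter.1 hV).1, (Finset.mem_filter.1 hV).2⟩

lemma card_filter_highSet {W : Finset (Fin (p + q))} (h4 : W.card = 4)
    (h2 : (W.filter fun i : Fin (p + q) => (i : ℕ) < p).card = 2) :
    (W.filter (· ∈ lowSet p)).card = 2 ∧ (W.filter (· ∈ highSet p)).card = 2 := by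
  have e1 : (W.filter fun i : Fin (p + q) => (i : ℕ) < p) = W.filter (· ∈ lowSet p) := by
    ext i; simp [mem_lowSet]
  have e2 : (W.filter fun i : Fin (p + q) => ¬ (i ∈ lowSet p)) = W.filter (· ∈ highSet p) := by
    ext i; simp [mem_lowSet, mem_highSet]
  have h := Finset.card_filter_add_card_filter_not (s := W) (· ∈ lowSet p)
  rw [e2] at h
  rw [e1] at h2
  omega

/-- With `sg = 1` and `cl = id` every word is leading for its own kernel with `E = 1`, so only the
kernel has to be classified. The remaining conditions in `hankelPairings` hold for the kernels that
reach the full dimension. -/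
theorem tendsto_hankelCov (ha : IsEntryFamily μ a id) (h2 : ∀ x, ∫ ω, a x ω ^ 2 ∂μ = 1) {κ : ℝ}
    (h4 : ∀ x, ∫ ω, a x ω ^ 4 ∂μ = κ) {β : ℕ → ℝ} (hβ : Tendsto β atTop atTop) {b : ℝ}
    (hβb : Tendsto (fun n : ℕ => β n / n) atTop (𝓝 b)) {S : ℕ → Finset ℤ} {B : Set ℝ}
    (hS : Approximates β S B) {C₀ C₁ : ℝ} (hC₀ : ∀ᶠ n in atTop, ∀ k ∈ S n, |(k : ℝ)| ≤ C₀ * β n)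
    (hcard : ∀ᶠ n in atTop, ((S n).card : ℝ) ≤ C₁ * β n) (p q : ℕ) (hp : 1 ≤ p) :
    Tendsto (fun n => ∫ ω, traceFluctuation μ a (β n) n (fun k => (-1) ^ k) (S n) (2 * p) ω *
      traceFluctuation μ a (β n) n (fun k => (-1) ^ k) (S n) (2 * q) ω ∂μ) atTop
      (𝓝 (hankelCov B b κ p q : ℂ)) := by
  obtain ⟨N, hN⟩ : ∃ N, N + 2 = 2 * p + 2 * q := ⟨2 * p + 2 * q - 2, by omega⟩
  obtain ⟨C, hC⟩ := ha.exists_norm_pairCov_le (2 * p) (2 * q)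
  set e : Fin (2 * p + 2 * q) → ℤ := fun i => (-1) ^ (i : ℕ) with he
  have hestep : ∀ i : Fin (2 * p + 2 * q), stepSign (fun k => (-1) ^ k) (2 * p) i * 1 = e i :=
    fun i => by rw [stepSign_alternating, mul_one]
  have hes : ∀ i, (e i : ℝ) = hankelSign i := fun i => by rw [hankelSign_eq]; simp [he]
  have he1 : ∀ i, e i = 1 ∨ e i = -1 := fun i => neg_one_pow_eq_or ℤ _
  have hdisjK : Disjoint (hankelPairings (2 * p) (2 * q)) (hankelPairings₂₄ (2 * p) (2 * q)) := by
    rw [Finset.disjoint_left]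
    intro π h h'
    exact not_isPairing_of_mem_pairings₂₄ (Finset.mem_filter.1 h').1
      (exists_isCrossing_of_mem_pairings₂ (Finset.mem_filter.1 h).1).1
  have hker : ∀ π ∈ hankelPairings (2 * p) (2 * q), ∀ z : {V // V ∈ π.parts} → ℝ,
      linForm (blockForm π e (lowSet (2 * p))) z = 0 → linForm (blockForm π e (highSet (2 * p))) z = 0 := by
    intro π hπ z hz
    have := (Finset.mem_filter.1 hπ).2.1 z
    rw [firstSum_eq_linForm π _ e hes, secondSum_eq_linForm π _ e hes] at this
    exact this hz
  have hmain := tendsto_sum_doubleWords (p := 2 * p) (q := 2 * q) (τ := fun k => (-1) ^ k)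
    isSignDecomposition_one_id hβ hcard N (pairCov μ a) hC
    (hankelPairings (2 * p) (2 * q) ∪ hankelPairings₂₄ (2 * p) (2 * q)) (fun π => π) (fun _ _ => 1)
    (fun π => if IsPairing π then 1 else (κ : ℂ) - 1)
    (fun π => if IsPairing π then typeI B b (2 * p) π hankelSign 1 else
      typeII B b (2 * p) π hankelSign 1) ?_ ?_ ?_ ?_
  · rw [Finset.sum_union hdisjK] at hmain
    have e1 : ∑ π ∈ hankelPairings (2 * p) (2 * q), (if IsPairing π then 1 else (κ : ℂ) - 1) *
        ((if IsPairing π then typeI B b (2 * p) π hankelSign 1 else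
          typeII B b (2 * p) π hankelSign 1 : ℝ) : ℂ) =
        ((∑ π ∈ hankelPairings (2 * p) (2 * q), typeI B b (2 * p) π hankelSign 1 : ℝ) : ℂ) := by
      push_cast
      refine Finset.sum_congr rfl fun π hπ => ?_
      have := (exists_isCrossing_of_mem_pairings₂ (Finset.mem_filter.1 hπ).1).1
      rw [if_pos this, if_pos this, one_mul]
    have e2 : ∑ π ∈ hankelPairings₂₄ (2 * p) (2 * q), (if IsPairing π then 1 else (κ : ℂ) - 1) *
        ((if IsPairing π then typeI B b (2 * p) π hankelSign 1 else
          typeII B b (2 * p) π hankelSign 1 : ℝ) : ℂ) =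
        (((κ - 1) * ∑ π ∈ hankelPairings₂₄ (2 * p) (2 * q), typeII B b (2 * p) π hankelSign 1 : ℝ) : ℂ) := by
      push_cast
      rw [Finset.mul_sum]
      refine Finset.sum_congr rfl fun π hπ => ?_
      have := not_isPairing_of_mem_pairings₂₄ (Finset.mem_filter.1 hπ).1
      rw [if_neg this, if_neg this]
    rw [e1, e2, ← Complex.ofReal_add] at hmain
    refine hmain.congr' ?_
    filter_upwards [hβ.eventually_gt_atTop 0] with n hn
    exact (ha.integral_traceFluctuation_mul hn n _ (S n) hN).symm
  · intro n w hw hne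
    have hsg : (fun i => stepSign (fun k => (-1) ^ k) (2 * p) i *
        (fun _ : Fin (2 * p + 2 * q) => (1 : ℤ)) i) = e := funext hestep
    have hlead : IsLeading id (kernel id w) (fun _ => 1) w :=
      ⟨rfl, fun i j hij => by rw [eq_of_blockOf_eq hij]⟩
    rcases balance_trichotomy he1 (fun V hV => ha.two_le_card_of_pairCov_ne_zero hne V hV)
      (ha.exists_isCrossing_of_pairCov_ne_zero hne) hN with h | ⟨h, hf, hg⟩ | ⟨h, hk⟩
    · right
      unfold patternDim
      rw [hsg]
      exact h
    · left
      refine ⟨_, Finset.mem_union_right _ (Finset.mem_filter.2 ⟨h, fun x => ?_⟩), hlead⟩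
      rw [firstSum_eq_linForm _ _ e hes, secondSum_eq_linForm _ _ e hes, hf, hg]
      simp [linForm]
    · left
      refine ⟨_, Finset.mem_union_left _ (Finset.mem_filter.2 ⟨h, fun x hx => ?_, fun V W hVW => ?_⟩),
        hlead⟩
      · rw [firstSum_eq_linForm _ _ e hes] at hx
        rw [secondSum_eq_linForm _ _ e hes]
        exact hk x hx
      · obtain ⟨h3, h4, -⟩ := mem_doubleWords.1 hw
        have h5 := (mem_closedWords_fstWord h3).1 h4
        -- The word itself is the solution that separates `V` and `W`: it is closed, and different
        -- blocks of its kernel carry different letters.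
        refine ⟨fun V => (blockValue _ id w V : ℝ), ?_, fun h6 => hVW ?_⟩
        · rw [firstSum_eq_linForm _ _ e hes, ← cast_linForm, linForm_blockForm]
          simp_rw [blockValue_blockOf (rfl : kernel id w = kernel id w)]
          have : ∑ i ∈ lowSet (2 * p), ((e i : ℤ) : ℤ) * id (w i) = 0 := by
            rw [← h5]
            refine Finset.sum_congr rfl fun i _ => ?_
            rw [← hestep, mul_one]; rfl
          rw [Int.cast_eq_zero]
          exact this
        · have h7 : w (rep _ V) = w (rep _ W) := Int.cast_injective (α := ℝ) h6
          rw [← blockOf_rep _ V, ← blockOf_rep _ W]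
          exact blockOf_kernel_eq_iff.2 h7
  · intro n w _ π _ π' _ h h'
    exact h.1.symm.trans h'.1
  · intro n w _ π hπ hlead
    obtain rfl : kernel id w = π := hlead.1
    rcases Finset.mem_union.1 hπ with h | h
    · obtain ⟨h1, h3⟩ := exists_isCrossing_of_mem_pairings₂ (Finset.mem_filter.1 h).1
      rw [if_pos h1, ha.pairCov_of_isPairing h1 h3]
      exact Finset.prod_eq_one fun V hV => integral_prod_of_card h2 hV subset_rfl (h1 V hV) two_ne_zero
    · have h1 := (Finset.mem_filter.1 h).1
      rw [if_neg (not_isPairing_of_mem_pairings₂₄ h1)]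
      obtain ⟨W, hW, hc4, hc2, hother⟩ := (Finset.mem_filter.1 h1).2
      obtain ⟨hc2, hc2'⟩ := card_filter_highSet hc4 hc2
      exact ha.pairCov_of_four hW (fun V hV hne => (hother V hV hne).2)
        (fun V hV hne => integral_prod_of_card h2 hV subset_rfl (hother V hV hne).1 two_ne_zero)
        (integral_prod_of_card h4 hW subset_rfl hc4 four_ne_zero)
        (integral_prod_of_card h2 hW (Finset.filter_subset _ _) hc2 two_ne_zero)
        (integral_prod_of_card h2 hW (Finset.filter_subset _ _) hc2' two_ne_zero)
  · intro π hπ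
    rcases Finset.mem_union.1 hπ with h | h
    · obtain ⟨h1, h3⟩ := exists_isCrossing_of_mem_pairings₂ (Finset.mem_filter.1 h).1
      rw [if_pos h1]
      obtain ⟨hnc, -⟩ := proportional_of_ker_le h1 he1 h3 (hker π h)
      refine tendsto_leading_typeI isSignDecomposition_one_id hβ hβb hS hC₀ hcard h1
        (fun _ => Or.inl rfl) (fun n i x hx => by rwa [one_mul]) (fun i x => by rw [one_mul])
        hankelSign 1 hestep (fun i _ => hes i) (fun i _ => by rw [one_mul, hes]) ?_ ?_ (hker π h) ?_ hN
      · intro V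
        by_cases hV : IsCrossing (2 * p) V.1
        · exact Or.inr (blockForm_ne_zero_of_crossing he1 hV (h1 V.1 V.2)).1
        · exact Or.inl (hnc V hV).1
      · obtain ⟨V, hV, hVc⟩ := h3
        have hV1 := (blockForm_ne_zero_of_crossing he1 (V := ⟨V, hV⟩) hVc (h1 V hV)).1
        have hV0 : blockForm π e (lowSet (2 * p)) ⟨V, hV⟩ ≠ 0 := by
          rcases hV1 with h | h <;> rw [h] <;> simp
        -- The alternating signs over the first `2 p` positions add up to `0`, so the vector of ones
        -- solves the equation. A single nonzero coefficient is thus impossible.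
        by_contra hcon
        push Not at hcon
        have hsum : linForm (blockForm π e (lowSet (2 * p))) (fun _ => (1 : ℤ)) = 0 := by
          rw [linForm_blockForm, sum_lowSet]
          simpa [he] using sum_alternating p
        unfold linForm at hsum
        rw [Finset.sum_eq_single ⟨V, hV⟩] at hsum
        · simp at hsum
          exact hV0 hsum
        · intro W _ hne
          rw [hcon ⟨V, hV⟩ W hne.symm hV0]
          simp
        · simp
      · intro V W hVW x y
        obtain ⟨z, hz1, hz2⟩ := (Finset.mem_filter.1 h).2.2 V W hVW
        rw [firstSum_eq_linForm _ _ e hes] at hz1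
        exact ⟨z, hz1, by simpa using hz2⟩
    · have h1 := (Finset.mem_filter.1 h).1
      rw [if_neg (not_isPairing_of_mem_pairings₂₄ h1)]
      have h0 := (Finset.mem_filter.1 h).2
      have hform : ∀ A : Finset (Fin (2 * p + 2 * q)), (∀ x : {V // V ∈ π.parts} → ℝ,
          linForm (blockForm π e A) x = 0) → blockForm π e A = 0 := by
        intro A hA
        funext V
        have := hA (Pi.single V 1)
        rw [linForm_single] at this
        exact_mod_cast this
      refine tendsto_leading_typeII isSignDecomposition_one_id hβ hβb hS hC₀ hcard
        (fun _ => Or.inl rfl) (fun n i x hx => by rwa [one_mul]) (fun i x => by rw [one_mul])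
        hankelSign 1 hestep (fun i _ => hes i) (fun i _ => by rw [one_mul, hes])
        (hform _ fun x => ?_) (hform _ fun x => ?_) ?_
      · rw [← firstSum_eq_linForm _ _ e hes]; exact (h0 x).1
      · rw [← secondSum_eq_linForm _ _ e hes]; exact (h0 x).2
      · have := card_parts_of_mem_pairings₂₄ h1
        omega

end Hankel

end SparseToeplitz
end

noncomputable section
namespace SparseToeplitz

/-! ### The limit covariances and limit moments of Toeplitz matrices -/

section Signs

open Classical

variable {m p q : ℕ}

/-- The Toeplitz signs as integers. -/
def intSign (π : SetPartition m) (i : Fin m) : ℤ :=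
  if (∀ j ∈ π.part i, i ≤ j) ∨ ((π.part i).card = 4 ∧ ∀ j ∈ π.part i, j ≤ i) then 1 else -1

lemma cast_intSign (π : SetPartition m) (i : Fin m) : (intSign π i : ℝ) = toeplitzSign π i := by
  unfold intSign toeplitzSign
  split_ifs <;> simp

lemma intSign_eq (π : SetPartition m) (i : Fin m) : intSign π i = 1 ∨ intSign π i = -1 := by
  unfold intSign
  split_ifs <;> simp

lemma exists_pair {π : SetPartition m} {V : Finset (Fin m)} (hV : V ∈ π.parts) (h2 : V.card = 2) :
    ∃ i j, i < j ∧ V = {i, j} ∧ intSign π i = 1 ∧ intSign π j = -1 := by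
  obtain ⟨i, j, hij, hVij⟩ : ∃ i j, i < j ∧ V = {i, j} := by
    obtain ⟨i, j, hne, h⟩ := Finset.card_eq_two.1 h2
    rcases lt_or_gt_of_ne hne with hlt | hlt
    · exact ⟨i, j, hlt, h⟩
    · exact ⟨j, i, hlt, by rw [h, Finset.pair_comm]⟩
  have hi : π.part i = V := (π.part_eq_iff_mem hV).2 (by rw [hVij]; simp)
  have hj : π.part j = V := (π.part_eq_iff_mem hV).2 (by rw [hVij]; simp)
  refine ⟨i, j, hij, hVij, ?_, ?_⟩
  · rw [intSign, hi, if_pos]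
    left
    rw [hVij]
    simp [hij.le]
  · rw [intSign, hj, if_neg]
    rintro (h | h)
    · exact absurd (h i (by rw [hVij]; simp)) (not_le.2 hij)
    · omega

/-- The signs along the block are `+, -, -, +`, so each half contributes `0` to its balance
equation. -/
lemma exists_four {π : SetPartition m} {W : Finset (Fin m)} (hW : W ∈ π.parts)
    (hl : (W.filter (· ∈ lowSet p)).card = 2) (hh : (W.filter (· ∈ highSet p)).card = 2) :
    ∃ i₁ i₂ i₃ i₄ : Fin m, i₁ < i₂ ∧ (i₂ : ℕ) < p ∧ p ≤ (i₃ : ℕ) ∧ i₃ < i₄ ∧ W = {i₁, i₂, i₃, i₄} ∧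
      W.filter (· ∈ lowSet p) = {i₁, i₂} ∧ W.filter (· ∈ highSet p) = {i₃, i₄} ∧
      intSign π i₁ = 1 ∧ intSign π i₂ = -1 ∧ intSign π i₃ = -1 ∧ intSign π i₄ = 1 := by
  have hpair : ∀ A : Finset (Fin m), A.card = 2 → ∃ i j, i < j ∧ A = {i, j} := by
    intro A hA
    obtain ⟨i, j, hne, h⟩ := Finset.card_eq_two.1 hA
    rcases lt_or_gt_of_ne hne with hlt | hlt
    · exact ⟨i, j, hlt, h⟩
    · exact ⟨j, i, hlt, by rw [h, Finset.pair_comm]⟩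
  obtain ⟨i₁, i₂, h12, hL⟩ := hpair _ hl
  obtain ⟨i₃, i₄, h34, hH⟩ := hpair _ hh
  have hmemL : ∀ i, i ∈ W.filter (· ∈ lowSet p) ↔ i = i₁ ∨ i = i₂ := by rw [hL]; simp
  have hmemH : ∀ i, i ∈ W.filter (· ∈ highSet p) ↔ i = i₃ ∨ i = i₄ := by rw [hH]; simp
  simp only [Finset.mem_filter, mem_lowSet, mem_highSet] at hmemL hmemH
  have m1 := (hmemL i₁).2 (Or.inl rfl)
  have m2 := (hmemL i₂).2 (Or.inr rfl)
  have m3 := (hmemH i₃).2 (Or.inl rfl)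
  have m4 := (hmemH i₄).2 (Or.inr rfl)
  have h23 : i₂ < i₃ := Fin.lt_def.2 (by omega)
  have hWe : W = {i₁, i₂, i₃, i₄} := by
    ext i
    simp only [Finset.mem_insert, Finset.mem_singleton]
    constructor
    · intro hi
      rcases lt_or_ge (i : ℕ) p with h | h
      · rcases (hmemL i).1 ⟨hi, h⟩ with h | h <;> simp [h]
      · rcases (hmemH i).1 ⟨hi, h⟩ with h | h <;> simp [h]
    · rintro (rfl | rfl | rfl | rfl)
      · exact m1.1
      · exact m2.1
      · exact m3.1
      · exact m4.1
  have h4 : W.card = 4 := by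
    rw [hWe, Finset.card_insert_of_notMem, Finset.card_insert_of_notMem, Finset.card_pair h34.ne]
    · simp [h23.ne, (h23.trans h34).ne]
    · simp [h12.ne, (h12.trans h23).ne, (h12.trans (h23.trans h34)).ne]
  have hpart : ∀ i ∈ W, π.part i = W := fun i hi => (π.part_eq_iff_mem hW).2 hi
  refine ⟨i₁, i₂, i₃, i₄, h12, m2.2, m3.2, h34, hWe, hL, hH, ?_, ?_, ?_, ?_⟩
  · rw [intSign, hpart _ m1.1, if_pos]
    left
    rw [hWe]
    simp [h12.le, (h12.trans h23).le, (h12.trans (h23.trans h34)).le]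
  · rw [intSign, hpart _ m2.1, if_neg]
    rintro (h | ⟨-, h⟩)
    · exact absurd (h i₁ m1.1) (not_le.2 h12)
    · exact absurd (h i₃ m3.1) (not_le.2 h23)
  · rw [intSign, hpart _ m3.1, if_neg]
    rintro (h | ⟨-, h⟩)
    · exact absurd (h i₂ m2.1) (not_le.2 h23)
    · exact absurd (h i₄ m4.1) (not_le.2 h34)
  · rw [intSign, hpart _ m4.1, if_pos]
    right
    refine ⟨h4, ?_⟩
    rw [hWe]
    simp [h34.le, (h23.trans h34).le, (h12.trans (h23.trans h34)).le]

/-- The signs `s i` on the first word and `t * s i` on the second one. -/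
def relativeSign (p : ℕ) (π : SetPartition m) (t : ℤ) (i : Fin m) : ℤ :=
  if (i : ℕ) < p then intSign π i else t * intSign π i

lemma relativeSign_eq {t : ℤ} (ht : t = 1 ∨ t = -1) (π : SetPartition m) (i : Fin m) :
    relativeSign p π t i = 1 ∨ relativeSign p π t i = -1 := by
  unfold relativeSign
  rcases ht with h | h <;> rcases intSign_eq π i with h' | h' <;> split_ifs <;> simp [h, h']

lemma same_side_of_not_isCrossing {i j : Fin m} (h : ¬ IsCrossing p ({i, j} : Finset (Fin m))) :
    (i : ℕ) < p ↔ (j : ℕ) < p := by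
  by_contra hcon
  apply h
  by_cases hi : (i : ℕ) < p
  · have hj : ¬ (j : ℕ) < p := fun hj => hcon (iff_of_true hi hj)
    exact ⟨⟨i, by simp, hi⟩, j, by simp, not_lt.1 hj⟩
  · have hj : (j : ℕ) < p := by
      by_contra hj
      exact hcon (iff_of_false hi hj)
    exact ⟨⟨j, by simp, hj⟩, i, by simp, not_lt.1 hi⟩

lemma lt_le_of_isCrossing {i j : Fin m} (hij : i < j) (h : IsCrossing p ({i, j} : Finset (Fin m))) :
    (i : ℕ) < p ∧ p ≤ (j : ℕ) := by
  have hlt := Fin.lt_def.1 hij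
  obtain ⟨⟨k, hk, hkp⟩, l, hl, hlp⟩ := h
  simp only [Finset.mem_insert, Finset.mem_singleton] at hk hl
  rcases hk with rfl | rfl <;> rcases hl with rfl | rfl <;> constructor <;> omega

lemma blockForm_noncrossing_pair {π : SetPartition m} {e : Fin m → ℤ} {V : {V // V ∈ π.parts}}
    {i j : Fin m} (hij : i ≠ j) (hV : V.1 = {i, j}) (h : ¬ IsCrossing p V.1) :
    (blockForm π e (lowSet p) V = 0 ∧ blockForm π e (highSet p) V = 0) ↔ e i + e j = 0 := by
  have hs := same_side_of_not_isCrossing (hV ▸ h)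
  rw [blockForm_pair hij hV, blockForm_pair hij hV]
  simp only [mem_lowSet, mem_highSet]
  by_cases hi : (i : ℕ) < p
  · have hj := hs.1 hi
    simp [hi, hj, not_le.2 hi, not_le.2 hj]
  · have hj : ¬ (j : ℕ) < p := fun h => hi (hs.2 h)
    simp [hi, hj, not_lt.1 hi, not_lt.1 hj]

/-- The sign of an integer, with the convention that `0` has sign `1`. -/
def unitSign (x : ℤ) : ℤ := if x < 0 then -1 else 1

lemma isSignDecomposition_unitSign : IsSignDecomposition unitSign fun x => |x| where
  eq x := by
    unfold unitSign
    split_ifs with h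
    · rw [abs_of_neg h]; ring
    · rw [abs_of_nonneg (not_lt.1 h)]; ring
  sign x := by
    unfold unitSign
    split_ifs <;> simp

lemma eq_neg_of_unitSign {x y : ℤ} (h : |x| = |y|) (hs : unitSign x + unitSign y = 0) : x = -y := by
  rw [← isSignDecomposition_unitSign.eq x, ← isSignDecomposition_unitSign.eq y]
  simp only [h]
  rw [eq_neg_of_add_eq_zero_left hs]
  ring

lemma isLeading_of_blocks {P : Type*} [Fintype P] [DecidableEq P] {cl : ℤ → ℤ} {w E : P → ℤ}
    (h : ∀ V ∈ (kernel cl w).parts, ∃ c, ∀ i ∈ V, E i * w i = c) : IsLeading cl (kernel cl w) E w := by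
  refine ⟨rfl, fun i j hij => ?_⟩
  obtain ⟨c, hc⟩ := h _ (blockOf (kernel cl w) i).2
  rw [hc i (mem_blockOf _ i), hc j (hij ▸ mem_blockOf _ j)]

lemma IsLeading.eq_of_mem {P : Type*} [Fintype P] [DecidableEq P] {cl : ℤ → ℤ} {w E : P → ℤ}
    {π : Finpartition (Finset.univ : Finset P)} (h : IsLeading cl π E w) {V : Finset P}
    (hV : V ∈ π.parts) {i j : P} (hi : i ∈ V) (hj : j ∈ V) : E i * w i = E j * w j :=
  h.2 i j (((blockOf_eq_iff π i ⟨V, hV⟩).2 hi).trans ((blockOf_eq_iff π j ⟨V, hV⟩).2 hj).symm)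

lemma IsLeading.neg_of_noncrossing {π : SetPartition m} {t : ℤ} (ht : t = 1 ∨ t = -1) {w : Fin m → ℤ}
    (h : IsLeading (fun x => |x|) π (relativeSign p π t) w) {V : Finset (Fin m)} (hV : V ∈ π.parts)
    (hcr : ¬ IsCrossing p V) {i j : Fin m} (hVij : V = {i, j}) (hi : intSign π i = 1)
    (hj : intSign π j = -1) : w j = -w i := by
  have h1 := h.eq_of_mem hV (i := i) (j := j) (by rw [hVij]; simp) (by rw [hVij]; simp)
  have hs := same_side_of_not_isCrossing (hVij ▸ hcr)
  unfold relativeSign at h1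
  rw [hi, hj] at h1
  by_cases hip : (i : ℕ) < p
  · rw [if_pos hip, if_pos (hs.1 hip)] at h1
    linarith
  · rw [if_neg hip, if_neg fun h => hip (hs.2 h)] at h1
    rcases ht with h | h <;> rw [h] at h1 <;> linarith

end Signs

end SparseToeplitz
end

noncomputable section
namespace SparseToeplitz

/-! ### Leading words in the Toeplitz models. -/

section Toeplitz

open Classical

/-- The mixed moments of the entries of Toeplitz matrices: `𝔼 |a x|² = 1`, `𝔼 (a x)² = η` and
`𝔼 |a x|⁴ = κ` for `x ≠ 0`, where `a (-x)` is the conjugate of `a x`. -/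
structure IsToeplitzFamily {Ω : Type*} [MeasurableSpace Ω] (μ : Measure Ω) (a : ℤ → Ω → ℂ)
    (η κ : ℝ) : Prop where
  entry : IsEntryFamily μ a fun x => |x|
  neg : ∀ x, x ≠ 0 → ∫ ω, a x ω * a (-x) ω ∂μ = 1
  sq : ∀ x, x ≠ 0 → ∫ ω, a x ω * a x ω ∂μ = η
  four : ∀ x, x ≠ 0 → ∫ ω, (a x ω * a (-x) ω) * (a x ω * a (-x) ω) ∂μ = κ

/-- The limit covariance in terms of `η = 𝔼 (a x)²`. -/
def toeplitzCovWith (η : ℝ) (B : Set ℝ) (b κ : ℝ) (p q : ℕ) : ℝ :=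
  ∑ π ∈ toeplitzPairings p q,
      (typeI B b p π (toeplitzSign π) 1 + η * typeI B b p π (toeplitzSign π) (-1)) +
    (κ - 1) * ∑ π ∈ pairings₂₄ p q,
      (typeII B b p π (toeplitzSign π) 1 + typeII B b p π (toeplitzSign π) (-1))

variable {Ω : Type*} [MeasurableSpace Ω] {μ : Measure Ω} [IsProbabilityMeasure μ]
  {a : ℤ → Ω → ℂ} {p q : ℕ} {η κ : ℝ}

lemma IsToeplitzFamily.integral_pair (ha : IsToeplitzFamily μ a η κ) {P : Type*} [DecidableEq P]
    {w : P → ℤ} {i j : P} (hij : i ≠ j) (h0 : w i ≠ 0) (h : w j = -w i) :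
    ∫ ω, ∏ k ∈ ({i, j} : Finset P), a (w k) ω ∂μ = 1 := by
  simp_rw [Finset.prod_pair hij, h]
  exact ha.neg _ h0

/-- Non-crossing pairs consist of opposite letters and contribute `1`. Crossing pairs consist of
opposite letters if `t = 1` and of equal letters if `t = -1`, each of the latter contributing `η`.
As `η` is `0` or `1`, the power of `η` over the crossing blocks is `η` itself. -/
lemma IsToeplitzFamily.pairCov_of_isLeading (ha : IsToeplitzFamily μ a η κ) (hη : η = 0 ∨ η = 1)
    {w : Fin (p + q) → ℤ} (hw : ∀ i, w i ≠ 0) {t : ℤ} (ht : t = 1 ∨ t = -1)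
    (hlead : IsLeading (fun x => |x|) (kernel (fun x => |x|) w)
      (relativeSign p (kernel (fun x => |x|) w) t) w)
    (hpair : IsPairing (kernel (fun x => |x|) w))
    (hcr : ∃ V ∈ (kernel (fun x => |x|) w).parts, IsCrossing p V) :
    pairCov μ a w = if t = 1 then 1 else (η : ℂ) := by
  have hval : ∀ V ∈ (kernel (fun x => |x|) w).parts, ∫ ω, ∏ i ∈ V, a (w i) ω ∂μ =
      if IsCrossing p V then (if t = 1 then 1 else (η : ℂ)) else 1 := by
    intro V hV
    obtain ⟨i, j, hij, hVij, hi, hj⟩ := exists_pair hV (hpair V hV)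
    by_cases hc : IsCrossing p V
    · rw [if_pos hc]
      obtain ⟨hip, hjp⟩ := lt_le_of_isCrossing hij (hVij ▸ hc)
      have h1 := hlead.eq_of_mem hV (i := i) (j := j) (by rw [hVij]; simp) (by rw [hVij]; simp)
      unfold relativeSign at h1
      rw [if_pos hip, if_neg (not_lt.2 hjp), hi, hj] at h1
      rcases ht with rfl | rfl
      · rw [if_pos rfl, hVij]
        exact ha.integral_pair hij.ne (hw i) (by linarith)
      · rw [if_neg (by decide), hVij]
        have h2 : w j = w i := by linarith
        simp_rw [Finset.prod_pair hij.ne, h2]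
        exact ha.sq _ (hw i)
    · rw [if_neg hc, hVij]
      exact ha.integral_pair hij.ne (hw i) (hlead.neg_of_noncrossing ht hV hc hVij hi hj)
  rw [ha.entry.pairCov_of_isPairing hpair hcr, Finset.prod_congr rfl hval, Finset.prod_ite,
    Finset.prod_const_one, mul_one, Finset.prod_const]
  have hpos : ((kernel (fun x => |x|) w).parts.filter (IsCrossing p)).card ≠ 0 := by
    obtain ⟨V, hV, hc⟩ := hcr
    exact Finset.card_ne_zero_of_mem (Finset.mem_filter.2 ⟨hV, hc⟩)
  split_ifs
  · exact one_pow _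
  · rcases hη with rfl | rfl
    · rw [Complex.ofReal_zero, zero_pow hpos]
    · rw [Complex.ofReal_one, one_pow]

/-- In each half the block of four consists of opposite letters. So it contributes the fourth
absolute moment jointly and `1` in each word separately, for both orientations. -/
lemma IsToeplitzFamily.pairCov_of_isLeading_four (ha : IsToeplitzFamily μ a η κ)
    {w : Fin (p + q) → ℤ} (hw : ∀ i, w i ≠ 0) {t : ℤ} (ht : t = 1 ∨ t = -1)
    (hlead : IsLeading (fun x => |x|) (kernel (fun x => |x|) w)
      (relativeSign p (kernel (fun x => |x|) w) t) w)
    (hπ : kernel (fun x => |x|) w ∈ pairings₂₄ p q) : pairCov μ a w = (κ : ℂ) - 1 := by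
  obtain ⟨W, hW, hc4, hc2, hother⟩ := (Finset.mem_filter.1 hπ).2
  obtain ⟨hc2, hc2'⟩ := card_filter_highSet hc4 hc2
  obtain ⟨i₁, i₂, i₃, i₄, h12, hi₂, hi₃, h34, hWe, hL, hH, s1, s2, s3, s4⟩ := exists_four hW hc2 hc2'
  have hlt12 := Fin.lt_def.1 h12
  have hlt34 := Fin.lt_def.1 h34
  have hE : relativeSign p (kernel (fun x => |x|) w) t i₁ = 1 ∧
      relativeSign p (kernel (fun x => |x|) w) t i₂ = -1 ∧
      relativeSign p (kernel (fun x => |x|) w) t i₃ = -t ∧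
      relativeSign p (kernel (fun x => |x|) w) t i₄ = t := by
    unfold relativeSign
    rw [if_pos (by omega), if_pos hi₂, if_neg (by omega), if_neg (by omega), s1, s2, s3, s4]
    simp
  have m1 : i₁ ∈ W := by rw [hWe]; simp
  have m2 : i₂ ∈ W := by rw [hWe]; simp
  have m3 : i₃ ∈ W := by rw [hWe]; simp
  have m4 : i₄ ∈ W := by rw [hWe]; simp
  have e12 := hlead.eq_of_mem hW m1 m2
  have e13 := hlead.eq_of_mem hW m1 m3
  have e14 := hlead.eq_of_mem hW m1 m4
  rw [hE.1, hE.2.1] at e12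
  rw [hE.1, hE.2.2.1] at e13
  rw [hE.1, hE.2.2.2] at e14
  have hw2 : w i₂ = -w i₁ := by linarith
  have hw4 : w i₄ = -w i₃ := by
    rcases ht with rfl | rfl <;> linarith
  refine ha.entry.pairCov_of_four hW (fun V hV hne => (hother V hV hne).2) (fun V hV hne => ?_) ?_ ?_ ?_
  · obtain ⟨h2, hnc⟩ := hother V hV hne
    obtain ⟨i, j, hij, hVij, hi, hj⟩ := exists_pair hV h2
    rw [hVij]
    exact ha.integral_pair hij.ne (hw i) (hlead.neg_of_noncrossing ht hV hnc hVij hi hj)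
  · rw [← ha.four (w i₁) (hw i₁)]
    refine integral_congr_ae (Eventually.of_forall fun ω => ?_)
    have hprod := Finset.prod_filter_mul_prod_filter_not W (· ∈ lowSet p) fun i => a (w i) ω
    have e2 : (W.filter fun i : Fin (p + q) => ¬ (i ∈ lowSet p)) = W.filter (· ∈ highSet p) := by
      ext i; simp [mem_lowSet, mem_highSet]
    rw [e2, hL, hH, Finset.prod_pair h12.ne, Finset.prod_pair h34.ne, hw2, hw4] at hprod
    simp only
    rw [← hprod]
    rcases ht with rfl | rfl
    · have : w i₃ = -w i₁ := by linarith
      rw [this, neg_neg]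
      ring
    · have : w i₃ = w i₁ := by linarith
      rw [this]
  · rw [hL]
    exact ha.integral_pair h12.ne (hw i₁) hw2
  · rw [hH]
    exact ha.integral_pair h34.ne (hw i₃) hw4

lemma stepSign_one {m : ℕ} (i : Fin m) : stepSign (fun _ => 1) p i = 1 := by
  unfold stepSign
  split_ifs <;> rfl

lemma abs_eq_of_mem_part {P : Type*} [Fintype P] [DecidableEq P] {w : P → ℤ} {V : Finset P}
    (hV : V ∈ (kernel (fun x => |x|) w).parts) {i j : P} (hi : i ∈ V) (hj : j ∈ V) : |w i| = |w j| :=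
  cl_eq_of_mem_part hV hi hj

lemma exists_const_of_pair {m : ℕ} {π : SetPartition m} {w : Fin m → ℤ} {t : ℤ} {V : Finset (Fin m)}
    {i j : Fin m} (hVij : V = {i, j}) (h : relativeSign p π t i * w i = relativeSign p π t j * w j) :
    ∃ c, ∀ k ∈ V, relativeSign p π t k * w k = c := by
  refine ⟨relativeSign p π t i * w i, fun k hk => ?_⟩
  rw [hVij, Finset.mem_insert, Finset.mem_singleton] at hk
  rcases hk with rfl | rfl
  · rfl
  · exact h.symm

lemma relativeSign_mul_eq_of_neg {m : ℕ} {π : SetPartition m} {w : Fin m → ℤ} {t : ℤ} {i j : Fin m}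
    (hs : (i : ℕ) < p ↔ (j : ℕ) < p) (hi : intSign π i = 1) (hj : intSign π j = -1)
    (hw : w i = -w j) : relativeSign p π t i * w i = relativeSign p π t j * w j := by
  unfold relativeSign
  by_cases hip : (i : ℕ) < p
  · rw [if_pos hip, if_pos (hs.1 hip), hi, hj, hw]; ring
  · rw [if_neg hip, if_neg fun h => hip (hs.2 h), hi, hj, hw]; ring

/-- In a non-crossing pair without contribution to the balance equations the letters are opposite. -/
lemma exists_const_of_noncrossing {m : ℕ} {w : Fin m → ℤ} (t : ℤ)
    {V : Finset (Fin m)} (hV : V ∈ (kernel (fun x => |x|) w).parts) (h2 : V.card = 2)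
    (hc : ¬ IsCrossing p V)
    (h0 : blockForm (kernel (fun x => |x|) w) (fun i => unitSign (w i)) (lowSet p) ⟨V, hV⟩ = 0 ∧
      blockForm (kernel (fun x => |x|) w) (fun i => unitSign (w i)) (highSet p) ⟨V, hV⟩ = 0) :
    ∃ c, ∀ k ∈ V, relativeSign p (kernel (fun x => |x|) w) t k * w k = c := by
  obtain ⟨i, j, hij, hVij, hi, hj⟩ := exists_pair hV h2
  have h1 := (blockForm_noncrossing_pair hij.ne hVij hc).1 h0
  have habs := abs_eq_of_mem_part hV (i := i) (j := j) (by rw [hVij]; simp) (by rw [hVij]; simp)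
  exact exists_const_of_pair hVij (relativeSign_mul_eq_of_neg
    (same_side_of_not_isCrossing (hVij ▸ hc)) hi hj (eq_neg_of_unitSign habs h1))

/-- Words of type II are leading. -/
lemma exists_isLeading_four {w : Fin (p + q) → ℤ} (hπ : kernel (fun x => |x|) w ∈ pairings₂₄ p q)
    (hf : blockForm (kernel (fun x => |x|) w) (fun i => unitSign (w i)) (lowSet p) = 0)
    (hg : blockForm (kernel (fun x => |x|) w) (fun i => unitSign (w i)) (highSet p) = 0) :
    ∃ t : ℤ, (t = 1 ∨ t = -1) ∧ IsLeading (fun x => |x|) (kernel (fun x => |x|) w)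
      (relativeSign p (kernel (fun x => |x|) w) t) w := by
  obtain ⟨W, hW, hc4, hc2, hother⟩ := (Finset.mem_filter.1 hπ).2
  obtain ⟨hc2, hc2'⟩ := card_filter_highSet hc4 hc2
  obtain ⟨i₁, i₂, i₃, i₄, h12, hi₂, hi₃, h34, hWe, hL, hH, s1, s2, s3, s4⟩ := exists_four hW hc2 hc2'
  have hlt12 := Fin.lt_def.1 h12
  have hlt34 := Fin.lt_def.1 h34
  have m1 : i₁ ∈ W := by rw [hWe]; simp
  have m2 : i₂ ∈ W := by rw [hWe]; simp
  have m3 : i₃ ∈ W := by rw [hWe]; simp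
  have m4 : i₄ ∈ W := by rw [hWe]; simp
  have hfW := congrFun hf ⟨W, hW⟩
  have hgW := congrFun hg ⟨W, hW⟩
  rw [blockForm_apply, hL, Finset.sum_pair h12.ne, Pi.zero_apply] at hfW
  rw [blockForm_apply, hH, Finset.sum_pair h34.ne, Pi.zero_apply] at hgW
  have e12 := eq_neg_of_unitSign (abs_eq_of_mem_part hW m1 m2) hfW
  have e34 := eq_neg_of_unitSign (abs_eq_of_mem_part hW m3 m4) hgW
  -- The orientation is read off from one letter of each half, which agree up to sign.
  obtain ⟨t, ht, h13⟩ : ∃ t : ℤ, (t = 1 ∨ t = -1) ∧ w i₁ = -t * w i₃ := by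
    rcases abs_eq_abs.1 (abs_eq_of_mem_part hW m1 m3) with h | h
    · exact ⟨-1, Or.inr rfl, by rw [h]; ring⟩
    · exact ⟨1, Or.inl rfl, by rw [h]; ring⟩
  refine ⟨t, ht, isLeading_of_blocks fun V hV => ?_⟩
  by_cases hVW : V = W
  · subst hVW
    refine ⟨w i₁, fun k hk => ?_⟩
    rw [hWe] at hk
    simp only [Finset.mem_insert, Finset.mem_singleton] at hk
    unfold relativeSign
    rcases hk with rfl | rfl | rfl | rfl
    · rw [if_pos (by omega), s1, one_mul]
    · rw [if_pos (by omega), s2, e12]; ring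
    · rw [if_neg (by omega), s3, h13]; ring
    · rw [if_neg (by omega), s4, h13, e34]; ring
  · obtain ⟨h2, hnc⟩ := hother V hV hVW
    exact exists_const_of_noncrossing t hV h2 hnc ⟨congrFun hf _, congrFun hg _⟩

/-- Words of type I are leading. -/
lemma exists_isLeading_pair {w : Fin (p + q) → ℤ} (hpair : IsPairing (kernel (fun x => |x|) w))
    (hcr : ∃ V ∈ (kernel (fun x => |x|) w).parts, IsCrossing p V)
    (hker : ∀ z : {V // V ∈ (kernel (fun x => |x|) w).parts} → ℝ,
      linForm (blockForm (kernel (fun x => |x|) w) (fun i => unitSign (w i)) (lowSet p)) z = 0 →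
      linForm (blockForm (kernel (fun x => |x|) w) (fun i => unitSign (w i)) (highSet p)) z = 0) :
    ∃ t : ℤ, (t = 1 ∨ t = -1) ∧ IsLeading (fun x => |x|) (kernel (fun x => |x|) w)
      (relativeSign p (kernel (fun x => |x|) w) t) w := by
  obtain ⟨hnc, t, ht, hprop⟩ := proportional_of_ker_le hpair
    (fun i => isSignDecomposition_unitSign.sign (w i)) hcr hker
  refine ⟨t, ht, isLeading_of_blocks fun V hV => ?_⟩
  by_cases hc : IsCrossing p V
  · obtain ⟨i, j, hij, hVij, hi, hj⟩ := exists_pair hV (hpair V hV)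
    obtain ⟨hip, hjp⟩ := lt_le_of_isCrossing hij (hVij ▸ hc)
    have h1 := hprop ⟨V, hV⟩ hc
    obtain ⟨h2, h3⟩ := blockForm_crossing_pair (π := kernel (fun x => |x|) w) (V := ⟨V, hV⟩)
      (e := fun i => unitSign (w i)) hip hjp hij.ne hVij
    rw [h2, h3] at h1
    have habs := abs_eq_of_mem_part hV (i := i) (j := j) (by rw [hVij]; simp) (by rw [hVij]; simp)
    refine exists_const_of_pair hVij ?_
    unfold relativeSign
    rw [if_pos hip, if_neg (not_lt.2 hjp), hi, hj]
    rw [← isSignDecomposition_unitSign.eq (w i), ← isSignDecomposition_unitSign.eq (w j), h1]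
    simp only [habs]
    rcases ht with rfl | rfl <;> ring
  · exact exists_const_of_noncrossing t hV (hpair V hV) hc (hnc ⟨V, hV⟩ hc)

/-- A closed pair of words without zero letters whose crossing blocks are pairs has at least three
crossing blocks. -/
lemma three_le_crossingNumber {w : Fin (p + q) → ℤ} (hw : ∀ i, w i ≠ 0)
    (hpair : IsPairing (kernel (fun x => |x|) w))
    (hcr : ∃ V ∈ (kernel (fun x => |x|) w).parts, IsCrossing p V)
    (hnc : ∀ V : {V // V ∈ (kernel (fun x => |x|) w).parts}, ¬ IsCrossing p V.1 →
      blockForm (kernel (fun x => |x|) w) (fun i => unitSign (w i)) (lowSet p) V = 0)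
    (hsum : ∑ i ∈ lowSet p, w i = 0) : 3 ≤ crossingNumber p (kernel (fun x => |x|) w) := by
  set π := kernel (fun x => |x|) w with hπ
  set f := blockForm π (fun i => unitSign (w i)) (lowSet p) with hf
  set z := blockValue π (fun x => |x|) w with hz
  have hlin : linForm f z = 0 := by
    rw [hf, linForm_blockForm, ← hsum]
    refine Finset.sum_congr rfl fun i _ => ?_
    rw [hz, blockValue_blockOf rfl, Int.cast_id]
    exact isSignDecomposition_unitSign.eq (w i)
  have hzpos : ∀ V, 0 < z V := fun V => abs_pos.2 (hw _)
  have hfc : ∀ V : {V // V ∈ π.parts}, IsCrossing p V.1 → f V = 1 ∨ f V = -1 := fun V hV =>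
    (blockForm_ne_zero_of_crossing (fun i => isSignDecomposition_unitSign.sign (w i)) hV
      (hpair V.1 V.2)).1
  have hsum2 : ∑ V ∈ Finset.univ.filter (fun V : {V // V ∈ π.parts} => IsCrossing p V.1), f V * z V = 0 := by
    have hl : (∑ V, if IsCrossing p V.1 then f V * z V else 0) = linForm f z := by
      refine Finset.sum_congr rfl fun V _ => ?_
      split_ifs with h
      · simp
      · rw [hnc V h]; simp
    rw [Finset.sum_filter, hl, hlin]
  have hcard : crossingNumber p π =
      (Finset.univ.filter fun V : {V // V ∈ π.parts} => IsCrossing p V.1).card := by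
    unfold crossingNumber
    refine Finset.card_bij' (fun V hV => ⟨V, (Finset.mem_filter.1 hV).1⟩) (fun V _ => V.1) ?_ ?_ ?_ ?_
    · intro V hV
      exact Finset.mem_filter.2 ⟨Finset.mem_univ _, (Finset.mem_filter.1 hV).2⟩
    · intro V hV
      exact Finset.mem_filter.2 ⟨V.2, (Finset.mem_filter.1 hV).2⟩
    · intro V _; rfl
    · intro V _; rfl
  rw [hcard]
  set T := Finset.univ.filter fun V : {V // V ∈ π.parts} => IsCrossing p V.1 with hT
  have hTc : ∀ V ∈ T, f V = 1 ∨ f V = -1 := fun V hV => hfc V (Finset.mem_filter.1 hV).2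
  by_contra hlt
  have hpos : 0 < T.card := by
    obtain ⟨V, hV, hc⟩ := hcr
    exact Finset.card_pos.2 ⟨⟨V, hV⟩, Finset.mem_filter.2 ⟨Finset.mem_univ _, hc⟩⟩
  -- The block values are positive absolute values. One crossing block would give `± z = 0`; two
  -- would give `z V = z W`, which merges different blocks of the kernel.
  rcases (by omega : T.card = 1 ∨ T.card = 2) with h1 | h2
  · obtain ⟨V, hV⟩ := Finset.card_eq_one.1 h1
    rw [hV, Finset.sum_singleton] at hsum2
    have := hzpos V
    rcases hTc V (by rw [hV]; simp) with h | h <;> rw [h] at hsum2 <;> linarith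
  · obtain ⟨V, W, hne, hVW⟩ := Finset.card_eq_two.1 h2
    rw [hVW, Finset.sum_pair hne] at hsum2
    have hV := hzpos V
    have hW := hzpos W
    have heq : z V = z W := by
      rcases hTc V (by rw [hVW]; simp) with h | h <;> rcases hTc W (by rw [hVW]; simp) with h' | h' <;>
        rw [h, h'] at hsum2 <;> linarith
    refine hne ?_
    rw [← blockOf_rep π V, ← blockOf_rep π W]
    exact blockOf_kernel_eq_iff.2 heq

end Toeplitz

end SparseToeplitz
end

noncomputable section
namespace SparseToeplitz

/-! ### Limits of the covariances of Toeplitz matrices. -/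

section ToeplitzLimits

open Classical

variable {p q : ℕ}

lemma relativeSign_add_eq_zero {m : ℕ} {π : SetPartition m} {t : ℤ} {i j : Fin m}
    (hs : (i : ℕ) < p ↔ (j : ℕ) < p) (h : intSign π i + intSign π j = 0) :
    relativeSign p π t i + relativeSign p π t j = 0 := by
  unfold relativeSign
  by_cases hip : (i : ℕ) < p
  · rw [if_pos hip, if_pos (hs.1 hip), h]
  · rw [if_neg hip, if_neg fun h => hip (hs.2 h), ← mul_add, h, mul_zero]

lemma blockForm_relativeSign_noncrossing {m : ℕ} {π : SetPartition m} (t : ℤ) {V : {V // V ∈ π.parts}}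
    (h2 : V.1.card = 2) (hc : ¬ IsCrossing p V.1) :
    blockForm π (relativeSign p π t) (lowSet p) V = 0 ∧
      blockForm π (relativeSign p π t) (highSet p) V = 0 := by
  obtain ⟨i, j, hij, hVij, hi, hj⟩ := exists_pair V.2 h2
  exact (blockForm_noncrossing_pair hij.ne hVij hc).2
    (relativeSign_add_eq_zero (same_side_of_not_isCrossing (hVij ▸ hc)) (by rw [hi, hj]; rfl))

lemma blockForm_relativeSign_crossing {m : ℕ} {π : SetPartition m} (t : ℤ) {V : {V // V ∈ π.parts}}
    (h2 : V.1.card = 2) (hc : IsCrossing p V.1) :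
    blockForm π (relativeSign p π t) (lowSet p) V = 1 ∧
      blockForm π (relativeSign p π t) (highSet p) V = -t := by
  obtain ⟨i, j, hij, hVij, hi, hj⟩ := exists_pair V.2 h2
  obtain ⟨hip, hjp⟩ := lt_le_of_isCrossing hij (hVij ▸ hc)
  obtain ⟨h3, h4⟩ := blockForm_crossing_pair (e := relativeSign p π t) hip hjp hij.ne hVij
  rw [h3, h4]
  unfold relativeSign
  rw [if_pos hip, if_neg (not_lt.2 hjp), hi, hj]
  simp

lemma blockForm_relativeSign_four {π : SetPartition (p + q)} (hπ : π ∈ pairings₂₄ p q) (t : ℤ) :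
    blockForm π (relativeSign p π t) (lowSet p) = 0 ∧
      blockForm π (relativeSign p π t) (highSet p) = 0 := by
  obtain ⟨W, hW, hc4, hc2, hother⟩ := (Finset.mem_filter.1 hπ).2
  obtain ⟨hc2, hc2'⟩ := card_filter_highSet hc4 hc2
  obtain ⟨i₁, i₂, i₃, i₄, h12, hi₂, hi₃, h34, hWe, hL, hH, s1, s2, s3, s4⟩ := exists_four hW hc2 hc2'
  have hlt12 := Fin.lt_def.1 h12
  have hlt34 := Fin.lt_def.1 h34
  have key : ∀ V : {V // V ∈ π.parts}, blockForm π (relativeSign p π t) (lowSet p) V = 0 ∧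
      blockForm π (relativeSign p π t) (highSet p) V = 0 := by
    intro V
    by_cases hVW : V.1 = W
    · rw [blockForm_apply, blockForm_apply, hVW, hL, hH, Finset.sum_pair h12.ne,
        Finset.sum_pair h34.ne]
      refine ⟨relativeSign_add_eq_zero (by omega) (by rw [s1, s2]; rfl),
        relativeSign_add_eq_zero (by omega) (by rw [s3, s4]; rfl)⟩
    · obtain ⟨h2, hnc⟩ := hother V V.2 hVW
      exact blockForm_relativeSign_noncrossing t h2 hnc
  exact ⟨funext fun V => (key V).1, funext fun V => (key V).2⟩

/-- A crossing block compares a letter of the first word with a nonzero letter of the second, and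
the ratio determines `t`. -/
lemma IsLeading.sign_unique {π : SetPartition (p + q)} {w : Fin (p + q) → ℤ} (hw : ∀ i, w i ≠ 0)
    {t t' : ℤ} (h : IsLeading (fun x => |x|) π (relativeSign p π t) w)
    (h' : IsLeading (fun x => |x|) π (relativeSign p π t') w) (hcr : ∃ V ∈ π.parts, IsCrossing p V) :
    t = t' := by
  obtain ⟨V, hV, ⟨i, hi, hip⟩, j, hj, hjp⟩ := hcr
  have h1 := h.eq_of_mem hV hi hj
  have h2 := h'.eq_of_mem hV hi hj
  unfold relativeSign at h1 h2
  rw [if_pos hip, if_neg (not_lt.2 hjp)] at h1 h2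
  rw [h1, mul_assoc, mul_assoc] at h2
  refine mul_right_cancel₀ (mul_ne_zero ?_ (hw j)) h2
  rcases intSign_eq π j with h | h <;> rw [h] <;> simp

lemma exists_crossing_ne {π : SetPartition (p + q)} (h3 : 3 ≤ crossingNumber p π)
    (V W : {V // V ∈ π.parts}) : ∃ U : {V // V ∈ π.parts}, IsCrossing p U.1 ∧ U ≠ V ∧ U ≠ W := by
  have : ((π.parts.filter (IsCrossing p)) \ {V.1, W.1}).Nonempty := by
    rw [← Finset.card_pos]
    have h1 := Finset.le_card_sdiff {V.1, W.1} (π.parts.filter (IsCrossing p))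
    have h2 : ({V.1, W.1} : Finset (Finset (Fin (p + q)))).card ≤ 2 := Finset.card_le_two
    unfold crossingNumber at h3
    omega
  obtain ⟨U, hU⟩ := this
  simp only [Finset.mem_sdiff, Finset.mem_filter, Finset.mem_insert, Finset.mem_singleton, not_or] at hU
  exact ⟨⟨U, hU.1.1⟩, hU.1.2, fun h => hU.2.1 (congrArg Subtype.val h),
    fun h => hU.2.2 (congrArg Subtype.val h)⟩

variable {β : ℕ → ℝ} {b : ℝ} {S : ℕ → Finset ℤ} {B : Set ℝ} {C₀ C₁ : ℝ}

/-- The second balance form is `-t` times the first, so the first equation implies the second. Three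
crossing blocks leave enough freedom to separate any two unknowns. -/
lemma tendsto_leading_toeplitzPairings (hβ : Tendsto β atTop atTop)
    (hβb : Tendsto (fun n : ℕ => β n / n) atTop (𝓝 b)) (hS : Approximates β S B)
    (hC₀ : ∀ᶠ n in atTop, ∀ k ∈ S n, |(k : ℝ)| ≤ C₀ * β n)
    (hcard : ∀ᶠ n in atTop, ((S n).card : ℝ) ≤ C₁ * β n) (hneg : ∀ n, ∀ x ∈ S n, -x ∈ S n)
    {π : SetPartition (p + q)} (hπ : π ∈ toeplitzPairings p q) {t : ℤ} (ht : t = 1 ∨ t = -1)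
    {N : ℕ} (hN : N + 2 = p + q) :
    Tendsto (fun n => ((∑ w ∈ (doubleWords (fun _ => 1) (S n) p q).filter
      (IsLeading (fun x => |x|) π (relativeSign p π t)), pairCount n (fun _ => 1) w : ℕ) : ℝ) *
        scale (β n) N n) atTop (𝓝 (typeI B b p π (toeplitzSign π) t)) := by
  obtain ⟨hπ2, h3⟩ := Finset.mem_filter.1 hπ
  have hpair := (exists_isCrossing_of_mem_pairings₂ hπ2).1
  have hE := relativeSign_eq (p := p) ht π
  have hprop : ∀ V, blockForm π (relativeSign p π t) (highSet p) V =
      -t * blockForm π (relativeSign p π t) (lowSet p) V := by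
    intro V
    by_cases hc : IsCrossing p V.1
    · obtain ⟨h1, h2⟩ := blockForm_relativeSign_crossing t (hpair V.1 V.2) hc
      rw [h1, h2, mul_one]
    · obtain ⟨h1, h2⟩ := blockForm_relativeSign_noncrossing t (hpair V.1 V.2) hc
      rw [h1, h2, mul_zero]
  have hcross := fun (V : {V // V ∈ π.parts}) (hc : IsCrossing p V.1) =>
    (blockForm_relativeSign_crossing t (hpair V.1 V.2) hc).1
  refine tendsto_leading_typeI isSignDecomposition_unitSign hβ hβb hS hC₀ hcard hpair hE
    (fun n i x hx => ?_) (fun i x => ?_) (toeplitzSign π) t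
    (e := relativeSign p π t) (fun i => by rw [stepSign_one, one_mul]) (fun i hi => ?_)
    (fun i hi => ?_) (fun V => ?_) ?_ (fun z hz => ?_) (fun V W hVW x y => ?_) hN
  · rcases hE i with h | h <;> rw [h]
    · rwa [one_mul]
    · rw [neg_one_mul]; exact hneg n x hx
  · rcases hE i with h | h <;> rw [h] <;> simp
  · rw [relativeSign, if_pos hi, cast_intSign]
  · rw [relativeSign, if_neg (not_lt.2 hi), Int.cast_mul, cast_intSign]
  · by_cases hc : IsCrossing p V.1
    · exact Or.inr (Or.inl (hcross V hc))
    · exact Or.inl (blockForm_relativeSign_noncrossing t (hpair V.1 V.2) hc).1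
  · obtain ⟨V, hV, -⟩ := Finset.exists_mem_ne (show 1 < (π.parts.filter (IsCrossing p)).card by
      unfold crossingNumber at h3; omega) ∅
    obtain ⟨hV1, hV2⟩ := Finset.mem_filter.1 hV
    obtain ⟨U, hU, hne, -⟩ := exists_crossing_ne h3 ⟨V, hV1⟩ ⟨V, hV1⟩
    refine ⟨U, ⟨V, hV1⟩, hne, ?_, ?_⟩
    · rw [hcross U hU]; exact one_ne_zero
    · rw [hcross ⟨V, hV1⟩ hV2]; exact one_ne_zero
  · have : linForm (blockForm π (relativeSign p π t) (highSet p)) z =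
        -t * linForm (blockForm π (relativeSign p π t) (lowSet p)) z := by
      unfold linForm
      rw [Finset.mul_sum]
      refine Finset.sum_congr rfl fun V _ => ?_
      rw [hprop V]
      push_cast
      ring
    rw [this, hz, mul_zero]
  · by_cases hc : IsCrossing p V.1
    -- A third crossing block compensates the unknown of `V`, while that of `W` stays `0`.
    · obtain ⟨U, hU, hUV, hUW⟩ := exists_crossing_ne h3 V W
      refine ⟨Pi.single V 1 - Pi.single U 1, ?_, ?_⟩
      · rw [linForm_single_sub, hcross V hc, hcross U hU]; simp
      · simp [hUV.symm, hUW.symm, hVW.symm]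
    · refine ⟨Pi.single V 1, ?_, ?_⟩
      · rw [linForm_single, (blockForm_relativeSign_noncrossing t (hpair V.1 V.2) hc).1]; simp
      · simp [hVW.symm]

lemma tendsto_leading_relativeSign (hβ : Tendsto β atTop atTop)
    (hβb : Tendsto (fun n : ℕ => β n / n) atTop (𝓝 b)) (hS : Approximates β S B)
    (hC₀ : ∀ᶠ n in atTop, ∀ k ∈ S n, |(k : ℝ)| ≤ C₀ * β n)
    (hcard : ∀ᶠ n in atTop, ((S n).card : ℝ) ≤ C₁ * β n) (hneg : ∀ n, ∀ x ∈ S n, -x ∈ S n)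
    {π : SetPartition (p + q)} {t : ℤ} (ht : t = 1 ∨ t = -1)
    (hf : blockForm π (relativeSign p π t) (lowSet p) = 0)
    (hg : blockForm π (relativeSign p π t) (highSet p) = 0)
    {N : ℕ} (hN : N = 2 * Fintype.card {V // V ∈ π.parts}) :
    Tendsto (fun n => ((∑ w ∈ (doubleWords (fun _ => 1) (S n) p q).filter
      (IsLeading (fun x => |x|) π (relativeSign p π t)), pairCount n (fun _ => 1) w : ℕ) : ℝ) *
        scale (β n) N n) atTop (𝓝 (typeII B b p π (toeplitzSign π) t)) := by
  have hE := relativeSign_eq (p := p) ht π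
  refine tendsto_leading_typeII isSignDecomposition_unitSign hβ hβb hS hC₀ hcard hE
    (fun n i x hx => ?_) (fun i x => ?_) (toeplitzSign π) t
    (e := relativeSign p π t) (fun i => by rw [stepSign_one, one_mul]) (fun i hi => ?_)
    (fun i hi => ?_) hf hg hN
  · rcases hE i with h | h <;> rw [h]
    · rwa [one_mul]
    · rw [neg_one_mul]; exact hneg n x hx
  · rcases hE i with h | h <;> rw [h] <;> simp
  · rw [relativeSign, if_pos hi, cast_intSign]
  · rw [relativeSign, if_neg (not_lt.2 hi), Int.cast_mul, cast_intSign]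

variable {Ω : Type*} [MeasurableSpace Ω] {μ : Measure Ω} [IsProbabilityMeasure μ]
  {a : ℤ → Ω → ℂ} {η κ : ℝ}

set_option maxHeartbeats 600000 in
-- The leading families are indexed by a partition and an orientation `t = ±1`. Their weights are
-- `1` and `η` for pair partitions, and `κ - 1` for both orientations of the partitions with a block
-- of four.
theorem tendsto_toeplitzCovWith (ha : IsToeplitzFamily μ a η κ) (hη : η = 0 ∨ η = 1)
    (hβ : Tendsto β atTop atTop)
    (hβb : Tendsto (fun n : ℕ => β n / n) atTop (𝓝 b)) (hS : Approximates β S B)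
    (hC₀ : ∀ᶠ n in atTop, ∀ k ∈ S n, |(k : ℝ)| ≤ C₀ * β n)
    (hcard : ∀ᶠ n in atTop, ((S n).card : ℝ) ≤ C₁ * β n) (hneg : ∀ n, ∀ x ∈ S n, -x ∈ S n)
    (h0 : ∀ n, (0 : ℤ) ∉ S n) (p q : ℕ) (hp : 2 ≤ p) :
    Tendsto (fun n => ∫ ω, traceFluctuation μ a (β n) n (fun _ => 1) (S n) p ω *
      traceFluctuation μ a (β n) n (fun _ => 1) (S n) q ω ∂μ) atTop
      (𝓝 (toeplitzCovWith η B b κ p q : ℂ)) := by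
  obtain ⟨N, hN⟩ : ∃ N, N + 2 = p + q := ⟨p + q - 2, by omega⟩
  obtain ⟨C, hC⟩ := ha.entry.exists_norm_pairCov_le p q
  have hcrossing : ∀ π ∈ toeplitzPairings p q ∪ pairings₂₄ p q, ∃ V ∈ π.parts, IsCrossing p V := by
    intro π hπ
    rcases Finset.mem_union.1 hπ with h | h
    · exact (exists_isCrossing_of_mem_pairings₂ (Finset.mem_filter.1 h).1).2
    · obtain ⟨W, hW, hc4, hc2, -⟩ := (Finset.mem_filter.1 h).2
      obtain ⟨hc2, hc2'⟩ := card_filter_highSet hc4 hc2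
      obtain ⟨i, hi⟩ := Finset.card_pos.1 (by omega : 0 < (W.filter (· ∈ lowSet p)).card)
      obtain ⟨j, hj⟩ := Finset.card_pos.1 (by omega : 0 < (W.filter (· ∈ highSet p)).card)
      rw [Finset.mem_filter] at hi hj
      exact ⟨W, hW, ⟨i, hi.1, mem_lowSet.1 hi.2⟩, j, hj.1, mem_highSet.1 hj.2⟩
  have hdisjK : Disjoint (toeplitzPairings p q) (pairings₂₄ p q) := by
    rw [Finset.disjoint_left]
    intro π h h'
    exact not_isPairing_of_mem_pairings₂₄ h'
      (exists_isCrossing_of_mem_pairings₂ (Finset.mem_filter.1 h).1).1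
  have hsign : ∀ k ∈ (toeplitzPairings p q ∪ pairings₂₄ p q) ×ˢ ({1, -1} : Finset ℤ),
      k.2 = 1 ∨ k.2 = -1 := fun k hk => by simpa using (Finset.mem_product.1 hk).2
  have hletter : ∀ n, ∀ w ∈ doubleWords (fun _ => 1) (S n) p q, ∀ i, w i ≠ 0 := fun n w hw i h =>
    h0 n (h ▸ (mem_doubleWords.1 hw).1 i)
  have hmain := tendsto_sum_doubleWords (p := p) (q := q) (τ := fun _ => 1)
    isSignDecomposition_unitSign hβ hcard N (pairCov μ a) hC
    ((toeplitzPairings p q ∪ pairings₂₄ p q) ×ˢ {1, -1}) (fun k => k.1)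
    (fun k => relativeSign p k.1 k.2)
    (fun k => if IsPairing k.1 then (if k.2 = 1 then 1 else (η : ℂ)) else (κ : ℂ) - 1)
    (fun k => if IsPairing k.1 then typeI B b p k.1 (toeplitzSign k.1) k.2 else
      typeII B b p k.1 (toeplitzSign k.1) k.2) ?_ ?_ ?_ ?_
  · rw [Finset.sum_product, Finset.sum_union hdisjK] at hmain
    have hne : (1 : ℤ) ≠ -1 := by decide
    have e1 : (∑ π ∈ toeplitzPairings p q, ∑ t ∈ ({1, -1} : Finset ℤ),
        (if IsPairing π then (if t = 1 then 1 else (η : ℂ)) else (κ : ℂ) - 1) *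
        ((if IsPairing π then typeI B b p π (toeplitzSign π) t else
          typeII B b p π (toeplitzSign π) t : ℝ) : ℂ)) =
        ((∑ π ∈ toeplitzPairings p q, (typeI B b p π (toeplitzSign π) 1 +
          η * typeI B b p π (toeplitzSign π) (-1)) : ℝ) : ℂ) := by
      push_cast
      refine Finset.sum_congr rfl fun π hπ => ?_
      have := (exists_isCrossing_of_mem_pairings₂ (Finset.mem_filter.1 hπ).1).1
      rw [Finset.sum_pair hne]
      simp [this, hne.symm]
    have e2 : (∑ π ∈ pairings₂₄ p q, ∑ t ∈ ({1, -1} : Finset ℤ),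
        (if IsPairing π then (if t = 1 then 1 else (η : ℂ)) else (κ : ℂ) - 1) *
        ((if IsPairing π then typeI B b p π (toeplitzSign π) t else
          typeII B b p π (toeplitzSign π) t : ℝ) : ℂ)) =
        (((κ - 1) * ∑ π ∈ pairings₂₄ p q, (typeII B b p π (toeplitzSign π) 1 +
          typeII B b p π (toeplitzSign π) (-1)) : ℝ) : ℂ) := by
      push_cast
      rw [Finset.mul_sum]
      refine Finset.sum_congr rfl fun π hπ => ?_
      have := not_isPairing_of_mem_pairings₂₄ hπ
      rw [Finset.sum_pair hne]
      simp [this, mul_add]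
    rw [e1, e2, ← Complex.ofReal_add] at hmain
    refine hmain.congr' ?_
    filter_upwards [hβ.eventually_gt_atTop 0] with n hn
    exact (ha.entry.integral_traceFluctuation_mul hn n _ (S n) hN).symm
  · intro n w hw hne
    have hsg : (fun i => stepSign (fun _ => 1) p i * unitSign (w i)) = fun i => unitSign (w i) :=
      funext fun i => by rw [stepSign_one, one_mul]
    have hcr := ha.entry.exists_isCrossing_of_pairCov_ne_zero hne
    have he := fun i => isSignDecomposition_unitSign.sign (w i)
    rcases balance_trichotomy he (fun V hV => ha.entry.two_le_card_of_pairCov_ne_zero hne V hV)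
      hcr hN with h | ⟨h, hf, hg⟩ | ⟨h, hk⟩
    · right
      unfold patternDim
      rw [hsg]
      exact h
    · left
      obtain ⟨t, ht, hlead⟩ := exists_isLeading_four h hf hg
      exact ⟨(_, t), Finset.mem_product.2 ⟨Finset.mem_union_right _ h, by simpa using ht⟩, hlead⟩
    · left
      have hpair := (exists_isCrossing_of_mem_pairings₂ h).1
      obtain ⟨t, ht, hlead⟩ := exists_isLeading_pair hpair hcr hk
      obtain ⟨hnc, -⟩ := proportional_of_ker_le hpair he hcr hk
      obtain ⟨h3, h4, -⟩ := mem_doubleWords.1 hw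
      have h5 := (mem_closedWords_fstWord h3).1 h4
      simp_rw [stepSign_one, one_mul] at h5
      exact ⟨(_, t), Finset.mem_product.2 ⟨Finset.mem_union_left _ (Finset.mem_filter.2 ⟨h,
        three_le_crossingNumber (hletter n w hw) hpair hcr (fun V hV => (hnc V hV).1) h5⟩),
        by simpa using ht⟩, hlead⟩
  · rintro n w hw ⟨π, t⟩ hk ⟨π', t'⟩ _ h h'
    obtain rfl : π = π' := h.1.symm.trans h'.1
    exact Prod.ext rfl
      (IsLeading.sign_unique (hletter n w hw) h h' (hcrossing π (Finset.mem_product.1 hk).1))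
  · rintro n w hw ⟨π, t⟩ hk hlead
    have ht := hsign _ hk
    have hcr := hcrossing π (Finset.mem_product.1 hk).1
    obtain rfl : kernel (fun x => |x|) w = π := hlead.1
    rcases Finset.mem_union.1 (Finset.mem_product.1 hk).1 with h | h
    · have h1 := (exists_isCrossing_of_mem_pairings₂ (Finset.mem_filter.1 h).1).1
      refine Eq.trans ?_ (if_pos h1).symm
      exact ha.pairCov_of_isLeading hη (hletter n w hw) ht hlead h1 hcr
    · refine Eq.trans ?_ (if_neg (not_isPairing_of_mem_pairings₂₄ h)).symm
      exact ha.pairCov_of_isLeading_four (hletter n w hw) ht hlead h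
  · rintro ⟨π, t⟩ hk
    have ht := hsign _ hk
    rcases Finset.mem_union.1 (Finset.mem_product.1 hk).1 with h | h
    · have h1 := (exists_isCrossing_of_mem_pairings₂ (Finset.mem_filter.1 h).1).1
      simp only [if_pos h1]
      exact tendsto_leading_toeplitzPairings hβ hβb hS hC₀ hcard hneg h ht hN
    · simp only [if_neg (not_isPairing_of_mem_pairings₂₄ h)]
      obtain ⟨hf, hg⟩ := blockForm_relativeSign_four h t
      refine tendsto_leading_relativeSign hβ hβb hS hC₀ hcard hneg ht hf hg ?_
      have := card_parts_of_mem_pairings₂₄ h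
      omega

lemma toeplitzCovWith_one (B : Set ℝ) (b κ : ℝ) (p q : ℕ) :
    toeplitzCovWith 1 B b κ p q = toeplitzCov B b κ p q := by
  simp [toeplitzCovWith, toeplitzCov]

lemma toeplitzCovWith_zero (B : Set ℝ) (b κ : ℝ) (p q : ℕ) :
    toeplitzCovWith 0 B b κ p q = hermitianCov B b κ p q := by
  simp [toeplitzCovWith, hermitianCov]

end ToeplitzLimits

end SparseToeplitz
end

noncomputable section
namespace SparseToeplitz

/-! ### Limit moments of Toeplitz matrices. -/

section Moments

open Classical

variable {p : ℕ}

lemma not_isCrossing_of_le {m : ℕ} (h : m ≤ p) (V : Finset (Fin m)) : ¬ IsCrossing p V := by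
  rintro ⟨-, j, -, hj⟩
  have := j.2
  omega

lemma closedWords_zero (τ : ℕ → ℤ) (S : Finset ℤ) : closedWords τ S 0 = {Fin.elim0} := by
  ext x
  rw [Subsingleton.elim x Fin.elim0]
  simp [closedWords]
  exact Subsingleton.elim _ _

lemma startCount_zero (n : ℕ) (τ : ℕ → ℤ) (x : Fin 0 → ℤ) : startCount n τ x = n := by
  unfold startCount
  rw [Finset.filter_true_of_mem]
  · simp
  · intro i _ j
    exact j.elim0

/-- A single word is treated as a pair whose second word is empty; the empty walk has `n` starting
points. -/
lemma sum_doubleWords_zero (τ : ℕ → ℤ) (n : ℕ) (S : Finset ℤ) (Φ : (Fin p → ℤ) → ℂ) :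
    ∑ w ∈ doubleWords τ S p 0, (pairCount n τ w : ℂ) * Φ (fstWord w) =
      n * ∑ x ∈ closedWords τ S p, (startCount n τ x : ℂ) * Φ x := by
  have h := sum_doubleWords (τ := τ) (p := p) (q := 0) S
    fun x y => ((startCount n τ x * startCount n τ y : ℕ) : ℂ) * Φ x
  simp_rw [closedWords_zero, Finset.sum_singleton, startCount_zero] at h
  unfold pairCount
  simp_rw [startCount_zero]
  rw [← h, Finset.mul_sum]
  refine Finset.sum_congr rfl fun x _ => ?_
  push_cast
  ring

lemma typeII_zero (B : Set ℝ) (b t : ℝ) (π : SetPartition p) (s : Fin p → ℝ) :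
    typeII B b p π s t = ∫ x₀ in Set.Icc (0 : ℝ) 1, ∫ x : {V // V ∈ π.parts} → ℝ,
      {x : {V // V ∈ π.parts} → ℝ | (∀ V, x V ∈ B) ∧ ∀ j : Fin p,
        x₀ + b * ∑ i ∈ Finset.univ.filter (fun i : Fin p => i ≤ j), s i * x (block π i)
          ∈ Set.Icc (0 : ℝ) 1}.indicator (fun _ => (1 : ℝ)) x := by
  have hset : ∀ x₀ y₀, region B b p π s t x₀ y₀ = {x : {V // V ∈ π.parts} → ℝ | (∀ V, x V ∈ B) ∧
      ∀ j : Fin p, x₀ + b * ∑ i ∈ Finset.univ.filter (fun i : Fin p => i ≤ j), s i * x (block π i)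
          ∈ Set.Icc (0 : ℝ) 1} := by
    intro x₀ y₀
    ext x
    simp only [region, Set.mem_ofPred_eq]
    refine and_congr_right fun _ => ⟨fun h j => h.1 j j.2, fun h => ⟨fun j _ => h j, fun j hj => ?_⟩⟩
    have := j.2
    omega
  unfold typeII
  simp_rw [hset]
  simp

lemma limitMoment_eq (B : Set ℝ) (b : ℝ) (p : ℕ) :
    limitMoment B b p = ∑ π ∈ pairings p, typeII B b p π (toeplitzSign π) 1 :=
  Finset.sum_congr rfl fun π _ => (typeII_zero B b 1 π (toeplitzSign π)).symm

lemma limitMoment_odd (B : Set ℝ) (b : ℝ) (k : ℕ) : limitMoment B b (2 * k + 1) = 0 := by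
  refine Finset.sum_eq_zero fun π hπ => ?_
  have := two_mul_card_parts_of_isPairing (Finset.mem_filter.1 hπ).2
  omega

variable {β : ℕ → ℝ} {b : ℝ} {S : ℕ → Finset ℤ} {B : Set ℝ} {C₀ C₁ : ℝ}
  {Ω : Type*} [MeasurableSpace Ω] {μ : Measure Ω} [IsProbabilityMeasure μ]
  {a : ℤ → Ω → ℂ} {η κ : ℝ}

/-- The machinery for pairs with `q = 0`: the `n` starts of the empty walk turn the normalization
`n⁻²` into `n⁻¹`. No block can cross, so the orientation plays no role. -/
theorem tendsto_integral_walkSum (ha : IsToeplitzFamily μ a η κ) (hβ : Tendsto β atTop atTop)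
    (hβb : Tendsto (fun n : ℕ => β n / n) atTop (𝓝 b)) (hS : Approximates β S B)
    (hC₀ : ∀ᶠ n in atTop, ∀ k ∈ S n, |(k : ℝ)| ≤ C₀ * β n)
    (hcard : ∀ᶠ n in atTop, ((S n).card : ℝ) ≤ C₁ * β n) (hneg : ∀ n, ∀ x ∈ S n, -x ∈ S n)
    (h0 : ∀ n, (0 : ℤ) ∉ S n) (p : ℕ) :
    Tendsto (fun n : ℕ => (n : ℂ)⁻¹ * ∫ ω, walkSum a (β n) n (fun _ => 1) (S n) p ω ∂μ) atTop
      (𝓝 (limitMoment B b p : ℂ)) := by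
  obtain ⟨C, hC⟩ := ha.entry.exists_momentBound_wordProd p
  have hword : ∀ w : Fin (p + 0) → ℤ, fstWord w = w := fun w => rfl
  have hmain := tendsto_sum_doubleWords (p := p) (q := 0) (τ := fun _ => 1)
    isSignDecomposition_unitSign hβ hcard p (fun w => ∫ ω, wordProd a (fstWord w) ω ∂μ)
    (fun w => (hC (fstWord w) (by simp)).norm_integral_le)
    (pairings (p + 0)) (fun π => π) (fun π => relativeSign p π 1)
    (fun _ => 1) (fun π => typeII B b p π (toeplitzSign π) (1 : ℤ)) ?_ ?_ ?_ ?_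
  · simp only [one_mul, Int.cast_one] at hmain
    rw [limitMoment_eq]
    push_cast
    refine hmain.congr' ?_
    filter_upwards [eventually_gt_atTop 0] with n hn
    rw [sum_doubleWords_zero _ _ _ fun x => ∫ ω, wordProd a x ω ∂μ, ha.entry.integral_walkSum, scale]
    have : (n : ℂ) ≠ 0 := Nat.cast_ne_zero.2 hn.ne'
    push_cast
    field_simp
  · intro n w hw hne
    have hsg : (fun i => stepSign (fun _ => 1) p i * unitSign (w i)) = fun i => unitSign (w i) :=
      funext fun i => by rw [stepSign_one, one_mul]
    rcases balance_dichotomy (p := p) (q := 0) (e := fun i => unitSign (w i))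
      (fun V hV => ha.entry.two_le_card_of_integral_ne_zero hne V hV) with h | ⟨h, hf, hg⟩
    · right
      unfold patternDim
      rw [hsg]
      exact h
    · left
      refine ⟨_, Finset.mem_filter.2 ⟨Finset.mem_univ _, h⟩, isLeading_of_blocks fun V hV => ?_⟩
      exact exists_const_of_noncrossing 1 hV (h V hV) (not_isCrossing_of_le le_rfl V)
        ⟨congrFun hf _, congrFun hg _⟩
  · intro n w _ π _ π' _ h h'
    exact h.1.symm.trans h'.1
  · intro n w hw π hπ hlead
    obtain rfl : kernel (fun x => |x|) w = π := hlead.1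
    have hpair := (Finset.mem_filter.1 hπ).2
    have h1 := ha.entry.integral_prod_blocks w Finset.univ
    refine h1.trans (Finset.prod_eq_one fun V hV => ?_)
    obtain ⟨i, j, hij, hVij, hi, hj⟩ := exists_pair hV (hpair V hV)
    simp only [Finset.mem_univ, Finset.filter_true]
    rw [hVij]
    exact ha.integral_pair hij.ne (fun h => h0 n (h ▸ (mem_doubleWords.1 hw).1 i))
      (hlead.neg_of_noncrossing (Or.inl rfl) hV (not_isCrossing_of_le le_rfl V) hVij hi hj)
  · intro π hπ
    have hpair := (Finset.mem_filter.1 hπ).2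
    refine tendsto_leading_relativeSign hβ hβb hS hC₀ hcard hneg (Or.inl rfl) ?_ ?_ ?_
    · exact funext fun V => (blockForm_relativeSign_noncrossing 1 (hpair V.1 V.2)
        (not_isCrossing_of_le le_rfl V.1)).1
    · exact funext fun V => (blockForm_relativeSign_noncrossing 1 (hpair V.1 V.2)
        (not_isCrossing_of_le le_rfl V.1)).2
    · exact (two_mul_card_parts_of_isPairing hpair).symm

end Moments

/-! ### Nondegeneracy of the balance equations. -/

section Nondegenerate

variable {m : ℕ} {τ : ℕ → ℤ} {S : Finset ℤ}

lemma sum_mul_classCoeff (sg cl : ℤ → ℤ) (τ : ℕ → ℤ) (x : Fin m → ℤ) (g : ℤ → ℤ) :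
    ∑ c ∈ Finset.univ.image (fun i : Fin m => cl (x i)), classCoeff sg cl τ x c * g c =
      ∑ i : Fin m, τ i * sg (x i) * g (cl (x i)) := by
  rw [← Finset.sum_fiberwise_of_maps_to (t := Finset.univ.image fun i => cl (x i))
    (g := fun i => cl (x i)) fun i _ => Finset.mem_image_of_mem _ (Finset.mem_univ i)]
  refine Finset.sum_congr rfl fun c _ => ?_
  unfold classCoeff
  rw [Finset.sum_mul]
  exact Finset.sum_congr rfl fun i hi => by rw [(Finset.mem_filter.1 hi).2]

/-- If only one class had a nonzero coefficient, the sum grouped by classes would be a single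
nonzero term. For Toeplitz words `g` is the identity and the sum is the closing equation; for Hankel
words `g` is `1` and the sum is that of the alternating signs. -/
lemma isNondegenerate_of_sum_eq_zero {sg cl : ℤ → ℤ} {x : Fin m → ℤ} (g : ℤ → ℤ)
    (hg : ∀ i, g (cl (x i)) ≠ 0) (h : ∑ i : Fin m, τ i * sg (x i) * g (cl (x i)) = 0) :
    IsNondegenerate sg cl τ x := by
  intro c hc
  by_contra hcon
  push Not at hcon
  obtain ⟨i, hi, -⟩ := Finset.exists_ne_zero_of_sum_ne_zero hc
  obtain rfl := (Finset.mem_filter.1 hi).2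
  rw [← sum_mul_classCoeff, Finset.sum_eq_single_of_mem _
    (Finset.mem_image_of_mem _ (Finset.mem_univ i)) fun c' _ hne => by rw [hcon c' hne, zero_mul]] at h
  exact mul_ne_zero hc (hg i) h

lemma isNondegenerate_toeplitz (h0 : (0 : ℤ) ∉ S) {x : Fin m → ℤ}
    (hx : x ∈ closedWords (fun _ => 1) S m) : IsNondegenerate unitSign (fun x => |x|) (fun _ => 1) x := by
  obtain ⟨h1, h2⟩ := Finset.mem_filter.1 hx
  rw [Fintype.mem_piFinset] at h1
  refine isNondegenerate_of_sum_eq_zero id (fun i h => h0 (abs_eq_zero.1 h ▸ h1 i)) ?_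
  rw [← h2]
  refine Finset.sum_congr rfl fun i _ => ?_
  rw [mul_assoc, id, isSignDecomposition_unitSign.eq (x i)]

lemma isNondegenerate_hankel (p : ℕ) (x : Fin (2 * p) → ℤ) :
    IsNondegenerate (fun _ => 1) id (fun k => (-1) ^ k) x := by
  refine isNondegenerate_of_sum_eq_zero (fun _ => 1) (fun _ => one_ne_zero) ?_
  simpa using sum_alternating p

end Nondegenerate

end SparseToeplitz
end

noncomputable section
namespace SparseToeplitz

/-! ### Index sets -/

section IndexSets

variable {r : ℕ} {lo hi : Fin r → ℕ → ℝ} {l u : Fin r → ℝ} {β : ℕ → ℝ} {b : ℝ}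

lemma eventually_mem_window_iff (hβ : Tendsto β atTop atTop)
    (hlo : ∀ j, Tendsto (fun n : ℕ => lo j n / β n) atTop (𝓝 (l j)))
    (hhi : ∀ j, Tendsto (fun n : ℕ => hi j n / β n) atTop (𝓝 (u j))) {y : ℝ}
    (hyl : ∀ j, y ≠ l j) (hyu : ∀ j, y ≠ u j) {k : ℕ → ℤ}
    (hk : Tendsto (fun n => (k n : ℝ) / β n) atTop (𝓝 y)) :
    ∀ᶠ n in atTop, ((∃ j, (k n : ℝ) ∈ Set.Icc (lo j n) (hi j n)) ↔ y ∈ limitSet l u) := by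
  have h1 : ∀ j, ∀ᶠ n in atTop, ((k n : ℝ) ∈ Set.Icc (lo j n) (hi j n) ↔ y ∈ Set.Icc (l j) (u j)) := by
    intro j
    have hl : ∀ᶠ n in atTop, (lo j n ≤ k n ↔ l j ≤ y) := by
      rcases lt_or_gt_of_ne (hyl j) with h | h
      · filter_upwards [hk.eventually_lt (hlo j) h, hβ.eventually_gt_atTop 0] with n hn hn0
        have := (div_lt_div_iff_of_pos_right hn0).1 hn
        exact iff_of_false (not_le.2 this) (not_le.2 h)
      · filter_upwards [(hlo j).eventually_lt hk h, hβ.eventually_gt_atTop 0] with n hn hn0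
        have := (div_lt_div_iff_of_pos_right hn0).1 hn
        exact iff_of_true this.le h.le
    have hu : ∀ᶠ n in atTop, ((k n : ℝ) ≤ hi j n ↔ y ≤ u j) := by
      rcases lt_or_gt_of_ne (hyu j) with h | h
      · filter_upwards [hk.eventually_lt (hhi j) h, hβ.eventually_gt_atTop 0] with n hn hn0
        have := (div_lt_div_iff_of_pos_right hn0).1 hn
        exact iff_of_true this.le h.le
      · filter_upwards [(hhi j).eventually_lt hk h, hβ.eventually_gt_atTop 0] with n hn hn0
        have := (div_lt_div_iff_of_pos_right hn0).1 hn
        exact iff_of_false (not_le.2 this) (not_le.2 h)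
    filter_upwards [hl, hu] with n h2 h3
    rw [Set.mem_Icc, Set.mem_Icc, h2, h3]
  filter_upwards [eventually_all.2 h1] with n hn
  rw [limitSet, Set.mem_iUnion]
  exact exists_congr hn

/-- The cutoff at `n` is asymptotically void inside the window, because `|y| * b < 1`. -/
lemma eventually_abs_lt (hb : b ∈ Set.Icc (0 : ℝ) 1) (hβ : Tendsto β atTop atTop)
    (hβb : Tendsto (fun n : ℕ => β n / n) atTop (𝓝 b)) {y : ℝ} (hy : |y| < 1) {k : ℕ → ℤ}
    (hk : Tendsto (fun n => (k n : ℝ) / β n) atTop (𝓝 y)) : ∀ᶠ n : ℕ in atTop, |k n| < n := by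
  have h1 := (hk.mul hβb).abs
  have h2 : |y * b| < 1 := by
    rw [abs_mul, abs_of_nonneg hb.1]
    exact (mul_le_of_le_one_right (abs_nonneg y) hb.2).trans_lt hy
  filter_upwards [h1.eventually_lt_const h2, hβ.eventually_gt_atTop 0, eventually_gt_atTop 0]
    with n hn hn0 hpos
  rw [div_mul_div_cancel₀ hn0.ne', abs_div, Nat.abs_cast, div_lt_one (by exact_mod_cast hpos)] at hn
  exact_mod_cast hn

/-- The window is imposed on some `k'` with the same absolute value as `k`, which covers both the
symmetric and the signed pattern. -/
lemma exists_bound_index (hβ : Tendsto β atTop atTop)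
    (hlo : ∀ j, Tendsto (fun n : ℕ => lo j n / β n) atTop (𝓝 (l j)))
    (hhi : ∀ j, Tendsto (fun n : ℕ => hi j n / β n) atTop (𝓝 (u j))) {F : ℕ → Finset ℤ}
    (hF : ∀ n, ∀ k ∈ F n, ∃ j, ∃ k' : ℤ, |k'| = |k| ∧ (k' : ℝ) ∈ Set.Icc (lo j n) (hi j n)) :
    (∃ C, ∀ᶠ n in atTop, ∀ k ∈ F n, |(k : ℝ)| ≤ C * β n) ∧
      ∃ C, ∀ᶠ n in atTop, ((F n).card : ℝ) ≤ C * β n := by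
  set C : ℝ := ∑ j, (|l j| + 1 + (|u j| + 1)) with hC
  have hCj : ∀ j, |l j| + 1 ≤ C ∧ |u j| + 1 ≤ C := by
    intro j
    have := Finset.single_le_sum (f := fun j => |l j| + 1 + (|u j| + 1)) (fun i _ => by positivity)
      (Finset.mem_univ j)
    constructor <;> linarith [abs_nonneg (l j), abs_nonneg (u j)]
  have hbound : ∀ᶠ n in atTop, ∀ k ∈ F n, |(k : ℝ)| ≤ C * β n := by
    have h1 : ∀ᶠ n in atTop, ∀ j, |lo j n / β n| < |l j| + 1 := eventually_all.2 fun j =>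
      (hlo j).abs.eventually_lt_const (lt_add_one _)
    have h2 : ∀ᶠ n in atTop, ∀ j, |hi j n / β n| < |u j| + 1 := eventually_all.2 fun j =>
      (hhi j).abs.eventually_lt_const (lt_add_one _)
    filter_upwards [h1, h2, hβ.eventually_gt_atTop 0] with n h1 h2 hn k hk
    obtain ⟨j, k', hk', h3, h4⟩ := hF n k hk
    have h5 := h1 j
    have h6 := h2 j
    rw [abs_div, abs_of_pos hn, div_lt_iff₀ hn] at h5 h6
    have e : |(k : ℝ)| = |(k' : ℝ)| := by exact_mod_cast congrArg (Int.cast (R := ℝ)) hk'.symm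
    rw [e, abs_le]
    have h7 := mul_le_mul_of_nonneg_right (hCj j).1 hn.le
    have h8 := mul_le_mul_of_nonneg_right (hCj j).2 hn.le
    constructor
    · linarith [neg_abs_le (lo j n)]
    · linarith [le_abs_self (hi j n)]
  refine ⟨⟨C, hbound⟩, 2 * C + 1, ?_⟩
  filter_upwards [hbound, hβ.eventually_ge_atTop 1] with n hn h1
  have hC0 : 0 ≤ C := Finset.sum_nonneg fun j _ => by positivity
  have hsub : F n ⊆ Finset.Icc (-⌊C * β n⌋) ⌊C * β n⌋ := by
    intro k hk
    obtain ⟨h2, h3⟩ := abs_le.1 (hn k hk)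
    rw [Finset.mem_Icc]
    refine ⟨?_, Int.le_floor.2 h3⟩
    have : -k ≤ ⌊C * β n⌋ := Int.le_floor.2 (by push_cast; linarith)
    linarith
  have hfl : 0 ≤ ⌊C * β n⌋ := Int.floor_nonneg.2 (by positivity)
  have h2 := Finset.card_le_card hsub
  rw [Int.card_Icc] at h2
  have h3 : ((F n).card : ℤ) ≤ 2 * ⌊C * β n⌋ + 1 := by omega
  have h4 : ((F n).card : ℝ) ≤ 2 * ⌊C * β n⌋ + 1 := by exact_mod_cast h3
  linarith [Int.floor_le (C * β n)]

lemma approximates_signedIndexSet (hb : b ∈ Set.Icc (0 : ℝ) 1) (hβ : Tendsto β atTop atTop)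
    (hβb : Tendsto (fun n : ℕ => β n / n) atTop (𝓝 b))
    (hlo : ∀ j, Tendsto (fun n : ℕ => lo j n / β n) atTop (𝓝 (l j)))
    (hhi : ∀ j, Tendsto (fun n : ℕ => hi j n / β n) atTop (𝓝 (u j)))
    (hB : limitSet l u ⊆ Set.Icc (-1) 1) {F : ℕ → Finset ℤ}
    (hF : ∀ n k, k ∈ F n ↔ k ∈ signedIndexSet lo hi n) : Approximates β F (limitSet l u) := by
  classical
  -- Besides the end points of the intervals, `±1` is excluded, where the cutoff at `n` can
  -- interfere.
  refine ⟨Finset.univ.image l ∪ Finset.univ.image u ∪ {1, -1}, fun y hy k hk => ?_⟩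
  simp only [Finset.mem_union, Finset.mem_image, Finset.mem_univ, true_and, Finset.mem_insert,
    Finset.mem_singleton, not_or, not_exists] at hy
  obtain ⟨⟨hyl, hyu⟩, hy1, hy2⟩ := hy
  have h1 := eventually_mem_window_iff hβ hlo hhi (fun j => Ne.symm (hyl j)) (fun j => Ne.symm (hyu j)) hk
  by_cases hy : y ∈ limitSet l u
  · have habs : |y| < 1 :=
      abs_lt.2 ⟨lt_of_le_of_ne (hB hy).1 (Ne.symm hy2), lt_of_le_of_ne (hB hy).2 hy1⟩
    filter_upwards [h1, eventually_abs_lt hb hβ hβb habs hk] with n h2 h3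
    rw [hF]
    exact iff_of_true ⟨h2.2 hy, h3⟩ hy
  · filter_upwards [h1] with n h2
    rw [hF]
    exact iff_of_false (fun h => hy (h2.1 h.1)) hy

lemma mem_symmetrize_iff {y : ℝ} (hB : limitSet l u ⊆ Set.Icc 0 1) (hy : y ≠ 0) :
    y ∈ symmetrize (limitSet l u) ↔ |y| ∈ limitSet l u := by
  unfold symmetrize
  rw [Set.mem_union, Set.mem_ofPred_eq]
  rcases lt_or_gt_of_ne hy with h | h
  · rw [abs_of_neg h]
    exact or_iff_right fun h' => absurd (hB h').1 (not_le.2 h)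
  · rw [abs_of_pos h]
    exact or_iff_left fun h' => absurd (hB h').1 (by linarith)

lemma approximates_symmetrize (hb : b ∈ Set.Icc (0 : ℝ) 1) (hβ : Tendsto β atTop atTop)
    (hβb : Tendsto (fun n : ℕ => β n / n) atTop (𝓝 b))
    (hlo : ∀ j, Tendsto (fun n : ℕ => lo j n / β n) atTop (𝓝 (l j)))
    (hhi : ∀ j, Tendsto (fun n : ℕ => hi j n / β n) atTop (𝓝 (u j)))
    (hB : limitSet l u ⊆ Set.Icc 0 1) {F : ℕ → Finset ℤ}
    (hF : ∀ n k, k ≠ 0 → (k ∈ F n ↔ |k| ∈ indexSet lo hi n)) :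
    Approximates β F (symmetrize (limitSet l u)) := by
  classical
  -- The limit `0` is also exceptional: membership of the index `0` is left open by `hF`, so that
  -- the zero letter may be removed.
  refine ⟨Finset.univ.image l ∪ Finset.univ.image u ∪ (Finset.univ.image fun j => -l j) ∪
    (Finset.univ.image fun j => -u j) ∪ {0, 1, -1}, fun y hy k hk => ?_⟩
  simp only [Finset.mem_union, Finset.mem_image, Finset.mem_univ, true_and, Finset.mem_insert,
    Finset.mem_singleton, not_or, not_exists] at hy
  obtain ⟨⟨⟨⟨hyl, hyu⟩, hyl'⟩, hyu'⟩, hy0, hy1, hy2⟩ := hy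
  have hk' : Tendsto (fun n => ((|k n| : ℤ) : ℝ) / β n) atTop (𝓝 |y|) := by
    refine hk.abs.congr' ?_
    filter_upwards [hβ.eventually_gt_atTop 0] with n hn
    rw [abs_div, abs_of_pos hn, Int.cast_abs]
  have habs : ∀ c : ℝ, c ≠ y → -c ≠ y → |y| ≠ c := by
    intro c h1 h2 h
    rcases abs_choice y with h' | h' <;> rw [h'] at h
    · exact h1 h.symm
    · exact h2 (by rw [← h, neg_neg])
  have h1 := eventually_mem_window_iff hβ hlo hhi (fun j => habs _ (hyl j) (hyl' j))
    (fun j => habs _ (hyu j) (hyu' j)) hk'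
  have hne : ∀ᶠ n in atTop, k n ≠ 0 := by
    filter_upwards [hk.eventually_ne hy0] with n hn h
    rw [h] at hn
    simp at hn
  rw [mem_symmetrize_iff hB hy0]
  by_cases hy : |y| ∈ limitSet l u
  · have hlt : |(|y|)| < 1 := by
      rw [abs_abs]
      exact lt_of_le_of_ne (hB hy).2 (habs 1 (Ne.symm hy1) (Ne.symm hy2))
    filter_upwards [h1, eventually_abs_lt hb hβ hβb hlt hk', hne] with n h2 h3 h4
    rw [hF n _ h4]
    rw [abs_abs] at h3
    exact iff_of_true ⟨h2.2 hy, abs_nonneg _, h3⟩ hy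
  · filter_upwards [h1, hne] with n h2 h4
    rw [hF n _ h4]
    exact iff_of_false (fun h => hy (h2.1 h.1)) hy

end IndexSets

/-! ### The entries of the three models -/

section Models

variable {Ω : Type*} [MeasurableSpace Ω] {μ : Measure Ω} [IsProbabilityMeasure μ]

/-- Each entry is a function of the independent real variables indexed by `D x`, and these index
sets are disjoint for different classes. The sets are singletons or empty for real entries; a
nonzero complex index has the pair of real and imaginary part. -/
lemma indepFun_of_dependsOn {ι : Type*} [DecidableEq ι] {f : ι → Ω → ℝ} (hf : iIndepFun f μ)
    (hm : ∀ i, Measurable (f i)) {a : ℤ → Ω → ℂ} {cl : ℤ → ℤ} (D : ℤ → Finset ι)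
    (hD : ∀ x y, cl x ≠ cl y → Disjoint (D x) (D y))
    (ha : ∀ x, ∃ ψ : (D x → ℝ) → ℂ, Measurable ψ ∧ ∀ ω, a x ω = ψ fun i => f i ω)
    (F G : Finset ℤ) (hFG : ∀ x ∈ F, ∀ y ∈ G, cl x ≠ cl y) :
    IndepFun (fun ω (x : F) => a x ω) (fun ω (y : G) => a y ω) μ := by
  choose ψ hψ hψa using ha
  have hdisj : Disjoint (F.biUnion D) (G.biUnion D) := by
    rw [Finset.disjoint_biUnion_left]
    intro x hx
    rw [Finset.disjoint_biUnion_right]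
    exact fun y hy => hD x y (hFG x hx y hy)
  have h := hf.indepFun_finset (F.biUnion D) (G.biUnion D) hdisj hm
  have hmeas : ∀ H : Finset ℤ, Measurable fun (v : ↥(H.biUnion D) → ℝ) (x : H) =>
      ψ x fun i => v ⟨i, Finset.mem_biUnion.2 ⟨x, x.2, i.2⟩⟩ := fun H =>
    measurable_pi_lambda _ fun x => (hψ x).comp
      (measurable_pi_lambda _ fun i => measurable_pi_apply _)
  have h2 := h.comp (hmeas F) (hmeas G)
  convert h2 using 1 <;> funext ω x <;> exact hψa _ _

lemma exists_momentBound {f : ℤ → Ω → ℂ} {P : ℤ → Prop} (hm : ∀ j, Measurable (f j))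
    (hb : ∀ k : ℕ, 3 ≤ k → ∃ C : ℝ, ∀ j : ℤ, P j →
      Integrable (fun ω => ‖f j ω‖ ^ k) μ ∧ ∫ ω, ‖f j ω‖ ^ k ∂μ ≤ C) :
    ∃ B : ℕ → ℝ, ∀ j, P j → MomentBound μ (f j) B := by
  have h : ∀ k : ℕ, ∃ C : ℝ, ∀ j : ℤ, P j →
      Integrable (fun ω => ‖f j ω‖ ^ k) μ ∧ ∫ ω, ‖f j ω‖ ^ k ∂μ ≤ C := by
    intro k
    rcases le_or_gt 3 k with hk | hk
    · exact hb k hk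
    · obtain ⟨C, hC⟩ := hb 3 le_rfl
      -- Moments of order below three are dominated by `1 + ‖f‖ ^ 3`.
      refine ⟨1 + C, fun j hj => integrable_norm_pow_of_le k (hm j)
        ((integrable_const 1).add (hC j hj).1) (fun ω => ?_) ?_⟩
      · rcases le_or_gt ‖f j ω‖ 1 with h1 | h1
        · exact (pow_le_one₀ (norm_nonneg _) h1).trans (le_add_of_nonneg_right (by positivity))
        · exact (pow_le_pow_right₀ h1.le hk.le).trans (le_add_of_nonneg_left zero_le_one)
      · rw [integral_add' (integrable_const 1) (hC j hj).1]
        simpa using (hC j hj).2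
  choose B hB using h
  exact ⟨B, fun j hj => ⟨hm j, fun k => hB k j hj⟩⟩

/-- Common to the real and the complex model: the moments at negative indices follow from those at
positive ones by conjugation, with `η = 1` for real entries and `η = 0` for complex ones. -/
lemma isToeplitzFamily_of_conj {a : ℤ → Ω → ℂ} {η κ : ℝ} (hm : ∀ j, Measurable (a j))
    (hsymm : ∀ j ω, a (-j) ω = (starRingEnd ℂ) (a j ω)) (hzero : ∀ ω, a 0 ω = 0)
    (hindep : ∀ F G : Finset ℤ, (∀ x ∈ F, ∀ y ∈ G, |x| ≠ |y|) →
      IndepFun (fun ω (x : F) => a x ω) (fun ω (y : G) => a y ω) μ)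
    (hmean : ∀ j : ℤ, 1 ≤ j → ∫ ω, a j ω ∂μ = 0)
    (hsecond : ∀ j : ℤ, 1 ≤ j → ∫ ω, ‖a j ω‖ ^ 2 ∂μ = 1)
    (hsquare : ∀ j : ℤ, 1 ≤ j → ∫ ω, (a j ω) ^ 2 ∂μ = η)
    (hfourth : ∀ j : ℤ, 1 ≤ j → ∫ ω, ‖a j ω‖ ^ 4 ∂μ = κ)
    (hbounded : ∀ k : ℕ, 3 ≤ k → ∃ C : ℝ, ∀ j : ℤ, 1 ≤ j →
      Integrable (fun ω => ‖a j ω‖ ^ k) μ ∧ ∫ ω, ‖a j ω‖ ^ k ∂μ ≤ C) :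
    IsToeplitzFamily μ a η κ := by
  have hnorm : ∀ j ω, ‖a (-j) ω‖ = ‖a j ω‖ := fun j ω => by rw [hsymm, RCLike.norm_conj]
  have hcases : ∀ j : ℤ, j = 0 ∨ 1 ≤ j ∨ 1 ≤ -j := fun j => by omega
  have hprod : ∀ j ω, a j ω * a (-j) ω = ((‖a j ω‖ ^ 2 : ℝ) : ℂ) := fun j ω => by
    rw [hsymm, Complex.mul_conj, Complex.normSq_eq_norm_sq]
  have hpos : ∀ j : ℤ, j ≠ 0 → ∃ i : ℤ, 1 ≤ i ∧ ∀ ω, ‖a j ω‖ = ‖a i ω‖ := by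
    intro j hj
    rcases hcases j with h | h | h
    · exact absurd h hj
    · exact ⟨j, h, fun _ => rfl⟩
    · exact ⟨-j, h, fun ω => (hnorm j ω).symm⟩
  refine ⟨⟨hindep, fun x => ?_, ?_⟩, fun x hx => ?_, fun x hx => ?_, fun x hx => ?_⟩
  · rcases hcases x with rfl | h | h
    · simp [hzero]
    · exact hmean x h
    · have h1 : ∀ ω, a x ω = (starRingEnd ℂ) (a (-x) ω) := fun ω => by rw [← hsymm, neg_neg]
      simp_rw [h1]
      rw [integral_conj, hmean _ h, map_zero]
  · obtain ⟨B, hB⟩ := exists_momentBound (P := fun j => 1 ≤ j) hm hbounded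
    have hB1 := hB 1 le_rfl
    refine ⟨fun k => B k + 1, fun x => ⟨hm x, fun k => ?_⟩⟩
    by_cases hx : x = 0
    · subst hx
      have hBk : 0 ≤ B k := (integral_nonneg fun ω => by positivity).trans (hB1.2 k).2
      simp only [hzero, norm_zero]
      refine ⟨integrable_const _, ?_⟩
      rw [integral_const, probReal_univ, one_smul]
      exact (pow_le_one₀ le_rfl zero_le_one).trans (by linarith)
    · obtain ⟨i, hi, h⟩ := hpos x hx
      simp_rw [h]
      exact ⟨((hB i hi).2 k).1, ((hB i hi).2 k).2.trans (by linarith)⟩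
  · obtain ⟨i, hi, h⟩ := hpos x hx
    simp_rw [hprod, h]
    rw [integral_complex_ofReal, hsecond i hi, Complex.ofReal_one]
  · rcases hcases x with h | h | h
    · exact absurd h hx
    · simp_rw [← sq]
      exact hsquare x h
    · have h1 : ∀ ω, a x ω * a x ω = (starRingEnd ℂ) (a (-x) ω ^ 2) := fun ω => by
        rw [map_pow, ← hsymm, neg_neg, sq]
      simp_rw [h1]
      rw [integral_conj, hsquare _ h, Complex.conj_ofReal]
  · obtain ⟨i, hi, h⟩ := hpos x hx
    simp_rw [hprod, h, ← Complex.ofReal_mul, ← pow_add]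
    rw [integral_complex_ofReal, hfourth i hi]

lemma natAbs_sub_one {x : ℤ} (hx : x ≠ 0) : ((x.natAbs - 1 : ℕ) : ℤ) + 1 = |x| := by
  rw [Int.abs_eq_natAbs]
  omega

lemma IsSymmetricEntries.isToeplitzFamily {a : ℤ → Ω → ℝ} {κ : ℝ} (ha : IsSymmetricEntries μ a κ) :
    IsToeplitzFamily μ (fun k ω => (a k ω : ℂ)) 1 κ := by
  have habs : ∀ x ω, a |x| ω = a x ω := fun x ω => by
    rcases abs_choice x with h | h <;> rw [h]
    exact ha.symm x ω
  have hpow : ∀ x ω, (a x ω) ^ 2 = |a x ω| ^ 2 := fun x ω => (sq_abs _).symm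
  refine isToeplitzFamily_of_conj (fun j => Complex.measurable_ofReal.comp (ha.measurable j))
    (fun j ω => by rw [Complex.conj_ofReal, ha.symm]) (fun ω => by rw [ha.zero, Complex.ofReal_zero])
    (indepFun_of_dependsOn (a := fun k ω => (a k ω : ℂ)) (cl := fun x => |x|) ha.indep (fun k => ha.measurable _)
      (fun x => if x = 0 then ∅ else {x.natAbs - 1}) ?_ ?_)
    (fun j hj => ?_) (fun j hj => ?_) (fun j hj => ?_) (fun j hj => ?_) fun k hk => ?_
  · intro x y hxy
    by_cases hx : x = 0
    · simp [hx]
    by_cases hy : y = 0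
    · simp [hy]
    simp only [hx, hy, if_false, Finset.disjoint_singleton]
    intro h
    exact hxy (by rw [← natAbs_sub_one hx, ← natAbs_sub_one hy, h])
  · intro x
    by_cases hx : x = 0
    · exact ⟨fun _ => 0, measurable_const, fun ω => by rw [hx, ha.zero, Complex.ofReal_zero]⟩
    · refine ⟨fun v => (v ⟨x.natAbs - 1, by simp [hx]⟩ : ℂ),
        Complex.measurable_ofReal.comp (measurable_pi_apply _), fun ω => ?_⟩
      simp only
      rw [natAbs_sub_one hx, habs]
  · rw [integral_complex_ofReal, ha.mean j hj, Complex.ofReal_zero]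
  · simp_rw [Complex.norm_real, Real.norm_eq_abs]
    exact ha.second j hj
  · simp_rw [← Complex.ofReal_pow, hpow]
    rw [integral_complex_ofReal, ha.second j hj]
  · simp_rw [Complex.norm_real, Real.norm_eq_abs]
    exact ha.fourth j hj
  · simp_rw [Complex.norm_real, Real.norm_eq_abs]
    exact ha.bounded k hk

lemma IsHermitianEntries.isToeplitzFamily {a : ℤ → Ω → ℂ} {κ : ℝ} (ha : IsHermitianEntries μ a κ) :
    IsToeplitzFamily μ a 0 κ := by
  refine isToeplitzFamily_of_conj ha.measurable ha.symm ha.zero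
    (indepFun_of_dependsOn (cl := fun x => |x|) ha.indep ?_
      (fun x => if x = 0 then ∅ else {Sum.inl (x.natAbs - 1), Sum.inr (x.natAbs - 1)}) ?_ ?_)
    ha.mean ha.second (fun j hj => by rw [ha.square j hj, Complex.ofReal_zero]) ha.fourth ha.bounded
  · rintro (k | k)
    · exact Complex.measurable_re.comp (ha.measurable _)
    · exact Complex.measurable_im.comp (ha.measurable _)
  · intro x y hxy
    by_cases hx : x = 0
    · simp [hx]
    by_cases hy : y = 0
    · simp [hy]
    have h : x.natAbs - 1 ≠ y.natAbs - 1 := fun h =>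
      hxy (by rw [← natAbs_sub_one hx, ← natAbs_sub_one hy, h])
    simp [hx, hy, h.symm]
  · intro x
    by_cases hx : x = 0
    · exact ⟨fun _ => 0, measurable_const, fun ω => by rw [hx, ha.zero]⟩
    · have h1 : Sum.inl (x.natAbs - 1) ∈ (if x = 0 then ∅ else
          ({Sum.inl (x.natAbs - 1), Sum.inr (x.natAbs - 1)} : Finset (ℕ ⊕ ℕ))) := by simp [hx]
      have h2 : Sum.inr (x.natAbs - 1) ∈ (if x = 0 then ∅ else
          ({Sum.inl (x.natAbs - 1), Sum.inr (x.natAbs - 1)} : Finset (ℕ ⊕ ℕ))) := by simp [hx]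
      rcases lt_or_gt_of_ne hx with h | h
      · refine ⟨fun v => (v ⟨_, h1⟩ : ℂ) - (v ⟨_, h2⟩ : ℂ) * Complex.I, by fun_prop, fun ω => ?_⟩
        simp only [Sum.elim_inl, Sum.elim_inr]
        rw [natAbs_sub_one hx, abs_of_neg h, ha.symm]
        apply Complex.ext <;> simp
      · refine ⟨fun v => (v ⟨_, h1⟩ : ℂ) + (v ⟨_, h2⟩ : ℂ) * Complex.I, by fun_prop, fun ω => ?_⟩
        simp only [Sum.elim_inl, Sum.elim_inr]
        rw [natAbs_sub_one hx, abs_of_pos h]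
        exact (Complex.re_add_im _).symm

lemma IsHankelEntries.isEntryFamily {a : ℤ → Ω → ℝ} {κ : ℝ} (ha : IsHankelEntries μ a κ) :
    IsEntryFamily μ (fun k ω => (a k ω : ℂ)) id := by
  refine ⟨indepFun_of_dependsOn (a := fun k ω => (a k ω : ℂ)) (cl := id) ha.indep ha.measurable (fun x => {x}) ?_ fun x => ?_, fun x => ?_, ?_⟩
  · intro x y hxy
    exact Finset.disjoint_singleton.2 hxy
  · exact ⟨fun v => (v ⟨x, Finset.mem_singleton_self x⟩ : ℂ),
      Complex.measurable_ofReal.comp (measurable_pi_apply _), fun ω => rfl⟩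
  · rw [integral_complex_ofReal, ha.mean x, Complex.ofReal_zero]
  · obtain ⟨B, hB⟩ := exists_momentBound (μ := μ) (f := fun k ω => (a k ω : ℂ)) (P := fun _ => True)
      (fun j => Complex.measurable_ofReal.comp (ha.measurable j)) fun k hk => by
        simp_rw [Complex.norm_real, Real.norm_eq_abs]
        obtain ⟨C, hC⟩ := ha.bounded k hk
        exact ⟨C, fun j _ => hC j⟩
    exact ⟨B, fun x => hB x trivial⟩

end Models

end SparseToeplitz
end

noncomputable section
namespace SparseToeplitz

/-! ### Traces of powers and of polynomials. -/

section Conclusions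

variable {Ω : Type*} [MeasurableSpace Ω] {μ : Measure Ω} [IsProbabilityMeasure μ]
  {β : ℕ → ℝ} {b : ℝ} {F : ℕ → Finset ℤ} {B : Set ℝ} {C₀ C₁ : ℝ} {κ : ℝ}

theorem toeplitz_conclusions {𝕜 : Type*} [RCLike 𝕜] {a : ℤ → Ω → ℂ} {η : ℝ}
    (ha : IsToeplitzFamily μ a η κ) (hη : η = 0 ∨ η = 1) (hβ : Tendsto β atTop atTop)
    (hβb : Tendsto (fun n : ℕ => β n / n) atTop (𝓝 b)) (hS : Approximates β F B)
    (hC₀ : ∀ᶠ n in atTop, ∀ k ∈ F n, |(k : ℝ)| ≤ C₀ * β n)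
    (hcard : ∀ᶠ n in atTop, ((F n).card : ℝ) ≤ C₁ * β n) (hneg : ∀ n, ∀ x ∈ F n, -x ∈ F n)
    (h0 : ∀ n, (0 : ℤ) ∉ F n) (A : (n : ℕ) → Ω → Matrix (Fin n) (Fin n) 𝕜)
    (hA : ∀ n ω p, (realTrace (A n ω ^ p) : ℂ) = walkSum a (β n) n (fun _ => 1) (F n) p ω) :
    (∀ p : ℕ, 2 ≤ p → ConvergesToNormal μ
      (fun n => fluctuation μ (β n) n (fun ω => realTrace (A n ω ^ p)))
      (toeplitzCovWith η B b κ p p)) ∧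
    (∀ Q : Polynomial ℝ, Q.coeff 0 = 0 → Q.coeff 1 = 0 → ConvergesToNormal μ
      (fun n => fluctuation μ (β n) n (fun ω => realTrace (Polynomial.aeval (A n ω) Q)))
      (polyVariance 2 Q (toeplitzCovWith η B b κ))) ∧
    ∀ p : ℕ, Tendsto (fun n : ℕ => ∫ ω, (1 / (n : ℝ)) * realTrace (A n ω ^ p) ∂μ) atTop
      (𝓝 (limitMoment B b p)) := by
  have hnormal : ∀ (I : Finset ℕ) (_ : ∀ p ∈ I, 2 ≤ p) (q : ℕ → ℝ) (X : (n : ℕ) → Ω → ℝ)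
      (_ : ∀ n ω, (X n ω : ℂ) =
        (0 : ℝ) + ∑ p ∈ I, (q p : ℂ) * walkSum a (β n) n (fun _ => 1) (F n) p ω),
      ConvergesToNormal μ (fun n => fluctuation μ (β n) n (X n))
        (∑ i ∈ I, ∑ j ∈ I, q i * q j * toeplitzCovWith η B b κ i j) := fun I hI q X hX =>
    ha.entry.convergesToNormal isSignDecomposition_unitSign (fun _ => Or.inl rfl) hβ hcard I
      (fun p _ n x hx => isNondegenerate_toeplitz (h0 n) hx) q _
      (fun n ω => ha.entry.ofReal_fluctuation I q 0 (X n) (hX n) ω) _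
      fun p hp p' _ => tendsto_toeplitzCovWith ha hη hβ hβb hS hC₀ hcard hneg h0 p p' (hI p hp)
  refine ⟨fun p hp => ?_, fun Q hQ0 hQ1 => ?_, fun p => ?_⟩
  · have h := hnormal {p} (by simpa using hp) (fun _ => 1) (fun n ω => realTrace (A n ω ^ p))
      fun n ω => by simp [hA]
    simpa using h
  · refine hnormal (Finset.Icc 2 Q.natDegree) (fun p hp => (Finset.mem_Icc.1 hp).1) Q.coeff
      (fun n ω => realTrace (Polynomial.aeval (A n ω) Q)) fun n ω => ?_
    rw [realTrace_aeval, Complex.ofReal_zero, zero_add]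
    push_cast
    simp_rw [hA]
    refine (Finset.sum_subset (fun j hj => ?_) fun j hj hj' => ?_).symm
    · rw [Finset.mem_Icc] at hj
      rw [Finset.mem_range]
      omega
    · rw [Finset.mem_range] at hj
      rw [Finset.mem_Icc] at hj'
      rcases (by omega : j = 0 ∨ j = 1) with rfl | rfl
      · rw [hQ0, Complex.ofReal_zero, zero_mul]
      · rw [hQ1, Complex.ofReal_zero, zero_mul]
  · rw [← tendsto_ofReal_iff]
    refine (tendsto_integral_walkSum ha hβ hβb hS hC₀ hcard hneg h0 p).congr fun n => ?_
    rw [← integral_complex_ofReal, ← integral_const_mul]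
    refine integral_congr_ae (Eventually.of_forall fun ω => ?_)
    simp [hA]

theorem hankel_conclusions {a : ℤ → Ω → ℝ} (ha : IsHankelEntries μ a κ) (hβ : Tendsto β atTop atTop)
    (hβb : Tendsto (fun n : ℕ => β n / n) atTop (𝓝 b)) (hS : Approximates β F B)
    (hC₀ : ∀ᶠ n in atTop, ∀ k ∈ F n, |(k : ℝ)| ≤ C₀ * β n)
    (hcard : ∀ᶠ n in atTop, ((F n).card : ℝ) ≤ C₁ * β n) {S : ℕ → Set ℤ}
    (hF : ∀ n k, k ∈ F n ↔ k ∈ S n) (A : (n : ℕ) → Ω → Matrix (Fin n) (Fin n) ℝ)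
    (hA : ∀ n ω, A n ω = (√(β n))⁻¹ • (backwardIdentity n * toeplitz n (S n) fun j => a j ω)) :
    (∀ p : ℕ, 1 ≤ p → ConvergesToNormal μ
      (fun n => fluctuation μ (β n) n (fun ω => realTrace (A n ω ^ (2 * p))))
      (hankelCov B b κ p p)) ∧
    (∀ Q : Polynomial ℝ, ConvergesToNormal μ
      (fun n => fluctuation μ (β n) n (fun ω => realTrace (Polynomial.aeval (A n ω ^ 2) Q)))
      (polyVariance 1 Q (hankelCov B b κ))) := by
  have hfam := ha.isEntryFamily
  have htrace : ∀ n ω p, (realTrace (A n ω ^ (2 * p)) : ℂ) =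
      walkSum (fun k ω => (a k ω : ℂ)) (β n) n (fun k => (-1) ^ k) (F n) (2 * p) ω := fun n ω p => by
    rw [hA]
    exact ofReal_realTrace_hankel_pow (hF n) (β n) p
  have h2 : ∀ x, ∫ ω, (a x ω : ℂ) ^ 2 ∂μ = 1 := fun x => by
    simp_rw [← Complex.ofReal_pow]
    rw [integral_complex_ofReal, ← Complex.ofReal_one, ← ha.second x]
    simp_rw [sq_abs]
  have h4 : ∀ x, ∫ ω, (a x ω : ℂ) ^ 4 ∂μ = κ := fun x => by
    simp_rw [← Complex.ofReal_pow]
    rw [integral_complex_ofReal, ← ha.fourth x]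
    simp_rw [Even.pow_abs (by decide : Even 4)]
  have hnormal : ∀ (J : Finset ℕ) (_ : ∀ p ∈ J, 1 ≤ p) (q : ℕ → ℝ) (c : ℕ → ℝ) (X : (n : ℕ) → Ω → ℝ)
      (_ : ∀ n ω, X n ω = c n + ∑ p ∈ J, q p * realTrace (A n ω ^ (2 * p))),
      ConvergesToNormal μ (fun n => fluctuation μ (β n) n (X n))
        (∑ i ∈ J, ∑ j ∈ J, q i * q j * hankelCov B b κ i j) := by
    intro J hJ q c X hX
    have hinj : Function.Injective fun p : ℕ => 2 * p := fun _ _ h => Nat.eq_of_mul_eq_mul_left two_pos h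
    -- Only even powers occur, so the general statement is used for the exponents `2 * p`, and
    -- halving recovers the index of the coefficient.
    have h := hfam.convergesToNormal isSignDecomposition_one_id (fun k => neg_one_pow_eq_or ℤ k) hβ hcard
      (J.map ⟨_, hinj⟩) ?_ (fun p => q (p / 2)) (fun n => fluctuation μ (β n) n (X n))
      (fun n ω => hfam.ofReal_fluctuation (J.map ⟨_, hinj⟩) (fun p => q (p / 2)) (c n) (X n)
        (fun ω => ?_) ω) (fun i j => hankelCov B b κ (i / 2) (j / 2)) ?_
    · simpa [Finset.sum_map] using h
    · intro p hp n x _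
      obtain ⟨j, -, rfl⟩ := Finset.mem_map.1 hp
      exact isNondegenerate_hankel j x
    · rw [hX, Finset.sum_map]
      push_cast
      simp [htrace]
    · intro p hp p' hp'
      obtain ⟨j, hj, rfl⟩ := Finset.mem_map.1 hp
      obtain ⟨j', -, rfl⟩ := Finset.mem_map.1 hp'
      simp only [Function.Embedding.coeFn_mk, Nat.mul_div_cancel_left _ two_pos]
      exact tendsto_hankelCov hfam h2 h4 hβ hβb hS hC₀ hcard j j' (hJ j hj)
  refine ⟨fun p hp => ?_, fun Q => ?_⟩
  · have h := hnormal {p} (by simpa using hp) (fun _ => 1) (fun _ => 0)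
      (fun n ω => realTrace (A n ω ^ (2 * p))) fun n ω => by simp
    simpa using h
  -- The constant coefficient only adds a deterministic multiple of the trace of the identity, which
  -- centring removes.
  · refine hnormal (Finset.Icc 1 Q.natDegree) (fun p hp => (Finset.mem_Icc.1 hp).1) Q.coeff
      (fun n => Q.coeff 0 * realTrace (1 : Matrix (Fin n) (Fin n) ℝ))
      (fun n ω => realTrace (Polynomial.aeval (A n ω ^ 2) Q)) fun n ω => ?_
    rw [realTrace_aeval, Finset.sum_range_succ', pow_zero, add_comm]
    congr 1
    rw [Finset.range_eq_Ico, Finset.sum_Ico_add' (fun j => Q.coeff j * realTrace ((A n ω ^ 2) ^ j)) 0 _ 1]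
    refine Finset.sum_congr (by ext j; simp) fun j _ => ?_
    rw [pow_mul]

end Conclusions

/-! ### Finite index sets and Hermitian symmetry. -/

section IndexFinsets

open Classical

variable {r : ℕ}

/-- The integers `k` with `|k| ∈ S`, for `S` contained in `{0, …, n - 1}`. -/
def symmetricFinset (lo hi : Fin r → ℕ → ℝ) (n : ℕ) : Finset ℤ :=
  (Finset.Ioo (-n : ℤ) n).filter fun k => |k| ∈ indexSet lo hi n

lemma mem_symmetricFinset {lo hi : Fin r → ℕ → ℝ} {n : ℕ} {k : ℤ} :
    k ∈ symmetricFinset lo hi n ↔ |k| ∈ indexSet lo hi n := by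
  unfold symmetricFinset
  rw [Finset.mem_filter, Finset.mem_Ioo, and_iff_right_iff_imp]
  exact fun h => abs_lt.1 h.2.2

/-- The elements of `signedIndexSet`. -/
def signedFinset (lo hi : Fin r → ℕ → ℝ) (n : ℕ) : Finset ℤ :=
  (Finset.Ioo (-n : ℤ) n).filter fun k => k ∈ signedIndexSet lo hi n

lemma mem_signedFinset {lo hi : Fin r → ℕ → ℝ} {n : ℕ} {k : ℤ} :
    k ∈ signedFinset lo hi n ↔ k ∈ signedIndexSet lo hi n := by
  unfold signedFinset
  rw [Finset.mem_filter, Finset.mem_Ioo, and_iff_right_iff_imp]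
  exact fun h => abs_lt.1 h.2

variable {n : ℕ}

lemma isHermitian_smul_toeplitz {S : Set ℤ} {a : ℤ → ℂ} (hS : ∀ k, k ∈ S ↔ -k ∈ S)
    (ha : ∀ k, a (-k) = (starRingEnd ℂ) (a k)) (c : ℝ) : (c • toeplitz n S a).IsHermitian := by
  ext i j
  have h : (i : ℤ) - j = -((j : ℤ) - i) := by ring
  simp only [toeplitz, Matrix.conjTranspose_apply, Matrix.smul_apply, Matrix.of_apply, h,
    ← hS ((j : ℤ) - i), ha]
  split_ifs <;> simp

end IndexFinsets

end SparseToeplitz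
end

/-! ### The central limit theorem for the three models. -/

theorem mainTheorem8 {Ω : Type*} [MeasurableSpace Ω] (μ : Measure Ω) [IsProbabilityMeasure μ]
    (r : ℕ) (lo hi : Fin r → ℕ → ℝ) (l u : Fin r → ℝ) (β : ℕ → ℝ) (b : ℝ)
    (hb : b ∈ Set.Icc (0 : ℝ) 1)
    (hβ : Tendsto β atTop atTop)
    (hβb : Tendsto (fun n : ℕ => β n / n) atTop (𝓝 b))
    (hlo : ∀ j, Tendsto (fun n : ℕ => lo j n / β n) atTop (𝓝 (l j)))
    (hhi : ∀ j, Tendsto (fun n : ℕ => hi j n / β n) atTop (𝓝 (u j)))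
    (κ : ℝ) :
    (limitSet l u ⊆ Set.Icc 0 1 →
      -- real symmetric sparse Toeplitz matrices
      (∀ a : ℤ → Ω → ℝ, IsSymmetricEntries μ a κ →
        ∀ A : (n : ℕ) → Ω → Matrix (Fin n) (Fin n) ℝ,
        (∀ n ω, A n ω = (√(β n))⁻¹ •
          sparseToeplitz n (indexSet lo hi n) (fun j => a j ω)) →
        (∀ p : ℕ, 2 ≤ p → ConvergesToNormal μ
          (fun n => fluctuation μ (β n) n
            (fun ω => realTrace (A n ω ^ p)))
          (toeplitzCov
            (symmetrize (limitSet l u)) b κ p p)) ∧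
        (∀ Q : Polynomial ℝ, Q.coeff 0 = 0 → Q.coeff 1 = 0 → ConvergesToNormal μ
          (fun n => fluctuation μ (β n) n
            (fun ω => realTrace (Polynomial.aeval (A n ω) Q)))
          (polyVariance 2 Q (toeplitzCov
            (symmetrize (limitSet l u)) b κ))) ∧
        (∀ k : ℕ, Tendsto
          (fun n : ℕ => ∫ ω, (1 / (n : ℝ)) * realTrace (A n ω ^ (2 * k)) ∂μ) atTop
          (𝓝 (limitMoment
            (symmetrize (limitSet l u)) b (2 * k)))) ∧
        (∀ k : ℕ, Tendsto
          (fun n : ℕ => ∫ ω, (1 / (n : ℝ)) * realTrace (A n ω ^ (2 * k + 1)) ∂μ)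
          atTop (𝓝 0))) ∧
      -- complex Hermitian sparse Toeplitz matrices
      (∀ a : ℤ → Ω → ℂ, IsHermitianEntries μ a κ →
        ∀ A : (n : ℕ) → Ω → Matrix (Fin n) (Fin n) ℂ,
        (∀ n ω, A n ω = (√(β n))⁻¹ •
          sparseToeplitz n (indexSet lo hi n) (fun j => a j ω)) →
        (∀ p : ℕ, 2 ≤ p → ConvergesToNormal μ
          (fun n => fluctuation μ (β n) n
            (fun ω => realTrace (A n ω ^ p)))
          (hermitianCov
            (symmetrize (limitSet l u)) b κ p p)) ∧
        (∀ Q : Polynomial ℝ, Q.coeff 0 = 0 → Q.coeff 1 = 0 → ConvergesToNormal μ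
          (fun n => fluctuation μ (β n) n
            (fun ω => realTrace (Polynomial.aeval (A n ω) Q)))
          (polyVariance 2 Q (hermitianCov
            (symmetrize (limitSet l u)) b κ))) ∧
        (∀ k : ℕ, Tendsto
          (fun n : ℕ => ∫ ω, (1 / (n : ℝ)) * realTrace (A n ω ^ (2 * k)) ∂μ) atTop
          (𝓝 (limitMoment
            (symmetrize (limitSet l u)) b (2 * k)))) ∧
        (∀ k : ℕ, Tendsto
          (fun n : ℕ => ∫ ω, (1 / (n : ℝ)) * realTrace (A n ω ^ (2 * k + 1)) ∂μ)
          atTop (𝓝 0))) ∧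
      -- sparse Hankel matrices, with the same sparsity pattern
      (∀ a : ℤ → Ω → ℝ, IsHankelEntries μ a κ →
        ∀ A : (n : ℕ) → Ω → Matrix (Fin n) (Fin n) ℝ,
        (∀ n ω, A n ω = (√(β n))⁻¹ • (backwardIdentity n *
          sparseToeplitz n (indexSet lo hi n) (fun j => a j ω))) →
        (∀ p : ℕ, 1 ≤ p → ConvergesToNormal μ
          (fun n => fluctuation μ (β n) n
            (fun ω => realTrace (A n ω ^ (2 * p))))
          (hankelCov
            (symmetrize (limitSet l u)) b κ p p)) ∧
        (∀ Q : Polynomial ℝ, ConvergesToNormal μ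
          (fun n => fluctuation μ (β n) n
            (fun ω => realTrace (Polynomial.aeval (A n ω ^ 2) Q)))
          (polyVariance 1 Q (hankelCov
            (symmetrize (limitSet l u)) b κ))))) ∧
    -- sparse Hankel matrices, with a sparsity pattern which need not be symmetric
    (limitSet l u ⊆ Set.Icc (-1) 1 →
      ∀ a : ℤ → Ω → ℝ, IsHankelEntries μ a κ →
        ∀ A : (n : ℕ) → Ω → Matrix (Fin n) (Fin n) ℝ,
        (∀ n ω, A n ω = (√(β n))⁻¹ • (backwardIdentity n *
          toeplitz n (signedIndexSet lo hi n) (fun j => a j ω))) →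
        (∀ p : ℕ, 1 ≤ p → ConvergesToNormal μ
          (fun n => fluctuation μ (β n) n
            (fun ω => realTrace (A n ω ^ (2 * p))))
          (hankelCov (limitSet l u) b κ p p)) ∧
        (∀ Q : Polynomial ℝ, ConvergesToNormal μ
          (fun n => fluctuation μ (β n) n
            (fun ω => realTrace (Polynomial.aeval (A n ω ^ 2) Q)))
          (polyVariance 1 Q
            (hankelCov (limitSet l u) b κ)))) := by
  refine ⟨fun hB => ?_, fun hB a ha A hA => ?_⟩
  · have hsymm : ∀ n k, k ∈ symmetricFinset lo hi n →
        ∃ j, ∃ k' : ℤ, |k'| = |k| ∧ (k' : ℝ) ∈ Set.Icc (lo j n) (hi j n) := fun n k hk => by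
      obtain ⟨⟨j, hj⟩, -⟩ := mem_symmetricFinset.1 hk
      exact ⟨j, |k|, abs_abs k, hj⟩
    -- The index `0` is erased: the diagonal vanishes in the Toeplitz models, and their words must
    -- have nonzero letters for the balance equations to be nondegenerate.
    have hF : ∀ n k, k ≠ 0 →
        (k ∈ (symmetricFinset lo hi n).erase 0 ↔ |k| ∈ indexSet lo hi n) := fun n k hk => by
      rw [Finset.mem_erase, mem_symmetricFinset, and_iff_right hk]
    have hneg : ∀ n, ∀ x ∈ (symmetricFinset lo hi n).erase 0,
        -x ∈ (symmetricFinset lo hi n).erase 0 := fun n x hx => by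
      rw [Finset.mem_erase, mem_symmetricFinset] at hx ⊢
      rwa [neg_ne_zero, abs_neg]
    have h0 : ∀ n, (0 : ℤ) ∉ (symmetricFinset lo hi n).erase 0 := fun n => Finset.notMem_erase 0 _
    have hmem : ∀ n (c : ℤ → ℂ), c 0 = 0 → ∀ k, k ∈ (symmetricFinset lo hi n).erase 0 ↔
        k ∈ {k : ℤ | |k| ∈ indexSet lo hi n} ∧
          (k = 0 → c 0 ≠ 0 ∨ 0 ∈ (symmetricFinset lo hi n).erase 0) := fun n c hc k => by
      rw [Finset.mem_erase, mem_symmetricFinset, and_comm]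
      simp [hc]
    have hS := approximates_symmetrize (F := fun n => (symmetricFinset lo hi n).erase 0)
      hb hβ hβb hlo hhi hB hF
    obtain ⟨⟨C₀, hC₀⟩, C₁, hC₁⟩ := exists_bound_index
      (F := fun n => (symmetricFinset lo hi n).erase 0) hβ hlo hhi
      fun n k hk => hsymm n k (Finset.mem_of_mem_erase hk)
    refine ⟨fun a ha A hA => ?_, fun a ha A hA => ?_, fun a ha A hA => ?_⟩
    · obtain ⟨h1, h2, h3⟩ := toeplitz_conclusions ha.isToeplitzFamily (Or.inr rfl) hβ hβb hS hC₀ hC₁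
        hneg h0 A fun n ω p => by
          rw [hA, sparseToeplitz, ofReal_realTrace, map_ofReal_pow, map_ofReal_toeplitz]
          exact trace_smul_toeplitz_pow (a := fun k ω => (a k ω : ℂ))
            (hmem n (fun k => (a k ω : ℂ)) (by rw [ha.zero, Complex.ofReal_zero])) (β n) p
      refine ⟨fun p hp => toeplitzCovWith_one _ b κ p p ▸ h1 p hp, fun Q hQ0 hQ1 => ?_,
        fun k => h3 (2 * k), fun k => limitMoment_odd _ b k ▸ h3 (2 * k + 1)⟩
      have h := h2 Q hQ0 hQ1
      simp only [polyVariance, toeplitzCovWith_one] at h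
      exact h
    · obtain ⟨h1, h2, h3⟩ := toeplitz_conclusions ha.isToeplitzFamily (Or.inl rfl) hβ hβb hS hC₀ hC₁
        hneg h0 A fun n ω p => by
          have hherm : (A n ω).IsHermitian := by
            rw [hA, sparseToeplitz]
            exact isHermitian_smul_toeplitz (fun k => by simp) (fun k => ha.symm k ω) _
          rw [ofReal_realTrace_of_isHermitian (hherm.pow p), hA, sparseToeplitz]
          exact trace_smul_toeplitz_pow (hmem n (fun k => a k ω) (ha.zero ω)) (β n) p
      refine ⟨fun p hp => toeplitzCovWith_zero _ b κ p p ▸ h1 p hp, fun Q hQ0 hQ1 => ?_,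
        fun k => h3 (2 * k), fun k => limitMoment_odd _ b k ▸ h3 (2 * k + 1)⟩
      have h := h2 Q hQ0 hQ1
      simp only [polyVariance, toeplitzCovWith_zero] at h
      exact h
    -- In the Hankel model `a 0` is an ordinary entry, so the index `0` is kept.
    · have hS' := approximates_symmetrize (F := symmetricFinset lo hi) hb hβ hβb hlo hhi hB
        fun n k _ => mem_symmetricFinset
      obtain ⟨⟨C₀', hC₀'⟩, C₁', hC₁'⟩ := exists_bound_index (F := symmetricFinset lo hi)
        hβ hlo hhi hsymm
      exact hankel_conclusions ha hβ hβb hS' hC₀' hC₁' (fun n k => mem_symmetricFinset) A hA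
  · have hS := approximates_signedIndexSet (F := signedFinset lo hi) hb hβ hβb hlo hhi hB
      fun n k => mem_signedFinset
    obtain ⟨⟨C₀, hC₀⟩, C₁, hC₁⟩ := exists_bound_index (F := signedFinset lo hi) hβ hlo hhi
      fun n k hk => by
        obtain ⟨⟨j, hj⟩, -⟩ := mem_signedFinset.1 hk
        exact ⟨j, k, rfl, hj⟩
    exact hankel_conclusions ha hβ hβb hS hC₀ hC₁ (fun n k => mem_signedFinset) A hA
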